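/- Let $T$ be an oriented one-holed torus, let $x,y$ be right-handed Dehn twists along two simple closed curves in $T$ that meet transversely in one point, and let $$h=(xy)^3x^{a_1}y^{-b_1}\cdots x^{a_n}y^{-b_n}\in \mathrm{Diff}^+(T,\partial T),\qquad a_i,b_i,n\ge 1,\quad N:=\sum_{i=1}^n b_i\ge 2,$$ where in a product the left factor is applied first. Put $$(c_1,\dots,c_N)=(a_1+2,\underbrace{2,\dots,2}_{b_1-1},a_2+2,\dots,a_n+2,\underbrace{2,\dots,2}_{b_n-1}).$$ Let $L=L_1\cup\dots\cup L_N\subset S^3$ be the closed chain of $N$ unknots, drawn as planar ovals each clasped once with the next one cyclically, such that, if all ovals are oriented anticlockwise, each clasp of $L_i$ with $L_{i+1}$ ($1\le i<N$) contributes $-1$ and the clasp of $L_N$ with $L_1$ contributes $+1$ to the linking number; let $L_i$ have framing $c_i$. Let $X$ be the 4-manifold obtained from $B^4$ by attaching 2-handles along this framed link. Identify $\partial X$ with the open book manifold $Y_{(T,h)}=T\times[0,1]/((p,1)\sim(h(p),0))\ \cup_\partial\ \partial T\times D^2$, preserving orientations, in such a way that one page is the standard once punctured torus $S\subset S^3\setminus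 L$ located at the clasp of two components $L_k$ and $L_{k+1}$, $1\le k<N$. (This $S$ is the boundary of a solid torus that contains the end of $L_k$ at the clasp and whose hole is threaded by $L_{k+1}$, minus a disc through which $L_k$ leaves the solid torus.) Let $\xi=\xi_{(T,h)}=\ker\lambda$ be a contact structure supported by this open book, that is, $\lambda$ is a positive contact form which is positive on the oriented binding and for which $d\lambda$ is positive on the interiors of the oriented pages. A spin structure $\Theta$ on $Y_{(T,h)}$ corresponds to the sublink of $L$ consisting of those components $L_i$ such that $\Theta$ does not extend across the 2-handle of $X$ attached along $L_i$. A sublink $C$ of $L$ is characteristic if $\mathrm{lk}(C,L_i)\equiv \mathrm{lk}(L_i,L_i):=c_i \pmod 2$ for all $i$. Then $\xi$, oriented by $d\lambda$, has a trivialization as an oriented 2-plane bundle, and any two are homotopic through trivializations. All of them induce, by adding a vector field positively transverse to $\xi$ to obtain a framing of $TY_{(T,h)}$, one and the same spin structure $\Theta_\xi$ on $Y_{(T,h)}$. The sublink that corresponds to $\Theta_\xi$ is the whole link $L$, and $L$ is a characteristic sublink of itself. -/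

import Mathlib

open scoped Manifold ContDiff Topology

noncomputable section

namespace SpinSurgery

/-! ### Frames, orientations and spin structures on manifolds -/

abbrev E (n : ℕ) := EuclideanSpace ℝ (Fin n)

section Frames

variable (n : ℕ) (M : Type*) [TopologicalSpace M] [ChartedSpace (E n) M] [IsManifold (𝓡 n) ∞ M]

/-- An `n`-tuple of tangent vectors at one point of the `n`-manifold `M`. -/
@[ext] structure Tuple where
  base : M
  vec : Fin n → TangentSpace (𝓡 n) base

variable {n M}

/-- The `i`-th vector as a point of the total space `TM`. -/
def Tuple.tot (f : Tuple n M) (i : Fin n) : TangentBundle (𝓡 n) M := ⟨f.base, f.vec i⟩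

/-- The topology of the `n`-fold fibre product of `TM` over `M` (also recording the base point,
which matters only for `n = 0`). -/
instance : TopologicalSpace (Tuple n M) :=
  TopologicalSpace.induced (fun f => (f.base, f.tot)) inferInstance

variable (n M)

/-- An orientation of `M`: in each tangent space one of the two `GL⁺`-orbits of frames, called the
positive frames, such that the positive frames form an open subset. -/
structure MfdOrientation where
  pos : ∀ y : M, (Fin n → TangentSpace (𝓡 n) y) → Prop
  exists_pos : ∀ y, ∃ v, pos y v
  indep : ∀ y v, pos y v → LinearIndependent ℝ v
  pos_iff : ∀ y v, pos y v → ∀ w, pos y w ↔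
    ∃ A : Matrix (Fin n) (Fin n) ℝ, 0 < A.det ∧ ∀ i, w i = ∑ j, A i j • v j
  isOpen_pos : IsOpen {f : Tuple n M | pos f.base f.vec}

variable {n M}

/-- The bundle of positive frames of `TM` over the subset `K` of `M`. -/
def OFrame (o : MfdOrientation n M) (K : Set M) : Type _ :=
  {f : Tuple n M // f.base ∈ K ∧ o.pos f.base f.vec}

instance (o : MfdOrientation n M) (K : Set M) : TopologicalSpace (OFrame o K) :=
  inferInstanceAs (TopologicalSpace {f : Tuple n M // f.base ∈ K ∧ o.pos f.base f.vec})

/-- The loop `p` of frames stays over one point and turns the first two vectors of its initial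
frame `f` once around in the plane that they span, keeping the other vectors fixed. -/
def IsFullRotation [NeZero n] {o : MfdOrientation n M} {K : Set M} (f : OFrame o K)
    (p : Path f f) : Prop :=
  ∀ t : unitInterval, (p t).1 = ⟨f.1.base, fun i =>
    if i = 0 then Real.cos (2 * Real.pi * t) • f.1.vec 0 + Real.sin (2 * Real.pi * t) • f.1.vec 1
    else if i = 1 then
      -(Real.sin (2 * Real.pi * t)) • f.1.vec 0 + Real.cos (2 * Real.pi * t) • f.1.vec 1
    else f.1.vec i⟩

/-- A spin structure on the oriented bundle `TM|_K` (of rank `n ≥ 3`): a class in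
`H¹(Fr⁺(TM|_K); ℤ/2)`, that is, a double cover of the bundle of positive frames, whose restriction
to each fibre is the nontrivial class. A class in `H¹( · ; ℤ/2) = Hom(π₁, ℤ/2)` is given by its
values on loops: it is invariant under homotopy and change of base point, and additive. -/
@[ext] structure SpinStructure [NeZero n] (o : MfdOrientation n M) (K : Set M) where
  val : ∀ f : OFrame o K, Path f f → ZMod 2
  homotopic : ∀ f (p q : Path f f), p.Homotopic q → val f p = val f q
  trans : ∀ f (p q : Path f f), val f (p.trans q) = val f p + val f q
  conj : ∀ f g (γ : Path f g) (p : Path f f), val g (γ.symm.trans (p.trans γ)) = val f p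
  fibre : ∀ f (p : Path f f), IsFullRotation f p → val f p = 1

/-- A (continuous, positive) global framing of the tangent bundle. -/
structure Framing (o : MfdOrientation n M) where
  sec : C(M, OFrame o Set.univ)
  base_sec : ∀ y, (sec y).1.base = y

/-- The spin structure `Θ` is the one determined by the framing `σ`: the framing, as a section of
the frame bundle, lifts to the double cover `Θ`. -/
def SpinStructure.IsInducedBy [NeZero n] {o : MfdOrientation n M}
    (Θ : SpinStructure o Set.univ) (σ : Framing o) : Prop :=
  ∀ (y : M) (γ : Path y y), Θ.val (σ.sec y) (γ.map σ.sec.continuous) = 0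

end Frames

/-! ### The 2-handle -/

/-- The point `(w, u)` of `ℂ² = ℝ⁴`. -/
def pt4 (w u : ℂ) : E 4 := !₂[w.re, w.im, u.re, u.im]

/-- The determinant of four vectors of `ℝ⁴`. -/
def det4 (v : Fin 4 → E 4) : ℝ := (Matrix.of fun i j => v i j).det

theorem continuous_vec4 (i : Fin 4) :
    Continuous fun f : Tuple 4 (E 4) => @id (E 4) (f.vec i) := by
  have h1 : Continuous fun f : Tuple 4 (E 4) => f.tot i :=
    (continuous_apply (A := fun _ : Fin 4 => TangentBundle (𝓡 4) (E 4)) i).comp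
      (continuous_snd.comp
        (continuous_induced_dom (f := fun f : Tuple 4 (E 4) => (f.base, f.tot))))
  have h2 : Continuous fun x : TangentBundle (𝓡 4) (E 4) =>
      (tangentBundleModelSpaceHomeomorph (𝓡 4) x) :=
    (tangentBundleModelSpaceHomeomorph (𝓡 4)).continuous
  have h3 : Continuous fun x : ModelProd (E 4) (E 4) => (x.2 : E 4) := continuous_snd
  rw [tangentBundleModelSpaceHomeomorph_coe] at h2
  exact h3.comp (h2.comp h1)

theorem det4_pos_iff (v : Fin 4 → E 4) (hv : 0 < det4 v) (w : Fin 4 → E 4) : 0 < det4 w ↔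
    ∃ A : Matrix (Fin 4) (Fin 4) ℝ, 0 < A.det ∧ ∀ i, w i = ∑ j, A i j • v j := by
  have key : ∀ A : Matrix (Fin 4) (Fin 4) ℝ, (∀ i, w i = ∑ j, A i j • v j) ↔
      (Matrix.of fun i j => w i j) = A * (Matrix.of fun i j => v i j) := by
    intro A
    constructor
    · intro h
      ext i j
      rw [Matrix.of_apply, h i]
      simp [Matrix.mul_apply]
    · intro h i
      ext j
      have := congrFun (congrFun h i) j
      simpa [Matrix.mul_apply] using this
  constructor
  · intro hw
    have hu : IsUnit (Matrix.of fun i j => v i j).det := (ne_of_gt hv).isUnit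
    refine ⟨(Matrix.of fun i j => w i j) * (Matrix.of fun i j => v i j)⁻¹, ?_, ?_⟩
    · rw [Matrix.det_mul, Matrix.det_nonsing_inv, Ring.inverse_eq_inv']
      exact mul_pos hw (inv_pos.mpr hv)
    · refine (key _).2 ?_
      rw [Matrix.mul_assoc, Matrix.nonsing_inv_mul _ hu, Matrix.mul_one]
  · rintro ⟨A, hA, h⟩
    have := (key A).1 h
    rw [det4, this, Matrix.det_mul]
    exact mul_pos hA hv

/-- The standard orientation of `ℝ⁴`. -/
def stdOrientation : MfdOrientation 4 (E 4) where
  pos _ v := 0 < det4 v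
  exists_pos y := by
    refine ⟨fun i => (EuclideanSpace.single i (1 : ℝ) : E 4), ?_⟩
    have : (Matrix.of fun i j => (EuclideanSpace.single i (1 : ℝ) : E 4) j)
        = (1 : Matrix (Fin 4) (Fin 4) ℝ) := by
      ext i j
      simp [Matrix.one_apply, eq_comm]
    change 0 < (Matrix.of fun i j => (EuclideanSpace.single i (1 : ℝ) : E 4) j).det
    rw [this]; simp
  indep y v hv := by
    have h := Matrix.linearIndependent_rows_of_det_ne_zero (ne_of_gt hv)
    exact LinearIndependent.of_comp (WithLp.linearEquiv 2 ℝ (Fin 4 → ℝ)).toLinearMap h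
  pos_iff _ v hv w := by
    revert v w
    change ∀ v : Fin 4 → E 4, 0 < det4 v → ∀ w : Fin 4 → E 4, 0 < det4 w ↔
      ∃ A : Matrix (Fin 4) (Fin 4) ℝ, 0 < A.det ∧ ∀ i, w i = ∑ j, A i j • v j
    exact det4_pos_iff
  isOpen_pos := by
    refine isOpen_lt continuous_const ?_
    refine Continuous.matrix_det ?_
    refine continuous_matrix fun i j => ?_
    exact (EuclideanSpace.proj (𝕜 := ℝ) j).continuous.comp (continuous_vec4 i)

/-- The 2-handle `D² × D²` in `ℂ²`; it is attached along `∂D² × D²`. -/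
def handle : Set (E 4) := {x | ∃ w u : ℂ, ‖w‖ ≤ 1 ∧ ‖u‖ ≤ 1 ∧ x = pt4 w u}

section Handle

variable {Y : Type*} [TopologicalSpace Y] [ChartedSpace (E 3) Y] [IsManifold (𝓡 3) ∞ Y]

/-- Let `j : ℂ × ℝ → Y`, `(w, φ) ↦ j (w, φ)`, be the embedding of the free part `D² × ∂D²` of the
boundary of the 2-handle into `Y`, where `φ` is the angle of the point `e^{iφ}` of `∂D²`. The frame
`g` of the handle is the stabilization of the frame `f` of `Y`: the outward normal of the handle
followed by `f`, carried to the handle. -/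
def IsStabilization (j : ℂ × ℝ → Y) {o : MfdOrientation 3 Y} (f : OFrame o Set.univ)
    (g : OFrame stdOrientation handle) : Prop :=
  ∃ (w : ℂ) (φ : ℝ) (v : Fin 3 → ℂ × ℝ), ‖w‖ < 1 ∧
    f.1 = ⟨j (w, φ), fun i => mfderiv 𝓘(ℝ, ℂ × ℝ) (𝓡 3) j (w, φ) (v i)⟩ ∧
    g.1 = ⟨pt4 w (Complex.exp (φ * Complex.I)),
      Fin.cons (pt4 0 (Complex.exp (φ * Complex.I)))
        (fun i => pt4 (v i).1 ((v i).2 * Complex.I * Complex.exp (φ * Complex.I)))⟩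

/-- The spin structure `Θ` of `Y` extends across the 2-handle: some spin structure of the handle
restricts, on the part `D² × ∂D²` that the handle shares with `Y`, to `Θ`. -/
def ExtendsAcross (j : ℂ × ℝ → Y) {o : MfdOrientation 3 Y} (Θ : SpinStructure o Set.univ) : Prop :=
  ∃ Θ' : SpinStructure stdOrientation handle,
    ∀ (f : OFrame o Set.univ) (g : OFrame stdOrientation handle) (p : Path f f) (q : Path g g),
      (∀ t, IsStabilization j (p t) (q t)) → Θ.val f p = Θ'.val g q

end Handle

/-! ### The framed link -/

/-- The string `(a₁ + 2, 2, …, 2, a₂ + 2, …, aₙ + 2, 2, …, 2)`, the `i`-th block of `2`s having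
length `bᵢ - 1`; its length is `b₁ + ⋯ + bₙ` if all `bᵢ ≥ 1`. -/
def cString {n : ℕ} (a b : Fin n → ℕ) : List ℕ :=
  (List.ofFn fun i => (a i + 2) :: List.replicate (b i - 1) 2).flatten

/-- Coordinates of `ℝ³` around the `k`-th link of a planar necklace of `N` links around the origin:
`X` is radial, `Y` is the direction anticlockwise along the necklace, `Z` the height over the disc
that the component bounds. That disc is tilted, by `ε`, at the head (large `Y`) of the component. -/
def chainMap (N k : ℕ) (ε X Y Z : ℝ) : E 3 :=
  !₂[(3 + X) * Real.cos (2 * Real.pi * k / N + 5 * Real.pi / (4 * N) * Y),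
     (3 + X) * Real.sin (2 * Real.pi * k / N + 5 * Real.pi / (4 * N) * Y),
     Z + ε * X * (1 + Y)]

/-- The clasps of consecutive components are alike, except for the clasp of the last component
with the first one. -/
def claspSign (N k : ℕ) : ℝ := if k + 1 = N then -1 else 1

/-- The `k`-th component (`k = 0, …, N - 1`) of the link in `ℝ³`, parametrized so that its planar
projection is an oval run through anticlockwise. Consecutive ovals cross at two points, once over
and once under, and the linking numbers are `-1`, but `+1` for the last and the first. -/
def component (N k : ℕ) (s : ℝ) : E 3 :=
  chainMap N k (claspSign N k) (Real.cos s) (Real.sin s) 0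

/-- The attaching map `∂D² × D² → ℝ³` of the `k`-th 2-handle: an (orientation-reversing) tubular
neighbourhood of the `k`-th component with framing `c`. For `c = 0` the parallel curves
`ζ = const` have linking number `0` with the component, since they have the same planar projection
for `ζ` imaginary; in general `ζ` turns `c` times. -/
def attach (N k c : ℕ) (q ζ : ℂ) : E 3 :=
  chainMap N k (claspSign N k)
    ((1 + ((starRingEnd ℂ q) ^ c * ζ).re / 10) * q.re)
    ((1 + ((starRingEnd ℂ q) ^ c * ζ).re / 10) * q.im)
    (((starRingEnd ℂ q) ^ c * ζ).im / 10)

/-- The once punctured torus at the clasp of the components `k` and `k + 1`: the boundary of a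
solid torus which contains the head of the component `k` and whose hole is threaded by the
component `k + 1`, minus an open disc through which the component `k` leaves the solid torus. -/
def pageTorus (N k : ℕ) : Set (E 3) :=
  {x | ∃ θ φ : ℝ, 1 ≤ 3 / 5 * (1 + Real.sin θ) + (1 - Real.cos φ) ∧
    x = chainMap N k 1 ((3 / 5 + 3 / 20 * Real.cos φ) * Real.cos θ)
      (2 / 5 + (3 / 5 + 3 / 20 * Real.cos φ) * Real.sin θ) (3 / 20 * Real.sin φ)}

/-- The crossings of the components `k` and `l` in the planar projection. -/
def crossings (N k l : ℕ) : Set (ℝ × ℝ) :=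
  {p | p.1 ∈ Set.Ico 0 (2 * Real.pi) ∧ p.2 ∈ Set.Ico 0 (2 * Real.pi) ∧
    component N k p.1 0 = component N l p.2 0 ∧ component N k p.1 1 = component N l p.2 1}

/-- The sign of a crossing of the components `k` and `l`. -/
def crossingSign (N k l : ℕ) (p : ℝ × ℝ) : ℤ :=
  SignType.sign ((component N k p.1 2 - component N l p.2 2) *
    (deriv (fun s => component N k s 0) p.1 * deriv (fun s => component N l s 1) p.2 -
      deriv (fun s => component N k s 1) p.1 * deriv (fun s => component N l s 0) p.2))

/-- The linking number of two distinct components: half the sum of the signs of the crossings. -/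
def linkingNumber (N k l : ℕ) : ℤ := (∑ᶠ p ∈ crossings N k l, crossingSign N k l p) / 2

/-- The sublink `C` is characteristic: `lk(C, Lᵢ) ≡ lk(Lᵢ, Lᵢ) mod 2` for every component `Lᵢ`,
where `lk(Lᵢ, Lᵢ)` is the framing of `Lᵢ`. -/
def IsCharacteristic (c : List ℕ) (C : Finset (Fin c.length)) : Prop :=
  ∀ i : Fin c.length,
    (∑ j ∈ C, if j = i then (c.get i : ℤ) else linkingNumber c.length j i) ≡ (c.get i : ℤ) [ZMOD 2]

/-! ### Surgery -/

abbrev S3 := Metric.sphere (0 : EuclideanSpace ℝ (Fin (3 + 1))) 1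

theorem invStereo_mem (x : E 3) :
    (!₂[2 * x 0 / (‖x‖ ^ 2 + 1), 2 * x 1 / (‖x‖ ^ 2 + 1), 2 * x 2 / (‖x‖ ^ 2 + 1),
      (‖x‖ ^ 2 - 1) / (‖x‖ ^ 2 + 1)] : EuclideanSpace ℝ (Fin (3 + 1))) ∈
      Metric.sphere (0 : EuclideanSpace ℝ (Fin (3 + 1))) 1 := by
  rw [mem_sphere_zero_iff_norm, EuclideanSpace.norm_eq, Real.sqrt_eq_one]
  have h : ‖x‖ ^ 2 = x 0 ^ 2 + x 1 ^ 2 + x 2 ^ 2 := by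
    rw [EuclideanSpace.norm_sq_eq]; simp [Fin.sum_univ_three]
  have hp : (‖x‖ ^ 2 + 1) ≠ 0 := by positivity
  simp [Fin.sum_univ_four]
  field_simp
  rw [h]; ring

/-- Inverse stereographic projection from the north pole, `ℝ³ → S³`; it preserves orientations if
`S³` is oriented as the boundary of the ball. -/
def invStereo (x : E 3) : S3 := ⟨_, invStereo_mem x⟩

/-- The link with as many components as the string `c` has entries, as a subset of `S³`. -/
def link (c : List ℕ) : Set S3 :=
  invStereo '' {x | ∃ k < c.length, ∃ s : ℝ, x = component c.length k s}

variable {Y : Type*} [TopologicalSpace Y] [ChartedSpace (E 3) Y] [IsManifold (𝓡 3) ∞ Y]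

/-- The frame that a map `φ` from a vector space induces from three vectors at `x` is positive. -/
def PosAt {V : Type*} [NormedAddCommGroup V] [NormedSpace ℝ V] (o : MfdOrientation 3 Y)
    (φ : V → Y) (x : V) (b : Fin 3 → V) : Prop :=
  o.pos (φ x) fun i => mfderiv 𝓘(ℝ, V) (𝓡 3) φ x (b i)

/-- An identification of the oriented manifold `Y` with the result of surgery on the link framed
by the entries of `c`, that is, with the boundary of the 4-manifold `B⁴ ∪ 2-handles`: `Y` is glued
from `S³ ∖ L` and, for each component, from the free part `{|w| < 1} × ∂D²` of the boundary of a
2-handle, a point `(w, e^{iφ})` with `w = ρ q`, `ρ > 0`, `|q| = 1`, being glued to the image of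
`(q, ρ e^{iφ})` under the attaching map. -/
structure SurgeryPresentation (c : List ℕ) (o : MfdOrientation 3 Y) where
  ext : S3 → Y
  belt : Fin c.length → ℂ × ℝ → Y
  ext_smooth : ContMDiffOn (𝓡 3) (𝓡 3) ∞ ext (link c)ᶜ
  ext_injOn : Set.InjOn ext (link c)ᶜ
  ext_immersion : ∀ x ∉ link c, Function.Injective (mfderiv (𝓡 3) (𝓡 3) ext x)
  ext_pos : ∀ x : E 3, invStereo x ∉ link c →
    PosAt o (fun x => ext (invStereo x)) x fun i => EuclideanSpace.single i 1
  belt_smooth : ∀ k, ContMDiffOn 𝓘(ℝ, ℂ × ℝ) (𝓡 3) ∞ (belt k) {x | ‖x.1‖ < 1}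
  belt_pos : ∀ k (x : ℂ × ℝ), ‖x.1‖ < 1 → PosAt o (belt k) x ![(1, 0), (Complex.I, 0), (0, 1)]
  belt_eq_iff : ∀ k l (x x' : ℂ × ℝ), ‖x.1‖ < 1 → ‖x'.1‖ < 1 →
    (belt k x = belt l x' ↔ k = l ∧ x.1 = x'.1 ∧ ∃ m : ℤ, x.2 = x'.2 + 2 * Real.pi * m)
  glue : ∀ x ∉ link c, ∀ k (w : ℂ) (φ : ℝ), ‖w‖ < 1 → (ext x = belt k (w, φ) ↔ w ≠ 0 ∧
    x = invStereo (attach c.length k (c.get k) (w / ‖w‖) (‖w‖ * Complex.exp (φ * Complex.I))))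
  cover : ∀ y, (∃ x ∉ link c, ext x = y) ∨ ∃ k x, ‖x.1‖ < 1 ∧ belt k x = y

open Classical in
/-- The sublink that corresponds to the spin structure `Θ`: all components such that `Θ` does not
extend across the 2-handle attached along the component. -/
def SurgeryPresentation.sublink {c : List ℕ} {o : MfdOrientation 3 Y}
    (D : SurgeryPresentation c o) (Θ : SpinStructure o Set.univ) : Finset (Fin c.length) :=
  Finset.univ.filter fun k => ¬ ExtendsAcross (D.belt k) Θ

/-! ### The open book -/

/-- A smooth function which is constant, equal to an integer, near each integer, increases from `m`
to `m + 1` on `[m, m + 1]`. -/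
def step (s : ℝ) : ℝ := ⌊s⌋ + Real.smoothTransition (2 * Int.fract s - 1 / 2)

/-- The lift to `ℝ²` of the right-handed Dehn twist of `ℝ²/ℤ²` along a horizontal curve; it is a
translation by a vector of `ℤ²` near each point of `ℤ²`. -/
def twistX : Equiv.Perm (ℝ × ℝ) where
  toFun p := (p.1 + step p.2, p.2)
  invFun p := (p.1 - step p.2, p.2)
  left_inv p := by simp
  right_inv p := by simp

/-- The same for a vertical curve. -/
def twistY : Equiv.Perm (ℝ × ℝ) where
  toFun p := (p.1, p.2 - step p.1)
  invFun p := (p.1, p.2 + step p.1)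
  left_inv p := by simp
  right_inv p := by simp

/-- The word `(xy)³ x^{a₁} y^{-b₁} ⋯ x^{aₙ} y^{-bₙ}`, where in a product the left factor is applied
first. -/
def monodromy {n : ℕ} (a b : Fin n → ℕ) : Equiv.Perm (ℝ × ℝ) :=
  ([twistX, twistY, twistX, twistY, twistX, twistY] ++
    (List.ofFn fun i => [twistX ^ a i, twistY⁻¹ ^ b i]).flatten).foldl
      (fun g f => g.trans f) (Equiv.refl _)

/-- The point of `ℝ²` with integer coordinates `m`. -/
def latticePt (m : ℤ × ℤ) : ℝ × ℝ := (m.1, m.2)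

/-- An identification of the oriented manifold `Y` with `Y_{(T,h)}`, where the interior of the
one-holed torus `T` is `(ℝ² ∖ ℤ²)/ℤ²`, its ends at the boundary being the rays into the puncture,
and the diffeomorphism `h` of `T` is given by a lift to `ℝ²` which is an integral translation on
the discs of radius `1/4` around the points of `ℤ²`. The manifold is glued from the mapping torus
of `h` on the interior of `T`, with `(p, t + 1) ∼ (h p, t)`, and from `∂T × {|z| < 1}`, where the
point `(u, r e^{2πit})` with `r > 0` is glued to `(p, t)`, `p` having distance `r/4` from the
puncture and angle `-u`. So `u` runs through the binding `∂T × {0}` in the direction of the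
boundary of a page, and the pages are the sets of constant `t`, completed by the binding. -/
structure OpenBook (h : Equiv.Perm (ℝ × ℝ)) (o : MfdOrientation 3 Y) where
  tor : (ℝ × ℝ) × ℝ → Y
  nbhd : ℝ × ℂ → Y
  tor_smooth : ContMDiffOn 𝓘(ℝ, (ℝ × ℝ) × ℝ) (𝓡 3) ∞ tor {x | x.1 ∉ Set.range latticePt}
  tor_pos : ∀ x : (ℝ × ℝ) × ℝ, x.1 ∉ Set.range latticePt →
    PosAt o tor x ![((1, 0), 0), ((0, 1), 0), ((0, 0), 1)]
  tor_eq_iff : ∀ p ∉ Set.range latticePt, ∀ p' ∉ Set.range latticePt, ∀ t t' : ℝ,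
    (tor (p, t) = tor (p', t') ↔
      ∃ (k : ℤ) (m : ℤ × ℤ), t = t' + k ∧ p' = (h ^ k) p + latticePt m)
  nbhd_smooth : ContMDiffOn 𝓘(ℝ, ℝ × ℂ) (𝓡 3) ∞ nbhd {x | ‖x.2‖ < 1}
  nbhd_pos : ∀ x : ℝ × ℂ, ‖x.2‖ < 1 → PosAt o nbhd x ![(1, 0), (0, 1), (0, Complex.I)]
  nbhd_eq_iff : ∀ x x' : ℝ × ℂ, ‖x.2‖ < 1 → ‖x'.2‖ < 1 →
    (nbhd x = nbhd x' ↔ x.2 = x'.2 ∧ ∃ m : ℤ, x.1 = x'.1 + 2 * Real.pi * m)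
  glue : ∀ p ∉ Set.range latticePt, ∀ (t u : ℝ) (z : ℂ), ‖z‖ < 1 →
    (tor (p, t) = nbhd (u, z) ↔ z ≠ 0 ∧ z = ‖z‖ * Complex.exp (2 * Real.pi * t * Complex.I) ∧
      ∃ m : ℤ × ℤ, p = latticePt m + (‖z‖ / 4 * Real.cos u, -(‖z‖ / 4 * Real.sin u)))
  cover : ∀ y, (∃ x, x.1 ∉ Set.range latticePt ∧ tor x = y) ∨ ∃ x, ‖x.2‖ < 1 ∧ nbhd x = y

/-- The page `T × {0}`, with its boundary, the binding. -/
def OpenBook.page {h : Equiv.Perm (ℝ × ℝ)} {o : MfdOrientation 3 Y} (B : OpenBook h o) : Set Y :=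
  {y | (∃ p ∉ Set.range latticePt, y = B.tor (p, 0)) ∨ ∃ u : ℝ, y = B.nbhd (u, 0)}

/-! ### Contact forms and trivializations of contact structures -/

/-- The 1-form `lam` in the preferred chart at `y₀`. -/
def inChart (lam : ∀ y : Y, TangentSpace (𝓡 3) y →L[ℝ] ℝ) (y₀ : Y) : E 3 → (E 3 →L[ℝ] ℝ) :=
  fun x => (lam ((extChartAt (𝓡 3) y₀).symm x)).comp
    (mfderiv 𝓘(ℝ, E 3) (𝓡 3) (extChartAt (𝓡 3) y₀).symm x)

/-- The 1-form `lam` is smooth. -/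
def IsSmoothForm (lam : ∀ y : Y, TangentSpace (𝓡 3) y →L[ℝ] ℝ) : Prop :=
  ∀ y₀ : Y, ContDiffOn ℝ ∞ (inChart lam y₀) (extChartAt (𝓡 3) y₀).target

/-- The exterior derivative of the 1-form `lam` at `y`, evaluated on two tangent vectors:
`dα(u, v) = (D_u α)(v) - (D_v α)(u)` in a chart. -/
def extd (lam : ∀ y : Y, TangentSpace (𝓡 3) y →L[ℝ] ℝ) (y : Y) (u v : TangentSpace (𝓡 3) y) : ℝ :=
  let x : E 3 := extChartAt (𝓡 3) y y
  let u' : E 3 := mfderiv (𝓡 3) 𝓘(ℝ, E 3) (extChartAt (𝓡 3) y) y u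
  let v' : E 3 := mfderiv (𝓡 3) 𝓘(ℝ, E 3) (extChartAt (𝓡 3) y) y v
  fderiv ℝ (inChart lam y) x u' v' - fderiv ℝ (inChart lam y) x v' u'

/-- `lam` is a positive contact form: smooth with `lam ∧ d lam > 0`. -/
def IsContactForm (o : MfdOrientation 3 Y) (lam : ∀ y : Y, TangentSpace (𝓡 3) y →L[ℝ] ℝ) : Prop :=
  IsSmoothForm lam ∧ ∀ y v, o.pos y v →
    0 < lam y (v 0) * extd lam y (v 1) (v 2) + lam y (v 1) * extd lam y (v 2) (v 0)
      + lam y (v 2) * extd lam y (v 0) (v 1)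

/-- `lam` is adapted to the open book: `lam` is positive on the oriented binding, and `d lam` is
positive on the interior of each oriented page. -/
def OpenBook.Supports {h : Equiv.Perm (ℝ × ℝ)} {o : MfdOrientation 3 Y} (B : OpenBook h o)
    (lam : ∀ y : Y, TangentSpace (𝓡 3) y →L[ℝ] ℝ) : Prop :=
  (∀ u : ℝ, 0 < lam (B.nbhd (u, 0)) (mfderiv 𝓘(ℝ, ℝ × ℂ) (𝓡 3) B.nbhd (u, 0) (1, 0))) ∧
  ∀ x : (ℝ × ℝ) × ℝ, x.1 ∉ Set.range latticePt → 0 < extd lam (B.tor x)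
    (mfderiv 𝓘(ℝ, (ℝ × ℝ) × ℝ) (𝓡 3) B.tor x ((1, 0), 0))
    (mfderiv 𝓘(ℝ, (ℝ × ℝ) × ℝ) (𝓡 3) B.tor x ((0, 1), 0))

/-- `e` is a (continuous) trivialization of the oriented plane field `ξ = ker lam`, where
`ξ` is oriented by `d lam`. -/
def IsTrivialization (lam : ∀ y : Y, TangentSpace (𝓡 3) y →L[ℝ] ℝ)
    (e : Fin 2 → ∀ y : Y, TangentSpace (𝓡 3) y) : Prop :=
  (∀ i, Continuous fun y => (⟨y, e i y⟩ : TangentBundle (𝓡 3) Y)) ∧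
  (∀ i y, lam y (e i y) = 0) ∧ ∀ y, 0 < extd lam y (e 0 y) (e 1 y)

/-- The two trivializations of `ker lam` are homotopic through trivializations. -/
def TrivializationsHomotopic (lam : ∀ y : Y, TangentSpace (𝓡 3) y →L[ℝ] ℝ)
    (e e' : Fin 2 → ∀ y : Y, TangentSpace (𝓡 3) y) : Prop :=
  ∃ H : unitInterval → Fin 2 → ∀ y : Y, TangentSpace (𝓡 3) y,
    (∀ i, Continuous fun x : unitInterval × Y => (⟨x.2, H x.1 i x.2⟩ : TangentBundle (𝓡 3) Y)) ∧
    (∀ t, IsTrivialization lam (H t)) ∧ H 0 = e ∧ H 1 = e'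

/-- The spin structure `Θ` is induced by the trivialization `e` of `ker lam`: it is determined by
a framing that consists of `e` and a vector field positively transverse to `ker lam`. -/
def IsInducedByTrivialization {o : MfdOrientation 3 Y}
    (lam : ∀ y : Y, TangentSpace (𝓡 3) y →L[ℝ] ℝ) (e : Fin 2 → ∀ y : Y, TangentSpace (𝓡 3) y)
    (Θ : SpinStructure o Set.univ) : Prop :=
  ∃ (σ : Framing o) (ν : ∀ y : Y, TangentSpace (𝓡 3) y),
    (∀ y, 0 < lam y (ν y)) ∧ (∀ y, (σ.sec y).1 = ⟨y, ![e 0 y, e 1 y, ν y]⟩) ∧ Θ.IsInducedBy σ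

end SpinSurgery

end

noncomputable section
namespace SpinSurgery

open scoped Real
open Real (cos sin sqrt sin_sq_add_cos_sq norm_eq_abs neg_one_le_cos
  neg_one_le_sin two_pi_pos cos_le_one sin_le_one pi_pos smoothTransition)
open Matrix (mul_apply det_fin_three det det_mul mul_nonsing_inv)
open Complex (exp I norm_exp_ofReal_mul_I norm_real exp_eq_exp_iff_exists_int)
open Set (range univ Icc projIcc_of_mem)
open Fin (sum_univ_three)
open Function (uncurry Injective uncurry_def invFunOn)
open Filter (Tendsto)
open AffineMap (lineMap_apply_module)
open Equiv (Perm)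

/-- The full angle. -/
local notation "τ" => 2 * π

local notation "𝕀" => unitInterval

/-- The tangent spaces of a 3-manifold. -/
local notation "𝕋" => TangentSpace (𝓡 3)

variable {X : Type*} [TopologicalSpace X]

/-! ### Mod 2 cohomology classes as functions on loops -/

/-- A class in `H¹({x // P x}; ℤ/2)`, given by its values on loops. -/
structure LoopClass (P : X → Prop) where
  val : ∀ x : {x // P x}, Path x x → ZMod 2
  homotopic : ∀ x (p q : Path x x), p.Homotopic q → val x p = val x q
  trans : ∀ x (p q : Path x x), val x (p.trans q) = val x p + val x q
  conj : ∀ x y (γ : Path x y) (p : Path x x), val y (γ.symm.trans (p.trans γ)) = val x p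

def IsLoop (P : X → Prop) (f : 𝕀 → X) : Prop := (∀ t, P (f t)) ∧ Continuous f ∧ f 0 = f 1

def IsLoop.path {P : X → Prop} {f : 𝕀 → X}
    (h : IsLoop P f) : Path (⟨f 0, h.1 0⟩ : {x // P x}) ⟨f 0, h.1 0⟩ where
  toFun t := ⟨f t, h.1 t⟩
  continuous_toFun := h.2.1.subtype_mk _
  source' := rfl
  target' := Subtype.ext h.2.2.symm

def seg {V : Type*} [NormedAddCommGroup V] [NormedSpace ℝ V] (a b : V) : Path a b where
  toFun t := AffineMap.lineMap a b (t : ℝ)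
  continuous_toFun := by
    simp only [lineMap_apply_module]
    fun_prop
  source' := by simp
  target' := by simp

lemma homotopic_of_map {Z : Type*} [TopologicalSpace Z] (G : C(ℝ × ℝ, Z)) {a b : ℝ × ℝ}
    (r r' : Path a b) {x y : Z} (u u' : Path x y) (hu : ∀ t, u t = G (r t))
    (hu' : ∀ t, u' t = G (r' t)) : u.Homotopic u' := by
  have hx : x = G a := by simpa using hu 0
  have hy : y = G b := by simpa using hu 1
  subst hx hy
  have e : u = r.map G.continuous := by ext t; exact hu t
  have e' : u' = r'.map G.continuous := by ext t; exact hu' t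
  rw [e, e']
  exact (SimplyConnectedSpace.paths_homotopic r r').map G

namespace LoopClass

variable {P : X → Prop} (δ : LoopClass P)

open Classical in
/-- The value on a loop given as a function (`0` if the function is not a loop). -/
def ev (f : 𝕀 → X) : ZMod 2 := if h : IsLoop P f then δ.val _ h.path else 0

lemma val_congr {x y : {x // P x}} (p : Path x x) (q : Path y y) (h : ∀ t, p t = q t) :
    δ.val x p = δ.val y q := by
  have : x = y := by simpa using h 0
  subst this
  congr 1
  ext t
  rw [h t]

lemma isLoop_coe {x : {x // P x}} (p : Path x x) : IsLoop P fun t => (p t : X) :=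
  ⟨fun t => (p t).2, continuous_subtype_val.comp p.continuous, by simp⟩

lemma ev_coe {x : {x // P x}} (p : Path x x) : δ.ev (fun t => (p t : X)) = δ.val x p := by
  rw [ev, dif_pos (isLoop_coe p)]
  exact δ.val_congr _ _ fun t => rfl

lemma ev_eq {f : 𝕀 → X} (h : IsLoop P f) : δ.ev f = δ.val _ h.path := dif_pos h

lemma val_refl (x : {x // P x}) : δ.val x (Path.refl x) = 0 := by
  have h := δ.trans x (Path.refl x) (Path.refl x)
  rw [δ.homotopic x _ _ ⟨Path.Homotopy.reflTrans (Path.refl x)⟩] at h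
  simpa using h

lemma ev_const (x : X) : δ.ev (fun _ => x) = 0 := by
  by_cases h : P x
  · have := δ.ev_coe (Path.refl (⟨x, h⟩ : {x // P x}))
    rw [val_refl] at this
    exact this
  · exact dif_neg fun h' => h (h'.1 0)

lemma val_eq_of_square {x y : {x // P x}} (p : Path x x) (q : Path y y) (γ : Path x y)
    (h : (p.trans γ).Homotopic (γ.trans q)) : δ.val x p = δ.val y q := by
  rw [← δ.conj x y γ p]
  refine δ.homotopic _ _ _ ?_
  have h1 : (γ.symm.trans (p.trans γ)).Homotopic (γ.symm.trans (γ.trans q)) :=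
    Path.Homotopic.hcomp (Path.Homotopic.refl _) h
  have h2 : (γ.symm.trans (γ.trans q)).Homotopic ((γ.symm.trans γ).trans q) :=
    Path.Homotopic.symm ⟨Path.Homotopy.transAssoc _ _ _⟩
  have h3 : ((γ.symm.trans γ).trans q).Homotopic ((Path.refl y).trans q) := Path.Homotopic.hcomp
      (Path.Homotopic.symm ⟨Path.Homotopy.reflSymmTrans γ⟩)
      (Path.Homotopic.refl _)
  exact ((h1.trans h2).trans h3).trans ⟨Path.Homotopy.reflTrans q⟩

def squareMap (F : 𝕀 × 𝕀 → X) (hF : Continuous F) (hP : ∀ x, P (F x)) :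
    C(ℝ × ℝ, {x // P x}) where
  toFun x := ⟨F (Set.projIcc 0 1 zero_le_one x.1, Set.projIcc 0 1 zero_le_one x.2), hP _⟩
  continuous_toFun := by
    refine Continuous.subtype_mk (hF.comp ?_) _
    exact (continuous_projIcc.comp continuous_fst).prodMk (continuous_projIcc.comp continuous_snd)

lemma ev_homotopy (F : 𝕀 × 𝕀 → X) (hF : Continuous F)
    (hP : ∀ x, P (F x)) (h : ∀ s, F (s, 0) = F (s, 1)) :
    δ.ev (fun t => F (0, t)) = δ.ev (fun t => F (1, t)) := by
  have l0 : IsLoop P fun t => F (0, t) := ⟨fun t => hP _, by fun_prop, h 0⟩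
  have l1 : IsLoop P fun t => F (1, t) := ⟨fun t => hP _, by fun_prop, h 1⟩
  rw [δ.ev_eq l0, δ.ev_eq l1]
  let γ : Path (⟨F (0, 0), l0.1 0⟩ : {x // P x}) ⟨F (1, 0), l1.1 0⟩ :=
    { toFun := fun s => ⟨F (s, 0), hP _⟩
      continuous_toFun := by
        refine Continuous.subtype_mk ?_ _
        fun_prop
      source' := rfl
      target' := rfl }
  refine δ.val_eq_of_square _ _ γ ?_
  refine homotopic_of_map (squareMap F hF hP)
    ((seg ((0, 0) : ℝ × ℝ) (0, 1)).trans (seg (0, 1) (1, 1)))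
    ((seg ((0, 0) : ℝ × ℝ) (1, 0)).trans (seg (1, 0) (1, 1))) _ _ ?_ ?_
  · intro t
    simp only [Path.trans_apply]
    split_ifs with ht
    · have hm : 2 * (t : ℝ) ∈ Icc (0 : ℝ) 1 := ⟨by linarith [t.2.1], by linarith⟩
      simp [squareMap, seg, IsLoop.path, lineMap_apply_module, projIcc_of_mem _ hm]
    · have hm : 2 * (t : ℝ) - 1 ∈ Icc (0 : ℝ) 1 :=
        ⟨by linarith [not_le.1 ht], by linarith [t.2.2]⟩
      have : ∀ s : 𝕀, γ s = ⟨F (s, 1), hP _⟩ := fun s => Subtype.ext (h s)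
      rw [this]
      simp [squareMap, seg, lineMap_apply_module, projIcc_of_mem _ hm]
  · intro t
    simp only [Path.trans_apply]
    split_ifs with ht
    · have hm : 2 * (t : ℝ) ∈ Icc (0 : ℝ) 1 := ⟨by linarith [t.2.1], by linarith⟩
      simp [squareMap, seg, γ, lineMap_apply_module, projIcc_of_mem _ hm]
    · have hm : 2 * (t : ℝ) - 1 ∈ Icc (0 : ℝ) 1 :=
        ⟨by linarith [not_le.1 ht], by linarith [t.2.2]⟩
      simp [squareMap, seg, IsLoop.path, lineMap_apply_module, projIcc_of_mem _ hm]

lemma ev_torus (F : 𝕀 × 𝕀 → X) (hF : Continuous F)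
    (hP : ∀ x, P (F x)) (h : ∀ s, F (s, 0) = F (s, 1)) (h' : ∀ t, F (0, t) = F (1, t)) :
    δ.ev (fun t => F (t, t)) = δ.ev (fun t => F (t, 0)) + δ.ev (fun t => F (0, t)) := by
  have l0 : IsLoop P fun t => F (t, t) := ⟨fun t => hP _, by fun_prop, (h' 0).trans (h 1)⟩
  have l1 : IsLoop P fun t => F (t, 0) := ⟨fun t => hP _, by fun_prop, h' 0⟩
  have l2 : IsLoop P fun t => F (0, t) := ⟨fun t => hP _, by fun_prop, h 0⟩
  rw [δ.ev_eq l0, δ.ev_eq l1, δ.ev_eq l2]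
  change δ.val ⟨F (0, 0), _⟩ _ = δ.val ⟨F (0, 0), _⟩ _ + δ.val ⟨F (0, 0), _⟩ _
  rw [← δ.trans]
  refine δ.homotopic _ _ _ ?_
  refine homotopic_of_map (squareMap F hF hP) (seg ((0, 0) : ℝ × ℝ) (1, 1))
    ((seg ((0, 0) : ℝ × ℝ) (1, 0)).trans (seg (1, 0) (1, 1))) _ _ ?_ ?_
  · intro t
    simp [squareMap, seg, IsLoop.path, lineMap_apply_module]
  · intro t
    simp only [Path.trans_apply]
    split_ifs with ht
    · have hm : 2 * (t : ℝ) ∈ Icc (0 : ℝ) 1 := ⟨by linarith [t.2.1], by linarith⟩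
      simp [squareMap, seg, IsLoop.path, lineMap_apply_module, projIcc_of_mem _ hm]
    · have hm : 2 * (t : ℝ) - 1 ∈ Icc (0 : ℝ) 1 :=
        ⟨by linarith [not_le.1 ht], by linarith [t.2.2]⟩
      simp [squareMap, seg, IsLoop.path, lineMap_apply_module, projIcc_of_mem _ hm, h']

lemma ev_congr (F : 𝕀 → 𝕀 → X) (hF : Continuous (uncurry F))
    (hP : ∀ s t, P (F s t)) (h : ∀ s, F s 0 = F s 1) {f g : 𝕀 → X}
    (hf : ∀ t, F 0 t = f t) (hg : ∀ t, F 1 t = g t) : δ.ev f = δ.ev g := by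
  rw [← funext hf, ← funext hg]
  exact δ.ev_homotopy (uncurry F) hF (fun x => hP x.1 x.2) h

lemma ev_add_of_torus (F : 𝕀 → 𝕀 → X)
    (hF : Continuous (uncurry F))
    (hP : ∀ s t, P (F s t)) (h : ∀ s, F s 0 = F s 1) (h' : ∀ t, F 0 t = F 1 t)
    {f g k : 𝕀 → X}
    (hf : ∀ t, F t t = f t) (hg : ∀ t, F t 0 = g t) (hk : ∀ t, F 0 t = k t) :
    δ.ev f = δ.ev g + δ.ev k := by
  rw [← funext hf, ← funext hg, ← funext hk]
  exact δ.ev_torus (uncurry F) hF (fun x => hP x.1 x.2) h h'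

def comap {X' : Type*} [TopologicalSpace X'] {P' : X' → Prop} (g : X' → X)
    (hg : Continuous fun x : {x // P' x} => g x) (hP : ∀ x, P' x → P (g x)) : LoopClass P' :=
  let G : {x // P' x} → {x // P x} := fun x => ⟨g x, hP _ x.2⟩
  have hG : Continuous G := hg.subtype_mk _
  { val := fun x p => δ.val (G x) (p.map hG)
    homotopic := fun x p q h => δ.homotopic _ _ _ (h.map ⟨G, hG⟩)
    trans := fun x p q => by rw [Path.map_trans, δ.trans]
    conj := fun x y γ p => by
      rw [Path.map_trans, Path.map_trans, ← Path.map_symm, δ.conj] }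

lemma ev_comap {X' : Type*} [TopologicalSpace X'] {P' : X' → Prop} (g : X' → X)
    (hg : Continuous fun x : {x // P' x} => g x) (hP : ∀ x, P' x → P (g x))
    {f : 𝕀 → X'} (hf : IsLoop P' f) :
    (δ.comap g hg hP).ev f = δ.ev (fun t => g (f t)) := by
  have h : IsLoop P fun t => g (f t) :=
    ⟨fun t => hP _ (hf.1 t), hg.comp (hf.2.1.subtype_mk hf.1), congrArg g hf.2.2⟩
  rw [ev_eq _ hf, δ.ev_eq h]
  exact δ.val_congr _ _ fun t => rfl

end LoopClass

/-! ### The double cover of the rotation group -/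

abbrev M3 := Matrix (Fin 3) (Fin 3) ℝ

/-- The matrix of the conjugation `x ↦ q x q̄` of the imaginary quaternions. -/
def conjMat (a b c d : ℝ) : M3 :=
  !![a ^ 2 + b ^ 2 - c ^ 2 - d ^ 2, 2 * (b * c - a * d), 2 * (b * d + a * c);
    2 * (b * c + a * d), a ^ 2 - b ^ 2 + c ^ 2 - d ^ 2, 2 * (c * d - a * b);
    2 * (b * d - a * c), 2 * (c * d + a * b), a ^ 2 - b ^ 2 - c ^ 2 + d ^ 2]

lemma conjMat_det (a b c d : ℝ) :
    (conjMat a b c d).det = (a ^ 2 + b ^ 2 + c ^ 2 + d ^ 2) ^ 3 := by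
  simp [conjMat, det_fin_three]
  ring

lemma conjMat_mul_transpose (a b c d : ℝ) :
    conjMat a b c d * (conjMat a b c d).transpose =
      ((a ^ 2 + b ^ 2 + c ^ 2 + d ^ 2) ^ 2) • (1 : M3) := by
  ext i j
  fin_cases i <;> fin_cases j <;>
    simp [conjMat, mul_apply, sum_univ_three] <;> ring

lemma continuous_conjMat :
    Continuous fun q : ℝ × ℝ × ℝ × ℝ => conjMat q.1 q.2.1 q.2.2.1 q.2.2.2 := by
  refine continuous_matrix fun i j => ?_
  fin_cases i <;> fin_cases j <;> simp [conjMat] <;> fun_prop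

abbrev UnitQuat := Metric.sphere (0 : Quaternion ℝ) 1

abbrev SO3 := Matrix.specialOrthogonalGroup (Fin 3) ℝ

lemma mem_unitQuat (q : Quaternion ℝ) :
    q ∈ UnitQuat ↔ q.re ^ 2 + q.imI ^ 2 + q.imJ ^ 2 + q.imK ^ 2 = 1 := by
  rw [mem_sphere_zero_iff_norm, ← Quaternion.normSq_def', Quaternion.normSq_eq_norm_mul_self, ← sq,
    pow_eq_one_iff_of_nonneg (norm_nonneg q) two_ne_zero]

lemma conjMat_mul (a b c d a' b' c' d' : ℝ) :
    conjMat a b c d * conjMat a' b' c' d' =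
      conjMat (a * a' - b * b' - c * c' - d * d') (a * b' + b * a' + c * d' - d * c')
        (a * c' - b * d' + c * a' + d * b') (a * d' + b * c' - c * b' + d * a') := by
  ext i j
  fin_cases i <;> fin_cases j <;>
    simp [conjMat, mul_apply, sum_univ_three] <;> ring

def quatMat (q : Quaternion ℝ) : M3 := conjMat q.re q.imI q.imJ q.imK

lemma quatMat_mul (p q : Quaternion ℝ) : quatMat (p * q) = quatMat p * quatMat q := by
  have h1 := Quaternion.re_mul p q
  have h2 := Quaternion.imI_mul p q
  have h3 := Quaternion.imJ_mul p q
  have h4 := Quaternion.imK_mul p q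
  generalize p * q = r at *
  simp only [quatMat]
  rw [conjMat_mul, h1, h2, h3, h4]

lemma quatMat_one : quatMat 1 = 1 := by
  have h : quatMat 1 = conjMat 1 0 0 0 := by
    rw [quatMat, Quaternion.re_one, Quaternion.imI_one, Quaternion.imJ_one, Quaternion.imK_one]
  rw [h]
  ext i j
  fin_cases i <;> fin_cases j <;> simp [conjMat]

lemma continuous_quatMat : Continuous quatMat := by
  have h1 := Quaternion.continuous_re
  have h2 := Quaternion.continuous_imI
  have h3 := Quaternion.continuous_imJ
  have h4 := Quaternion.continuous_imK
  refine continuous_matrix fun i j => ?_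
  fin_cases i <;> fin_cases j <;> simp [quatMat, conjMat] <;> fun_prop

lemma mem_SO3_iff (A : M3) :
    A ∈ Matrix.specialOrthogonalGroup (Fin 3) ℝ ↔ A * A.transpose = 1 ∧ A.det = 1 := by
  exact Matrix.mem_specialOrthogonalGroup_iff.trans
    (and_congr_left' (Matrix.mem_orthogonalGroup_iff (Fin 3) ℝ))

/-- The double cover `S³ → SO(3)`. -/
def quatHom : UnitQuat →* SO3 where
  toFun q := ⟨quatMat q, by
    rw [mem_SO3_iff]
    have h := (mem_unitQuat q.1).1 q.2
    refine ⟨?_, ?_⟩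
    · rw [quatMat, conjMat_mul_transpose, h]; simp
    · rw [quatMat, conjMat_det, h]; simp⟩
  map_one' := by
    apply Subtype.ext
    exact quatMat_one
  map_mul' p q := Subtype.ext (quatMat_mul p q)

lemma continuous_quatHom : Continuous quatHom :=
  (continuous_quatMat.comp continuous_subtype_val).subtype_mk _

/-- The rotation by the angle `α` in the plane of the first two coordinates, acting on rows. -/
def rotZ (α : ℝ) : M3 := !![cos α, sin α, 0; -sin α, cos α, 0; 0, 0, 1]

lemma exists_quat_of_column (x y z : ℝ) (h : x ^ 2 + y ^ 2 + z ^ 2 = 1) :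
    ∃ q : UnitQuat, (quatMat q) 0 0 = x ∧ (quatMat q) 1 0 = y ∧ (quatMat q) 2 0 = z := by
  by_cases hx : x = -1
  · subst hx
    have hy : y = 0 := by nlinarith [sq_nonneg y, sq_nonneg z]
    have hz : z = 0 := by nlinarith [sq_nonneg y, sq_nonneg z]
    refine ⟨⟨(⟨0, 0, 1, 0⟩ : Quaternion ℝ), ?_⟩, ?_⟩
    · exact (mem_unitQuat _).2 (by norm_num)
    · simp [quatMat, conjMat, hy, hz]
  · have hx1 : 0 < 1 + x := by
      rcases lt_or_gt_of_ne hx with h' | h'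
      · nlinarith [sq_nonneg y, sq_nonneg z]
      · linarith
    set s := sqrt (2 * (1 + x)) with hs
    have hs2 : s ^ 2 = 2 * (1 + x) := Real.sq_sqrt (by linarith)
    have hs0 : s ≠ 0 := (Real.sqrt_pos.2 (by linarith)).ne'
    refine ⟨⟨(⟨0, (1 + x) / s, y / s, z / s⟩ : Quaternion ℝ), ?_⟩, ?_⟩
    · refine (mem_unitQuat _).2 ?_
      simp only [div_pow, hs2]
      field_simp
      linear_combination h
    · have h1 : ∀ u v : ℝ, u / s * (v / s) = u * v / (2 * (1 + x)) := fun u v => by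
        rw [← hs2]; field_simp
      simp only [quatMat, conjMat, Matrix.of_apply, Matrix.cons_val', Matrix.cons_val_zero,
        Matrix.cons_val_one, Matrix.cons_val, sq, h1]
      refine ⟨?_, ?_, ?_⟩ <;> field_simp <;> nlinarith

lemma exists_of_column_eq {S : M3} (h : S * S.transpose = 1) (hdet : S.det = 1)
    (s00 : S 0 0 = 1) (s10 : S 1 0 = 0) (s20 : S 2 0 = 0) :
    ∃ α : ℝ, S = !![1, 0, 0; 0, cos α, -sin α; 0, sin α, cos α] := by
  have t00 := congrFun (congrFun h 0) 0
  have t11 := congrFun (congrFun h 1) 1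
  have t22 := congrFun (congrFun h 2) 2
  simp only [mul_apply, sum_univ_three, Matrix.transpose_apply, s00, s10, s20,
    Matrix.one_apply_eq] at t00 t11 t22
  rw [det_fin_three] at hdet
  simp only [s00, s10, s20] at hdet
  clear h
  have s01 : S 0 1 = 0 := by
    have : S 0 1 ^ 2 ≤ 0 := by linarith [sq_nonneg (S 0 2), sq (S 0 1), sq (S 0 2)]
    exact pow_eq_zero_iff two_ne_zero |>.1 (le_antisymm this (sq_nonneg _))
  have s02 : S 0 2 = 0 := by
    have : S 0 2 ^ 2 ≤ 0 := by linarith [sq_nonneg (S 0 1), sq (S 0 1), sq (S 0 2)]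
    exact pow_eq_zero_iff two_ne_zero |>.1 (le_antisymm this (sq_nonneg _))
  have hsum : (S 2 2 - S 1 1) ^ 2 + (S 1 2 + S 2 1) ^ 2 = 0 := by
    linear_combination t11 + t22 - 2 * hdet
  have hz : S 2 2 = S 1 1 := by
    have : (S 2 2 - S 1 1) ^ 2 ≤ 0 := by linarith [sq_nonneg (S 1 2 + S 2 1)]
    linarith [pow_eq_zero_iff two_ne_zero |>.1 (le_antisymm this (sq_nonneg _))]
  have hy : S 1 2 = -S 2 1 := by
    have : (S 1 2 + S 2 1) ^ 2 ≤ 0 := by linarith [sq_nonneg (S 2 2 - S 1 1)]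
    linarith [pow_eq_zero_iff two_ne_zero |>.1 (le_antisymm this (sq_nonneg _))]
  have huv : S 1 1 * S 1 1 + S 2 1 * S 2 1 = 1 := by rw [hz] at t22; linarith
  obtain ⟨w, hw⟩ : ∃ w : ℂ, w = ⟨S 1 1, S 2 1⟩ := ⟨_, rfl⟩
  have hw1 : ‖w‖ = 1 := by
    rw [← sq_eq_sq₀ (norm_nonneg _) zero_le_one, ← Complex.normSq_eq_norm_sq, hw,
      Complex.normSq_mk, huv, one_pow]
  have hw0 : w ≠ 0 := fun h => by simp [h] at hw1
  have hcos : cos w.arg = S 1 1 := by rw [Complex.cos_arg hw0, hw1, hw]; simp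
  have hsin : sin w.arg = S 2 1 := by rw [Complex.sin_arg, hw1, hw]; simp
  refine ⟨w.arg, ?_⟩
  ext i j
  fin_cases i <;> fin_cases j <;> simp [s00, s10, s20, s01, s02, hz, hy, hcos, hsin]

lemma quatHom_surjective : Function.Surjective quatHom := by
  intro R
  have hR := (mem_SO3_iff R.1).1 R.2
  have hR' : R.1.transpose * R.1 = 1 := mul_eq_one_comm.1 hR.1
  have hc : R.1 0 0 ^ 2 + R.1 1 0 ^ 2 + R.1 2 0 ^ 2 = 1 := by
    have := congrFun (congrFun hR' 0) 0
    simp only [mul_apply, sum_univ_three, Matrix.transpose_apply, Matrix.one_apply_eq] at this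
    linarith
  obtain ⟨q, h0, h1, h2⟩ := exists_quat_of_column _ _ _ hc
  set S : SO3 := (quatHom q)⁻¹ * R with hS
  have hSm := (mem_SO3_iff S.1).1 S.2
  have hcol : R = quatHom q * S := by rw [hS]; group
  have hq := (mem_SO3_iff (quatHom q).1).1 (quatHom q).2
  have hq' : (quatHom q).1.transpose * (quatHom q).1 = 1 := mul_eq_one_comm.1 hq.1
  have hSR : S.1 = (quatHom q).1.transpose * R.1 := by
    rw [hcol]; change _ = _ * ((quatHom q).1 * S.1)
    rw [← Matrix.mul_assoc, hq', Matrix.one_mul]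
  have hq1 := fun i j => congrFun (congrFun hq' i) j
  have e0 : ∀ i, R.1 i 0 = (quatHom q).1 i 0 := by
    intro i
    fin_cases i
    · exact h0.symm
    · exact h1.symm
    · exact h2.symm
  have hS0 : ∀ i, S.1 i 0 = (1 : M3) i 0 := by
    intro i
    rw [hSR, ← hq1 i 0, mul_apply, mul_apply]
    exact Finset.sum_congr rfl fun j _ => by rw [e0]
  obtain ⟨α, hα⟩ := exists_of_column_eq hSm.1 hSm.2 (by simpa using hS0 0) (by simpa using hS0 1)
    (by simpa using hS0 2)
  have hq2 : (⟨cos (α / 2), sin (α / 2), 0, 0⟩ : Quaternion ℝ) ∈ UnitQuat :=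
    (mem_unitQuat _).2 (by simp)
  refine ⟨q * ⟨_, hq2⟩, ?_⟩
  rw [map_mul, hcol]
  congr 1
  apply Subtype.ext
  have hc2 : cos α = cos (α / 2) ^ 2 - sin (α / 2) ^ 2 := by
    rw [← Real.cos_two_mul']; ring_nf
  have hs2 : sin α = 2 * sin (α / 2) * cos (α / 2) := by
    rw [← Real.sin_two_mul]; ring_nf
  have hcs := Real.cos_sq_add_sin_sq (α / 2)
  change conjMat (cos (α / 2)) (sin (α / 2)) 0 0 = S.1
  rw [hα]
  ext i j
  fin_cases i <;> fin_cases j <;> simp [conjMat, hc2, hs2] <;> ring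

lemma mem_ker_quatHom {q : UnitQuat} (h : quatHom q = 1) : q = 1 ∨ q = -1 := by
  have h1 : quatMat q = 1 := congrArg Subtype.val h
  have h00 := congrFun (congrFun h1 0) 0
  have h11 := congrFun (congrFun h1 1) 1
  have h22 := congrFun (congrFun h1 2) 2
  have hn := (mem_unitQuat q.1).1 q.2
  simp [quatMat, conjMat] at h00 h11 h22
  have hi : q.1.imI = 0 := by
    nlinarith [sq_nonneg q.1.imI, sq_nonneg q.1.imJ, sq_nonneg q.1.imK]
  have hj : q.1.imJ = 0 := by
    nlinarith [sq_nonneg q.1.imI, sq_nonneg q.1.imJ, sq_nonneg q.1.imK]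
  have hk : q.1.imK = 0 := by
    nlinarith [sq_nonneg q.1.imI, sq_nonneg q.1.imJ, sq_nonneg q.1.imK]
  rw [hi, hj, hk] at hn
  have : (q.1.re - 1) * (q.1.re + 1) = 0 := by linarith
  rcases mul_eq_zero.1 this with h | h
  · left
    apply Subtype.ext
    refine QuaternionAlgebra.ext ?_ hi hj hk
    change q.1.re = 1
    linarith
  · right
    apply Subtype.ext
    refine QuaternionAlgebra.ext ?_ (hi.trans neg_zero.symm) (hj.trans neg_zero.symm)
      (hk.trans neg_zero.symm)
    change q.1.re = -1
    linarith

lemma isCoveringMap_quatHom : IsCoveringMap quatHom := by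
  have hq : Topology.IsQuotientMap quatHom :=
    (continuous_quatHom.isClosedMap).isQuotientMap continuous_quatHom quatHom_surjective
  refine (hq.isQuotientCoveringMap_of_isDiscrete_ker_monoidHom ?_).isCoveringMap
  have hfin : (quatHom.ker : Set UnitQuat) ⊆ {1, -1} := fun q h => mem_ker_quatHom h
  exact ((Set.toFinite _).subset hfin).isDiscrete

/-! ### The generator of `H¹(GL⁺(3); ℤ/2)` -/

/-- The path `p` of rotations lifts to a path of quaternions from `e` to `e'`. -/
def Lifts {x y : SO3} (p : Path x y) (e e' : UnitQuat) : Prop :=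
  ∃ Γ : Path e e', ∀ t, quatHom (Γ t) = p t

namespace Lifts

variable {x y z : SO3} {p : Path x y} {q : Path y z} {e e' e'' : UnitQuat}

lemma exists_lift (p : Path x y) (he : quatHom e = x) : ∃ e', Lifts p e e' := by
  have h0 : p.toContinuousMap 0 = quatHom e := by simp [he]
  let Γ := isCoveringMap_quatHom.liftPath p.toContinuousMap e h0
  refine ⟨Γ 1, ⟨⟨Γ, isCoveringMap_quatHom.liftPath_zero .., rfl⟩, fun t => ?_⟩⟩
  exact congrFun (isCoveringMap_quatHom.liftPath_lifts p.toContinuousMap e h0) t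

lemma unique_of_homotopic {p p' : Path x y} {e₁ : UnitQuat} (hp : p.Homotopic p')
    (h : Lifts p e e') (h' : Lifts p' e e₁) : e' = e₁ := by
  obtain ⟨Γ, hΓ⟩ := h
  obtain ⟨Γ', hΓ'⟩ := h'
  have h0 : p.toContinuousMap 0 = quatHom e := by
    have := hΓ 0
    simpa using this.symm
  have h0' : p'.toContinuousMap 0 = quatHom e := by
    have := hΓ' 0
    simpa using this.symm
  have e1 : Γ.toContinuousMap = isCoveringMap_quatHom.liftPath p.toContinuousMap e h0 :=
    (isCoveringMap_quatHom.eq_liftPath_iff' ..).2 ⟨funext hΓ, Γ.source⟩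
  have e2 : Γ'.toContinuousMap = isCoveringMap_quatHom.liftPath p'.toContinuousMap e h0' :=
    (isCoveringMap_quatHom.eq_liftPath_iff' ..).2 ⟨funext hΓ', Γ'.source⟩
  have := isCoveringMap_quatHom.liftPath_apply_one_eq_of_homotopicRel hp e h0 h0'
  rw [← e1, ← e2] at this
  simpa using this

lemma unique {e₁ : UnitQuat} (h : Lifts p e e') (h' : Lifts p e e₁) : e' = e₁ :=
  unique_of_homotopic (Path.Homotopic.refl p) h h'

lemma symm (h : Lifts p e e') : Lifts p.symm e' e := by
  obtain ⟨Γ, hΓ⟩ := h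
  exact ⟨Γ.symm, fun t => hΓ _⟩

lemma trans (h : Lifts p e e') (h' : Lifts q e' e'') : Lifts (p.trans q) e e'' := by
  obtain ⟨Γ, hΓ⟩ := h
  obtain ⟨Γ', hΓ'⟩ := h'
  refine ⟨Γ.trans Γ', fun t => ?_⟩
  simp only [Path.trans_apply]
  split_ifs
  · exact hΓ _
  · exact hΓ' _

lemma source (h : Lifts p e e') : quatHom e = x := by
  obtain ⟨Γ, hΓ⟩ := h
  simpa using hΓ 0

lemma target (h : Lifts p e e') : quatHom e' = y := by
  obtain ⟨Γ, hΓ⟩ := h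
  simpa using hΓ 1

lemma quatHom_neg (e : UnitQuat) : quatHom (-e) = quatHom e := by
  apply Subtype.ext
  change quatMat (-e.1) = quatMat e.1
  simp [quatMat, conjMat]

lemma neg (h : Lifts p e e') : Lifts p (-e) (-e') := by
  obtain ⟨Γ, hΓ⟩ := h
  refine ⟨Γ.map continuous_neg, fun t => ?_⟩
  rw [Path.map_coe, Function.comp, quatHom_neg, hΓ]

end Lifts

lemma eq_or_eq_neg {e e' : UnitQuat} (h : quatHom e = quatHom e') : e' = e ∨ e' = -e := by
  have : quatHom (e' * e⁻¹) = 1 := by rw [map_mul, map_inv, h, mul_inv_cancel]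
  rcases mem_ker_quatHom this with h | h
  · left; rwa [mul_inv_eq_one] at h
  · right
    rw [mul_inv_eq_iff_eq_mul] at h
    rw [h]
    apply Subtype.ext
    change (-1 : Quaternion ℝ) * e.1 = -e.1
    exact neg_one_mul _

lemma UnitQuat_ne_neg (e : UnitQuat) : e ≠ -e := fun h =>
  ne_neg_of_mem_unit_sphere ℝ e h

open Classical in
/-- The class of the double cover `S³ → SO(3)`. -/
def spinVal {x : SO3} (p : Path x x) : ZMod 2 := if ∃ e, Lifts p e e then 0 else 1

lemma spinVal_eq_zero_iff {x : SO3} {p : Path x x} {e e' : UnitQuat} (h : Lifts p e e') :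
    spinVal p = 0 ↔ e' = e := by
  rw [spinVal]
  constructor
  · intro h0
    split_ifs at h0 with h1
    · obtain ⟨e₁, h₁⟩ := h1
      rcases eq_or_eq_neg (h₁.source.trans h.source.symm) with rfl | rfl
      · exact h.unique h₁
      · exact h.unique h₁.neg
    · exact absurd h0 (by decide)
  · rintro rfl
    rw [if_pos ⟨_, h⟩]

lemma spinVal_eq_one_iff {x : SO3} {p : Path x x} {e e' : UnitQuat} (h : Lifts p e e') :
    spinVal p = 1 ↔ e' = -e := by
  have h01 : spinVal p = 1 ↔ ¬ spinVal p = 0 := by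
    generalize spinVal p = a
    revert a
    decide
  rw [h01, spinVal_eq_zero_iff h]
  constructor
  · intro h'
    exact (eq_or_eq_neg (h.source.trans h.target.symm)).resolve_left h'
  · rintro rfl h'
    exact UnitQuat_ne_neg e h'.symm

lemma spinVal_cases {x : SO3} (p : Path x x) {e : UnitQuat} (he : quatHom e = x) :
    (spinVal p = 0 ∧ Lifts p e e) ∨ (spinVal p = 1 ∧ Lifts p e (-e)) := by
  obtain ⟨e', h⟩ := Lifts.exists_lift p he
  rcases eq_or_eq_neg (h.source.trans h.target.symm) with rfl | rfl
  · exact Or.inl ⟨(spinVal_eq_zero_iff h).2 rfl, h⟩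
  · exact Or.inr ⟨(spinVal_eq_one_iff h).2 rfl, h⟩

lemma spinVal_homotopic {x : SO3} {p q : Path x x} (h : p.Homotopic q) :
    spinVal p = spinVal q := by
  obtain ⟨e, he⟩ := quatHom_surjective x
  obtain ⟨e₁, h₁⟩ := Lifts.exists_lift p he
  obtain ⟨e₂, h₂⟩ := Lifts.exists_lift q he
  obtain rfl := Lifts.unique_of_homotopic h h₁ h₂
  rcases spinVal_cases p he with ⟨h3, h4⟩ | ⟨h3, h4⟩
  · obtain rfl := h4.unique h₁
    rw [h3, (spinVal_eq_zero_iff h₂).2 rfl]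
  · obtain rfl := h4.unique h₁
    rw [h3, (spinVal_eq_one_iff h₂).2 rfl]

lemma spinVal_trans {x : SO3} (p q : Path x x) :
    spinVal (p.trans q) = spinVal p + spinVal q := by
  obtain ⟨e, he⟩ := quatHom_surjective x
  rcases spinVal_cases p he with ⟨h3, h4⟩ | ⟨h3, h4⟩ <;>
    rcases spinVal_cases q he with ⟨h5, h6⟩ | ⟨h5, h6⟩ <;> rw [h3, h5]
  · exact (spinVal_eq_zero_iff (h4.trans h6)).2 rfl
  · exact (spinVal_eq_one_iff (h4.trans h6)).2 rfl
  · exact (spinVal_eq_one_iff (h4.trans h6.neg)).2 rfl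
  · exact (spinVal_eq_zero_iff (h4.trans h6.neg)).2 (neg_neg e)

lemma spinVal_conj {x y : SO3} (γ : Path x y) (p : Path x x) :
    spinVal (γ.symm.trans (p.trans γ)) = spinVal p := by
  obtain ⟨e, he⟩ := quatHom_surjective x
  obtain ⟨e₁, h₁⟩ := Lifts.exists_lift γ he
  rcases spinVal_cases p he with ⟨h3, h4⟩ | ⟨h3, h4⟩ <;> rw [h3]
  · exact (spinVal_eq_zero_iff (h₁.symm.trans (h4.trans h₁))).2 rfl
  · exact (spinVal_eq_one_iff (h₁.symm.trans (h4.trans h₁.neg))).2 rfl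

def IsGL (A : M3) : Prop := 0 < A.det

/-- Orthonormalization of the rows of a matrix of positive determinant. -/
def gsU (A : M3) (j : Fin 3) : ℝ := A 0 j / sqrt (A 0 0 ^ 2 + A 0 1 ^ 2 + A 0 2 ^ 2)

def crossRow (A : M3) : Fin 3 → ℝ :=
  ![A 0 1 * A 1 2 - A 0 2 * A 1 1, A 0 2 * A 1 0 - A 0 0 * A 1 2, A 0 0 * A 1 1 - A 0 1 * A 1 0]

def gsN (A : M3) (j : Fin 3) : ℝ :=
  crossRow A j / sqrt (crossRow A 0 ^ 2 + crossRow A 1 ^ 2 + crossRow A 2 ^ 2)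

def gs (A : M3) : M3 := !![gsU A 0, gsU A 1, gsU A 2;
    gsN A 1 * gsU A 2 - gsN A 2 * gsU A 1, gsN A 2 * gsU A 0 - gsN A 0 * gsU A 2,
      gsN A 0 * gsU A 1 - gsN A 1 * gsU A 0;
    gsN A 0, gsN A 1, gsN A 2]

lemma det_eq_crossRow (A : M3) :
    A.det = A 2 0 * crossRow A 0 + A 2 1 * crossRow A 1 + A 2 2 * crossRow A 2 := by
  rw [det_fin_three]
  simp [crossRow]
  ring

lemma crossRow_pos {A : M3} (h : IsGL A) :
    0 < crossRow A 0 ^ 2 + crossRow A 1 ^ 2 + crossRow A 2 ^ 2 := by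
  by_contra hc
  have h0 : crossRow A 0 = 0 := by nlinarith [sq_nonneg (crossRow A 0), sq_nonneg (crossRow A 1), sq_nonneg (crossRow A 2)]
  have h1 : crossRow A 1 = 0 := by nlinarith [sq_nonneg (crossRow A 0), sq_nonneg (crossRow A 1), sq_nonneg (crossRow A 2)]
  have h2 : crossRow A 2 = 0 := by nlinarith [sq_nonneg (crossRow A 0), sq_nonneg (crossRow A 1), sq_nonneg (crossRow A 2)]
  rw [IsGL, det_eq_crossRow, h0, h1, h2] at h
  simp at h

lemma row_pos {A : M3} (h : IsGL A) : 0 < A 0 0 ^ 2 + A 0 1 ^ 2 + A 0 2 ^ 2 := by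
  by_contra hc
  have h0 : A 0 0 = 0 := by nlinarith [sq_nonneg (A 0 0), sq_nonneg (A 0 1), sq_nonneg (A 0 2)]
  have h1 : A 0 1 = 0 := by nlinarith [sq_nonneg (A 0 0), sq_nonneg (A 0 1), sq_nonneg (A 0 2)]
  have h2 : A 0 2 = 0 := by nlinarith [sq_nonneg (A 0 0), sq_nonneg (A 0 1), sq_nonneg (A 0 2)]
  rw [IsGL, det_fin_three, h0, h1, h2] at h
  simp at h

lemma exists_triangular {A : M3} (h : IsGL A) :
    ∃ a b c p q r : ℝ, 0 < a ∧ 0 < b ∧ 0 < c ∧ A = !![a, 0, 0; p, b, 0; q, r, c] * gs A ∧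
      gs A * (gs A).transpose = 1 ∧ (gs A).det = 1 := by
  set s := sqrt (A 0 0 ^ 2 + A 0 1 ^ 2 + A 0 2 ^ 2) with hs
  set n := sqrt (crossRow A 0 ^ 2 + crossRow A 1 ^ 2 + crossRow A 2 ^ 2) with hn
  have s0 : 0 < s := Real.sqrt_pos.2 (row_pos h)
  have n0 : 0 < n := Real.sqrt_pos.2 (crossRow_pos h)
  have s2 : s ^ 2 = A 0 0 ^ 2 + A 0 1 ^ 2 + A 0 2 ^ 2 := Real.sq_sqrt (row_pos h).le
  have n2 : n ^ 2 = crossRow A 0 ^ 2 + crossRow A 1 ^ 2 + crossRow A 2 ^ 2 :=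
    Real.sq_sqrt (crossRow_pos h).le
  have uu : gsU A 0 ^ 2 + gsU A 1 ^ 2 + gsU A 2 ^ 2 = 1 := by
    simp only [gsU, ← hs, div_pow, ← add_div]
    rw [← s2]
    exact div_self (pow_pos s0 2).ne'
  have nn : gsN A 0 ^ 2 + gsN A 1 ^ 2 + gsN A 2 ^ 2 = 1 := by
    simp only [gsN, ← hn, div_pow, ← add_div]
    rw [← n2]
    exact div_self (pow_pos n0 2).ne'
  have un : gsU A 0 * gsN A 0 + gsU A 1 * gsN A 1 + gsU A 2 * gsN A 2 = 0 := by
    simp only [gsU, gsN, ← hs, ← hn]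
    field_simp
    simp [crossRow]
    ring
  have bn : A 1 0 * gsN A 0 + A 1 1 * gsN A 1 + A 1 2 * gsN A 2 = 0 := by
    simp only [gsN, ← hn]
    field_simp
    simp [crossRow]
    ring
  have au : ∀ j, A 0 j = s * gsU A j := fun j => by simp only [gsU, ← hs]; field_simp
  have cn : ∀ j, crossRow A j = n * gsN A j := fun j => by simp only [gsN, ← hn]; field_simp
  have horth : gs A * (gs A).transpose = 1 := by
    ext i j
    fin_cases i <;> fin_cases j <;> simp [gs, mul_apply, sum_univ_three]
    · linear_combination uu
    · ring
    · linear_combination un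
    · ring
    · linear_combination (gsN A 0 ^ 2 + gsN A 1 ^ 2 + gsN A 2 ^ 2) * uu + nn -
        (gsU A 0 * gsN A 0 + gsU A 1 * gsN A 1 + gsU A 2 * gsN A 2) * un
    · ring
    · linear_combination un
    · ring
    · linear_combination nn
  have hdet : (gs A).det = 1 := by
    simp only [gs, det_fin_three]
    simp
    linear_combination (gsN A 0 ^ 2 + gsN A 1 ^ 2 + gsN A 2 ^ 2) * uu + nn -
      (gsU A 0 * gsN A 0 + gsU A 1 * gsN A 1 + gsU A 2 * gsN A 2) * un
  have horth' : (gs A).transpose * gs A = 1 := mul_eq_one_comm.1 horth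
  have hA : A = (A * (gs A).transpose) * gs A := by
    rw [Matrix.mul_assoc, horth', Matrix.mul_one]
  set T := A * (gs A).transpose with hT
  have t00 : T 0 0 = s := by
    simp [hT, gs, mul_apply, sum_univ_three, au]
    linear_combination s * uu
  have t01 : T 0 1 = 0 := by
    simp [hT, gs, mul_apply, sum_univ_three, au]
    ring
  have t02 : T 0 2 = 0 := by
    simp [hT, gs, mul_apply, sum_univ_three, au]
    linear_combination s * un
  have t12 : T 1 2 = 0 := by
    simp [hT, gs, mul_apply, sum_univ_three]
    linear_combination bn
  have t11 : T 1 1 = n / s := by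
    have c0 := cn 0
    have c1 := cn 1
    have c2 := cn 2
    simp only [crossRow, au 0, au 1, au 2] at c0 c1 c2
    simp at c0 c1 c2
    simp [hT, gs, mul_apply, sum_univ_three]
    rw [eq_div_iff s0.ne']
    linear_combination n * nn + gsN A 0 * c0 + gsN A 1 * c1 + gsN A 2 * c2
  have t22 : T 2 2 = A.det / n := by
    rw [eq_div_iff n0.ne', det_eq_crossRow, cn, cn, cn]
    simp [hT, gs, mul_apply, sum_univ_three]
    ring
  refine ⟨T 0 0, T 1 1, T 2 2, T 1 0, T 2 0, T 2 1, ?_, ?_, ?_, ?_, horth, hdet⟩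
  · rw [t00]; exact s0
  · rw [t11]; positivity
  · rw [t22]; exact div_pos h n0
  · have : T = !![T 0 0, 0, 0; T 1 0, T 1 1, 0; T 2 0, T 2 1, T 2 2] := by
      ext i j
      fin_cases i <;> fin_cases j <;> simp [t01, t02, t12]
    rw [← this]
    exact hA

lemma exists_norm_ge (f : 𝕀 → Fin 4 → ℝ) (hf : Continuous f) (h0 : ∀ t, f t ≠ 0) :
    ∃ m > 0, ∀ t, m ≤ ‖f t‖ := by
  obtain ⟨t, -, ht⟩ := isCompact_univ.exists_isMinOn Set.univ_nonempty hf.norm.continuousOn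
  exact ⟨‖f t‖, norm_pos_iff.2 (h0 t), fun s => ht (Set.mem_univ s)⟩

/-- Loops in `ℝ⁴ ∖ 0` are null-homotopic. -/
lemma ev_punctured_space (δ : LoopClass fun v : Fin 4 → ℝ => v ≠ 0)
    {f : 𝕀 → Fin 4 → ℝ} (hf : IsLoop (fun v : Fin 4 → ℝ => v ≠ 0) f) : δ.ev f = 0 := by
  obtain ⟨h0, hc, hl⟩ := hf
  obtain ⟨m, hm, hfm⟩ := exists_norm_ge f hc h0
  have hp : ∀ i : Fin 4, ∃ p : Polynomial ℝ, ∀ t : 𝕀,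
      |p.eval (t : ℝ) - f t i| < m / 4 := by
    intro i
    obtain ⟨p, hp⟩ := exists_polynomial_near_continuousMap 0 1
      (⟨fun t => f t i, by fun_prop⟩ : C(Icc (0 : ℝ) 1, ℝ)) (m / 4) (by positivity)
    refine ⟨p, fun t => ?_⟩
    have := (ContinuousMap.norm_lt_iff _ (by positivity)).1 hp t
    simpa using this
  choose p hp using hp
  let g : ℝ → Fin 4 → ℝ := fun t i => (p i).eval t + t * ((p i).eval 0 - (p i).eval 1)
  have hgd : ContDiff ℝ 1 g := by
    refine contDiff_pi.2 fun i => ?_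
    have h1 : ContDiff ℝ 1 fun t : ℝ => (p i).eval t := by
      simpa [Polynomial.aeval_def] using (p i).contDiff_aeval (𝕜 := ℝ) 1
    exact h1.add (contDiff_id.mul contDiff_const)
  have hgl : g 0 = g 1 := by ext i; simp [g]
  have hgf : ∀ t : 𝕀, ‖g t - f t‖ < m := by
    intro t
    refine (pi_norm_lt_iff hm).2 fun i => ?_
    have h1 := hp i t
    have h2 := hp i 0
    have h3 := hp i 1
    have h4 := congrFun hl i
    have ht := t.2
    rw [norm_eq_abs, Pi.sub_apply]
    simp only [g]
    rw [abs_lt] at *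
    simp only [Icc.coe_zero, Icc.coe_one] at h2 h3
    constructor <;> nlinarith [ht.1, ht.2]
  have hgc : Continuous g := hgd.continuous
  have hne : ∀ (s t : 𝕀), (1 - (s : ℝ)) • f t + (s : ℝ) • g t ≠ 0 := by
    intro s t h
    have h1 : f t = -((s : ℝ) • (g t - f t)) := by
      rw [← sub_eq_zero, ← h]; module
    have h2 := hgf t
    have h3 := hfm t
    rw [h1, norm_neg, norm_smul, norm_eq_abs, abs_of_nonneg s.2.1] at h3
    nlinarith [s.2.1, s.2.2, norm_nonneg (g t - f t)]
  have step1 : δ.ev f = δ.ev fun t => g t := by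
    refine δ.ev_congr (fun s t => (1 - (s : ℝ)) • f t + (s : ℝ) • g t) ?_ hne ?_ ?_ ?_
    · simp only [uncurry_def]; fun_prop
    · intro s; simp [hl, hgl]
    · intro t; simp
    · intro t; simp
  have hcone : ContDiff ℝ 1 fun x : ℝ × ℝ => x.2 • g x.1 :=
    contDiff_snd.smul (hgd.comp contDiff_fst)
  have hd := hcone.dense_compl_range_of_finrank_lt_finrank (by simp)
  obtain ⟨v, hv⟩ := hd.nonempty
  have hg0 : ∀ t : 𝕀, g t ≠ 0 := fun t => by simpa using hne 1 t
  have step2 : δ.ev (fun t => g t) = δ.ev fun _ => -v := by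
    refine δ.ev_congr (fun s t => (1 - (s : ℝ)) • g t + (s : ℝ) • (-v)) ?_ ?_ ?_ ?_ ?_
    · simp only [uncurry_def]; fun_prop
    · intro s t h
      by_cases hs : (s : ℝ) = 0
      · rw [hs] at h
        exact hg0 t (by simpa using h)
      · apply hv
        refine ⟨(t, (s : ℝ)⁻¹ * (1 - s)), ?_⟩
        simp only
        rw [mul_smul, inv_smul_eq_iff₀ hs]
        rw [smul_neg, ← sub_eq_add_neg, sub_eq_zero] at h
        exact h
    · intro s; simp [hgl]
    · intro t; simp
    · intro t; simp
  rw [step1, step2, δ.ev_const]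

lemma ev_conjMat (δ : LoopClass IsGL) {f : 𝕀 → Fin 4 → ℝ}
    (hf : IsLoop (fun v : Fin 4 → ℝ => v ≠ 0) f) :
    δ.ev (fun t => conjMat (f t 0) (f t 1) (f t 2) (f t 3)) = 0 := by
  have hc : Continuous fun v : {v : Fin 4 → ℝ // v ≠ 0} =>
      conjMat (v.1 0) (v.1 1) (v.1 2) (v.1 3) := by
    refine continuous_conjMat.comp (f := fun v : {v : Fin 4 → ℝ // v ≠ 0} =>
      (v.1 0, v.1 1, v.1 2, v.1 3)) ?_
    have h : ∀ i, Continuous fun v : {v : Fin 4 → ℝ // v ≠ 0} => v.1 i := fun i =>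
      (continuous_apply i).comp continuous_subtype_val
    exact (h 0).prodMk ((h 1).prodMk ((h 2).prodMk (h 3)))
  have hP : ∀ v : Fin 4 → ℝ, v ≠ 0 → IsGL (conjMat (v 0) (v 1) (v 2) (v 3)) := by
    intro v hv
    rw [IsGL, conjMat_det]
    refine pow_pos (lt_of_le_of_ne (by positivity) fun h => hv ?_) 3
    ext i
    have h' : ∀ i, v i ^ 2 = 0 := by
      intro i
      fin_cases i <;> simp only [Fin.zero_eta, Fin.mk_one, Fin.reduceFinMk] <;>
      nlinarith [sq_nonneg (v 0), sq_nonneg (v 1), sq_nonneg (v 2), sq_nonneg (v 3)]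
    simpa using h' i
  rw [← δ.ev_comap (fun v : Fin 4 → ℝ => conjMat (v 0) (v 1) (v 2) (v 3)) hc hP hf]
  exact ev_punctured_space _ hf

lemma isGL_of_mem_SO3 {A : M3} (h : A ∈ SO3) : IsGL A := by
  rw [IsGL, ((mem_SO3_iff A).1 h).2]; exact one_pos

lemma gs_mem {A : M3} (h : IsGL A) : gs A ∈ SO3 := by
  obtain ⟨a, b, c, p, q, r, -, -, -, -, h1, h2⟩ := exists_triangular h
  exact (mem_SO3_iff _).2 ⟨h1, h2⟩

lemma continuous_gs : Continuous fun A : {A : M3 // IsGL A} => gs A := by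
  have he : ∀ i j, Continuous fun A : {A : M3 // IsGL A} => A.1 i j := fun i j =>
    continuous_subtype_val.matrix_elem i j
  have hu : ∀ j, Continuous fun A : {A : M3 // IsGL A} => gsU A.1 j := by
    intro j
    refine (he 0 j).div (Continuous.sqrt ?_) fun A => (Real.sqrt_pos.2 (row_pos A.2)).ne'
    exact (((he 0 0).pow 2).add ((he 0 1).pow 2)).add ((he 0 2).pow 2)
  have hr : ∀ j, Continuous fun A : {A : M3 // IsGL A} => crossRow A.1 j := by
    intro j
    fin_cases j
    · exact ((he 0 1).mul (he 1 2)).sub ((he 0 2).mul (he 1 1))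
    · exact ((he 0 2).mul (he 1 0)).sub ((he 0 0).mul (he 1 2))
    · exact ((he 0 0).mul (he 1 1)).sub ((he 0 1).mul (he 1 0))
  have hn : ∀ j, Continuous fun A : {A : M3 // IsGL A} => gsN A.1 j := by
    intro j
    refine (hr j).div (Continuous.sqrt ?_) fun A => (Real.sqrt_pos.2 (crossRow_pos A.2)).ne'
    have := hr 0; have := hr 1; have := hr 2
    fun_prop
  have := hu 0; have := hu 1; have := hu 2
  have := hn 0; have := hn 1; have := hn 2
  refine continuous_matrix fun i j => ?_
  fin_cases i <;> fin_cases j <;> simp [gs] <;> fun_prop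

lemma isGL_segment_gs {A : M3} (h : IsGL A) (s : 𝕀) :
    IsGL ((1 - (s : ℝ)) • A + (s : ℝ) • gs A) := by
  obtain ⟨a, b, c, p, q, r, ha, hb, hc, hA, h1, h2⟩ := exists_triangular h
  have : (1 - (s : ℝ)) • A + (s : ℝ) • gs A =
      ((1 - (s : ℝ)) • !![a, 0, 0; p, b, 0; q, r, c] + (s : ℝ) • (1 : M3)) * gs A := by
    rw [Matrix.add_mul, Matrix.smul_mul, Matrix.smul_mul, Matrix.one_mul, ← hA]
  rw [IsGL, this, det_mul, h2, mul_one, det_fin_three]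
  have hpos : ∀ x : ℝ, 0 < x → 0 < (1 - (s : ℝ)) * x + s := fun x hx => by
    have h0 := s.2.1
    have h1 := s.2.2
    rcases h0.eq_or_lt with h | h
    · rw [← h]; linarith
    · nlinarith
  simp
  have := mul_pos (mul_pos (hpos a ha) (hpos b hb)) (hpos c hc)
  linarith

lemma isLoop_gs {A : 𝕀 → M3} (hA : IsLoop IsGL A) :
    IsLoop (fun B : M3 => B ∈ SO3) fun t => gs (A t) :=
  ⟨fun t => gs_mem (hA.1 t), continuous_gs.comp (hA.2.1.subtype_mk hA.1), congrArg gs hA.2.2⟩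

lemma ev_gs (δ : LoopClass IsGL) {A : 𝕀 → M3} (hA : IsLoop IsGL A) :
    δ.ev A = δ.ev fun t => gs (A t) := by
  have hg := (isLoop_gs hA).2.1
  have hA' := hA.2.1
  refine δ.ev_congr (fun s t => (1 - (s : ℝ)) • A t + (s : ℝ) • gs (A t)) ?_
    (fun s t => isGL_segment_gs (hA.1 t) s) (fun s => by rw [hA.2.2]) (fun t => by simp)
    (fun t => by simp)
  exact ((continuous_const.sub (continuous_subtype_val.comp continuous_fst)).smul
    (hA'.comp continuous_snd)).add ((continuous_subtype_val.comp continuous_fst).smul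
      (hg.comp continuous_snd))

lemma exists_path_one {A : M3} (hA : IsGL A) :
    ∃ c : 𝕀 → M3, Continuous c ∧ (∀ s, IsGL (c s)) ∧ c 0 = A ∧ c 1 = 1 := by
  obtain ⟨q, hq⟩ := quatHom_surjective ⟨gs A, gs_mem hA⟩
  have hpc : IsPathConnected (Metric.sphere (0 : Quaternion ℝ) 1) := by
    refine isPathConnected_sphere ?_ _ zero_le_one
    rw [← Module.finrank_eq_rank, Quaternion.finrank_eq_four]
    norm_num
  have hpcs : PathConnectedSpace UnitQuat := isPathConnected_iff_pathConnectedSpace.1 hpc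
  obtain ⟨Γ⟩ := hpcs.joined q 1
  have h1 : Continuous fun s : 𝕀 => (1 - (s : ℝ)) • A + (s : ℝ) • gs A := by fun_prop
  let p1 : Path A (gs A) := ⟨⟨_, h1⟩, by simp, by simp⟩
  have hq' : quatMat q = gs A := congrArg Subtype.val hq
  let p2 : Path (gs A) 1 := ⟨⟨fun s => quatMat (Γ s), continuous_quatMat.comp (by fun_prop)⟩,
    by simp [hq'], by simp [quatMat_one]⟩
  refine ⟨p1.trans p2, (p1.trans p2).continuous, fun s => ?_, by simp, by simp⟩
  rw [Path.trans_apply]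
  split_ifs
  · exact isGL_segment_gs hA _
  · exact isGL_of_mem_SO3 (quatHom (Γ _)).2

lemma IsGL.mul {A B : M3} (hA : IsGL A) (hB : IsGL B) : IsGL (A * B) := by
  rw [IsGL, det_mul]; exact mul_pos hA hB

lemma isGL_one : IsGL 1 := by rw [IsGL, Matrix.det_one]; exact one_pos

lemma ev_mul_const (δ : LoopClass IsGL) {A : 𝕀 → M3} (hA : IsLoop IsGL A) {B : M3}
    (hB : IsGL B) : δ.ev (fun t => A t * B) = δ.ev A := by
  obtain ⟨c, hc, hc', h0, h1⟩ := exists_path_one hB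
  have hA' := hA.2.1
  refine δ.ev_congr (fun s t => A t * c s) ?_ (fun s t => (hA.1 t).mul (hc' s))
    (fun s => by rw [hA.2.2]) (fun t => by rw [h0]) (fun t => by rw [h1, mul_one])
  simp only [uncurry_def]
  fun_prop

lemma ev_const_mul (δ : LoopClass IsGL) {A : 𝕀 → M3} (hA : IsLoop IsGL A) {B : M3}
    (hB : IsGL B) : δ.ev (fun t => B * A t) = δ.ev A := by
  obtain ⟨c, hc, hc', h0, h1⟩ := exists_path_one hB
  have hA' := hA.2.1
  refine δ.ev_congr (fun s t => c s * A t) ?_ (fun s t => (hc' s).mul (hA.1 t))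
    (fun s => by rw [hA.2.2]) (fun t => by rw [h0]) (fun t => by rw [h1, one_mul])
  simp only [uncurry_def]
  fun_prop

lemma ev_mul (δ : LoopClass IsGL) {A B : 𝕀 → M3} (hA : IsLoop IsGL A)
    (hB : IsLoop IsGL B) : δ.ev (fun t => A t * B t) = δ.ev A + δ.ev B := by
  have hA' := hA.2.1
  have hB' := hB.2.1
  rw [δ.ev_add_of_torus (fun s t => A s * B t) ?_ (fun s t => (hA.1 s).mul (hB.1 t))
    (fun s => by rw [hB.2.2]) (fun t => by rw [hA.2.2]) (fun t => rfl) (fun t => rfl)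
    (fun t => rfl), ev_mul_const δ hA (hB.1 0), ev_const_mul δ hB (hA.1 0)]
  simp only [uncurry_def]
  fun_prop

lemma IsLoop.mul {A B : 𝕀 → M3} (hA : IsLoop IsGL A)
    (hB : IsLoop IsGL B) : IsLoop IsGL fun t => A t * B t :=
  ⟨fun t => (hA.1 t).mul (hB.1 t), hA.2.1.matrix_mul hB.2.1, by
    change A 0 * B 0 = A 1 * B 1
    rw [hA.2.2, hB.2.2]⟩

lemma isGL_rotZ (α : ℝ) : IsGL (rotZ α) := by
  rw [IsGL, rotZ, det_fin_three]
  simp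
  nlinarith [Real.cos_sq_add_sin_sq α]

lemma continuous_rotZ : Continuous rotZ := by
  refine continuous_matrix fun i j => ?_
  fin_cases i <;> fin_cases j <;> simp [rotZ] <;> fun_prop

def fullRot (t : 𝕀) : M3 := rotZ (τ * t)

lemma isLoop_fullRot : IsLoop IsGL fullRot :=
  ⟨fun t => isGL_rotZ _, continuous_rotZ.comp (by fun_prop), by
    ext i j; fin_cases i <;> fin_cases j <;> simp [fullRot, rotZ]⟩

lemma rotZ_eq_conjMat (α : ℝ) :
    rotZ α = conjMat (cos (α / 2)) 0 0 (-sin (α / 2)) := by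
  have hc2 : cos α = cos (α / 2) ^ 2 - sin (α / 2) ^ 2 := by
    rw [← Real.cos_two_mul']; ring_nf
  have hs2 : sin α = 2 * sin (α / 2) * cos (α / 2) := by
    rw [← Real.sin_two_mul]; ring_nf
  ext i j
  fin_cases i <;> fin_cases j <;> simp [conjMat, rotZ, hc2, hs2] <;> ring

lemma gs_eq_self {A : M3} (h : A ∈ SO3) : gs A = A := by
  obtain ⟨a, b, c, p, q, r, ha, hb, hc, hA, h1, h2⟩ := exists_triangular (isGL_of_mem_SO3 h)
  have hAA := ((mem_SO3_iff A).1 h).1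
  set T : M3 := !![a, 0, 0; p, b, 0; q, r, c] with hT
  have hTT : T * T.transpose = 1 := by
    have h3 : A * A.transpose = (T * gs A) * (T * gs A).transpose := by rw [← hA]
    rw [← hAA, h3, Matrix.transpose_mul, Matrix.mul_assoc, ← Matrix.mul_assoc (gs A), h1,
      Matrix.one_mul]
  have t := fun i j => congrFun (congrFun hTT i) j
  have t00 := t 0 0
  have t01 := t 0 1
  have t02 := t 0 2
  have t11 := t 1 1
  have t12 := t 1 2
  have t22 := t 2 2
  simp [hT, mul_apply, sum_univ_three] at t00 t01 t02 t11 t12 t22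
  have pos_one : ∀ x : ℝ, 0 < x → x * x = 1 → x = 1 := fun x hx h => by nlinarith
  obtain rfl := pos_one a ha t00
  obtain rfl : p = 0 := by simpa using t01
  obtain rfl : q = 0 := by simpa using t02
  obtain rfl := pos_one b hb (by simpa using t11)
  obtain rfl : r = 0 := by simpa using t12
  obtain rfl := pos_one c hc (by simpa using t22)
  have : T = 1 := by
    ext i j
    fin_cases i <;> fin_cases j <;> simp [hT]
  rw [this, Matrix.one_mul] at hA
  exact hA.symm

def soClass : LoopClass fun A : M3 => A ∈ SO3 where
  val _ p := spinVal p
  homotopic _ _ _ h := spinVal_homotopic h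
  trans _ p q := spinVal_trans p q
  conj _ _ γ p := spinVal_conj γ p

/-- The generator of `H¹(GL⁺(3); ℤ/2)`. -/
def kap : LoopClass IsGL := soClass.comap gs continuous_gs fun _ => gs_mem

def rotLift (t : 𝕀) : UnitQuat := ⟨(⟨cos (π * t), 0, 0, -sin (π * t)⟩ : Quaternion ℝ),
    (mem_unitQuat _).2 (by simp)⟩

lemma continuous_rotLift : Continuous rotLift := by
  obtain ⟨k, hk⟩ : ∃ k : Quaternion ℝ, k = (⟨0, 0, 0, -1⟩ : Quaternion ℝ) := ⟨_, rfl⟩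
  have h : ∀ t, (rotLift t).1 = cos (π * t) • (1 : Quaternion ℝ) +
      sin (π * t) • k := fun t => by
    rw [hk]
    refine QuaternionAlgebra.ext ?_ ?_ ?_ ?_
    · change cos (π * t) = cos (π * t) * 1 + sin (π * t) * 0
      ring
    · change 0 = cos (π * t) * 0 + sin (π * t) * 0
      ring
    · change 0 = cos (π * t) * 0 + sin (π * t) * 0
      ring
    · change -sin (π * t) = cos (π * t) * 0 + sin (π * t) * -1
      ring
  refine continuous_induced_rng.2 ?_
  change Continuous fun t => (rotLift t).1
  simp only [h]
  fun_prop

lemma rotLift_one : rotLift 1 = -rotLift 0 := by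
  apply Subtype.ext
  refine QuaternionAlgebra.ext ?_ ?_ ?_ ?_
  · change cos (π * (1 : ℝ)) = -cos (π * (0 : ℝ))
    simp
  · exact neg_zero.symm
  · exact neg_zero.symm
  · change -sin (π * (1 : ℝ)) = - -sin (π * (0 : ℝ))
    simp

lemma quatMat_rotLift (t : 𝕀) : quatMat (rotLift t) = fullRot t := by
  rw [fullRot, rotZ_eq_conjMat, quatMat, rotLift]
  simp only
  congr 2 <;> ring_nf

lemma kap_fullRot : kap.ev fullRot = 1 := by
  rw [kap, LoopClass.ev_comap _ _ _ _ isLoop_fullRot, LoopClass.ev_eq _ (isLoop_gs isLoop_fullRot)]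
  refine (spinVal_eq_one_iff (e := rotLift 0) (e' := rotLift 1)
    ⟨⟨⟨rotLift, continuous_rotLift⟩, rfl, rfl⟩, fun t => ?_⟩).2 rotLift_one
  apply Subtype.ext
  change quatMat (rotLift t) = gs (fullRot t)
  rw [← quatMat_rotLift]
  exact (gs_eq_self (quatHom (rotLift t)).2).symm

lemma ev_eq_mul_kap (δ : LoopClass IsGL) {A : 𝕀 → M3} (hA : IsLoop IsGL A) :
    δ.ev A = δ.ev fullRot * kap.ev A := by
  have hg := isLoop_gs hA
  obtain ⟨e, he⟩ := quatHom_surjective ⟨gs (A 0), hg.1 0⟩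
  have hk : kap.ev A = spinVal hg.path := by
    rw [kap, LoopClass.ev_comap _ _ _ _ hA, LoopClass.ev_eq _ hg]
    rfl
  have hcoord : ∀ Γ : 𝕀 → UnitQuat, Continuous Γ → Γ 0 = Γ 1 →
      δ.ev (fun t => quatMat (Γ t)) = 0 := by
    intro Γ hΓ hl
    refine ev_conjMat δ (f := fun t => ![(Γ t).1.re, (Γ t).1.imI, (Γ t).1.imJ, (Γ t).1.imK])
      ⟨fun t h => ?_, ?_, congrArg (fun q : UnitQuat => ![q.1.re, q.1.imI, q.1.imJ, q.1.imK]) hl⟩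
    · have := (mem_unitQuat (Γ t).1).1 (Γ t).2
      have h0 := congrFun h 0
      have h1 := congrFun h 1
      have h2 := congrFun h 2
      have h3 := congrFun h 3
      simp at h0 h1 h2 h3
      rw [h0, h1, h2, h3] at this
      norm_num at this
    · have h1 := Quaternion.continuous_re
      have h2 := Quaternion.continuous_imI
      have h3 := Quaternion.continuous_imJ
      have h4 := Quaternion.continuous_imK
      refine continuous_pi fun i => ?_
      fin_cases i <;> simp <;> fun_prop
  rw [ev_gs δ hA, hk]
  rcases spinVal_cases hg.path he with ⟨h3, Γ, hΓ⟩ | ⟨h3, Γ, hΓ⟩ <;> rw [h3]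
  · rw [mul_zero, ← hcoord Γ Γ.continuous (by simp)]
    congr 1
    funext t
    exact (congrArg Subtype.val (hΓ t)).symm
  · rw [mul_one]
    have h5 : δ.ev (fun t => gs (A t) * fullRot t) = 0 := by
      rw [← hcoord (fun t => Γ t * rotLift t) (Γ.continuous.mul continuous_rotLift) ?_]
      · congr 1
        funext t
        have h6 : quatMat (Γ t) = gs (A t) := congrArg Subtype.val (hΓ t)
        change _ = quatMat ((Γ t).1 * (rotLift t).1)
        rw [quatMat_mul, quatMat_rotLift, h6]
      · rw [rotLift_one, Γ.source, Γ.target]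
        apply Subtype.ext
        change e.1 * (rotLift 0).1 = (-e.1) * (-(rotLift 0).1)
        rw [neg_mul_neg]
    have hg' : IsLoop IsGL fun t => gs (A t) := ⟨fun t => isGL_of_mem_SO3 (hg.1 t), hg.2.1, hg.2.2⟩
    rw [ev_mul δ hg' isLoop_fullRot] at h5
    generalize δ.ev fullRot = a at *
    generalize δ.ev (fun t => gs (A t)) = b at *
    revert a b
    decide

/-! ### Tuples of tangent vectors in charts -/

variable {V V' : Type*} [NormedAddCommGroup V] [NormedSpace ℝ V] [NormedAddCommGroup V']
  [NormedSpace ℝ V'] {Y : Type*} [TopologicalSpace Y]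
  [ChartedSpace (E 3) Y] [IsManifold (𝓡 3) ∞ Y]
  {o : MfdOrientation 3 Y} {lam : ∀ y : Y, 𝕋 y →L[ℝ] ℝ}
  {h : Perm (ℝ × ℝ)} {c : List ℕ}

instance : IsManifold (𝓡 3) 1 Y := IsManifold.of_le (n := ∞) (by simp)

/-- The coordinates, in the chart at `y₀`, of tangent vectors at `y`. -/
def chartVec (y₀ y : Y) : 𝕋 y →L[ℝ] E 3 := (trivializationAt (E 3) 𝕋 y₀).continuousLinearMapAt ℝ y

lemma chartVec_eq_mfderiv {y₀ y : Y} (h : y ∈ (chartAt (E 3) y₀).source) :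
    chartVec y₀ y = mfderiv (𝓡 3) 𝓘(ℝ, E 3) (extChartAt (𝓡 3) y₀) y :=
  TangentBundle.continuousLinearMapAt_trivializationAt h

lemma chartVec_injective {y₀ y : Y} (h : y ∈ (chartAt (E 3) y₀).source) :
    Injective (chartVec y₀ y) := by
  have h' : y ∈ (trivializationAt (E 3) 𝕋 y₀).baseSet := by
    rwa [TangentBundle.trivializationAt_baseSet]
  exact Function.LeftInverse.injective
    ((trivializationAt (E 3) 𝕋 y₀).symmL_continuousLinearMapAt (R := ℝ) h')

lemma continuousAt_vec_iff {b : X → Y}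
    {v : ∀ x, 𝕋 (b x)} {x₀ : X} :
    ContinuousAt (fun x => (⟨b x, v x⟩ : TangentBundle (𝓡 3) Y)) x₀ ↔
      ContinuousAt b x₀ ∧ ContinuousAt (fun x => chartVec (b x₀) (b x) (v x)) x₀ := by
  rw [FiberBundle.continuousAt_totalSpace]
  refine and_congr_right fun hb => ?_
  refine continuousAt_congr ?_
  have hs : (chartAt (E 3) (b x₀)).source ∈ 𝓝 (b x₀) := chart_source_mem_nhds _ _
  filter_upwards [hb hs] with x hx
  rw [chartVec, Bundle.Trivialization.continuousLinearMapAt_apply_of_mem]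
  rwa [TangentBundle.trivializationAt_baseSet]

def chartMat (y₀ : Y) (f : Tuple 3 Y) : M3 := Matrix.of fun i j => chartVec y₀ f.base (f.vec i) j

lemma continuousAt_tuple_iff {F : X → Tuple 3 Y} {x₀ : X} :
    ContinuousAt F x₀ ↔ ContinuousAt (fun x => (F x).base) x₀ ∧
      ContinuousAt (fun x => chartMat (F x₀).base (F x)) x₀ := by
  have hind : Topology.IsInducing fun f : Tuple 3 Y => (f.base, f.tot) := ⟨rfl⟩
  rw [hind.continuousAt_iff]
  have h1 : ContinuousAt ((fun f : Tuple 3 Y => (f.base, f.tot)) ∘ F) x₀ ↔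
      ContinuousAt (fun x => (F x).base) x₀ ∧ ∀ i, ContinuousAt (fun x => (F x).tot i) x₀ := by
    refine ⟨fun h => ⟨h.fst, fun i => ?_⟩, fun h => h.1.prodMk (continuousAt_pi.2 h.2)⟩
    exact (continuousAt_pi.1 h.snd) i
  rw [h1]
  refine and_congr_right fun hb => ?_
  have h2 : ∀ i, ContinuousAt (fun x => (F x).tot i) x₀ ↔
      ContinuousAt (fun x => chartVec (F x₀).base (F x).base ((F x).vec i)) x₀ := fun i =>
    continuousAt_vec_iff.trans (and_iff_right hb)
  simp only [h2]
  constructor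
  · intro h
    refine continuousAt_pi.2 fun i => continuousAt_pi.2 fun j => ?_
    exact (EuclideanSpace.proj (𝕜 := ℝ) j).continuous.continuousAt.comp (h i)
  · intro h i
    have h3 : ContinuousAt (fun x => WithLp.toLp 2 (chartMat (F x₀).base (F x) i)) x₀ :=
      (PiLp.continuous_toLp 2 _).continuousAt.comp (continuousAt_pi.1 h i)
    exact h3

/-- The coordinates of the vectors of a tuple in the preferred chart at the base point. -/
def rawMat (f : Tuple 3 Y) : M3 := Matrix.of fun i j => (show E 3 from f.vec i) j

def transMat (y₀ y : Y) : M3 :=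
  Matrix.of fun i j => chartVec y₀ y (show E 3 from EuclideanSpace.single i 1) j

lemma chartMat_eq (y₀ : Y) (f : Tuple 3 Y) :
    chartMat y₀ f = rawMat f * transMat y₀ f.base := by
  ext i j
  obtain ⟨y, v⟩ := f
  let w : E 3 := v i
  let L : E 3 →L[ℝ] E 3 := chartVec y₀ y
  have hw : w = ∑ k, w k • (EuclideanSpace.single k (1 : ℝ) : E 3) := by
    ext l
    simp [Finset.sum_apply, Pi.single_apply]
  have : L w = ∑ k, w k • L (EuclideanSpace.single k (1 : ℝ)) := by
    conv_lhs => rw [hw]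
    rw [map_sum]
    simp only [map_smul]
  change (L w) j = _
  rw [this, mul_apply]
  simp [rawMat, transMat, w, L, Finset.sum_apply]
  rfl

lemma isUnit_transMat {y₀ y : Y} (h : y ∈ (chartAt (E 3) y₀).source) :
    IsUnit (transMat y₀ y).det := by
  let L : E 3 →L[ℝ] E 3 := chartVec y₀ y
  have hL : Injective L := chartVec_injective h
  have hli : LinearIndependent ℝ fun i : Fin 3 => L (EuclideanSpace.single i (1 : ℝ)) := by
    have hb := (EuclideanSpace.basisFun (Fin 3) ℝ).toBasis.linearIndependent
    have := hb.map' L.toLinearMap (LinearMap.ker_eq_bot.2 hL)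
    convert this using 2
    · simp
    · rfl
  have h2 : LinearIndependent ℝ (transMat y₀ y).row :=
    hli.map' (WithLp.linearEquiv 2 ℝ (Fin 3 → ℝ)).toLinearMap (LinearEquiv.ker _)
  rw [← Matrix.isUnit_iff_isUnit_det]
  exact Matrix.linearIndependent_rows_iff_isUnit.1 h2

/-- The action of matrices on tuples. -/
def act (A : M3) (f : Tuple 3 Y) : Tuple 3 Y := ⟨f.base, fun i => ∑ j, A i j • f.vec j⟩

@[simp] theorem act_base (A : M3) (f : Tuple 3 Y) : (act A f).base = f.base := rfl

lemma rawMat_act (A : M3) (f : Tuple 3 Y) : rawMat (act A f) = A * rawMat f := by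
  ext i j
  rw [mul_apply]
  change (show E 3 from ∑ k, A i k • f.vec k) j = _
  have : (show E 3 from ∑ k, A i k • f.vec k) = ∑ k, A i k • (show E 3 from f.vec k) := rfl
  rw [this]
  generalize hw : (fun k => (show E 3 from f.vec k)) = w
  have hw' : ∀ k, (show E 3 from f.vec k) = w k := fun k => congrFun hw k
  simp only [rawMat, Matrix.of_apply, hw']
  simp [Finset.sum_apply]

lemma chartMat_act (y₀ : Y) (A : M3) (f : Tuple 3 Y) :
    chartMat y₀ (act A f) = A * chartMat y₀ f := by
  rw [chartMat_eq, chartMat_eq, rawMat_act, Matrix.mul_assoc, act_base]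

lemma tuple_ext {f g : Tuple 3 Y} (h : f.base = g.base) (h' : rawMat f = rawMat g) : f = g := by
  obtain ⟨y, v⟩ := f
  obtain ⟨y', w⟩ := g
  dsimp only at h
  subst h
  congr 1
  funext i
  have : (show E 3 from v i) = (show E 3 from w i) := by
    ext j
    exact congrFun (congrFun h' i) j
  exact this

lemma act_one (f : Tuple 3 Y) : act 1 f = f :=
  tuple_ext rfl (by rw [rawMat_act, Matrix.one_mul])

lemma ContinuousAt.act {A : X → M3} {F : X → Tuple 3 Y} {x₀ : X}
    (hA : ContinuousAt A x₀) (hF : ContinuousAt F x₀) :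
    ContinuousAt (fun x => act (A x) (F x)) x₀ := by
  rw [continuousAt_tuple_iff] at hF ⊢
  refine ⟨hF.1, ?_⟩
  simp only [chartMat_act, act_base]
  exact (continuous_fst.matrix_mul continuous_snd).continuousAt.comp (hA.prodMk hF.2)

lemma Continuous.act {A : X → M3} {F : X → Tuple 3 Y}
    (hA : Continuous A) (hF : Continuous F) : Continuous fun x => act (A x) (F x) :=
  continuous_iff_continuousAt.2 fun _ => ContinuousAt.act hA.continuousAt hF.continuousAt

lemma continuous_tuple_base : Continuous fun f : Tuple 3 Y => f.base :=
  continuous_iff_continuousAt.2 fun _ => (continuousAt_tuple_iff.1 continuousAt_id).1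

/-- The matrix that expresses the tuple `f` by the tuple `g` with the same base point. -/
def coeff (f g : Tuple 3 Y) : M3 := rawMat f * (rawMat g)⁻¹

lemma act_coeff {f g : Tuple 3 Y} (h : f.base = g.base) (hg : IsUnit (rawMat g).det) :
    act (coeff f g) g = f :=
  tuple_ext h.symm (by rw [rawMat_act, coeff, Matrix.mul_assoc, Matrix.nonsing_inv_mul _ hg,
    Matrix.mul_one])

lemma coeff_act {A : M3} {g : Tuple 3 Y} (hg : IsUnit (rawMat g).det) : coeff (act A g) g = A := by
  rw [coeff, rawMat_act, Matrix.mul_assoc, mul_nonsing_inv _ hg, Matrix.mul_one]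

lemma coeff_eq_chartMat {f g : Tuple 3 Y} (h : f.base = g.base) {y₀ : Y}
    (hy : f.base ∈ (chartAt (E 3) y₀).source) :
    coeff f g = chartMat y₀ f * (chartMat y₀ g)⁻¹ := by
  have hu := isUnit_transMat hy
  rw [chartMat_eq, chartMat_eq, Matrix.mul_inv_rev, ← h, Matrix.mul_assoc,
    ← Matrix.mul_assoc (transMat y₀ f.base), mul_nonsing_inv _ hu, Matrix.one_mul, coeff]

lemma isUnit_chartMat {f : Tuple 3 Y} (h : IsUnit (rawMat f).det) {y₀ : Y}
    (hy : f.base ∈ (chartAt (E 3) y₀).source) : IsUnit (chartMat y₀ f).det := by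
  rw [chartMat_eq, det_mul]
  exact h.mul (isUnit_transMat hy)

lemma continuousAt_coeff {F G : X → Tuple 3 Y} {x₀ : X}
    (hF : ContinuousAt F x₀) (hG : ContinuousAt G x₀) (h : ∀ᶠ x in 𝓝 x₀, (F x).base = (G x).base)
    (hg : IsUnit (rawMat (G x₀)).det) : ContinuousAt (fun x => coeff (F x) (G x)) x₀ := by
  have h0 := h.self_of_nhds
  rw [continuousAt_tuple_iff] at hF hG
  rw [← h0] at hG
  have hs : (chartAt (E 3) (F x₀).base).source ∈ 𝓝 (F x₀).base := chart_source_mem_nhds _ _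
  have hev : (fun x => coeff (F x) (G x)) =ᶠ[𝓝 x₀] fun x =>
      chartMat (F x₀).base (F x) * (chartMat (F x₀).base (G x))⁻¹ := by
    filter_upwards [h, hF.1 hs] with x hx hx'
    exact coeff_eq_chartMat hx hx'
  refine (continuousAt_congr hev).2 ?_
  have hu : IsUnit (chartMat (F x₀).base (G x₀)).det :=
    isUnit_chartMat hg (by rw [← h0]; exact mem_chart_source _ _)
  have hinv : ContinuousAt (fun x => (chartMat (F x₀).base (G x))⁻¹) x₀ := by
    refine ContinuousAt.comp (g := fun A : M3 => A⁻¹) ?_ hG.2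
    simp only [Matrix.inv_def, Ring.inverse_eq_inv']
    refine ContinuousAt.smul (ContinuousAt.inv₀ ?_ hu.ne_zero) ?_
    · exact (Continuous.matrix_det continuous_id).continuousAt
    · exact (Continuous.matrix_adjugate continuous_id).continuousAt
  exact (continuous_fst.matrix_mul continuous_snd).continuousAt.comp (hF.2.prodMk hinv)

/-! ### Spin structures as classes of loops of frames -/

section Spin

variable (o)

def IsPos (f : Tuple 3 Y) : Prop := f.base ∈ univ ∧ o.pos f.base f.vec

variable {o}

lemma IsPos.isUnit {f : Tuple 3 Y} (h : IsPos o f) : IsUnit (rawMat f).det := by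
  have hli : LinearIndependent ℝ fun i => (show E 3 from f.vec i) := o.indep _ _ h.2
  have h2 : LinearIndependent ℝ (rawMat f).row :=
    hli.map' (WithLp.linearEquiv 2 ℝ (Fin 3 → ℝ)).toLinearMap (LinearEquiv.ker _)
  rw [← Matrix.isUnit_iff_isUnit_det]
  exact Matrix.linearIndependent_rows_iff_isUnit.1 h2

lemma IsPos.act {f : Tuple 3 Y} (h : IsPos o f) {A : M3} (hA : IsGL A) : IsPos o (act A f) :=
  ⟨trivial, (o.pos_iff _ _ h.2 _).2 ⟨A, hA, fun _ => rfl⟩⟩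

lemma IsPos.act_iff {f : Tuple 3 Y} (h : IsPos o f) {A : M3} :
    IsPos o (SpinSurgery.act A f) ↔ IsGL A := by
  refine ⟨fun h' => ?_, h.act⟩
  obtain ⟨B, hB, hB'⟩ := (o.pos_iff _ _ h.2 _).1 h'.2
  have : SpinSurgery.act A f = SpinSurgery.act B f := by
    rw [SpinSurgery.act, SpinSurgery.act]
    congr 1
    funext i
    exact hB' i
  rwa [← coeff_act (A := A) h.isUnit, this, coeff_act h.isUnit]

lemma isGL_coeff {f g : Tuple 3 Y} (hf : IsPos o f) (hg : IsPos o g) (h : f.base = g.base) :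
    IsGL (coeff f g) := by
  rw [← hg.act_iff, act_coeff h hg.isUnit]
  exact hf

/-- A spin structure as a class of loops of frames. -/
def SpinStructure.cls (Θ : SpinStructure o univ) : LoopClass (IsPos o) where
  val := Θ.val
  homotopic := Θ.homotopic
  trans := Θ.trans
  conj := Θ.conj

/-- The tuple `f`, its first two vectors turned by the angle `2πt`. -/
def rot (t : ℝ) (f : Tuple 3 Y) : Tuple 3 Y := ⟨f.base, fun i =>
    if i = 0 then cos (τ * t) • f.vec 0 + sin (τ * t) • f.vec 1
    else if i = 1 then
      -(sin (τ * t)) • f.vec 0 + cos (τ * t) • f.vec 1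
    else f.vec i⟩

lemma ev_act_fullRot (Θ : SpinStructure o univ) {f : Tuple 3 Y} (hf : IsPos o f) :
    Θ.cls.ev (fun t => act (fullRot t) f) = 1 := by
  have hl : IsLoop (IsPos o) fun t => act (fullRot t) f := ⟨fun t => hf.act (isLoop_fullRot.1 t),
      Continuous.act isLoop_fullRot.2.1 continuous_const, by
        simp only [isLoop_fullRot.2.2]⟩
  rw [LoopClass.ev_eq _ hl]
  refine Θ.fibre _ hl.path fun t => ?_
  have h0 : act (fullRot 0) f = f := by
    have : fullRot 0 = 1 := by
      ext i j; fin_cases i <;> fin_cases j <;> simp [fullRot, rotZ]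
    rw [this, act_one]
  change act (fullRot t) f = rot t (act (fullRot 0) f)
  rw [h0]
  change act (fullRot t) f = ⟨_, _⟩
  rw [act]
  congr 1
  funext i
  fin_cases i <;> simp [fullRot, rotZ, sum_univ_three]

lemma isLoop_act {f : 𝕀 → Tuple 3 Y} {A : 𝕀 → M3}
    (hf : IsLoop (IsPos o) f) (hA : IsLoop IsGL A) : IsLoop (IsPos o) fun t => act (A t) (f t) :=
  ⟨fun t => (hf.1 t).act (hA.1 t), Continuous.act hA.2.1 hf.2.1, by
    simp only [hA.2.2, hf.2.2]⟩

lemma ev_act (Θ : SpinStructure o univ) {f : 𝕀 → Tuple 3 Y}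
    {A : 𝕀 → M3} (hf : IsLoop (IsPos o) f) (hA : IsLoop IsGL A) :
    Θ.cls.ev (fun t => act (A t) (f t)) = Θ.cls.ev f + kap.ev A := by
  have hfc := hf.2.1
  have hAc := hA.2.1
  obtain ⟨c, hc, hc', h0, h1⟩ := exists_path_one (hA.1 0)
  have h2 : Θ.cls.ev (fun t => act (A 0) (f t)) = Θ.cls.ev f := by
    refine Θ.cls.ev_congr (fun s t => act (c s) (f t)) ?_ (fun s t => (hf.1 t).act (hc' s))
      (fun s => by rw [hf.2.2]) (fun t => by rw [h0]) (fun t => by rw [h1, act_one])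
    exact Continuous.act (hc.comp continuous_fst) (hfc.comp continuous_snd)
  have h3 : Θ.cls.ev (fun t => act (A t) (f 0)) = kap.ev A := by
    let δ : LoopClass IsGL := Θ.cls.comap (fun A => act A (f 0))
      (Continuous.act continuous_subtype_val continuous_const) fun B hB => (hf.1 0).act hB
    have e1 : δ.ev A = Θ.cls.ev (fun t => act (A t) (f 0)) := LoopClass.ev_comap _ _ _ _ hA
    have e2 : δ.ev fullRot = 1 := (LoopClass.ev_comap _ _ _ _ isLoop_fullRot).trans
      (ev_act_fullRot Θ (hf.1 0))
    rw [← e1, ev_eq_mul_kap δ hA, e2, one_mul]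
  rw [← h2, ← h3]
  refine Θ.cls.ev_add_of_torus (fun s t => act (A t) (f s)) ?_
    (fun s t => (hf.1 s).act (hA.1 t)) (fun s => by rw [hA.2.2]) (fun t => by rw [hf.2.2])
    (fun t => rfl) (fun t => rfl) (fun t => rfl)
  exact Continuous.act (hAc.comp continuous_snd) (hfc.comp continuous_fst)

def Framing.tuple (σ : Framing o) (y : Y) : Tuple 3 Y := (σ.sec y).1

lemma Framing.tuple_base (σ : Framing o) (y : Y) : (σ.tuple y).base = y := σ.base_sec y

lemma Framing.isPos (σ : Framing o) (y : Y) : IsPos o (σ.tuple y) := (σ.sec y).2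

lemma Framing.continuous_tuple (σ : Framing o) : Continuous fun y => σ.tuple y :=
  continuous_subtype_val.comp σ.sec.continuous

lemma continuous_framing_coeff (σ : Framing o) :
    Continuous fun f : {f : Tuple 3 Y // IsPos o f} => coeff f.1 (σ.tuple f.1.base) :=
  continuous_iff_continuousAt.2 fun f => continuousAt_coeff continuousAt_subtype_val
    (σ.continuous_tuple.comp (continuous_tuple_base.comp continuous_subtype_val)).continuousAt
    (.of_forall fun g => (σ.tuple_base _).symm) (σ.isPos _).isUnit

def Framing.cls (σ : Framing o) : LoopClass (IsPos o) :=
  kap.comap (fun f => coeff f (σ.tuple f.base)) (continuous_framing_coeff σ)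
    fun _ hf => isGL_coeff hf (σ.isPos _) (σ.tuple_base _).symm

def Framing.spin (σ : Framing o) : SpinStructure o univ where
  val := σ.cls.val
  homotopic := σ.cls.homotopic
  trans := σ.cls.trans
  conj := σ.cls.conj
  fibre f p hp := by
    have hl := LoopClass.isLoop_coe (P := IsPos o) p
    have e1 : σ.cls.ev (fun t => (p t).1) = σ.cls.val f p := LoopClass.ev_coe _ p
    rw [← e1]
    refine (LoopClass.ev_comap _ _ _ _ hl).trans ?_
    have h1 : ∀ t, (p t).1 = act (fullRot t) f.1 := by
      intro t
      rw [hp t, act]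
      congr 1
      funext i
      fin_cases i <;> simp [fullRot, rotZ, sum_univ_three]
    have h2 : ∀ t, coeff (p t).1 (σ.tuple (p t).1.base) =
        fullRot t * coeff f.1 (σ.tuple f.1.base) := by
      intro t
      rw [h1, act_base, coeff, rawMat_act, Matrix.mul_assoc, coeff]
    refine (congrArg kap.ev (funext h2)).trans ?_
    rw [ev_mul_const _ isLoop_fullRot (isGL_coeff f.2 (σ.isPos _) (σ.tuple_base _).symm)]
    exact kap_fullRot

lemma isInducedBy_iff (Θ : SpinStructure o univ) (σ : Framing o) :
    Θ.IsInducedBy σ ↔ ∀ γ : 𝕀 → Y, Continuous γ → γ 0 = γ 1 →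
      Θ.cls.ev (fun t => (σ.tuple (γ t))) = 0 := by
  constructor
  · intro h γ hγ hl
    let p : Path (γ 0) (γ 0) := ⟨⟨γ, hγ⟩, rfl, hl.symm⟩
    rw [← h (γ 0) p]
    exact LoopClass.ev_coe (P := IsPos o) Θ.cls (p.map σ.sec.continuous)
  · intro h y γ
    rw [← h γ γ.continuous (by simp)]
    exact (LoopClass.ev_coe (P := IsPos o) Θ.cls (γ.map σ.sec.continuous)).symm

lemma Framing.isInducedBy_spin (σ : Framing o) : σ.spin.IsInducedBy σ := by
  rw [isInducedBy_iff]
  intro γ hγ hl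
  have hloop : IsLoop (IsPos o) fun t => (σ.tuple (γ t)) :=
    ⟨fun t => σ.isPos _, σ.continuous_tuple.comp hγ, congrArg (fun y => σ.tuple y) hl⟩
  have e1 : σ.spin.cls.ev (fun t => (σ.tuple (γ t))) = σ.cls.ev (fun t => (σ.tuple (γ t))) := rfl
  rw [e1]
  refine (LoopClass.ev_comap _ _ _ _ hloop).trans ?_
  have : ∀ t, coeff (σ.tuple (γ t)) (σ.tuple (σ.tuple (γ t)).base) = 1 := fun t => by
    rw [σ.tuple_base, coeff, mul_nonsing_inv _ (σ.isPos _).isUnit]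
  simp only [this]
  exact kap.ev_const 1

lemma SpinStructure.IsInducedBy.unique {Θ Θ' : SpinStructure o univ} {σ : Framing o}
    (h : Θ.IsInducedBy σ) (h' : Θ'.IsInducedBy σ) : Θ = Θ' := by
  rw [isInducedBy_iff] at h h'
  ext f p
  have hl := LoopClass.isLoop_coe (P := IsPos o) p
  have hγ : Continuous fun t => (p t).1.base := continuous_tuple_base.comp hl.2.1
  have hγl : (p 0).1.base = (p 1).1.base := congrArg Tuple.base hl.2.2
  have hs : IsLoop (IsPos o) fun t => (σ.tuple (p t).1.base) :=
    ⟨fun t => σ.isPos _, σ.continuous_tuple.comp hγ, congrArg (fun y => σ.tuple y) hγl⟩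
  have hA : IsLoop IsGL fun t => coeff (p t).1 (σ.tuple (p t).1.base) :=
    ⟨fun t => isGL_coeff (hl.1 t) (σ.isPos _) (σ.tuple_base _).symm,
      (continuous_framing_coeff σ).comp (hl.2.1.subtype_mk hl.1), by simp⟩
  have key : ∀ Ψ : SpinStructure o univ, Ψ.val f p = Ψ.cls.ev (fun t => (σ.tuple (p t).1.base)) +
        kap.ev (fun t => coeff (p t).1 (σ.tuple (p t).1.base)) := by
    intro Ψ
    rw [← ev_act Ψ hs hA]
    refine (LoopClass.ev_coe (P := IsPos o) Ψ.cls p).symm.trans ?_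
    congr 1
    funext t
    exact (act_coeff (σ.tuple_base _).symm (σ.isPos _).isUnit).symm
  rw [key Θ, key Θ', h _ hγ hγl, h' _ hγ hγl]

end Spin

/-! ### Local parametrizations and the exterior derivative -/

section Param

lemma contDiffAt_chart {φ : V → Y} {x₀ : V} (h : ContMDiffAt 𝓘(ℝ, V) (𝓡 3) ∞ φ x₀) :
    ContDiffAt ℝ ∞ (extChartAt (𝓡 3) (φ x₀) ∘ φ) x₀ := by
  exact contMDiffAt_iff_contDiffAt.1 (contMDiffAt_iff_target.1 h).2

lemma chartVec_mfderiv {φ : V → Y} {x : V} {y₀ : Y}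
    (h : MDifferentiableAt 𝓘(ℝ, V) (𝓡 3) φ x) (hx : φ x ∈ (chartAt (E 3) y₀).source) (v : V) :
    chartVec y₀ (φ x) (mfderiv 𝓘(ℝ, V) (𝓡 3) φ x v) = fderiv ℝ (extChartAt (𝓡 3) y₀ ∘ φ) x v := by
  rw [chartVec_eq_mfderiv hx, ← mfderiv_eq_fderiv,
    mfderiv_comp x (mdifferentiableAt_extChartAt hx) h]
  rfl

lemma eventually_contMDiffAt {φ : V → Y} {x₀ : V} (h : ContMDiffAt 𝓘(ℝ, V) (𝓡 3) ∞ φ x₀) :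
    ∀ᶠ x in 𝓝 x₀, MDifferentiableAt 𝓘(ℝ, V) (𝓡 3) φ x := by
  have h1 : ContMDiffAt 𝓘(ℝ, V) (𝓡 3) 1 φ x₀ := h.of_le (by norm_cast)
  have h2 := (contMDiffAt_iff_contMDiffAt_nhds (by simp)).1 h1
  filter_upwards [h2] with x hx
  exact hx.mdifferentiableAt (by simp)

lemma continuousAt_mfderiv_vec {φ : V → Y} {g v : X → V} {x₀ : X}
    (h : ContMDiffAt 𝓘(ℝ, V) (𝓡 3) ∞ φ (g x₀)) (hg : ContinuousAt g x₀) (hv : ContinuousAt v x₀) :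
    ContinuousAt (fun x => (⟨φ (g x), mfderiv 𝓘(ℝ, V) (𝓡 3) φ (g x) (v x)⟩ :
      TangentBundle (𝓡 3) Y)) x₀ := by
  rw [continuousAt_vec_iff (b := fun x => φ (g x))]
  have hc : ContinuousAt (fun x => φ (g x)) x₀ := h.continuousAt.comp hg
  refine ⟨hc, ?_⟩
  have hs : (chartAt (E 3) (φ (g x₀))).source ∈ 𝓝 (φ (g x₀)) := chart_source_mem_nhds _ _
  have hev : (fun x => chartVec (φ (g x₀)) (φ (g x)) (mfderiv 𝓘(ℝ, V) (𝓡 3) φ (g x) (v x)))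
      =ᶠ[𝓝 x₀] fun x => fderiv ℝ (extChartAt (𝓡 3) (φ (g x₀)) ∘ φ) (g x) (v x) := by
    filter_upwards [hg (eventually_contMDiffAt h), hc hs] with x hx hx'
    exact chartVec_mfderiv hx hx' _
  refine (continuousAt_congr hev).2 ?_
  have h3 : ContinuousAt (fderiv ℝ (extChartAt (𝓡 3) (φ (g x₀)) ∘ φ)) (g x₀) :=
    ((contDiffAt_chart h).fderiv_right (m := 0) (by norm_cast)).continuousAt
  exact (h3.comp hg).clm_apply hv

lemma continuousAt_tuple_of_tot {F : X → Tuple 3 Y} {x₀ : X}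
    (h : ∀ i, ContinuousAt (fun x => (F x).tot i) x₀) : ContinuousAt F x₀ := by
  have hind : Topology.IsInducing fun f : Tuple 3 Y => (f.base, f.tot) := ⟨rfl⟩
  rw [hind.continuousAt_iff]
  exact ((continuousAt_vec_iff (b := fun x => (F x).base)).1 (h 0)).1.prodMk (continuousAt_pi.2 h)

lemma ContinuousAt.tot {F : X → Tuple 3 Y} {x₀ : X}
    (h : ContinuousAt F x₀) (i : Fin 3) : ContinuousAt (fun x => (F x).tot i) x₀ := by
  have hind : Topology.IsInducing fun f : Tuple 3 Y => (f.base, f.tot) := ⟨rfl⟩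
  rw [hind.continuousAt_iff] at h
  exact continuousAt_pi.1 h.snd i

/-- The tuple that a map `φ` induces from three vectors. -/
def pf (φ : V → Y) (b : Fin 3 → V) (x : V) : Tuple 3 Y :=
  ⟨φ x, fun i => mfderiv 𝓘(ℝ, V) (𝓡 3) φ x (b i)⟩

@[simp] theorem pf_base (φ : V → Y) (b : Fin 3 → V) (x : V) : (pf φ b x).base = φ x := rfl

lemma continuousAt_pf {φ : V → Y} {x₀ : V} (h : ContMDiffAt 𝓘(ℝ, V) (𝓡 3) ∞ φ x₀)
    (b : Fin 3 → V) : ContinuousAt (pf φ b) x₀ :=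
  continuousAt_tuple_of_tot fun i =>
    continuousAt_mfderiv_vec (g := id) h continuousAt_id (continuousAt_const (y := b i))

lemma act_pf (φ : V → Y) (b : Fin 3 → V) (x : V) (A : M3) :
    act A (pf φ b x) = pf φ (fun i => ∑ j, A i j • b j) x := by
  rw [act, pf, pf]
  congr 1
  funext i
  let L : V →L[ℝ] E 3 := mfderiv 𝓘(ℝ, V) (𝓡 3) φ x
  have : ∑ j, A i j • L (b j) = L (∑ j, A i j • b j) := by
    simp only [map_sum, map_smul]
  exact this

lemma pf_congr {φ φ' : V → Y} {x : V} (h : φ =ᶠ[𝓝 x] φ') (b : Fin 3 → V) :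
    pf φ b x = pf φ' b x := by
  refine tuple_ext h.self_of_nhds ?_
  ext i j
  exact congrArg (fun L : V →L[ℝ] E 3 => L (b i) j) h.mfderiv_eq

lemma pf_comp {φ : V → Y} {ι : V' → V}
    {x : V'} (hφ : MDifferentiableAt 𝓘(ℝ, V) (𝓡 3) φ (ι x)) (hι : DifferentiableAt ℝ ι x)
    {b : Fin 3 → V} {b' : Fin 3 → V'} {J : M3} (hJ : ∀ i, fderiv ℝ ι x (b' i) = ∑ j, J i j • b j) :
    pf (φ ∘ ι) b' x = act J (pf φ b (ι x)) := by
  rw [act_pf, pf, pf]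
  simp only [← hJ, mfderiv_comp x hφ hι.mdifferentiableAt, mfderiv_eq_fderiv]
  rfl

/-- The map `φ`, restricted to the open set `U`, is a positive local parametrization of `Y`. -/
structure IsParam (o : MfdOrientation 3 Y) (φ : V → Y) (U : Set V) (b : Fin 3 → V) : Prop where
  isOpen : IsOpen U
  smooth : ContMDiffOn 𝓘(ℝ, V) (𝓡 3) ∞ φ U
  pos : ∀ x ∈ U, PosAt o φ x b

namespace IsParam

variable {φ : V → Y} {U : Set V} {b : Fin 3 → V}

lemma contMDiffAt (h : IsParam o φ U b) {x : V} (hx : x ∈ U) :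
    ContMDiffAt 𝓘(ℝ, V) (𝓡 3) ∞ φ x := h.smooth.contMDiffAt (h.isOpen.mem_nhds hx)

lemma mdifferentiableAt (h : IsParam o φ U b) {x : V} (hx : x ∈ U) :
    MDifferentiableAt 𝓘(ℝ, V) (𝓡 3) φ x := (h.contMDiffAt hx).mdifferentiableAt (by simp)

lemma isPos (h : IsParam o φ U b) {x : V} (hx : x ∈ U) : IsPos o (pf φ b x) := ⟨trivial, h.pos x hx⟩

lemma continuousAt_pf (h : IsParam o φ U b) {x : V} (hx : x ∈ U) : ContinuousAt (pf φ b) x :=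
  SpinSurgery.continuousAt_pf (h.contMDiffAt hx) b

lemma continuous_pf (h : IsParam o φ U b) {g : X → V}
    (hg : Continuous g) (hU : ∀ x, g x ∈ U) : Continuous fun x => pf φ b (g x) :=
  continuous_iff_continuousAt.2 fun x => (h.continuousAt_pf (hU x)).comp hg.continuousAt

lemma comp (h : IsParam o φ U b)
    {ι : V' → V} {U' : Set V'} (hU' : IsOpen U') (hι : ContDiffOn ℝ ∞ ι U') (hU : ∀ x ∈ U', ι x ∈ U)
    {b' : Fin 3 → V'} {J : V' → M3}
    (hJ : ∀ x ∈ U', ∀ i, fderiv ℝ ι x (b' i) = ∑ j, J x i j • b j) (hdet : ∀ x ∈ U', IsGL (J x)) :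
    IsParam o (φ ∘ ι) U' b' where
  isOpen := hU'
  smooth := h.smooth.comp hι.contMDiffOn hU
  pos x hx := by
    have hd : DifferentiableAt ℝ ι x :=
      ((hι.contDiffAt (hU'.mem_nhds hx)).differentiableAt (by simp))
    have := pf_comp (h.mdifferentiableAt (hU x hx)) hd (hJ x hx)
    have h2 : IsPos o (pf (φ ∘ ι) b' x) := by
      rw [this]
      exact (h.isPos (hU x hx)).act (hdet x hx)
    exact h2.2

lemma pf_comp (h : IsParam o φ U b)
    {ι : V' → V} {x : V'} (hx : ι x ∈ U) {b' : Fin 3 → V'} {J : M3} {ι' : V' →L[ℝ] V}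
    (hι : HasFDerivAt ι ι' x) (hJ : ∀ i, ι' (b' i) = ∑ j, J i j • b j) :
    pf (φ ∘ ι) b' x = act J (pf φ b (ι x)) :=
  SpinSurgery.pf_comp (h.mdifferentiableAt hx) hι.differentiableAt (by rwa [hι.fderiv])

lemma map_nhds [FiniteDimensional ℝ V] (h : IsParam o φ U b)
    {x : V} (hx : x ∈ U) : Filter.map φ (𝓝 x) = 𝓝 (φ x) := by
  have : CompleteSpace V := FiniteDimensional.complete ℝ V
  set ψ := extChartAt (𝓡 3) (φ x) ∘ φ with hψ
  have hc := contDiffAt_chart (h.contMDiffAt hx)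
  have hs : HasStrictFDerivAt ψ (fderiv ℝ ψ x) x := hc.hasStrictFDerivAt (by simp)
  have hli : LinearIndependent ℝ fun i => fderiv ℝ ψ x (b i) := by
    have h1 : LinearIndependent ℝ fun i => (mfderiv 𝓘(ℝ, V) (𝓡 3) φ x (b i) : 𝕋 (φ x)) :=
      o.indep _ _ (h.pos x hx)
    have h2 := h1.map' (chartVec (φ x) (φ x)).toLinearMap
      (LinearMap.ker_eq_bot.2 (chartVec_injective (mem_chart_source _ _)))
    convert h2 using 2 with i
    · exact (chartVec_mfderiv (h.mdifferentiableAt hx) (mem_chart_source _ _) (b i)).symm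
    · rfl
  have hsurj : (fderiv ℝ ψ x).range = ⊤ := by
    have h3 : Submodule.span ℝ (range fun i => fderiv ℝ ψ x (b i)) = ⊤ :=
      hli.span_eq_top_of_card_eq_finrank' (by simp [E])
    rw [eq_top_iff, ← h3, Submodule.span_le]
    rintro _ ⟨i, rfl⟩
    exact ⟨b i, rfl⟩
  have h4 := hs.map_nhds_eq_of_surj hsurj
  have hcont : ContinuousAt φ x := (h.contMDiffAt hx).continuousAt
  have h5 : Filter.map (extChartAt (𝓡 3) (φ x)).symm (Filter.map ψ (𝓝 x)) = Filter.map φ (𝓝 x) := by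
    rw [Filter.map_map]
    refine Filter.map_congr ?_
    filter_upwards [hcont (extChartAt_source_mem_nhds (I := 𝓡 3) (φ x))] with z hz
    exact (extChartAt (𝓡 3) (φ x)).left_inv hz
  rw [← h5, h4]
  have h6 := map_extChartAt_symm_nhdsWithin_range (I := 𝓡 3) (φ x)
  have h7 : range (𝓡 3) = univ := by simp
  rw [h7, nhdsWithin_univ] at h6
  exact h6

end IsParam

end Param

section Forms

lemma totalSpace_ext {p q : TangentBundle (𝓡 3) Y} (h : p.1 = q.1)
    (h' : (show E 3 from p.2) = (show E 3 from q.2)) : p = q := by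
  obtain ⟨y, v⟩ := p
  obtain ⟨y', v'⟩ := q
  dsimp only at h
  subst h
  congr 1

lemma lam_congr (lam : ∀ y : Y, 𝕋 y →L[ℝ] ℝ) {y y' : Y}
    {v : 𝕋 y} {v' : 𝕋 y'}
    (h : (⟨y, v⟩ : TangentBundle (𝓡 3) Y) = ⟨y', v'⟩) : lam y v = lam y' v' :=
  congrArg (fun p : TangentBundle (𝓡 3) Y => lam p.1 p.2) h

def pullForm
    (lam : ∀ y : Y, 𝕋 y →L[ℝ] ℝ) (φ : V → Y) (x : V) : V →L[ℝ] ℝ :=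
  (lam (φ x)).comp (mfderiv 𝓘(ℝ, V) (𝓡 3) φ x)

lemma pullForm_eventuallyEq {φ : V → Y}
    {x₀ : V} (h : ContMDiffAt 𝓘(ℝ, V) (𝓡 3) ∞ φ x₀) :
    pullForm lam φ =ᶠ[𝓝 x₀] fun x => (inChart lam (φ x₀) ((extChartAt (𝓡 3) (φ x₀) ∘ φ) x)).comp
      (fderiv ℝ (extChartAt (𝓡 3) (φ x₀) ∘ φ) x) := by
  have hs : (chartAt (E 3) (φ x₀)).source ∈ 𝓝 (φ x₀) := chart_source_mem_nhds _ _
  have hev : ∀ᶠ x in 𝓝 x₀, φ x ∈ (chartAt (E 3) (φ x₀)).source := h.continuousAt hs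
  filter_upwards [eventually_contMDiffAt h, hev.eventually_nhds] with x hx hx'
  have hx1 := hx'.self_of_nhds
  ext v
  refine lam_congr lam (totalSpace_ext ?_ ?_)
  · exact ((extChartAt (𝓡 3) (φ x₀)).left_inv (by rwa [extChartAt_source])).symm
  · have e1 : ((extChartAt (𝓡 3) (φ x₀)).symm ∘ (extChartAt (𝓡 3) (φ x₀) ∘ φ)) =ᶠ[𝓝 x] φ := by
      filter_upwards [hx'] with z hz
      exact (extChartAt (𝓡 3) (φ x₀)).left_inv (by rwa [extChartAt_source])
    have e2 := congrArg (fun L : V →L[ℝ] E 3 => L v)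
      (Filter.EventuallyEq.mfderiv_eq (I := 𝓘(ℝ, V)) (I' := 𝓡 3) e1)
    refine e2.symm.trans ?_
    have hd : MDifferentiableAt 𝓘(ℝ, V) 𝓘(ℝ, E 3) (extChartAt (𝓡 3) (φ x₀) ∘ φ) x :=
      (mdifferentiableAt_extChartAt (I := 𝓡 3) hx1).comp x hx
    have hd2 : MDifferentiableAt 𝓘(ℝ, E 3) (𝓡 3) (extChartAt (𝓡 3) (φ x₀)).symm
        ((extChartAt (𝓡 3) (φ x₀) ∘ φ) x) := by
      have hm : (extChartAt (𝓡 3) (φ x₀)) (φ x) ∈ (extChartAt (𝓡 3) (φ x₀)).target :=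
        (extChartAt (𝓡 3) (φ x₀)).map_source (by rwa [extChartAt_source])
      exact ((contMDiffOn_extChartAt_symm (I := 𝓡 3) (n := ∞) (φ x₀)).contMDiffAt
        ((isOpen_extChartAt_target (I := 𝓡 3) (φ x₀)).mem_nhds hm)).mdifferentiableAt (by simp)
    rw [mfderiv_comp x hd2 hd, mfderiv_eq_fderiv]
    rfl

lemma contDiffAt_inChart (hs : IsSmoothForm lam) {y₀ y : Y}
    (hy : y ∈ (chartAt (E 3) y₀).source) :
    ContDiffAt ℝ ∞ (inChart lam y₀) (extChartAt (𝓡 3) y₀ y) :=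
  (hs y₀).contDiffAt ((isOpen_extChartAt_target (I := 𝓡 3) y₀).mem_nhds
    ((extChartAt (𝓡 3) y₀).map_source (by rwa [extChartAt_source])))

lemma extd_mfderiv (hs : IsSmoothForm lam)
    {φ : V → Y} {x₀ : V} (h : ContMDiffAt 𝓘(ℝ, V) (𝓡 3) ∞ φ x₀) (u v : V) :
    extd lam (φ x₀) (mfderiv 𝓘(ℝ, V) (𝓡 3) φ x₀ u) (mfderiv 𝓘(ℝ, V) (𝓡 3) φ x₀ v) =
      fderiv ℝ (pullForm lam φ) x₀ u v - fderiv ℝ (pullForm lam φ) x₀ v u := by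
  set ψ := extChartAt (𝓡 3) (φ x₀) ∘ φ with hψ
  set β := inChart lam (φ x₀) with hβ
  have hψc : ContDiffAt ℝ ∞ ψ x₀ := contDiffAt_chart h
  have hβc : ContDiffAt ℝ ∞ β (ψ x₀) := contDiffAt_inChart hs (mem_chart_source _ _)
  have hψd : HasFDerivAt ψ (fderiv ℝ ψ x₀) x₀ := (hψc.differentiableAt (by simp)).hasFDerivAt
  have hψdd : HasFDerivAt (fderiv ℝ ψ) (fderiv ℝ (fderiv ℝ ψ) x₀) x₀ :=
    ((hψc.fderiv_right (m := 1) (by norm_cast)).differentiableAt (by simp)).hasFDerivAt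
  have hβd : HasFDerivAt β (fderiv ℝ β (ψ x₀)) (ψ x₀) :=
    (hβc.differentiableAt (by simp)).hasFDerivAt
  have hd := (hβd.comp x₀ hψd).clm_comp hψdd
  have hd' := hd.congr_of_eventuallyEq (pullForm_eventuallyEq (lam := lam) h)
  have hsymm : fderiv ℝ (fderiv ℝ ψ) x₀ u v = fderiv ℝ (fderiv ℝ ψ) x₀ v u :=
    (hψc.isSymmSndFDerivAt (by simp only [minSmoothness_of_isRCLikeNormedField]; exact WithTop.coe_le_coe.2 (le_top : (2 : ℕ∞) ≤ ⊤))) u v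
  have hm : ∀ w : V, mfderiv (𝓡 3) 𝓘(ℝ, E 3) (extChartAt (𝓡 3) (φ x₀)) (φ x₀)
      (mfderiv 𝓘(ℝ, V) (𝓡 3) φ x₀ w) = fderiv ℝ ψ x₀ w := fun w => by
    rw [← chartVec_eq_mfderiv (mem_chart_source _ _)]
    exact chartVec_mfderiv (h.mdifferentiableAt (by simp)) (mem_chart_source _ _) w
  rw [hd'.fderiv]
  have hl : extd lam (φ x₀) (mfderiv 𝓘(ℝ, V) (𝓡 3) φ x₀ u) (mfderiv 𝓘(ℝ, V) (𝓡 3) φ x₀ v) =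
      fderiv ℝ β (ψ x₀) (fderiv ℝ ψ x₀ u) (fderiv ℝ ψ x₀ v) -
        fderiv ℝ β (ψ x₀) (fderiv ℝ ψ x₀ v) (fderiv ℝ ψ x₀ u) := by
    rw [← hm u, ← hm v]
    rfl
  rw [hl]
  simp [hsymm]

lemma chartVec_symm {y₀ : Y} {x : E 3} (hx : x ∈ (extChartAt (𝓡 3) y₀).target)
    (u : 𝕋 ((extChartAt (𝓡 3) y₀).symm x)) :
    mfderiv 𝓘(ℝ, E 3) (𝓡 3) (extChartAt (𝓡 3) y₀).symm x
      (chartVec y₀ ((extChartAt (𝓡 3) y₀).symm x) u) = u := by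
  have hy : (extChartAt (𝓡 3) y₀).symm x ∈ (chartAt (E 3) y₀).source := by
    rw [← extChartAt_source (𝓡 3)]
    exact (extChartAt (𝓡 3) y₀).map_target hx
  have hc := (contMDiffOn_extChartAt_symm (I := 𝓡 3) (n := ∞) y₀).contMDiffAt
    ((isOpen_extChartAt_target (I := 𝓡 3) y₀).mem_nhds hx)
  refine chartVec_injective hy ?_
  rw [chartVec_mfderiv (hc.mdifferentiableAt (by simp)) hy]
  have : (extChartAt (𝓡 3) y₀ ∘ (extChartAt (𝓡 3) y₀).symm) =ᶠ[𝓝 x] id := by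
    filter_upwards [(isOpen_extChartAt_target (I := 𝓡 3) y₀).mem_nhds hx] with z hz
    exact (extChartAt (𝓡 3) y₀).right_inv hz
  rw [this.fderiv_eq, fderiv_id]
  rfl

lemma extd_eq_chart (hs : IsSmoothForm lam) {y₀ y : Y} (hy : y ∈ (chartAt (E 3) y₀).source)
    (u v : 𝕋 y) : extd lam y u v =
      fderiv ℝ (inChart lam y₀) (extChartAt (𝓡 3) y₀ y) (chartVec y₀ y u) (chartVec y₀ y v) -
      fderiv ℝ (inChart lam y₀) (extChartAt (𝓡 3) y₀ y) (chartVec y₀ y v) (chartVec y₀ y u) := by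
  obtain ⟨x, hx, rfl⟩ : ∃ x ∈ (extChartAt (𝓡 3) y₀).target, (extChartAt (𝓡 3) y₀).symm x = y :=
    ⟨extChartAt (𝓡 3) y₀ y, (extChartAt (𝓡 3) y₀).map_source (by rwa [extChartAt_source]),
      (extChartAt (𝓡 3) y₀).left_inv (by rwa [extChartAt_source])⟩
  have hc := (contMDiffOn_extChartAt_symm (I := 𝓡 3) (n := ∞) y₀).contMDiffAt
    ((isOpen_extChartAt_target (I := 𝓡 3) y₀).mem_nhds hx)
  have := extd_mfderiv hs hc (chartVec y₀ ((extChartAt (𝓡 3) y₀).symm x) u)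
    (chartVec y₀ ((extChartAt (𝓡 3) y₀).symm x) v)
  rw [chartVec_symm hx, chartVec_symm hx] at this
  rw [this, (extChartAt (𝓡 3) y₀).right_inv hx]
  rfl

lemma lam_eq_chart (lam : ∀ y : Y, 𝕋 y →L[ℝ] ℝ) {y₀ y : Y}
    (hy : y ∈ (chartAt (E 3) y₀).source)
    (u : 𝕋 y) :
    lam y u = inChart lam y₀ (extChartAt (𝓡 3) y₀ y) (chartVec y₀ y u) := by
  obtain ⟨x, hx, rfl⟩ : ∃ x ∈ (extChartAt (𝓡 3) y₀).target, (extChartAt (𝓡 3) y₀).symm x = y :=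
    ⟨extChartAt (𝓡 3) y₀ y, (extChartAt (𝓡 3) y₀).map_source (by rwa [extChartAt_source]),
      (extChartAt (𝓡 3) y₀).left_inv (by rwa [extChartAt_source])⟩
  rw [(extChartAt (𝓡 3) y₀).right_inv hx]
  exact congrArg _ (chartVec_symm hx u).symm

lemma continuousAt_extd (hs : IsSmoothForm lam) {b : X → Y}
    {u v : ∀ x, 𝕋 (b x)} {x₀ : X}
    (hu : ContinuousAt (fun x => (⟨b x, u x⟩ : TangentBundle (𝓡 3) Y)) x₀)
    (hv : ContinuousAt (fun x => (⟨b x, v x⟩ : TangentBundle (𝓡 3) Y)) x₀) :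
    ContinuousAt (fun x => extd lam (b x) (u x) (v x)) x₀ := by
  rw [continuousAt_vec_iff] at hu hv
  have hsrc : (chartAt (E 3) (b x₀)).source ∈ 𝓝 (b x₀) := chart_source_mem_nhds _ _
  have hev : ∀ᶠ x in 𝓝 x₀, b x ∈ (chartAt (E 3) (b x₀)).source := hu.1 hsrc
  refine (continuousAt_congr (hev.mono fun x hx => extd_eq_chart hs hx (u x) (v x))).2 ?_
  have h1 : ContinuousAt (fun x => extChartAt (𝓡 3) (b x₀) (b x)) x₀ :=
    (continuousAt_extChartAt (I := 𝓡 3) (b x₀)).comp hu.1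
  have h2 : ContinuousAt (fderiv ℝ (inChart lam (b x₀))) (extChartAt (𝓡 3) (b x₀) (b x₀)) :=
    ((contDiffAt_inChart hs (mem_chart_source _ _)).fderiv_right (m := 0)
      (by norm_cast)).continuousAt
  have h3 : ContinuousAt (fun x => fderiv ℝ (inChart lam (b x₀))
      (extChartAt (𝓡 3) (b x₀) (b x))) x₀ := ContinuousAt.comp (f := fun x => extChartAt (𝓡 3) (b x₀) (b x)) h2 h1
  exact ((h3.clm_apply hu.2).clm_apply hv.2).sub ((h3.clm_apply hv.2).clm_apply hu.2)

lemma continuousAt_lam (hs : IsSmoothForm lam) {b : X → Y}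
    {u : ∀ x, 𝕋 (b x)} {x₀ : X}
    (hu : ContinuousAt (fun x => (⟨b x, u x⟩ : TangentBundle (𝓡 3) Y)) x₀) :
    ContinuousAt (fun x => lam (b x) (u x)) x₀ := by
  rw [continuousAt_vec_iff] at hu
  have hsrc : (chartAt (E 3) (b x₀)).source ∈ 𝓝 (b x₀) := chart_source_mem_nhds _ _
  have hev : ∀ᶠ x in 𝓝 x₀, b x ∈ (chartAt (E 3) (b x₀)).source := hu.1 hsrc
  refine (continuousAt_congr (hev.mono fun x hx => lam_eq_chart lam hx (u x))).2 ?_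
  have h1 : ContinuousAt (fun x => extChartAt (𝓡 3) (b x₀) (b x)) x₀ :=
    (continuousAt_extChartAt (I := 𝓡 3) (b x₀)).comp hu.1
  have h2 : ContinuousAt (inChart lam (b x₀)) (extChartAt (𝓡 3) (b x₀) (b x₀)) :=
    (contDiffAt_inChart hs (mem_chart_source _ _)).continuousAt
  have h3 : ContinuousAt (fun x => inChart lam (b x₀)
      (extChartAt (𝓡 3) (b x₀) (b x))) x₀ := ContinuousAt.comp (f := fun x => extChartAt (𝓡 3) (b x₀) (b x)) h2 h1
  exact h3.clm_apply hu.2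

lemma ContinuousAt.vec_add {b : X → Y}
    {u v : ∀ x, 𝕋 (b x)} {x₀ : X}
    (hu : ContinuousAt (fun x => (⟨b x, u x⟩ : TangentBundle (𝓡 3) Y)) x₀)
    (hv : ContinuousAt (fun x => (⟨b x, v x⟩ : TangentBundle (𝓡 3) Y)) x₀) :
    ContinuousAt (fun x => (⟨b x, u x + v x⟩ : TangentBundle (𝓡 3) Y)) x₀ := by
  rw [continuousAt_vec_iff] at hu hv ⊢
  refine ⟨hu.1, ?_⟩
  simp only [map_add]
  exact hu.2.add hv.2

lemma ContinuousAt.vec_smul {b : X → Y}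
    {u : ∀ x, 𝕋 (b x)} {c : X → ℝ} {x₀ : X} (hc : ContinuousAt c x₀)
    (hu : ContinuousAt (fun x => (⟨b x, u x⟩ : TangentBundle (𝓡 3) Y)) x₀) :
    ContinuousAt (fun x => (⟨b x, c x • u x⟩ : TangentBundle (𝓡 3) Y)) x₀ := by
  rw [continuousAt_vec_iff] at hu ⊢
  refine ⟨hu.1, ?_⟩
  simp only [map_smul]
  exact hc.smul hu.2

variable {y : Y} (u u' v : 𝕋 y) (c : ℝ)

lemma extd_add_left : extd lam y (u + u') v = extd lam y u v + extd lam y u' v := by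
  let L : E 3 →L[ℝ] E 3 := mfderiv (𝓡 3) 𝓘(ℝ, E 3) (extChartAt (𝓡 3) y) y
  let β : E 3 →L[ℝ] E 3 →L[ℝ] ℝ := fderiv ℝ (inChart lam y) (extChartAt (𝓡 3) y y)
  have : ∀ a a' w : E 3, β (L (a + a')) (L w) - β (L w) (L (a + a')) =
      (β (L a) (L w) - β (L w) (L a)) + (β (L a') (L w) - β (L w) (L a')) := by
    intro a a' w
    simp only [map_add, add_apply]
    ring
  exact this u u' v

lemma extd_smul_left : extd lam y (c • u) v = c * extd lam y u v := by
  let L : E 3 →L[ℝ] E 3 := mfderiv (𝓡 3) 𝓘(ℝ, E 3) (extChartAt (𝓡 3) y) y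
  let β : E 3 →L[ℝ] E 3 →L[ℝ] ℝ := fderiv ℝ (inChart lam y) (extChartAt (𝓡 3) y y)
  have : ∀ a w : E 3, β (L (c • a)) (L w) - β (L w) (L (c • a)) =
      c * (β (L a) (L w) - β (L w) (L a)) := by
    intro a w
    simp only [map_smul, smul_apply, smul_eq_mul]
    ring
  exact this u v

lemma extd_swap : extd lam y u v = -extd lam y v u := by
  simp only [extd]
  ring

lemma extd_self : extd lam y u u = 0 := by
  simp only [extd, sub_self]

lemma extd_add_right : extd lam y v (u + u') = extd lam y v u + extd lam y v u' := by
  rw [extd_swap, extd_add_left, extd_swap u, extd_swap u']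
  ring

lemma extd_smul_right : extd lam y v (c • u) = c * extd lam y v u := by
  rw [extd_swap, extd_smul_left, extd_swap u]
  ring

end Forms

/-! ### Contact forms: volume, Reeb field, trivializations and framings -/

/-- The value of `lam ∧ d lam` on three vectors. -/
def vol (lam : ∀ y : Y, 𝕋 y →L[ℝ] ℝ) (y : Y)
    (v : Fin 3 → 𝕋 y) : ℝ :=
  lam y (v 0) * extd lam y (v 1) (v 2) + lam y (v 1) * extd lam y (v 2) (v 0)
      + lam y (v 2) * extd lam y (v 0) (v 1)

lemma vol_act {y : Y} {v w : Fin 3 → 𝕋 y} {A : M3}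
    (h : ∀ i, w i = ∑ j, A i j • v j) : vol lam y w = A.det * vol lam y v := by
  have h01 := extd_swap (lam := lam) (v 1) (v 0)
  have h02 := extd_swap (lam := lam) (v 2) (v 0)
  have h12 := extd_swap (lam := lam) (v 2) (v 1)
  simp only [vol, h, sum_univ_three, extd_add_left, extd_add_right, extd_smul_left,
    extd_smul_right, extd_self, map_add, map_smul, smul_eq_mul, h01, h02, h12, det_fin_three]
  ring

lemma pos_iff_vol (hc : IsContactForm o lam) {y : Y} {v : Fin 3 → 𝕋 y} :
    o.pos y v ↔ 0 < vol lam y v := by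
  refine ⟨hc.2 y v, fun h => ?_⟩
  obtain ⟨w, hw⟩ := o.exists_pos y
  have hli : LinearIndependent ℝ fun i => (show E 3 from w i) := o.indep _ _ hw
  have hsp := hli.span_eq_top_of_card_eq_finrank' (by simp)
  have : ∀ i, ∃ c : Fin 3 → ℝ, ∑ j, c j • (show E 3 from w j) = v i := fun i =>
    (Submodule.mem_span_range_iff_exists_fun ℝ).1
      (by rw [hsp]; exact Submodule.mem_top : (show E 3 from v i) ∈ _)
  choose c hc' using this
  have h1 : ∀ i, v i = ∑ j, (Matrix.of c) i j • w j := fun i => (hc' i).symm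
  refine (o.pos_iff y w hw v).2 ⟨Matrix.of c, ?_, h1⟩
  rw [vol_act h1] at h
  exact pos_of_mul_pos_left h (hc.2 y w hw).le

lemma exists_coeffs {y : Y} {w : Fin 3 → 𝕋 y} (hw : o.pos y w)
    (v : 𝕋 y) : ∃ c : Fin 3 → ℝ, v = ∑ j, c j • w j := by
  have hli : LinearIndependent ℝ fun i => (show E 3 from w i) := o.indep _ _ hw
  have hsp := hli.span_eq_top_of_card_eq_finrank' (by simp)
  obtain ⟨c, hc⟩ := (Submodule.mem_span_range_iff_exists_fun ℝ).1
      (by rw [hsp]; exact Submodule.mem_top : (show E 3 from v) ∈ _)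
  exact ⟨c, hc.symm⟩

lemma eq_zero_of_lam_extd (hc : IsContactForm o lam) {y : Y} {v : 𝕋 y}
    (h : lam y v = 0) (h' : ∀ u, extd lam y v u = 0) : v = 0 := by
  obtain ⟨w, hw⟩ := o.exists_pos y
  obtain ⟨c, hv⟩ := exists_coeffs hw v
  have hp : vol lam y w ≠ 0 := (hc.2 y w hw).ne'
  have key : ∀ i, c i = 0 := by
    intro i
    have h2 : ∀ k, (Function.update w i v) k = ∑ j, (Matrix.of (Function.update
        (fun k j => if k = j then (1 : ℝ) else 0) i c)) k j • w j := by
      intro k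
      rcases eq_or_ne k i with rfl | hk
      · simp [hv]
      · simp [Function.update_of_ne hk]
    have h3 := vol_act (lam := lam) h2
    have h4 : vol lam y (Function.update w i v) = 0 := by
      have h5 : ∀ u, extd lam y u v = 0 := fun u => by rw [extd_swap, h', neg_zero]
      fin_cases i <;> simp [vol, Function.update, h, h', h5]
    rw [h4] at h3
    have h6 : (Matrix.of (Function.update
        (fun k j => if k = j then (1 : ℝ) else 0) i c)).det = c i := by
      fin_cases i <;> simp [det_fin_three, Function.update]
    rw [h6] at h3
    exact (mul_eq_zero.1 h3.symm).resolve_right hp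
  rw [hv]
  simp [key]

/-- The Reeb vector, computed in a frame. -/
def reebOf (lam : ∀ y : Y, 𝕋 y →L[ℝ] ℝ) (y : Y)
    (v : Fin 3 → 𝕋 y) : 𝕋 y :=
  (vol lam y v)⁻¹ • (extd lam y (v 1) (v 2) • v 0 + extd lam y (v 2) (v 0) • v 1 +
    extd lam y (v 0) (v 1) • v 2)

lemma lam_reebOf (hc : IsContactForm o lam) {y : Y} {v : Fin 3 → 𝕋 y}
    (hv : o.pos y v) : lam y (reebOf lam y v) = 1 := by
  have hp : vol lam y v ≠ 0 := (hc.2 y v hv).ne'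
  simp only [reebOf, map_add, map_smul, smul_eq_mul]
  rw [inv_mul_eq_one₀ hp, vol]
  ring

lemma extd_reebOf {y : Y} {v : Fin 3 → 𝕋 y}
    (hv : o.pos y v) (u : 𝕋 y) : extd lam y (reebOf lam y v) u = 0 := by
  obtain ⟨c, rfl⟩ := exists_coeffs hv u
  have h01 := extd_swap (lam := lam) (v 1) (v 0)
  have h02 := extd_swap (lam := lam) (v 2) (v 0)
  have h12 := extd_swap (lam := lam) (v 2) (v 1)
  simp only [reebOf, sum_univ_three, extd_add_left, extd_add_right, extd_smul_left,
    extd_smul_right, extd_self, h01, h02, h12]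
  ring

/-- The Reeb vector field of a contact form. -/
def reeb (hc : IsContactForm o lam) (y : Y) : 𝕋 y := reebOf lam y (o.exists_pos y).choose

lemma lam_reeb (hc : IsContactForm o lam) (y : Y) : lam y (reeb hc y) = 1 :=
  lam_reebOf hc (o.exists_pos y).choose_spec

lemma extd_reeb (hc : IsContactForm o lam) (y : Y) (u : 𝕋 y) :
    extd lam y (reeb hc y) u = 0 := extd_reebOf (o.exists_pos y).choose_spec u

lemma extd_reeb_right (hc : IsContactForm o lam) (y : Y) (u : 𝕋 y) :
    extd lam y u (reeb hc y) = 0 := by rw [extd_swap, extd_reeb, neg_zero]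

lemma reeb_eq (hc : IsContactForm o lam) {y : Y} {v : 𝕋 y} (h : lam y v = 1)
    (h' : ∀ u, extd lam y v u = 0) : v = reeb hc y := by
  have h1 : v + (-1 : ℝ) • reeb hc y = 0 := by
    refine eq_zero_of_lam_extd hc ?_ fun u => ?_
    · rw [map_add, map_smul, h, lam_reeb]; norm_num
    · rw [extd_add_left, extd_smul_left, h', extd_reeb]; norm_num
  rw [neg_one_smul] at h1
  exact eq_of_sub_eq_zero (by rw [sub_eq_add_neg]; exact h1)

/-- The vector field near `y₀` with constant coordinates in the chart at `y₀`. -/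
def chartSec (y₀ : Y) (c : E 3) (y : Y) : 𝕋 y := (trivializationAt (E 3) 𝕋 y₀).symm y c

lemma continuousAt_chartSec {y₀ y : Y} (hy : y ∈ (chartAt (E 3) y₀).source) (c : E 3) :
    ContinuousAt (fun y => (⟨y, chartSec y₀ c y⟩ : TangentBundle (𝓡 3) Y)) y := by
  set e := trivializationAt (E 3) (𝕋 : Y → Type) y₀
  have hb : e.baseSet = (chartAt (E 3) y₀).source := TangentBundle.trivializationAt_baseSet y₀
  have hev : (fun y => (⟨y, chartSec y₀ c y⟩ : TangentBundle (𝓡 3) Y)) =ᶠ[𝓝 y]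
      fun y => e.toOpenPartialHomeomorph.symm (y, c) := by
    filter_upwards [(chartAt (E 3) y₀).open_source.mem_nhds hy] with z hz
    exact e.mk_symm (by rwa [hb]) c
  refine (continuousAt_congr hev).2 ?_
  have hm : (y, c) ∈ e.target := e.mem_target.2 (by rwa [hb])
  have h1 : ContinuousAt e.toOpenPartialHomeomorph.symm (y, c) :=
    e.toOpenPartialHomeomorph.symm.continuousAt hm
  exact ContinuousAt.comp (f := fun y => (y, c)) h1 (continuousAt_id.prodMk continuousAt_const)

lemma exists_chartSec_eq (y₀ : Y) (v : 𝕋 y₀) :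
    ∃ c, chartSec y₀ c y₀ = v :=
  ⟨chartVec y₀ y₀ v, by
    have h := (trivializationAt (E 3) 𝕋 y₀).symmL_continuousLinearMapAt (R := ℝ)
      (FiberBundle.mem_baseSet_trivializationAt' y₀) v
    rwa [Bundle.Trivialization.symmL_apply _ (FiberBundle.mem_baseSet_trivializationAt' y₀)] at h⟩

lemma exists_local_frame (o : MfdOrientation 3 Y) (y₀ : Y) :
    ∃ F : Fin 3 → ∀ y, 𝕋 y, ∀ᶠ y in 𝓝 y₀, o.pos y (fun i => F i y) ∧
      ∀ i, ContinuousAt (fun y => (⟨y, F i y⟩ : TangentBundle (𝓡 3) Y)) y := by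
  obtain ⟨v, hv⟩ := o.exists_pos y₀
  choose c hc using fun i => exists_chartSec_eq y₀ (v i)
  refine ⟨fun i => chartSec y₀ (c i), Filter.Eventually.and ?_ ?_⟩
  · have h1 : ContinuousAt (fun y => (⟨y, fun i => chartSec y₀ (c i) y⟩ : Tuple 3 Y)) y₀ :=
      continuousAt_tuple_of_tot fun i => continuousAt_chartSec (mem_chart_source _ _) (c i)
    refine h1 (o.isOpen_pos.mem_nhds ?_)
    change o.pos y₀ fun i => chartSec y₀ (c i) y₀
    simpa only [hc] using hv
  · filter_upwards [(chartAt (E 3) y₀).open_source.mem_nhds (mem_chart_source _ y₀)] with y hy i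
    exact continuousAt_chartSec hy (c i)

lemma continuous_reeb (hc : IsContactForm o lam) :
    Continuous fun y => (⟨y, reeb hc y⟩ : TangentBundle (𝓡 3) Y) := by
  refine continuous_iff_continuousAt.2 fun y₀ => ?_
  obtain ⟨F, hF⟩ := exists_local_frame o y₀
  have hev : (fun y => (⟨y, reeb hc y⟩ : TangentBundle (𝓡 3) Y)) =ᶠ[𝓝 y₀]
      fun y => ⟨y, reebOf lam y fun i => F i y⟩ := by
    filter_upwards [hF] with y hy
    rw [reeb_eq hc (lam_reebOf hc hy.1) (extd_reebOf hy.1)]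
  refine (continuousAt_congr hev).2 ?_
  obtain ⟨hp, hF⟩ := hF.self_of_nhds
  have hx : ∀ i j, ContinuousAt (fun y => extd lam y (F i y) (F j y)) y₀ := fun i j =>
    continuousAt_extd (b := fun y => y) hc.1 (hF i) (hF j)
  have hl : ∀ i, ContinuousAt (fun y => lam y (F i y)) y₀ := fun i =>
    continuousAt_lam (b := fun y => y) hc.1 (hF i)
  have hv : ContinuousAt (fun y => (vol lam y fun i => F i y)⁻¹) y₀ :=
    ((((hl 0).mul (hx 1 2)).add ((hl 1).mul (hx 2 0))).add ((hl 2).mul (hx 0 1))).inv₀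
      (hc.2 _ _ hp).ne'
  exact ContinuousAt.vec_smul (b := fun y => y) hv (ContinuousAt.vec_add (b := fun y => y)
    (ContinuousAt.vec_add (b := fun y => y) (ContinuousAt.vec_smul (b := fun y => y) (hx 1 2) (hF 0))
    (ContinuousAt.vec_smul (b := fun y => y) (hx 2 0) (hF 1)))
    (ContinuousAt.vec_smul (b := fun y => y) (hx 0 1) (hF 2)))

/-- A trivialization of the contact structure exists if some vector field is nowhere parallel to
the Reeb field. It may be chosen such that its first vector is the projection of the vector field
along the Reeb field. -/
lemma exists_trivialization [T2Space Y] [CompactSpace Y] (hc : IsContactForm o lam)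
    (w : ∀ y : Y, 𝕋 y)
    (hw : Continuous fun y => (⟨y, w y⟩ : TangentBundle (𝓡 3) Y))
    (hw' : ∀ y, w y ≠ lam y (w y) • reeb hc y) :
    ∃ e, IsTrivialization lam e ∧ ∀ y, e 0 y = w y + (-lam y (w y)) • reeb hc y := by
  let P : (∀ y : Y, 𝕋 y) → ∀ y : Y, 𝕋 y := fun v y => v y + (-lam y (v y)) • reeb hc y
  have hPl : ∀ v y, lam y (P v y) = 0 := fun v y => by
    simp only [P, map_add, map_smul, lam_reeb, smul_eq_mul]; ring
  have hPc : ∀ v y, ContinuousAt (fun y => (⟨y, v y⟩ : TangentBundle (𝓡 3) Y)) y →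
      ContinuousAt (fun y => (⟨y, P v y⟩ : TangentBundle (𝓡 3) Y)) y := fun v y hv =>
    ContinuousAt.vec_add (b := fun y => y) hv (ContinuousAt.vec_smul (b := fun y => y)
      (continuousAt_lam (b := fun y => y) hc.1 hv).neg (continuous_reeb hc).continuousAt)
  have h0 : ∀ y, P w y ≠ 0 := fun y h => hw' y (by
    have h1 : w y + (-lam y (w y)) • reeb hc y = 0 := h
    rw [neg_smul] at h1
    exact eq_of_sub_eq_zero (by rw [sub_eq_add_neg]; exact h1))
  obtain ⟨s, hs⟩ := exists_contMDiffSection_forall_mem_convex_of_local (I := 𝓡 3) (n := 0)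
    (F_fiber := E 3) (𝕋 : Y → Type)
    (fun y => {v | lam y v = 0 ∧ 0 < extd lam y (P w y) v}) (fun y => by
      rintro u ⟨hu, hu'⟩ v ⟨hv, hv'⟩ a b ha hb hab
      refine ⟨by rw [map_add, map_smul, map_smul, hu, hv]; simp, ?_⟩
      rw [extd_add_right, extd_smul_right, extd_smul_right]
      rcases ha.eq_or_lt with rfl | ha
      · have : 0 < b := by linarith
        have := mul_pos this hv'
        linarith
      · have := mul_pos ha hu'
        have := mul_nonneg hb hv'.le
        linarith) (fun y₀ => by
      obtain ⟨u, hu⟩ : ∃ u, 0 < extd lam y₀ (P w y₀) u := by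
        by_contra! hcon
        refine h0 y₀ (eq_zero_of_lam_extd hc (hPl w y₀) fun u => le_antisymm (hcon u) ?_)
        have := hcon ((-1 : ℝ) • u)
        rw [extd_smul_right] at this
        linarith
      obtain ⟨c, rfl⟩ := exists_chartSec_eq y₀ u
      have hcs : ∀ᶠ y in 𝓝 y₀, ContinuousAt (fun y => (⟨y, P (chartSec y₀ c) y⟩ :
          TangentBundle (𝓡 3) Y)) y := by
        filter_upwards [(chartAt (E 3) y₀).open_source.mem_nhds (mem_chart_source _ y₀)] with y hy
        exact hPc _ _ (continuousAt_chartSec hy c)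
      have hpos : ∀ᶠ y in 𝓝 y₀, 0 < extd lam y (P w y) (P (chartSec y₀ c) y) := by
        have h2 := continuousAt_extd (b := fun y => y) hc.1 (hPc w y₀ hw.continuousAt)
          hcs.self_of_nhds
        refine h2.eventually (lt_mem_nhds ?_)
        change 0 < extd lam y₀ (P w y₀) (chartSec y₀ c y₀ + _ • reeb hc y₀)
        rwa [extd_add_right, extd_smul_right, extd_reeb_right, mul_zero, add_zero]
      obtain ⟨U, hU, hU'⟩ := Filter.eventually_iff_exists_mem.1 (hcs.and hpos)
      refine ⟨U, hU, P (chartSec y₀ c), ?_, fun y hy => ⟨hPl _ _, (hU' y hy).2⟩⟩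
      rw [show ((0 : ℕ∞) : WithTop ℕ∞) = 0 from rfl, contMDiffOn_zero_iff]
      exact fun y hy => (hU' y hy).1.continuousWithinAt)
  refine ⟨![P w, s], ⟨fun i => ?_, fun i y => ?_, fun y => (hs y).2⟩, fun y => rfl⟩
  · fin_cases i
    · exact continuous_iff_continuousAt.2 fun y => hPc w y hw.continuousAt
    · exact s.contMDiff.continuous
  · fin_cases i
    · exact hPl w y
    · exact (hs y).1

lemma exists_framing (hc : IsContactForm o lam) {e : Fin 2 → ∀ y : Y, 𝕋 y}
    (he : IsTrivialization lam e) {ν : ∀ y : Y, 𝕋 y}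
    (hν : Continuous fun y => (⟨y, ν y⟩ : TangentBundle (𝓡 3) Y)) (hν' : ∀ y, 0 < lam y (ν y)) :
    ∃ σ : Framing o, ∀ y, (σ.sec y).1 = ⟨y, ![e 0 y, e 1 y, ν y]⟩ := by
  refine ⟨⟨⟨fun y => ⟨⟨y, ![e 0 y, e 1 y, ν y]⟩, trivial, (pos_iff_vol hc).2 ?_⟩, ?_⟩, fun y => rfl⟩,
    fun y => rfl⟩
  · have h0 := he.2.1 0 y
    have h1 := he.2.1 1 y
    have : vol lam y ![e 0 y, e 1 y, ν y] = lam y (ν y) * extd lam y (e 0 y) (e 1 y) := by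
      simp [vol, h0, h1]
    change 0 < vol lam y ![e 0 y, e 1 y, ν y]
    rw [this]
    exact mul_pos (hν' y) (he.2.2 y)
  · refine Continuous.subtype_mk (continuous_iff_continuousAt.2 fun y =>
      continuousAt_tuple_of_tot fun i => ?_) _
    fin_cases i
    · exact (he.1 0).continuousAt
    · exact (he.1 1).continuousAt
    · exact hν.continuousAt

/-! ### Homotopies of trivializations and the induced spin structure -/

lemma exists_coeffs_plane (hc : IsContactForm o lam) {y : Y}
    {u u' v : 𝕋 y} (hu : lam y u = 0) (hu' : lam y u' = 0)
    (h : 0 < extd lam y u u') (hv : lam y v = 0) :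
    v = (extd lam y v u' / extd lam y u u') • u + (extd lam y u v / extd lam y u u') • u' := by
  have hpos : o.pos y ![u, u', reeb hc y] := by
    rw [pos_iff_vol hc]
    simpa [vol, hu, hu', lam_reeb] using h
  obtain ⟨c, rfl⟩ := exists_coeffs hpos v
  simp only [sum_univ_three, Matrix.cons_val_zero, Matrix.cons_val_one, Matrix.cons_val] at hv ⊢
  have h2 : c 2 = 0 := by
    simpa [hu, hu', lam_reeb] using hv
  rw [h2, zero_smul, add_zero]
  simp only [extd_add_left, extd_add_right, extd_smul_left, extd_smul_right, extd_self]
  have hne := h.ne'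
  congr 2
  · field_simp
    ring
  · field_simp
    ring

lemma trivializationsHomotopic_of_log (hc : IsContactForm o lam)
    (hlog : ∀ g : Y → ℂ, Continuous g → (∀ y, g y ≠ 0) →
      ∃ l : Y → ℂ, Continuous l ∧ ∀ y, exp (l y) = g y)
    {e e' : Fin 2 → ∀ y : Y, 𝕋 y} (he : IsTrivialization lam e)
    (he' : IsTrivialization lam e') : TrivializationsHomotopic lam e e' := by
  have hex : ∀ (u v : ∀ y : Y, 𝕋 y), Continuous (fun y => (⟨y, u y⟩ : TangentBundle (𝓡 3) Y)) →
      Continuous (fun y => (⟨y, v y⟩ : TangentBundle (𝓡 3) Y)) →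
      Continuous fun y => extd lam y (u y) (v y) := fun u v hu hv =>
    continuous_iff_continuousAt.2 fun y =>
      continuousAt_extd (b := fun y => y) hc.1 hu.continuousAt hv.continuousAt
  set w := fun y => extd lam y (e 0 y) (e 1 y) with hw
  have hwp : ∀ y, 0 < w y := he.2.2
  have hwc : Continuous w := hex _ _ (he.1 0) (he.1 1)
  set a := fun y => extd lam y (e' 0 y) (e 1 y) / w y with ha
  set b := fun y => extd lam y (e 0 y) (e' 0 y) / w y with hb
  set c := fun y => extd lam y (e' 1 y) (e 1 y) / w y with hcdef
  set d := fun y => extd lam y (e 0 y) (e' 1 y) / w y with hd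
  have hac : Continuous a := (hex _ _ (he'.1 0) (he.1 1)).div hwc fun y => (hwp y).ne'
  have hbc : Continuous b := (hex _ _ (he.1 0) (he'.1 0)).div hwc fun y => (hwp y).ne'
  have hcc : Continuous c := (hex _ _ (he'.1 1) (he.1 1)).div hwc fun y => (hwp y).ne'
  have hdc : Continuous d := (hex _ _ (he.1 0) (he'.1 1)).div hwc fun y => (hwp y).ne'
  have h0 : ∀ y, e' 0 y = a y • e 0 y + b y • e 1 y := fun y =>
    exists_coeffs_plane hc (he.2.1 0 y) (he.2.1 1 y) (he.2.2 y) (he'.2.1 0 y)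
  have h1 : ∀ y, e' 1 y = c y • e 0 y + d y • e 1 y := fun y =>
    exists_coeffs_plane hc (he.2.1 0 y) (he.2.1 1 y) (he.2.2 y) (he'.2.1 1 y)
  have hdet : ∀ y, 0 < a y * d y - b y * c y := by
    intro y
    have h2 := he'.2.2 y
    rw [h0, h1] at h2
    simp only [extd_add_left, extd_add_right, extd_smul_left, extd_smul_right, extd_self] at h2
    rw [extd_swap (e 1 y)] at h2
    have h3 : 0 < (a y * d y - b y * c y) * w y := by
      simp only [hw]; linarith
    exact pos_of_mul_pos_left h3 (hwp y).le
  have hn : ∀ y, 0 < a y ^ 2 + b y ^ 2 := by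
    intro y
    rcases eq_or_ne (a y) 0 with h | h
    · rcases eq_or_ne (b y) 0 with h' | h'
      · have := hdet y
        rw [h, h'] at this
        norm_num at this
      · positivity
    · positivity
  obtain ⟨l, hl, hl'⟩ := hlog (fun y => ⟨a y, b y⟩)
    ((Complex.equivRealProdCLM.symm.continuous.comp (hac.prodMk hbc)))
    (fun y h => by
      have h1 := congrArg Complex.re h
      have h2 := congrArg Complex.im h
      simp only [Complex.zero_re, Complex.zero_im] at h1 h2
      have := hn y
      rw [h1, h2] at this
      norm_num at this)
  let s : Y → ℝ := fun y => (a y * c y + b y * d y) / (a y ^ 2 + b y ^ 2)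
  let k : Y → ℝ := fun y => (a y * d y - b y * c y) / (a y ^ 2 + b y ^ 2)
  have hsc : Continuous s := (((hac.mul hcc).add (hbc.mul hdc)).div
    ((hac.pow 2).add (hbc.pow 2)) fun y => (hn y).ne')
  have hkc : Continuous k := (((hac.mul hdc).sub (hbc.mul hcc)).div
    ((hac.pow 2).add (hbc.pow 2)) fun y => (hn y).ne')
  have hkp : ∀ y, 0 < k y := fun y => div_pos (hdet y) (hn y)
  let A : 𝕀 × Y → ℝ := fun x => (exp ((x.1 : ℝ) * l x.2)).re
  let B : 𝕀 × Y → ℝ := fun x => (exp ((x.1 : ℝ) * l x.2)).im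
  have hEc : Continuous fun x : 𝕀 × Y => exp ((x.1 : ℝ) * l x.2) :=
    Complex.continuous_exp.comp ((Complex.continuous_ofReal.comp
      (continuous_subtype_val.comp continuous_fst)).mul (hl.comp continuous_snd))
  have hAc : Continuous A := Complex.continuous_re.comp hEc
  have hBc : Continuous B := Complex.continuous_im.comp hEc
  have hAB : ∀ x, 0 < A x ^ 2 + B x ^ 2 := by
    intro x
    have := Complex.normSq_pos.2 (Complex.exp_ne_zero ((x.1 : ℝ) * l x.2))
    rw [Complex.normSq_apply] at this
    simp only [A, B]
    linarith
  let K : 𝕀 × Y → ℝ := fun x => 1 - (x.1 : ℝ) + x.1 * k x.2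
  let S : 𝕀 × Y → ℝ := fun x => x.1 * s x.2
  have hKc : Continuous K := by fun_prop
  have hSc : Continuous S := by fun_prop
  have hKp : ∀ x, 0 < K x := by
    intro x
    have h1 := x.1.2.1
    have h2 := x.1.2.2
    have h3 := hkp x.2
    rcases h1.eq_or_lt with h | h
    · simp only [K, ← h]; norm_num
    · have := mul_pos h h3
      simp only [K]; linarith
  let H : 𝕀 → Fin 2 → ∀ y : Y, 𝕋 y := fun t =>
    ![fun y => A (t, y) • e 0 y + B (t, y) • e 1 y,
      fun y => (S (t, y) * A (t, y) - K (t, y) * B (t, y)) • e 0 y +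
        (S (t, y) * B (t, y) + K (t, y) * A (t, y)) • e 1 y]
  have hcomb : ∀ p q : 𝕀 × Y → ℝ, Continuous p → Continuous q → Continuous fun x : 𝕀 × Y =>
        (⟨x.2, p x • e 0 x.2 + q x • e 1 x.2⟩ : TangentBundle (𝓡 3) Y) := fun p q hp hq =>
    continuous_iff_continuousAt.2 fun x =>
      ContinuousAt.vec_add (b := fun x : 𝕀 × Y => x.2)
      (ContinuousAt.vec_smul (b := fun x : 𝕀 × Y => x.2) hp.continuousAt
        ((he.1 0).comp continuous_snd).continuousAt)
      (ContinuousAt.vec_smul (b := fun x : 𝕀 × Y => x.2) hq.continuousAt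
        ((he.1 1).comp continuous_snd).continuousAt)
  have hHc : ∀ i, Continuous fun x : 𝕀 × Y =>
      (⟨x.2, H x.1 i x.2⟩ : TangentBundle (𝓡 3) Y) := by
    intro i
    fin_cases i
    · exact hcomb A B hAc hBc
    · exact hcomb _ _ ((hSc.mul hAc).sub (hKc.mul hBc)) ((hSc.mul hBc).add (hKc.mul hAc))
  refine ⟨H, hHc, fun t => ⟨fun i => (hHc i).comp (Continuous.prodMk_right t), fun i y => ?_,
    fun y => ?_⟩, ?_, ?_⟩
  · have e0 := he.2.1 0 y
    have e1 := he.2.1 1 y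
    fin_cases i <;> simp [H, e0, e1]
  · change 0 < extd lam y (A (t, y) • e 0 y + B (t, y) • e 1 y)
      ((S (t, y) * A (t, y) - K (t, y) * B (t, y)) • e 0 y +
        (S (t, y) * B (t, y) + K (t, y) * A (t, y)) • e 1 y)
    simp only [extd_add_left, extd_add_right, extd_smul_left, extd_smul_right, extd_self]
    rw [extd_swap (e 1 y)]
    have := mul_pos (mul_pos (hAB (t, y)) (hKp (t, y))) (he.2.2 y)
    linarith
  · funext i y
    fin_cases i <;> simp [H, A, B, S, K]
  · have hA1 : ∀ y, A (1, y) = a y := fun y => by simp [A, hl']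
    have hB1 : ∀ y, B (1, y) = b y := fun y => by simp [B, hl']
    funext i y
    have hny := (hn y).ne'
    fin_cases i
    · change A (1, y) • e 0 y + B (1, y) • e 1 y = e' 0 y
      rw [hA1, hB1, h0]
    · change (S (1, y) * A (1, y) - K (1, y) * B (1, y)) • e 0 y +
        (S (1, y) * B (1, y) + K (1, y) * A (1, y)) • e 1 y = e' 1 y
      rw [hA1, hB1, h1]
      congr 2
      · simp only [S, K, s, k, Icc.coe_one]
        field_simp
        ring
      · simp only [S, K, s, k, Icc.coe_one]
        field_simp
        ring

lemma isInducedBy_of_homotopic {σ σ' : Framing o} {Θ : SpinStructure o univ}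
    (H : 𝕀 → Y → Tuple 3 Y) (hH : Continuous (uncurry H))
    (hp : ∀ t y, IsPos o (H t y)) (h0 : ∀ y, H 0 y = (σ.sec y).1) (h1 : ∀ y, H 1 y = (σ'.sec y).1)
    (h : Θ.IsInducedBy σ) : Θ.IsInducedBy σ' := by
  rw [isInducedBy_iff] at h ⊢
  intro γ hγ hl
  rw [← h γ hγ hl]
  symm
  refine Θ.cls.ev_congr (fun s t => H s (γ t)) ?_ (fun s t => hp _ _) (fun s => by rw [hl])
    (fun t => h0 _) (fun t => h1 _)
  exact hH.comp (continuous_fst.prodMk (hγ.comp continuous_snd))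

lemma isPos_trivialization (hc : IsContactForm o lam) {e : Fin 2 → ∀ y : Y, 𝕋 y}
    (he : IsTrivialization lam e) {y : Y} {v : 𝕋 y} (hv : 0 < lam y v) :
    IsPos o ⟨y, ![e 0 y, e 1 y, v]⟩ := by
  refine ⟨trivial, (pos_iff_vol hc).2 ?_⟩
  have h0 := he.2.1 0 y
  have h1 := he.2.1 1 y
  have : vol lam y ![e 0 y, e 1 y, v] = lam y v * extd lam y (e 0 y) (e 1 y) := by
    simp [vol, h0, h1]
  change 0 < vol lam y ![e 0 y, e 1 y, v]
  rw [this]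
  exact mul_pos hv (he.2.2 y)

lemma isInducedByTrivialization_iff (hc : IsContactForm o lam)
    (hhom : ∀ e e', IsTrivialization lam e → IsTrivialization lam e' →
      TrivializationsHomotopic lam e e')
    {e : Fin 2 → ∀ y : Y, 𝕋 y} (he : IsTrivialization lam e) {σ : Framing o}
    (hσ : ∀ y, (σ.sec y).1 = ⟨y, ![e 0 y, e 1 y, reeb hc y]⟩)
    {e' : Fin 2 → ∀ y : Y, 𝕋 y} (he' : IsTrivialization lam e')
    (Θ : SpinStructure o univ) : IsInducedByTrivialization lam e' Θ ↔ Θ = σ.spin := by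
  have hr : ∀ y, 0 < lam y (reeb hc y) := fun y => by rw [lam_reeb]; norm_num
  obtain ⟨σ', hσ'⟩ := exists_framing hc he' (continuous_reeb hc) hr
  have key : Θ.IsInducedBy σ' ↔ Θ = σ.spin := by
    have aux : ∀ {e₁ e₂ : Fin 2 → ∀ y : Y, 𝕋 y}, IsTrivialization lam e₁ →
        IsTrivialization lam e₂ → ∀ {σ₁ σ₂ : Framing o},
        (∀ y, (σ₁.sec y).1 = ⟨y, ![e₁ 0 y, e₁ 1 y, reeb hc y]⟩) →
        (∀ y, (σ₂.sec y).1 = ⟨y, ![e₂ 0 y, e₂ 1 y, reeb hc y]⟩) →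
        ∀ {Θ : SpinStructure o univ}, Θ.IsInducedBy σ₁ → Θ.IsInducedBy σ₂ := by
      intro e₁ e₂ he₁ he₂ σ₁ σ₂ hσ₁ hσ₂ Θ h
      obtain ⟨H, hH, hH', hH0, hH1⟩ := hhom e₁ e₂ he₁ he₂
      refine isInducedBy_of_homotopic (fun t y => ⟨y, ![H t 0 y, H t 1 y, reeb hc y]⟩) ?_
        (fun t y => isPos_trivialization hc (hH' t) (hr y)) (fun y => ?_) (fun y => ?_) h
      · refine continuous_iff_continuousAt.2 fun x => continuousAt_tuple_of_tot fun i => ?_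
        fin_cases i
        · exact (hH 0).continuousAt
        · exact (hH 1).continuousAt
        · exact ((continuous_reeb hc).comp continuous_snd).continuousAt
      · rw [hσ₁, hH0]
      · rw [hσ₂, hH1]
    constructor
    · intro h
      exact (aux he' he hσ' hσ h).unique σ.isInducedBy_spin
    · rintro rfl
      exact aux he he' hσ hσ' σ.isInducedBy_spin
  rw [← key]
  constructor
  · rintro ⟨ι, ν, hν, hι, hΘ⟩
    have hνc : Continuous fun y => (⟨y, ν y⟩ : TangentBundle (𝓡 3) Y) := by
      refine continuous_iff_continuousAt.2 fun y => ?_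
      have := ContinuousAt.tot (ι.continuous_tuple.continuousAt (x := y)) 2
      refine (continuousAt_congr (.of_forall fun z => ?_)).1 this
      exact congrArg (fun f : Tuple 3 Y => f.tot 2) (hι z)
    refine isInducedBy_of_homotopic (fun t y => ⟨y, ![e' 0 y, e' 1 y,
      (1 - (t : ℝ)) • ν y + (t : ℝ) • reeb hc y]⟩) ?_ (fun t y => ?_) (fun y => ?_) (fun y => ?_) hΘ
    · refine continuous_iff_continuousAt.2 fun x => continuousAt_tuple_of_tot fun i => ?_
      fin_cases i
      · exact ((he'.1 0).comp continuous_snd).continuousAt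
      · exact ((he'.1 1).comp continuous_snd).continuousAt
      · exact ContinuousAt.vec_add (b := fun x : 𝕀 × Y => x.2)
          (ContinuousAt.vec_smul (b := fun x : 𝕀 × Y => x.2)
            (c := fun x => 1 - (x.1 : ℝ)) (by fun_prop) (hνc.comp continuous_snd).continuousAt)
          (ContinuousAt.vec_smul (b := fun x : 𝕀 × Y => x.2)
            (c := fun x => (x.1 : ℝ)) (by fun_prop)
            ((continuous_reeb hc).comp continuous_snd).continuousAt)
    · refine isPos_trivialization hc he' ?_
      rw [map_add, map_smul, map_smul, lam_reeb, smul_eq_mul, smul_eq_mul]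
      have h1 := t.2.1
      have h2 := t.2.2
      have h3 := hν y
      rcases h2.eq_or_lt with h | h
      · rw [h]; norm_num
      · have := mul_pos (sub_pos.2 h) h3
        linarith
    · rw [hι]; simp
    · rw [hσ']; simp
  · intro h
    exact ⟨σ', reeb hc, hr, hσ', h⟩

/-! ### Continuous logarithms on the punctured plane -/

/-- `2πi`. -/
def tpi : ℂ := τ * I

lemma tpi_ne_zero : tpi ≠ 0 := Complex.two_pi_I_ne_zero

lemma exists_log_of_convex {F : Type*} [NormedAddCommGroup F] [NormedSpace ℝ F] {U : Set F}
    (hU : Convex ℝ U) (hU' : IsOpen U) (hne : U.Nonempty) {g : F → ℂ} (hg : ContinuousOn g U)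
    (h0 : ∀ x ∈ U, g x ≠ 0) : ∃ l : F → ℂ, ContinuousOn l U ∧ ∀ x ∈ U, exp (l x) = g x := by
  have hs : IsSimplyConnected U := by
    have := hU.contractibleSpace hne
    exact (inferInstance : SimplyConnectedSpace U)
  have := LocallyConvexSpace.toLocallyPathConnectedSpace (E := F)
  obtain ⟨l, hl, hl'⟩ := Complex.exists_continuousOn_eqOn_exp_comp hs hU' hg
    (by rintro ⟨x, hx, h⟩; exact h0 x hx h)
  exact ⟨l, hl, hl'⟩

lemma exists_int_of_exp_eq {S : Set X} (hS : IsPreconnected S)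
    {l l' : X → ℂ} (hl : ContinuousOn l S) (hl' : ContinuousOn l' S)
    (h : ∀ x ∈ S, exp (l x) = exp (l' x)) :
    ∃ n : ℤ, ∀ x ∈ S, l x = l' x + n * tpi := by
  have h1 : ∀ x ∈ S, ∃ n : ℤ, l x = l' x + n * tpi := fun x hx => by
    obtain ⟨n, hn⟩ := exp_eq_exp_iff_exists_int.1 (h x hx)
    exact ⟨n, by rw [hn, tpi]⟩
  rcases S.eq_empty_or_nonempty with rfl | ⟨x₀, hx₀⟩
  · exact ⟨0, by simp⟩
  obtain ⟨n₀, hn₀⟩ := h1 x₀ hx₀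
  refine ⟨n₀, fun x hx => ?_⟩
  have hd : ContinuousOn (fun x => (l x - l' x) / tpi) S := (hl.sub hl').div_const _
  have him : ((fun x => (l x - l' x) / tpi) '' S) ⊆ range ((↑) : ℤ → ℂ) := by
    rintro _ ⟨x, hx, rfl⟩
    obtain ⟨n, hn⟩ := h1 x hx
    exact ⟨n, by simp only [hn]; field_simp [tpi_ne_zero]; ring⟩
  have hpre := hS.image _ hd
  have hdisc : IsTotallyDisconnected (range ((↑) : ℤ → ℂ)) :=
    (Set.countable_range _).isTotallyDisconnected
  have hsub := hdisc _ him hpre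
  have := hsub ⟨x, hx, rfl⟩ ⟨x₀, hx₀, rfl⟩
  simp only at this
  rw [hn₀] at this
  have h2 : (l' x₀ + n₀ * tpi - l' x₀) / tpi = n₀ := by
    field_simp [tpi_ne_zero]; ring
  rw [h2, div_eq_iff tpi_ne_zero] at this
  rw [← this]; ring

/-- The complement of the lines over the lattice points. -/
def punct : Set ((ℝ × ℝ) × ℝ) := {x | x.1 ∉ range latticePt}

lemma mem_lattice_iff {p : ℝ × ℝ} :
    p ∈ range latticePt ↔ (∃ i : ℤ, (i : ℝ) = p.1) ∧ ∃ j : ℤ, (j : ℝ) = p.2 := by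
  constructor
  · rintro ⟨m, rfl⟩
    exact ⟨⟨m.1, rfl⟩, ⟨m.2, rfl⟩⟩
  · rintro ⟨⟨i, hi⟩, ⟨j, hj⟩⟩
    exact ⟨(i, j), Prod.ext hi hj⟩

lemma latticePt_add (m m' : ℤ × ℤ) : latticePt (m + m') = latticePt m + latticePt m' := by
  simp [latticePt]

lemma latticePt_zero : latticePt 0 = 0 := by
  simp [latticePt]

lemma latticePt_neg (m : ℤ × ℤ) : latticePt (-m) = -latticePt m := by
  simp [latticePt]

lemma add_latticePt_mem {p : ℝ × ℝ} {m : ℤ × ℤ} :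
    p + latticePt m ∈ range latticePt ↔ p ∈ range latticePt := by
  constructor
  · rintro ⟨k, hk⟩
    exact ⟨k - m, by rw [sub_eq_add_neg, latticePt_add, latticePt_neg, hk]; abel⟩
  · rintro ⟨k, rfl⟩
    exact ⟨k + m, latticePt_add _ _⟩

lemma countable_lattice : (range latticePt).Countable := Set.countable_range _

lemma isClosed_lattice : IsClosed (range latticePt) := by
  have h : range latticePt = range ((↑) : ℤ → ℝ) ×ˢ range ((↑) : ℤ → ℝ) := by
    ext p
    rw [mem_lattice_iff]
    rfl
  rw [h]
  exact Int.isClosedEmbedding_coe_real.isClosed_range.prod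
    Int.isClosedEmbedding_coe_real.isClosed_range

lemma isOpen_punct : IsOpen punct := isClosed_lattice.isOpen_compl.preimage continuous_fst

lemma isPathConnected_compl_lattice : IsPathConnected (range latticePt)ᶜ := by
  refine countable_lattice.isPathConnected_compl_of_one_lt_rank ?_
  rw [rank_prod', Module.rank_self]
  norm_num

lemma isPreconnected_punct : IsPreconnected punct := by
  have : punct = (range latticePt)ᶜ ×ˢ (univ : Set ℝ) := by
    ext x
    simp [punct]
  rw [this]
  exact isPathConnected_compl_lattice.isConnected.isPreconnected.prod isPreconnected_univ

lemma exists_log_punct {G : (ℝ × ℝ) × ℝ → ℂ} (hG : ContinuousOn G punct)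
    (h0 : ∀ x ∈ punct, G x ≠ 0) (hper : ∀ x ∈ punct, ∀ m, G (x.1 + latticePt m, x.2) = G x) :
    ∃ L : (ℝ × ℝ) × ℝ → ℂ, ContinuousOn L punct ∧ ∀ x ∈ punct, exp (L x) = G x := by
  let S : ℤ → Set ((ℝ × ℝ) × ℝ) := fun j => {x | (j : ℝ) < x.1.2 ∧ x.1.2 < j + 1}
  let T : ℤ → Set ((ℝ × ℝ) × ℝ) := fun i => {x | (i : ℝ) < x.1.1 ∧ x.1.1 < i + 1}
  have hnot : ∀ (i : ℤ) (a : ℝ), (i : ℝ) < a → a < i + 1 → ∀ j : ℤ, (j : ℝ) ≠ a := by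
    rintro i a h1 h2 j rfl
    norm_cast at h1 h2
    omega
  have hSp : ∀ j, S j ⊆ punct := fun j x hx hx' =>
    let ⟨_, k, hk⟩ := mem_lattice_iff.1 hx'
    hnot j _ hx.1 hx.2 k hk
  have hTp : ∀ j, T j ⊆ punct := fun j x hx hx' =>
    let ⟨⟨k, hk⟩, _⟩ := mem_lattice_iff.1 hx'
    hnot j _ hx.1 hx.2 k hk
  have hSo : ∀ j, IsOpen (S j) := fun j =>
    isOpen_Ioo.preimage (f := fun x : (ℝ × ℝ) × ℝ => x.1.2) (by fun_prop)
  have hTo : ∀ j, IsOpen (T j) := fun j =>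
    isOpen_Ioo.preimage (f := fun x : (ℝ × ℝ) × ℝ => x.1.1) (by fun_prop)
  have hSc : ∀ j, Convex ℝ (S j) := fun j => by
    have : S j = (fun x : (ℝ × ℝ) × ℝ => x.1.2) ⁻¹' Set.Ioo (j : ℝ) (j + 1) := rfl
    rw [this]
    exact (convex_Ioo _ _).linear_preimage
      ((LinearMap.snd ℝ ℝ ℝ).comp (LinearMap.fst ℝ (ℝ × ℝ) ℝ))
  have hTc : ∀ j, Convex ℝ (T j) := fun j => by
    have : T j = (fun x : (ℝ × ℝ) × ℝ => x.1.1) ⁻¹' Set.Ioo (j : ℝ) (j + 1) := rfl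
    rw [this]
    exact (convex_Ioo _ _).linear_preimage
      ((LinearMap.fst ℝ ℝ ℝ).comp (LinearMap.fst ℝ (ℝ × ℝ) ℝ))
  let z : ℤ → ℤ → (ℝ × ℝ) × ℝ := fun i j => ((i + 1 / 2, j + 1 / 2), 0)
  have hzS : ∀ i j, z i j ∈ S j := fun i j => ⟨by simp [z], by simp [z]; norm_num⟩
  have hzT : ∀ i j, z i j ∈ T i := fun i j => ⟨by simp [z], by simp [z]; norm_num⟩
  choose Lh hLh hLh' using fun j => exists_log_of_convex (hSc j) (hSo j) ⟨_, hzS 0 j⟩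
    (hG.mono (hSp j)) fun x hx => h0 x (hSp j hx)
  choose Lv hLv hLv' using fun i => exists_log_of_convex (hTc i) (hTo i) ⟨_, hzT i 0⟩
    (hG.mono (hTp i)) fun x hx => h0 x (hTp i hx)
  choose d hd using fun i j => exists_int_of_exp_eq ((hSc j).inter (hTc i)).isPreconnected
    ((hLh j).mono Set.inter_subset_left) ((hLv i).mono Set.inter_subset_right)
    fun x hx => by rw [hLh' j x hx.1, hLv' i x hx.2]
  let s : ℤ × ℤ → (ℝ × ℝ) × ℝ → (ℝ × ℝ) × ℝ := fun m x => (x.1 + latticePt m, x.2)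
  have hsc : ∀ m, Continuous (s m) := fun m => by simp only [s]; fun_prop
  have hsS : ∀ i k j x, x ∈ S j → s (i, k) x ∈ S (j + k) := fun i k j x hx => by
    have h1 := hx.1
    have h2 := hx.2
    constructor <;> simp [s, latticePt] <;> linarith
  have hsT : ∀ i k j x, x ∈ T j → s (i, k) x ∈ T (j + i) := fun i k j x hx => by
    have h1 := hx.1
    have h2 := hx.2
    constructor <;> simp [s, latticePt] <;> linarith
  choose α hα using fun j => exists_int_of_exp_eq (hSc j).isPreconnected
    (l := fun x => Lh j (s (1, 0) x)) (l' := Lh j)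
    ((hLh j).comp (hsc _).continuousOn fun x hx => by simpa using hsS 1 0 j x hx) (hLh j)
    fun x hx => by
      rw [hLh' j x hx, hLh' j _ (by simpa using hsS 1 0 j x hx)]
      exact hper x (hSp j hx) _
  choose β hβ using fun i => exists_int_of_exp_eq (hTc i).isPreconnected
    (l := fun x => Lv (i + 1) (s (1, 0) x)) (l' := Lv i)
    ((hLv (i + 1)).comp (hsc _).continuousOn fun x hx => hsT 1 0 i x hx) (hLv i)
    fun x hx => by
      rw [hLv' i x hx, hLv' (i + 1) _ (hsT 1 0 i x hx)]
      exact hper x (hTp i hx) _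
  choose γ hγ using fun j => exists_int_of_exp_eq (hSc j).isPreconnected
    (l := fun x => Lh (j + 1) (s (0, 1) x)) (l' := Lh j)
    ((hLh (j + 1)).comp (hsc _).continuousOn fun x hx => hsS 0 1 j x hx) (hLh j)
    fun x hx => by
      rw [hLh' j x hx, hLh' (j + 1) _ (hsS 0 1 j x hx)]
      exact hper x (hSp j hx) _
  have hcancel : ∀ {a b : ℤ} {c : ℂ}, c + a * tpi = c + b * tpi → a = b := fun {a b c} h => by
    have h1 := mul_right_cancel₀ tpi_ne_zero (add_left_cancel h)
    exact_mod_cast h1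
  have hαs : ∀ j, α (j + 1) = α j := fun j => by
    have hx := hzS 0 j
    have e1 := hα (j + 1) (s (0, 1) (z 0 j)) (hsS 0 1 j _ hx)
    have e2 := hγ j (s (1, 0) (z 0 j)) (by simpa using hsS 1 0 j _ hx)
    have e3 := hα j _ hx
    have e4 := hγ j _ hx
    have e5 : s (1, 0) (s (0, 1) (z 0 j)) = s (0, 1) (s (1, 0) (z 0 j)) := by
      simp only [s]; congr 1; abel
    rw [e5, e2, e3, e4] at e1
    exact (hcancel (c := Lh j (z 0 j) + γ j * tpi) (by linear_combination e1)).symm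
  have hα0 : ∀ j, α j = α 0 := fun j => by
    induction j using Int.induction_on with
    | zero => rfl
    | succ i ih => rw [hαs, ih]
    | pred i ih => rw [← ih, ← hαs]; congr 1; ring
  have hdd : ∀ i j, d (i + 1) j = d i j + α j - β i := fun i j => by
    have hx := hzS i j
    have hx' := hzT i j
    have e1 := hd (i + 1) j (s (1, 0) (z i j))
      ⟨by simpa using hsS 1 0 j _ hx, hsT 1 0 i _ hx'⟩
    have e2 := hα j _ hx
    have e3 := hβ i _ hx'
    have e4 := hd i j _ ⟨hx, hx'⟩
    rw [e2, e3, e4] at e1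
    refine hcancel (c := Lv i (z i j)) ?_
    push_cast
    linear_combination -e1
  have hde : ∀ i j, d i j - d i 0 = d 0 j - d 0 0 := fun i j => by
    induction i using Int.induction_on with
    | zero => rfl
    | succ i ih =>
      have h1 := hdd i j
      have h2 := hdd i 0
      rw [hα0 j] at h1
      omega
    | pred i ih =>
      have h1 := hdd (-i - 1) j
      have h2 := hdd (-i - 1) 0
      rw [hα0 j] at h1
      simp only [sub_add_cancel] at h1 h2
      omega
  let L : (ℝ × ℝ) × ℝ → ℂ := fun x => open Classical in
    if ∃ j, x ∈ S j then Lh ⌊x.1.2⌋ x - (d 0 ⌊x.1.2⌋ - d 0 0 : ℤ) * tpi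
    else Lv ⌊x.1.1⌋ x + (d ⌊x.1.1⌋ 0 : ℤ) * tpi
  have hfl : ∀ (j : ℤ) (a : ℝ), (j : ℝ) < a → a < j + 1 → ⌊a⌋ = j := fun j a h1 h2 =>
    Int.floor_eq_iff.2 ⟨h1.le, h2⟩
  have hLS : ∀ j, ∀ x ∈ S j, L x = Lh j x - (d 0 j - d 0 0 : ℤ) * tpi := fun j x hx => by
    simp only [L]
    rw [if_pos ⟨j, hx⟩, hfl j _ hx.1 hx.2]
  have hLT : ∀ i, ∀ x ∈ T i, L x = Lv i x + (d i 0 : ℤ) * tpi := fun i x hx => by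
    by_cases h : ∃ j, x ∈ S j
    · obtain ⟨j, hj⟩ := h
      rw [hLS j x hj, hd i j x ⟨hj, hx⟩, ← hde i j]
      push_cast
      ring
    · simp only [L]
      rw [if_neg h, hfl i _ hx.1 hx.2]
  have hcov : ∀ x ∈ punct, (∃ j, x ∈ S j) ∨ ∃ i, x ∈ T i := by
    intro x hx
    by_contra! hcon
    refine hx (mem_lattice_iff.2 ⟨⟨⌊x.1.1⌋, ?_⟩, ⟨⌊x.1.2⌋, ?_⟩⟩)
    · by_contra hne
      exact hcon.2 ⌊x.1.1⌋ ⟨lt_of_le_of_ne (Int.floor_le _) hne, Int.lt_floor_add_one _⟩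
    · by_contra hne
      exact hcon.1 ⌊x.1.2⌋ ⟨lt_of_le_of_ne (Int.floor_le _) hne, Int.lt_floor_add_one _⟩
  have hexp : ∀ (c : ℂ) (n : ℤ), exp (c + n * tpi) = exp c := fun c n =>
    Complex.exp_periodic.int_mul n c
  refine ⟨L, fun x hx => ContinuousAt.continuousWithinAt ?_, fun x hx => ?_⟩
  · rcases hcov x hx with ⟨j, hj⟩ | ⟨i, hi⟩
    · have hn := (hSo j).mem_nhds hj
      refine (continuousAt_congr (Filter.eventually_of_mem hn (hLS j))).2 ?_
      exact ((hLh j).continuousAt hn).sub continuousAt_const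
    · have hn := (hTo i).mem_nhds hi
      refine (continuousAt_congr (Filter.eventually_of_mem hn (hLT i))).2 ?_
      exact ((hLv i).continuousAt hn).add continuousAt_const
  · rcases hcov x hx with ⟨j, hj⟩ | ⟨i, hi⟩
    · rw [hLS j x hj, sub_eq_add_neg, ← neg_mul, ← Int.cast_neg, hexp, hLh' j x hj]
    · rw [hLT i x hi, hexp, hLv' i x hi]

lemma exists_log_periodic {G : (ℝ × ℝ) × ℝ → ℂ} (hG : ContinuousOn G punct)
    (h0 : ∀ x ∈ punct, G x ≠ 0) (hper : ∀ x ∈ punct, ∀ m, G (x.1 + latticePt m, x.2) = G x) :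
    ∃ L : (ℝ × ℝ) × ℝ → ℂ, ContinuousOn L punct ∧ (∀ x ∈ punct, exp (L x) = G x) ∧
      ∃ r : ℤ × ℤ →+ ℤ, ∀ x ∈ punct, ∀ m, L (x.1 + latticePt m, x.2) = L x + r m * tpi := by
  obtain ⟨L, hL, hL'⟩ := exists_log_punct hG h0 hper
  have hm : ∀ x ∈ punct, ∀ m : ℤ × ℤ, ((x.1 + latticePt m, x.2) : (ℝ × ℝ) × ℝ) ∈ punct :=
    fun x hx m h => hx (add_latticePt_mem.1 h)
  choose r hr using fun m : ℤ × ℤ => exists_int_of_exp_eq isPreconnected_punct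
    (l := fun x => L (x.1 + latticePt m, x.2)) (l' := L)
    (hL.comp (by fun_prop) fun x hx => hm x hx m) hL
    fun x hx => by rw [hL' _ (hm x hx m), hL' x hx, hper x hx]
  have hx₀ : (((1 / 2, 1 / 2), 0) : (ℝ × ℝ) × ℝ) ∈ punct := fun h => by
    obtain ⟨⟨i, hi⟩, -⟩ := mem_lattice_iff.1 h
    have : (2 * i : ℝ) = 1 := by rw [hi]; norm_num
    norm_cast at this
    omega
  refine ⟨L, hL, hL', AddMonoidHom.mk' r fun m m' => ?_, fun x hx m => hr m x hx⟩
  have e1 := hr (m + m') _ hx₀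
  have e2 := hr m' _ (hm _ hx₀ m)
  have e3 := hr m _ hx₀
  simp only at e1 e2 e3
  rw [e3, add_assoc, ← latticePt_add, e1] at e2
  have h1 : (r (m + m') : ℂ) * tpi = (r m + r m') * tpi := by linear_combination e2
  have h2 := mul_right_cancel₀ tpi_ne_zero h1
  exact_mod_cast h2

/-! ### The monodromy -/

abbrev M2 (R : Type*) := Matrix (Fin 2) (Fin 2) R

def mapP {R : Type*} [CommRing R] (A : M2 R) (m : R × R) : R × R :=
  (A 0 0 * m.1 + A 0 1 * m.2, A 1 0 * m.1 + A 1 1 * m.2)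

lemma mapP_mul {R : Type*} [CommRing R] (A B : M2 R) (m : R × R) :
    mapP (A * B) m = mapP A (mapP B m) := by
  simp only [mapP, mul_apply, Fin.sum_univ_two]
  ext <;> simp only <;> ring

lemma mapP_one {R : Type*} [CommRing R] (m : R × R) : mapP (1 : M2 R) m = m := by
  simp [mapP]

lemma step_eq {n : ℤ} {s : ℝ} (h1 : n - 1 / 4 ≤ s) (h2 : s ≤ n + 5 / 4) :
    step s = n + smoothTransition (2 * (s - n) - 1 / 2) := by
  rcases lt_or_ge s n with h | h
  · have hf : ⌊s⌋ = n - 1 := Int.floor_eq_iff.2 ⟨by push_cast; linarith, by push_cast; linarith⟩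
    rw [step, Int.fract, hf, smoothTransition.one_of_one_le (by push_cast; linarith),
      smoothTransition.zero_of_nonpos (by linarith)]
    push_cast; ring
  · rcases lt_or_ge s (n + 1) with h' | h'
    · have hf : ⌊s⌋ = n := Int.floor_eq_iff.2 ⟨h, h'⟩
      rw [step, Int.fract, hf]
    · have hf : ⌊s⌋ = n + 1 := Int.floor_eq_iff.2 ⟨by push_cast; linarith, by push_cast; linarith⟩
      rw [step, Int.fract, hf, smoothTransition.zero_of_nonpos (by push_cast; linarith),
        smoothTransition.one_of_one_le (by linarith)]
      push_cast; ring

lemma step_near {n : ℤ} {s : ℝ} (h1 : n - 1 / 4 ≤ s) (h2 : s ≤ n + 1 / 4) : step s = n := by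
  rw [step_eq h1 (by linarith), smoothTransition.zero_of_nonpos (by linarith), add_zero]

lemma contDiff_step : ContDiff ℝ ∞ step := by
  refine contDiff_iff_contDiffAt.2 fun s => ?_
  obtain ⟨n, hn⟩ : ∃ n : ℤ, n = ⌊s⌋ := ⟨_, rfl⟩
  have h1 : (n : ℝ) ≤ s := hn ▸ Int.floor_le s
  have h2 : s < n + 1 := hn ▸ Int.lt_floor_add_one s
  have hev : step =ᶠ[𝓝 s] fun s => n + smoothTransition (2 * (s - n) - 1 / 2) := by
    filter_upwards [isOpen_Ioo.mem_nhds (show s ∈ Set.Ioo ((n : ℝ) - 1 / 4) (n + 5 / 4) from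
      ⟨by linarith, by linarith⟩)] with t ht
    exact step_eq ht.1.le ht.2.le
  refine ContDiffAt.congr_of_eventuallyEq ?_ hev
  exact (contDiff_const.add (smoothTransition.contDiff.comp (by fun_prop))).contDiffAt

lemma step_add_int (s : ℝ) (m : ℤ) : step (s + m) = step s + m := by
  simp only [step, Int.floor_add_intCast, Int.fract_add_intCast]
  push_cast
  ring

lemma deriv_step_add_int (s : ℝ) (m : ℤ) : deriv step (s + m) = deriv step s := by
  have h : (fun s : ℝ => step (s + m)) = fun s => step s + m := funext fun s => step_add_int s m
  have h1 : deriv (fun s : ℝ => step (s + m)) s = deriv step (s + m) := deriv_comp_add_const ..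
  rw [← h1, h]
  simp

lemma deriv_step_near {s : ℝ} (h : |s| ≤ 1 / 4) : deriv step s = 0 := by
  have hint : ∀ s ∈ Set.Ioo (-(1 / 4) : ℝ) (1 / 4), deriv step s = 0 := by
    intro s hs
    have : step =ᶠ[𝓝 s] fun _ => ((0 : ℤ) : ℝ) := by
      filter_upwards [isOpen_Ioo.mem_nhds hs] with t ht
      exact step_near (by push_cast; linarith [ht.1]) (by push_cast; linarith [ht.2])
    rw [this.deriv_eq, deriv_const]
  have hcl : IsClosed {s : ℝ | deriv step s = 0} :=
    isClosed_eq (contDiff_step.continuous_deriv (by simp)) continuous_const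
  have h1 : closure (Set.Ioo (-(1 / 4) : ℝ) (1 / 4)) ⊆ {s | deriv step s = 0} :=
    closure_minimal hint hcl
  rw [closure_Ioo (by norm_num)] at h1
  exact h1 (abs_le.1 h)

/-- A diffeomorphism of the plane that is a lift of a diffeomorphism of the punctured torus with
the matrix `A`, a translation near the lattice points, whose differential is homotopic to the
identity. -/
structure IsTwist (h : ℝ × ℝ → ℝ × ℝ) (A : M2 ℤ) : Prop where
  smooth : ContDiff ℝ ∞ h
  det : A.det = 1
  injective : Injective h
  equiv : ∀ p m, h (p + latticePt m) = h p + latticePt (mapP A m)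
  near : ∃ m₀, ∀ p : ℝ × ℝ, |p.1| ≤ 1 / 4 → |p.2| ≤ 1 / 4 → h p = p + latticePt m₀
  isotopy : ∃ H : ℝ → ℝ × ℝ → M2 ℝ, Continuous (uncurry H) ∧
    (∀ s p m, H s (p + latticePt m) = H s p) ∧
    (∀ s (p : ℝ × ℝ), |p.1| ≤ 1 / 4 → |p.2| ≤ 1 / 4 → H s p = 1) ∧ (∀ s p, 0 < (H s p).det) ∧
    (∀ s p, s ≤ 1 / 4 → H s p = 1) ∧ ∀ s p, 3 / 4 ≤ s → ∀ v, fderiv ℝ h p v = mapP (H s p) v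

lemma IsTwist.comp {h h' : ℝ × ℝ → ℝ × ℝ} {A A' : M2 ℤ} (T : IsTwist h A) (T' : IsTwist h' A') :
    IsTwist (h' ∘ h) (A' * A) := by
  obtain ⟨m, hm⟩ := T.near
  obtain ⟨m', hm'⟩ := T'.near
  obtain ⟨H, H1, H2, H3, H4, H5, H6⟩ := T.isotopy
  obtain ⟨H', H1', H2', H3', H4', H5', H6'⟩ := T'.isotopy
  have hc := T.smooth.continuous
  refine ⟨T'.smooth.comp T.smooth, by rw [det_mul, T.det, T'.det, one_mul],
    T'.injective.comp T.injective, fun p k => ?_, ?_, ?_⟩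
  · rw [Function.comp_apply, T.equiv, T'.equiv, mapP_mul]; rfl
  · refine ⟨m' + mapP A' m, fun p h1 h2 => ?_⟩
    rw [Function.comp_apply, hm p h1 h2, T'.equiv, hm' p h1 h2, latticePt_add, add_assoc]
  · refine ⟨fun s p => H' s (h p) * H s p, ?_, ?_, ?_, ?_, ?_, ?_⟩
    · exact (H1'.comp (continuous_fst.prodMk (hc.comp continuous_snd))).matrix_mul H1
    · intro s p k
      beta_reduce
      rw [T.equiv, H2', H2]
    · intro s p h1 h2
      beta_reduce
      rw [hm p h1 h2, H2', H3' s p h1 h2, H3 s p h1 h2, one_mul]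
    · intro s p
      rw [det_mul]
      exact mul_pos (H4' _ _) (H4 _ _)
    · intro s p hs
      beta_reduce
      rw [H5 _ _ hs, H5' _ _ hs, one_mul]
    · intro s p hs v
      rw [fderiv_comp p (T'.smooth.differentiable (by simp) _) (T.smooth.differentiable (by simp) _),
        ContinuousLinearMap.comp_apply, H6 s p hs, H6' s _ hs, mapP_mul]

lemma isTwist_id : IsTwist id 1 := by
  refine ⟨contDiff_id, Matrix.det_one, Function.injective_id, fun p m => by rw [mapP_one]; rfl,
    ⟨0, fun p _ _ => by simp [latticePt_zero]⟩, fun _ _ => 1, continuous_const, fun _ _ _ => rfl,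
    fun _ _ _ _ => rfl, fun _ _ => by simp, fun _ _ _ => rfl, fun s p _ v => ?_⟩
  rw [fderiv_id, mapP_one]
  rfl

lemma isTwist_shearX (a : ℤ) : IsTwist (fun p => (p.1 + a * step p.2, p.2)) !![1, a; 0, 1] := by
  have hd := contDiff_step
  have hder : ∀ s, HasDerivAt step (deriv step s) s := fun s =>
    (hd.differentiable (by simp) s).hasDerivAt
  refine ⟨by fun_prop, by simp, ?_, ?_, ⟨0, ?_⟩,
    fun s p => !![1, a * deriv step p.2 * smoothTransition (2 * s - 1 / 2); 0, 1],
    ?_, ?_, ?_, ?_, ?_, ?_⟩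
  · rintro ⟨p1, p2⟩ ⟨q1, q2⟩ h
    simp only [Prod.mk.injEq] at h
    obtain ⟨h1, rfl⟩ := h
    simpa using h1
  · intro p m
    ext <;> simp [latticePt, mapP, step_add_int]
    ring
  · intro p _ h
    have := step_near (n := 0) (s := p.2) (by push_cast; linarith [(abs_le.1 h).1])
      (by push_cast; linarith [(abs_le.1 h).2])
    simp [latticePt_zero, this]
  · have h1 : Continuous (deriv step) := hd.continuous_deriv (by simp)
    have h2 := smoothTransition.continuous
    refine continuous_matrix fun i j => ?_
    fin_cases i <;> fin_cases j <;> simp [uncurry] <;> fun_prop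
  · intro s p m
    simp [latticePt, deriv_step_add_int]
  · intro s p _ h
    beta_reduce
    rw [deriv_step_near h]
    simp [Matrix.one_fin_two]
  · intro s p
    simp [Matrix.det_fin_two]
  · intro s p hs
    beta_reduce
    rw [smoothTransition.zero_of_nonpos (by linarith)]
    simp [Matrix.one_fin_two]
  · intro s p hs v
    beta_reduce
    rw [smoothTransition.one_of_one_le (by linarith)]
    have h1 : HasFDerivAt (fun p : ℝ × ℝ => (p.1 + a * step p.2, p.2))
        ((ContinuousLinearMap.fst ℝ ℝ ℝ + (a : ℝ) • (deriv step p.2 • ContinuousLinearMap.snd ℝ ℝ ℝ)).prod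
          (ContinuousLinearMap.snd ℝ ℝ ℝ)) p := by
      refine HasFDerivAt.prodMk ?_ hasFDerivAt_snd
      refine HasFDerivAt.add hasFDerivAt_fst ?_
      exact ((hder p.2).comp_hasFDerivAt p hasFDerivAt_snd).const_mul (a : ℝ)
    rw [h1.fderiv]
    simp [mapP]
    ring

lemma isTwist_shearY (b : ℤ) : IsTwist (fun p => (p.1, p.2 + b * step p.1)) !![1, 0; b, 1] := by
  have hd := contDiff_step
  have hder : ∀ s, HasDerivAt step (deriv step s) s := fun s =>
    (hd.differentiable (by simp) s).hasDerivAt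
  refine ⟨by fun_prop, by simp, ?_, ?_, ⟨0, ?_⟩,
    fun s p => !![1, 0; b * deriv step p.1 * smoothTransition (2 * s - 1 / 2), 1],
    ?_, ?_, ?_, ?_, ?_, ?_⟩
  · rintro ⟨p1, p2⟩ ⟨q1, q2⟩ h
    simp only [Prod.mk.injEq] at h
    obtain ⟨rfl, h1⟩ := h
    simpa using h1
  · intro p m
    ext <;> simp [latticePt, mapP, step_add_int]
    ring
  · intro p h _
    have := step_near (n := 0) (s := p.1) (by push_cast; linarith [(abs_le.1 h).1])
      (by push_cast; linarith [(abs_le.1 h).2])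
    simp [latticePt_zero, this]
  · have h1 : Continuous (deriv step) := hd.continuous_deriv (by simp)
    have h2 := smoothTransition.continuous
    refine continuous_matrix fun i j => ?_
    fin_cases i <;> fin_cases j <;> simp [uncurry] <;> fun_prop
  · intro s p m
    simp [latticePt, deriv_step_add_int]
  · intro s p h _
    beta_reduce
    rw [deriv_step_near h]
    simp [Matrix.one_fin_two]
  · intro s p
    simp [Matrix.det_fin_two]
  · intro s p hs
    beta_reduce
    rw [smoothTransition.zero_of_nonpos (by linarith)]
    simp [Matrix.one_fin_two]
  · intro s p hs v
    beta_reduce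
    rw [smoothTransition.one_of_one_le (by linarith)]
    have h1 : HasFDerivAt (fun p : ℝ × ℝ => (p.1, p.2 + b * step p.1))
        ((ContinuousLinearMap.fst ℝ ℝ ℝ).prod (ContinuousLinearMap.snd ℝ ℝ ℝ +
          (b : ℝ) • (deriv step p.1 • ContinuousLinearMap.fst ℝ ℝ ℝ))) p := by
      refine HasFDerivAt.prodMk hasFDerivAt_fst ?_
      refine HasFDerivAt.add hasFDerivAt_snd ?_
      exact ((hder p.1).comp_hasFDerivAt p hasFDerivAt_fst).const_mul (b : ℝ)
    rw [h1.fderiv]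
    simp [mapP]
    ring

lemma twistX_pow (a : ℕ) (p : ℝ × ℝ) : (twistX ^ a) p = (p.1 + (a : ℤ) * step p.2, p.2) := by
  induction a generalizing p with
  | zero => simp
  | succ a ih =>
    rw [pow_succ, Perm.mul_apply, ih]
    simp only [twistX, Equiv.coe_fn_mk]
    push_cast
    ext <;> simp only
    ring

lemma twistY_inv_pow (b : ℕ) (p : ℝ × ℝ) :
    (twistY⁻¹ ^ b) p = (p.1, p.2 + (b : ℤ) * step p.1) := by
  induction b generalizing p with
  | zero => simp
  | succ b ih =>
    rw [pow_succ, Perm.mul_apply, ih]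
    have : (twistY⁻¹ : Perm (ℝ × ℝ)) p = (p.1, p.2 + step p.1) := rfl
    rw [this]
    push_cast
    ext <;> simp only
    ring

lemma isTwist_twistX_pow (a : ℕ) : IsTwist (twistX ^ a : Perm (ℝ × ℝ)) !![1, (a : ℤ); 0, 1] := by
  rw [show ((twistX ^ a : Perm (ℝ × ℝ)) : ℝ × ℝ → ℝ × ℝ) = _ from funext (twistX_pow a)]
  exact isTwist_shearX a

lemma isTwist_twistY_inv_pow (b : ℕ) :
    IsTwist (twistY⁻¹ ^ b : Perm (ℝ × ℝ)) !![1, 0; (b : ℤ), 1] := by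
  rw [show ((twistY⁻¹ ^ b : Perm (ℝ × ℝ)) : ℝ × ℝ → ℝ × ℝ) = _ from funext (twistY_inv_pow b)]
  exact isTwist_shearY b

lemma isTwist_twistX : IsTwist twistX !![1, 1; 0, 1] := by
  simpa using isTwist_twistX_pow 1

lemma isTwist_twistY : IsTwist twistY !![1, 0; -1, 1] := by
  have : (twistY : ℝ × ℝ → ℝ × ℝ) = fun p => (p.1, p.2 + (-1 : ℤ) * step p.1) := by
    funext p
    simp [twistY, sub_eq_add_neg]
  rw [this]
  exact isTwist_shearY (-1)

lemma exists_isTwist_foldl (l : List (Perm (ℝ × ℝ)))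
    (hl : ∀ f ∈ l, ∃ P : M2 ℤ, IsTwist f P ∧ ∀ i j, 0 ≤ P i j) (g : Perm (ℝ × ℝ)) (Q : M2 ℤ)
    (hg : IsTwist g (-Q)) (hQ : ∀ i j, 0 ≤ Q i j) :
    ∃ P : M2 ℤ, IsTwist (l.foldl (fun g f => g.trans f) g : Perm (ℝ × ℝ)) (-P) ∧ ∀ i j, 0 ≤ P i j := by
  induction l generalizing g Q with
  | nil => exact ⟨Q, hg, hQ⟩
  | cons f l ih =>
    obtain ⟨P, hP, hP'⟩ := hl f (by simp)
    refine ih (fun f hf => hl f (by simp [hf])) (g.trans f) (P * Q) ?_ fun i j => ?_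
    · rw [← Matrix.mul_neg]
      exact hg.comp hP
    · rw [mul_apply]
      exact Finset.sum_nonneg fun k _ => mul_nonneg (hP' _ _) (hQ _ _)

/-- The matrix of the monodromy is the negative of a nonnegative matrix. -/
lemma isTwist_monodromy {n : ℕ} (a b : Fin n → ℕ) :
    ∃ P : M2 ℤ, IsTwist (monodromy a b) (-P) ∧ ∀ i j, 0 ≤ P i j := by
  rw [monodromy, List.foldl_append]
  refine exists_isTwist_foldl _ ?_ _ 1 ?_ ?_
  · intro f hf
    rw [List.mem_flatten] at hf
    obtain ⟨s, hs, hf⟩ := hf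
    obtain ⟨i, rfl⟩ := (List.mem_ofFn' _ _).1 hs
    simp only [List.mem_cons, List.not_mem_nil, or_false] at hf
    rcases hf with rfl | rfl
    · refine ⟨_, isTwist_twistX_pow _, fun i j => ?_⟩
      fin_cases i <;> fin_cases j <;> simp
    · refine ⟨_, isTwist_twistY_inv_pow _, fun i j => ?_⟩
      fin_cases i <;> fin_cases j <;> simp
  · have h1 := (isTwist_twistX.comp isTwist_twistY)
    have h2 := ((isTwist_id.comp h1).comp h1).comp h1
    have h3 : (!![1, 0; -1, 1] * !![1, 1; 0, 1] * (!![1, 0; -1, 1] * !![1, 1; 0, 1] *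
        (!![1, 0; -1, 1] * !![1, 1; 0, 1] * 1)) : M2 ℤ) = -1 := by
      ext i j
      fin_cases i <;> fin_cases j <;> simp [mul_apply, Fin.sum_univ_two]
    rw [h3] at h2
    exact h2
  · intro i j
    fin_cases i <;> fin_cases j <;> simp

lemma IsTwist.mem_lattice_iff {h : ℝ × ℝ → ℝ × ℝ} {A : M2 ℤ} (T : IsTwist h A) (p : ℝ × ℝ) :
    h p ∈ range latticePt ↔ p ∈ range latticePt := by
  obtain ⟨m₀, hm₀⟩ := T.near
  have h0 : ∀ m, h (latticePt m) = latticePt (m₀ + mapP A m) := fun m => by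
    have := T.equiv 0 m
    rw [hm₀ 0 (by simp) (by simp), zero_add, zero_add] at this
    rw [this, latticePt_add]
  constructor
  · rintro ⟨k, hk⟩
    have hs : mapP A (mapP A.adjugate (k - m₀)) = k - m₀ := by
      rw [← mapP_mul, Matrix.mul_adjugate, T.det, one_smul, mapP_one]
    refine ⟨mapP A.adjugate (k - m₀), T.injective ?_⟩
    rw [h0, hs, ← hk]
    congr 1
    abel
  · rintro ⟨k, rfl⟩
    exact ⟨_, (h0 k).symm⟩

lemma hom_eq_zero {P : M2 ℤ} (hP : ∀ i j, 0 ≤ P i j) (hdet : P.det = 1) {r : ℤ × ℤ →+ ℤ}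
    (h : ∀ m, r (mapP (-P) m) = r m) : r = 0 := by
  have hr : ∀ m : ℤ × ℤ, r m = m.1 * r (1, 0) + m.2 * r (0, 1) := fun m => by
    have : m = m.1 • ((1, 0) : ℤ × ℤ) + m.2 • ((0, 1) : ℤ × ℤ) := by ext <;> simp
    conv_lhs => rw [this]
    rw [map_add, map_zsmul, map_zsmul, smul_eq_mul, smul_eq_mul]
  have h1 := h (1, 0)
  have h2 := h (0, 1)
  rw [hr, hr (1, 0)] at h1
  rw [hr, hr (0, 1)] at h2
  simp only [mapP, Matrix.neg_apply, mul_one, mul_zero, add_zero, zero_add] at h1 h2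
  rw [Matrix.det_fin_two] at hdet
  have h00 := hP 0 0
  have h11 := hP 1 1
  have hD : 2 + P 0 0 + P 1 1 ≠ 0 := by omega
  have e1 : (2 + P 0 0 + P 1 1) * r (1, 0) = 0 := by
    linear_combination (-(1 + P 1 1)) * h1 + P 1 0 * h2 - r (1, 0) * hdet
  have e2 : (2 + P 0 0 + P 1 1) * r (0, 1) = 0 := by
    linear_combination (-(1 + P 0 0)) * h2 + P 0 1 * h1 - r (0, 1) * hdet
  have e3 := (mul_eq_zero.1 e1).resolve_left hD
  have e4 := (mul_eq_zero.1 e2).resolve_left hD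
  refine AddMonoidHom.ext fun m => ?_
  rw [hr, e3, e4]
  simp

/-! ### Functions on open books -/

lemma exists_glue {Y V₁ V₂ α : Type*} [TopologicalSpace Y] [TopologicalSpace V₁]
    [TopologicalSpace V₂] [TopologicalSpace α] {φ₁ : V₁ → Y} {φ₂ : V₂ → Y} {U₁ : Set V₁}
    {U₂ : Set V₂} (hφ₁ : ∀ x ∈ U₁, Filter.map φ₁ (𝓝 x) = 𝓝 (φ₁ x))
    (hφ₂ : ∀ x ∈ U₂, Filter.map φ₂ (𝓝 x) = 𝓝 (φ₂ x)) (hU₁ : IsOpen U₁) (hU₂ : IsOpen U₂)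
    {f₁ : V₁ → α} {f₂ : V₂ → α} (hf₁ : ContinuousOn f₁ U₁) (hf₂ : ContinuousOn f₂ U₂)
    (h11 : ∀ x ∈ U₁, ∀ x' ∈ U₁, φ₁ x = φ₁ x' → f₁ x = f₁ x')
    (h22 : ∀ x ∈ U₂, ∀ x' ∈ U₂, φ₂ x = φ₂ x' → f₂ x = f₂ x')
    (h12 : ∀ x ∈ U₁, ∀ x' ∈ U₂, φ₁ x = φ₂ x' → f₁ x = f₂ x')
    (hcov : ∀ y, (∃ x ∈ U₁, φ₁ x = y) ∨ ∃ x ∈ U₂, φ₂ x = y) :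
    ∃ f : Y → α, Continuous f ∧ (∀ x ∈ U₁, f (φ₁ x) = f₁ x) ∧ ∀ x ∈ U₂, f (φ₂ x) = f₂ x := by
  have key : ∀ y, ∃ a, (∀ x ∈ U₁, φ₁ x = y → f₁ x = a) ∧ ∀ x ∈ U₂, φ₂ x = y → f₂ x = a := by
    intro y
    rcases hcov y with ⟨x, hx, rfl⟩ | ⟨x, hx, rfl⟩
    · exact ⟨f₁ x, fun x' hx' h => h11 _ hx' _ hx h, fun x' hx' h => (h12 x hx x' hx' h.symm).symm⟩
    · exact ⟨f₂ x, fun x' hx' h => h12 _ hx' _ hx h, fun x' hx' h => h22 _ hx' _ hx h⟩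
  choose f hf hf' using key
  have e1 : ∀ x ∈ U₁, f (φ₁ x) = f₁ x := fun x hx => (hf _ x hx rfl).symm
  have e2 : ∀ x ∈ U₂, f (φ₂ x) = f₂ x := fun x hx => (hf' _ x hx rfl).symm
  refine ⟨f, continuous_iff_continuousAt.2 fun y => ?_, e1, e2⟩
  rcases hcov y with ⟨x, hx, rfl⟩ | ⟨x, hx, rfl⟩
  · rw [ContinuousAt, ← hφ₁ x hx, Filter.tendsto_map'_iff, e1 x hx]
    refine ((hf₁.continuousAt (hU₁.mem_nhds hx)).tendsto).congr' ?_
    filter_upwards [hU₁.mem_nhds hx] with z hz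
    exact (e1 z hz).symm
  · rw [ContinuousAt, ← hφ₂ x hx, Filter.tendsto_map'_iff, e2 x hx]
    refine ((hf₂.continuousAt (hU₂.mem_nhds hx)).tendsto).congr' ?_
    filter_upwards [hU₂.mem_nhds hx] with z hz
    exact (e2 z hz).symm

/-- The standard frame of the domain of `OpenBook.tor`. -/
def torVec : Fin 3 → (ℝ × ℝ) × ℝ := ![((1, 0), 0), ((0, 1), 0), ((0, 0), 1)]

/-- The standard frame of the domain of `OpenBook.nbhd`. -/
def nbhdVec : Fin 3 → ℝ × ℂ := ![(1, 0), (0, 1), (0, I)]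

def nbhdDom : Set (ℝ × ℂ) := {x | ‖x.2‖ < 1}

lemma isOpen_nbhdDom : IsOpen nbhdDom := isOpen_lt (by fun_prop) continuous_const

lemma convex_nbhdDom : Convex ℝ nbhdDom := by
  have : nbhdDom = (LinearMap.snd ℝ ℝ ℂ) ⁻¹' Metric.ball 0 1 := by
    ext x; simp [nbhdDom]
  rw [this]
  exact (convex_ball _ _).linear_preimage _

namespace OpenBook

lemma isParam_tor (B : OpenBook h o) : IsParam o B.tor punct torVec :=
  ⟨isOpen_punct, B.tor_smooth, B.tor_pos⟩

lemma isParam_nbhd (B : OpenBook h o) : IsParam o B.nbhd nbhdDom nbhdVec :=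
  ⟨isOpen_nbhdDom, B.nbhd_smooth, B.nbhd_pos⟩

lemma tor_add_lattice (B : OpenBook h o) {x : (ℝ × ℝ) × ℝ} (hx : x ∈ punct) (m : ℤ × ℤ) :
    B.tor (x.1 + latticePt m, x.2) = B.tor x := by
  refine ((B.tor_eq_iff x.1 hx (x.1 + latticePt m) (fun hm => hx (add_latticePt_mem.1 hm))
    x.2 x.2).2 ⟨0, m, by simp, by simp⟩).symm

lemma tor_add_one (B : OpenBook h o) {A : M2 ℤ} (T : IsTwist h A) {x : (ℝ × ℝ) × ℝ}
    (hx : x ∈ punct) : B.tor (x.1, x.2 + 1) = B.tor (h x.1, x.2) :=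
  (B.tor_eq_iff x.1 hx (h x.1) (fun hm => hx ((T.mem_lattice_iff _).1 hm))
    (x.2 + 1) x.2).2 ⟨1, 0, by simp, by simp [latticePt_zero]⟩

lemma _root_.SpinSurgery.IsTwist.zpow_mem_lattice_iff {A : M2 ℤ} (T : IsTwist h A) (k : ℤ) (p : ℝ × ℝ) :
    (h ^ k) p ∈ range latticePt ↔ p ∈ range latticePt := by
  induction k generalizing p with
  | zero => simp
  | succ k ih => rw [zpow_add_one, Perm.mul_apply, ih, T.mem_lattice_iff]
  | pred k ih =>
    rw [zpow_sub_one, Perm.mul_apply, ih, ← T.mem_lattice_iff]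
    simp

lemma tor_zpow (B : OpenBook h o) {A : M2 ℤ} (T : IsTwist h A) {p : ℝ × ℝ}
    (hp : p ∉ range latticePt) (t : ℝ) (k : ℤ) : B.tor (p, t + k) = B.tor ((h ^ k) p, t) :=
  (B.tor_eq_iff p hp ((h ^ k) p) (fun hm => hp ((T.zpow_mem_lattice_iff k p).1 hm)) _ _).2
    ⟨k, 0, rfl, by simp [latticePt_zero]⟩

lemma tor_congr (B : OpenBook h o) {A : M2 ℤ} (T : IsTwist h A) {α : Type*}
    {F : (ℝ × ℝ) × ℝ → α} (h1 : ∀ x ∈ punct, ∀ m, F (x.1 + latticePt m, x.2) = F x)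
    (h2 : ∀ x ∈ punct, F (x.1, x.2 + 1) = F (h x.1, x.2)) {x x' : (ℝ × ℝ) × ℝ} (hx : x ∈ punct)
    (hx' : x' ∈ punct) (he : B.tor x = B.tor x') : F x = F x' := by
  obtain ⟨k, m, ht, hp⟩ := (B.tor_eq_iff x.1 hx x'.1 hx' x.2 x'.2).1 he
  have key : ∀ (k : ℤ) (p : ℝ × ℝ) (t : ℝ), p ∉ range latticePt →
      F (p, t + k) = F ((h ^ k) p, t) := by
    intro k
    induction k with
    | zero => simp
    | succ k ih =>
      intro p t hp
      have e1 := h2 (p, t + k) hp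
      have e2 := ih (h p) t (fun hm => hp ((T.mem_lattice_iff p).1 hm))
      rw [zpow_add_one, Perm.mul_apply]
      simp only at e1 e2
      rw [← e2]
      push_cast
      rw [← add_assoc]
      exact e1
    | pred k ih =>
      intro p t hp
      have hq : h⁻¹ p ∉ range latticePt := fun hm => hp (by
        rw [← T.mem_lattice_iff] at hm
        simpa using hm)
      have e1 := h2 (h⁻¹ p, t + (-(k : ℤ) : ℤ) - 1) hq
      have e2 := ih (h⁻¹ p) t hq
      rw [zpow_sub_one, Perm.mul_apply, ← e2]
      have hh : h (h⁻¹ p) = p := by simp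
      simp only [hh] at e1
      rw [sub_add_cancel] at e1
      rw [e1]
      push_cast
      rw [add_sub_assoc]
  have e1 := h1 ((h ^ k) x.1, x'.2) (fun hm => hx ((T.zpow_mem_lattice_iff k _).1 hm)) m
  have e2 := key k x.1 x'.2 hx
  rw [← ht] at e2
  have e3 : F x = F ((h ^ k) x.1, x'.2) := e2
  rw [e3, ← e1]
  simp only [← hp]

/-- The point of the punctured plane with polar coordinates `r / 4`, `-u`. -/
def polarPt (u r : ℝ) : ℝ × ℝ := (r / 4 * cos u, -(r / 4 * sin u))

lemma tor_polarPt (B : OpenBook h o) {u r : ℝ} (hr : 0 < r) (hr' : r < 1) (t : ℝ)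
    (hp : polarPt u r ∉ range latticePt) :
    B.tor (polarPt u r, t) = B.nbhd (u, r * exp (τ * t * I)) := by
  have hn : ‖(r * exp (τ * t * I) : ℂ)‖ = r := by
    rw [norm_mul, norm_real, Real.norm_of_nonneg hr.le]
    have := norm_exp_ofReal_mul_I (τ * t)
    push_cast at this
    rw [this, mul_one]
  refine (B.glue _ hp t u _ (by rwa [hn])).2 ⟨?_, by rw [hn], 0, ?_⟩
  · rw [← norm_pos_iff, hn]; exact hr
  · rw [hn, latticePt_zero, zero_add]; rfl

lemma _root_.SpinSurgery.polarPt_not_mem {u r : ℝ} (hr : 0 < r) (hr' : r < 4) :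
    polarPt u r ∉ range latticePt := by
  intro hm
  obtain ⟨⟨i, hi⟩, ⟨j, hj⟩⟩ := mem_lattice_iff.1 hm
  simp only [polarPt] at hi hj
  have h1 : ((i : ℝ)) ^ 2 + (j : ℝ) ^ 2 = (r / 4) ^ 2 := by
    rw [hi, hj]
    linear_combination (r / 4) ^ 2 * sin_sq_add_cos_sq u
  have h2 : ((i ^ 2 + j ^ 2 : ℤ) : ℝ) = (r / 4) ^ 2 := by push_cast; exact h1
  have h3 : (0 : ℝ) < ((i ^ 2 + j ^ 2 : ℤ) : ℝ) := by rw [h2]; positivity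
  have h4 : ((i ^ 2 + j ^ 2 : ℤ) : ℝ) < 1 := by rw [h2]; nlinarith
  norm_cast at h3 h4
  omega

lemma eq_polar_of_tor_eq_nbhd (B : OpenBook h o) {p : ℝ × ℝ} (hp : p ∉ range latticePt)
    {t u : ℝ} {z : ℂ} (hz : ‖z‖ < 1) (he : B.tor (p, t) = B.nbhd (u, z)) :
    0 < ‖z‖ ∧ z = ‖z‖ * exp (τ * t * I) ∧ ∃ m : ℤ × ℤ, p = polarPt u ‖z‖ + latticePt m := by
  obtain ⟨h1, h2, m, hm⟩ := (B.glue p hp t u z hz).1 he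
  exact ⟨norm_pos_iff.2 h1, h2, m, by rw [hm, add_comm]; rfl⟩

/-- Nonvanishing functions on an open book whose monodromy acts without fixed vectors on the
cohomology of the page have logarithms. -/
lemma exists_log (B : OpenBook h o) {P : M2 ℤ} (T : IsTwist h (-P)) (hP : ∀ i j, 0 ≤ P i j)
    (g : Y → ℂ) (hg : Continuous g) (hg0 : ∀ y, g y ≠ 0) :
    ∃ l : Y → ℂ, Continuous l ∧ ∀ y, exp (l y) = g y := by
  have hdet : P.det = 1 := by
    have := T.det
    rw [Matrix.det_neg] at this
    simpa using this
  obtain ⟨m₀, hm₀⟩ := T.near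
  have htc : ContinuousOn B.tor punct := B.tor_smooth.continuousOn
  have hnc : ContinuousOn B.nbhd nbhdDom := B.nbhd_smooth.continuousOn
  obtain ⟨L, hL, hLe, r, hr⟩ := exists_log_periodic (G := fun x => g (B.tor x))
    (hg.comp_continuousOn htc) (fun x _ => hg0 _) fun x hx m => by rw [B.tor_add_lattice hx]
  have hshift : ∀ x ∈ punct, ((x.1, x.2 + 1) : (ℝ × ℝ) × ℝ) ∈ punct := fun x hx => hx
  have hact : ∀ x ∈ punct, ((h x.1, x.2) : (ℝ × ℝ) × ℝ) ∈ punct := fun x hx hm =>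
    hx ((T.mem_lattice_iff _).1 hm)
  have hlat : ∀ x ∈ punct, ∀ m, ((x.1 + latticePt m, x.2) : (ℝ × ℝ) × ℝ) ∈ punct :=
    fun x hx m hm => hx (add_latticePt_mem.1 hm)
  have hhc : Continuous h := T.smooth.continuous
  obtain ⟨κ, hκ⟩ := exists_int_of_exp_eq isPreconnected_punct
    (l := fun x => L (x.1, x.2 + 1)) (l' := fun x => L (h x.1, x.2))
    (hL.comp (by fun_prop) hshift) (hL.comp (by fun_prop) hact) fun x hx => by
      rw [hLe _ (hshift x hx), hLe _ (hact x hx), B.tor_add_one T hx]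
  have hpol : ∀ {u r : ℝ}, 0 < r → r < 1 → ∀ t : ℝ, ((polarPt u r, t) : (ℝ × ℝ) × ℝ) ∈ punct :=
    fun hr hr' t => polarPt_not_mem hr (by linarith)
  have hx₀ : ((polarPt 0 (1 / 2), 0) : (ℝ × ℝ) × ℝ) ∈ punct := hpol (by norm_num) (by norm_num) _
  have hr0 : r = 0 := by
    refine hom_eq_zero hP hdet fun m => ?_
    have e1 := hκ _ (hlat _ hx₀ m)
    have e2 := hr _ (hshift _ hx₀) m
    have e3 := hr _ (hact _ hx₀) (mapP (-P) m)
    have e4 := hκ _ hx₀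
    simp only at e1 e2 e3 e4
    rw [T.equiv] at e1
    rw [e3, e2, e4] at e1
    have h1 : (r (mapP (-P) m) : ℂ) * tpi = r m * tpi := by linear_combination -e1
    exact_mod_cast mul_right_cancel₀ tpi_ne_zero h1
  have hLper : ∀ x ∈ punct, ∀ m, L (x.1 + latticePt m, x.2) = L x := fun x hx m => by
    rw [hr x hx m, hr0]; simp
  have hgn : ContinuousOn (fun x => g (B.nbhd x)) nbhdDom := hg.comp_continuousOn hnc
  obtain ⟨Ln, hLn, hLne⟩ := exists_log_of_convex convex_nbhdDom isOpen_nbhdDom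
    ⟨(0, 0), by simp [nbhdDom]⟩ hgn fun x _ => hg0 _
  let D : Set ((ℝ × ℝ) × ℝ) := {x | x.1.2 ∈ Set.Ioo 0 1}
  have hD : IsPreconnected D := by
    have : Convex ℝ D := (convex_Ioo (0 : ℝ) 1).linear_preimage
      ((LinearMap.snd ℝ ℝ ℝ).comp (LinearMap.fst ℝ (ℝ × ℝ) ℝ))
    exact this.isPreconnected
  have hdom : ∀ x ∈ D, ((x.1.1, x.1.2 * exp (τ * x.2 * I)) : ℝ × ℂ) ∈
      nbhdDom := fun x hx => by
    have := norm_exp_ofReal_mul_I (τ * x.2)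
    push_cast at this
    simp only [nbhdDom, Set.mem_ofPred_eq]
    rw [norm_mul, this, mul_one, norm_real, Real.norm_of_nonneg hx.1.le]
    exact hx.2
  have hc1 : ContinuousOn (fun x : (ℝ × ℝ) × ℝ => L (polarPt x.1.1 x.1.2, x.2)) D := by
    refine hL.comp (Continuous.continuousOn ?_) fun x hx => hpol hx.1 hx.2 _
    simp only [polarPt]
    fun_prop
  obtain ⟨n, hn⟩ := exists_int_of_exp_eq hD (l := fun x => L (polarPt x.1.1 x.1.2, x.2))
    (l' := fun x => Ln (x.1.1, x.1.2 * exp (τ * x.2 * I))) hc1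
    (hLn.comp (by fun_prop) hdom) fun x hx => by
      rw [hLe _ (hpol hx.1 hx.2 _), hLne _ (hdom x hx), B.tor_polarPt hx.1 hx.2 _
        (hpol hx.1 hx.2 0)]
  have hκ0 : (κ : ℂ) * tpi = 0 := by
    have e1 := hκ _ hx₀
    have e2 := hn ((0, 1 / 2), 0) ⟨by norm_num, by norm_num⟩
    have e3 := hn ((0, 1 / 2), 0 + 1) ⟨by norm_num, by norm_num⟩
    have e4 : h (polarPt 0 (1 / 2)) = polarPt 0 (1 / 2) + latticePt m₀ :=
      hm₀ _ (by norm_num [polarPt, abs_of_nonneg]) (by norm_num [polarPt])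
    have e5 := hLper _ hx₀ m₀
    have e6 : exp (τ * ((0 + 1 : ℝ) : ℂ) * I) = exp (τ * ((0 : ℝ) : ℂ) * I) := by
      push_cast
      rw [zero_add, mul_one, mul_zero, zero_mul, Complex.exp_two_pi_mul_I, Complex.exp_zero]
    simp only at e1 e2 e3 e5
    rw [e4, e5] at e1
    rw [e6, ← e2] at e3
    rw [e3] at e1
    linear_combination -e1
  have hLh : ∀ x ∈ punct, L (x.1, x.2 + 1) = L (h x.1, x.2) := fun x hx => by
    have := hκ x hx
    rw [this, hκ0, add_zero]
  have h12 : ∀ x ∈ punct, ∀ x' ∈ nbhdDom, B.tor x = B.nbhd x' → L x = Ln x' + n * tpi := by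
    rintro ⟨p, t⟩ hx ⟨u, z⟩ hx' he
    obtain ⟨h1, h2, m, h3⟩ := B.eq_polar_of_tor_eq_nbhd hx hx' he
    have e1 := hLper (polarPt u ‖z‖, t) (hpol h1 hx' t) m
    subst h3
    refine e1.trans ?_
    have e2 := hn ((u, ‖z‖), t) ⟨h1, hx'⟩
    simp only at e2
    rw [e2, ← h2]
  obtain ⟨l, hl, hl1, hl2⟩ := exists_glue (φ₁ := B.tor) (φ₂ := B.nbhd) (U₁ := punct) (U₂ := nbhdDom)
    (fun x hx => B.isParam_tor.map_nhds hx) (fun x hx => B.isParam_nbhd.map_nhds hx)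
    isOpen_punct isOpen_nbhdDom hL (hLn.add (continuousOn_const (c := (n : ℂ) * tpi)))
    (fun x hx x' hx' he => B.tor_congr T hLper hLh hx hx' he) (by
      have hpm : ∀ m : ℤ, ∀ x ∈ nbhdDom, Ln (x.1 + τ * m, x.2) = Ln x := by
        intro m
        obtain ⟨j, hj⟩ := exists_int_of_exp_eq convex_nbhdDom.isPreconnected
          (l := fun x => Ln (x.1 + τ * m, x.2)) (l' := Ln)
          (hLn.comp (by fun_prop) fun x hx => hx) hLn fun x hx => by
            have hx2 : ((x.1 + τ * m, x.2) : ℝ × ℂ) ∈ nbhdDom := hx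
            rw [hLne _ hx2, hLne _ hx, (B.nbhd_eq_iff (x.1 + τ * m, x.2) x hx hx).2 ⟨rfl, m, rfl⟩]
        have e1 := hj (0, ((1 / 2 : ℝ) : ℂ) * exp (τ * (0 : ℝ) * I))
          (hdom ((0, 1 / 2), 0) ⟨by norm_num, by norm_num⟩)
        have e2 := hn ((0, 1 / 2), 0) ⟨by norm_num, by norm_num⟩
        have e3 := hn ((0 + τ * m, 1 / 2), 0) ⟨by norm_num, by norm_num⟩
        have e4 : polarPt (0 + τ * m) (1 / 2) = polarPt 0 (1 / 2) := by
          have h1 := Real.cos_add_int_mul_two_pi 0 m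
          have h2 := Real.sin_add_int_mul_two_pi 0 m
          rw [polarPt, polarPt, mul_comm τ (m : ℝ), h1, h2]
        simp only at e1 e2 e3
        rw [e4, e2, e1] at e3
        have hj0 : (j : ℂ) * tpi = 0 := by linear_combination -e3
        intro x hx
        have := hj x hx
        rw [this, hj0, add_zero]
      rintro ⟨u, z⟩ hx ⟨u', z'⟩ hx' he
      obtain ⟨h1, m, h2⟩ := (B.nbhd_eq_iff _ _ hx hx').1 he
      simp only at h1 h2
      subst h1 h2
      have := hpm m _ hx'
      exact congrArg (· + (n : ℂ) * tpi) this)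
    h12 B.cover
  refine ⟨l, hl, fun y => ?_⟩
  rcases B.cover y with ⟨x, hx, rfl⟩ | ⟨x, hx, rfl⟩
  · rw [hl1 x hx, hLe x hx]
  · rw [hl2 x hx]
    refine (Complex.exp_periodic.int_mul n (Ln x)).trans (hLne x hx)

end OpenBook

/-! ### Tangent vectors given by parametrizations -/

section TangentVectors

def tv (φ : V → Y) (x v : V) : TangentBundle (𝓡 3) Y := ⟨φ x, mfderiv 𝓘(ℝ, V) (𝓡 3) φ x v⟩

lemma tv_comp {φ₁ : V' → Y} {φ : V → Y} {ι : V' → V} {ι' : V' →L[ℝ] V} {x : V'}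
    (h : φ₁ =ᶠ[𝓝 x] φ ∘ ι) (hφ : MDifferentiableAt 𝓘(ℝ, V) (𝓡 3) φ (ι x))
    (hι : HasFDerivAt ι ι' x) (v : V') : tv φ₁ x v = tv φ (ι x) (ι' v) := by
  refine totalSpace_ext h.self_of_nhds ?_
  have h1 := congrArg (fun L : V' →L[ℝ] E 3 => L v)
    (Filter.EventuallyEq.mfderiv_eq (I := 𝓘(ℝ, V')) (I' := 𝓡 3) h)
  refine h1.trans ?_
  rw [mfderiv_comp x hφ hι.differentiableAt.mdifferentiableAt, mfderiv_eq_fderiv, hι.fderiv]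
  rfl

lemma extd_congr (lam : ∀ y : Y, 𝕋 y →L[ℝ] ℝ) {y y' : Y}
    {u v : 𝕋 y} {u' v' : 𝕋 y'}
    (hu : (⟨y, u⟩ : TangentBundle (𝓡 3) Y) = ⟨y', u'⟩)
    (hv : (⟨y, v⟩ : TangentBundle (𝓡 3) Y) = ⟨y', v'⟩) : extd lam y u v = extd lam y' u' v' := by
  have hy : y = y' := congrArg Bundle.TotalSpace.proj hu
  subst hy
  rw [Bundle.TotalSpace.mk.injEq] at hu hv
  rw [eq_of_heq hu.2, eq_of_heq hv.2]

def pullExtd (lam : ∀ y : Y, 𝕋 y →L[ℝ] ℝ) (φ : V → Y) (x ξ η : V) : ℝ :=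
  extd lam (φ x) (mfderiv 𝓘(ℝ, V) (𝓡 3) φ x ξ) (mfderiv 𝓘(ℝ, V) (𝓡 3) φ x η)

variable {φ : V → Y} {x ξ ξ' η : V} {c : ℝ}

lemma pullExtd_add_left :
    pullExtd lam φ x (ξ + ξ') η = pullExtd lam φ x ξ η + pullExtd lam φ x ξ' η := by
  rw [pullExtd, pullExtd, pullExtd, ← extd_add_left]
  congr 1
  exact map_add (show V →L[ℝ] E 3 from mfderiv 𝓘(ℝ, V) (𝓡 3) φ x) ξ ξ'

lemma pullExtd_smul_left : pullExtd lam φ x (c • ξ) η = c * pullExtd lam φ x ξ η := by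
  rw [pullExtd, pullExtd, ← extd_smul_left]
  congr 1
  exact map_smul (show V →L[ℝ] E 3 from mfderiv 𝓘(ℝ, V) (𝓡 3) φ x) c ξ

lemma pullExtd_swap : pullExtd lam φ x ξ η = -pullExtd lam φ x η ξ := extd_swap _ _

lemma pullExtd_self : pullExtd lam φ x ξ ξ = 0 := extd_self _

lemma pullExtd_add_right :
    pullExtd lam φ x η (ξ + ξ') = pullExtd lam φ x η ξ + pullExtd lam φ x η ξ' := by
  rw [pullExtd_swap, pullExtd_add_left, pullExtd_swap (ξ := ξ), pullExtd_swap (ξ := ξ')]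
  ring

lemma pullExtd_smul_right : pullExtd lam φ x η (c • ξ) = c * pullExtd lam φ x η ξ := by
  rw [pullExtd_swap, pullExtd_smul_left, pullExtd_swap (ξ := ξ)]
  ring

lemma continuousAt_pullExtd (hs : IsSmoothForm lam)
    {g u v : X → V} {x₀ : X} (h : ContMDiffAt 𝓘(ℝ, V) (𝓡 3) ∞ φ (g x₀)) (hg : ContinuousAt g x₀)
    (hu : ContinuousAt u x₀) (hv : ContinuousAt v x₀) :
    ContinuousAt (fun x => pullExtd lam φ (g x) (u x) (v x)) x₀ :=
  continuousAt_extd (b := fun x => φ (g x)) hs (continuousAt_mfderiv_vec h hg hu)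
    (continuousAt_mfderiv_vec h hg hv)

end TangentVectors

namespace OpenBook

lemma tor_translate (B : OpenBook h o) {x : (ℝ × ℝ) × ℝ} (hx : x ∈ punct) (m : ℤ × ℤ)
    (v : (ℝ × ℝ) × ℝ) : tv B.tor x v = tv B.tor (x.1 + latticePt m, x.2) v := by
  have hm : ((x.1 + latticePt m, x.2) : (ℝ × ℝ) × ℝ) ∈ punct :=
    fun hm => hx (add_latticePt_mem.1 hm)
  have hd : HasFDerivAt (fun x : (ℝ × ℝ) × ℝ => (x.1 + latticePt m, x.2))
      (ContinuousLinearMap.id ℝ _) x := by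
    have h1 := (hasFDerivAt_id (𝕜 := ℝ) x).add_const ((latticePt m, 0) : (ℝ × ℝ) × ℝ)
    refine h1.congr_of_eventuallyEq (.of_forall fun z => ?_)
    ext <;> simp
  refine tv_comp (ι := fun x : (ℝ × ℝ) × ℝ => (x.1 + latticePt m, x.2)) ?_
    (B.isParam_tor.mdifferentiableAt hm) hd v
  filter_upwards [isOpen_punct.mem_nhds hx] with z hz
  exact (B.tor_add_lattice hz m).symm

lemma tor_monodromy (B : OpenBook h o) {A : M2 ℤ} (T : IsTwist h A) {p : ℝ × ℝ} {t : ℝ}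
    (hp : p ∉ range latticePt) (v : ℝ × ℝ) (c : ℝ) :
    tv B.tor (p, t + 1) (v, c) = tv B.tor (h p, t) (fderiv ℝ h p v, c) := by
  have hm : ((h p, t) : (ℝ × ℝ) × ℝ) ∈ punct := fun hm => hp ((T.mem_lattice_iff _).1 hm)
  have hd : HasFDerivAt (fun x : (ℝ × ℝ) × ℝ => (h x.1, x.2 - 1))
      ((fderiv ℝ h p).prodMap (ContinuousLinearMap.id ℝ ℝ)) (p, t + 1) := by
    have h1 : HasFDerivAt h (fderiv ℝ h p) p :=
      (T.smooth.differentiable (by simp) p).hasFDerivAt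
    have h2 : HasFDerivAt (fun t : ℝ => t - 1) (ContinuousLinearMap.id ℝ ℝ) (t + 1) :=
      (hasFDerivAt_id (t + 1)).sub_const 1
    exact HasFDerivAt.prodMap (p, t + 1) h1 h2
  have key := tv_comp (φ₁ := B.tor) (φ := B.tor) (ι := fun x : (ℝ × ℝ) × ℝ => (h x.1, x.2 - 1))
    (x := (p, t + 1)) ?_ ?_ hd (v, c)
  · rw [key]
    simp only [add_sub_cancel_right]
    rfl
  · filter_upwards [isOpen_punct.mem_nhds (show ((p, t + 1) : (ℝ × ℝ) × ℝ) ∈ punct from hp)]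
      with z hz
    have := B.tor_add_one T (x := (z.1, z.2 - 1)) hz
    simp only [sub_add_cancel] at this
    exact this
  · simp only [add_sub_cancel_right]
    exact B.isParam_tor.mdifferentiableAt hm

lemma nbhd_translate (B : OpenBook h o) {x : ℝ × ℂ} (hx : x ∈ nbhdDom) (m : ℤ)
    (v : ℝ × ℂ) : tv B.nbhd x v = tv B.nbhd (x.1 + τ * m, x.2) v := by
  have hd : HasFDerivAt (fun x : ℝ × ℂ => (x.1 + τ * m, x.2))
      (ContinuousLinearMap.id ℝ _) x := by
    have h1 := (hasFDerivAt_id (𝕜 := ℝ) x).add_const ((τ * m, 0) : ℝ × ℂ)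
    refine h1.congr_of_eventuallyEq (.of_forall fun z => ?_)
    ext <;> simp
  refine tv_comp (ι := fun x : ℝ × ℂ => (x.1 + τ * m, x.2)) ?_
    (B.isParam_nbhd.mdifferentiableAt (x := (x.1 + τ * m, x.2)) hx) hd v
  filter_upwards [isOpen_nbhdDom.mem_nhds hx] with z hz
  exact ((B.nbhd_eq_iff (z.1 + τ * m, z.2) z hz hz).2 ⟨rfl, m, rfl⟩).symm

lemma tor_eq_nbhd (B : OpenBook h o) {u r t : ℝ} (hr : 0 < r) (hr' : r < 1) (a b c : ℝ) :
    tv B.tor (polarPt u r, t)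
      ((-(r / 4 * sin u) * a + cos u / 4 * b, -(r / 4 * cos u) * a - sin u / 4 * b), c) =
    tv B.nbhd (u, r * exp (τ * t * I))
      (a, (b + τ * c * r * I) * exp (τ * t * I)) := by
  let Γ : (ℝ × ℝ) × ℝ → (ℝ × ℝ) × ℝ := fun x => (polarPt x.1.1 x.1.2, x.2)
  let Γ' : (ℝ × ℝ) × ℝ → ℝ × ℂ := fun x =>
    (x.1.1, x.1.2 * exp (τ * x.2 * I))
  let π1 : (ℝ × ℝ) × ℝ →L[ℝ] ℝ := (ContinuousLinearMap.fst ℝ ℝ ℝ).comp (ContinuousLinearMap.fst ℝ (ℝ × ℝ) ℝ)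
  let π2 : (ℝ × ℝ) × ℝ →L[ℝ] ℝ := (ContinuousLinearMap.snd ℝ ℝ ℝ).comp (ContinuousLinearMap.fst ℝ (ℝ × ℝ) ℝ)
  let π3 : (ℝ × ℝ) × ℝ →L[ℝ] ℝ := ContinuousLinearMap.snd ℝ (ℝ × ℝ) ℝ
  set x₀ : (ℝ × ℝ) × ℝ := ((u, r), t) with hx₀
  have d1 : HasFDerivAt (fun x : (ℝ × ℝ) × ℝ => x.1.1) π1 x₀ := π1.hasFDerivAt
  have d2 : HasFDerivAt (fun x : (ℝ × ℝ) × ℝ => x.1.2) π2 x₀ := π2.hasFDerivAt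
  have d3 : HasFDerivAt (fun x : (ℝ × ℝ) × ℝ => x.2) π3 x₀ := π3.hasFDerivAt
  have dΓ := ((((d2.mul_const (4⁻¹ : ℝ)).mul d1.cos).prodMk
    ((d2.mul_const (4⁻¹ : ℝ)).mul d1.sin).neg).prodMk d3)
  have dexp : HasFDerivAt (fun x : (ℝ × ℝ) × ℝ => exp (τ * x.2 * I))
      (exp (τ * t * I) • ((τ * I : ℂ) • (Complex.ofRealCLM.comp π3))) x₀ := by
    have h1 : HasFDerivAt (fun x : (ℝ × ℝ) × ℝ => (τ * x.2 * I : ℂ))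
      ((τ * I : ℂ) • (Complex.ofRealCLM.comp π3)) x₀ := by
      have h2 := (Complex.ofRealCLM.hasFDerivAt.comp x₀ d3).const_mul (τ * I : ℂ)
      refine h2.congr_of_eventuallyEq (.of_forall fun z => ?_)
      simp only [Function.comp_apply, Complex.ofRealCLM_apply]
      ring
    exact h1.cexp
  have dΓ' : HasFDerivAt Γ' _ x₀ := d1.prodMk ((Complex.ofRealCLM.hasFDerivAt.comp x₀ d2).mul dexp)
  have dΓ2 : HasFDerivAt Γ _ x₀ := dΓ.congr_of_eventuallyEq
    (.of_forall fun z => by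
      ext <;> simp [Γ, polarPt, div_eq_mul_inv])
  have hdom : Γ' x₀ ∈ nbhdDom := by
    have := norm_exp_ofReal_mul_I (τ * t)
    push_cast at this
    simp only [nbhdDom, Γ', x₀, Set.mem_ofPred_eq]
    rw [norm_mul, this, mul_one, norm_real, Real.norm_of_nonneg hr.le]
    exact hr'
  have hpun : Γ x₀ ∈ punct := polarPt_not_mem hr (by linarith)
  have hev : (B.tor ∘ Γ) =ᶠ[𝓝 x₀] B.nbhd ∘ Γ' := by
    have : {x : (ℝ × ℝ) × ℝ | 0 < x.1.2 ∧ x.1.2 < 1} ∈ 𝓝 x₀ :=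
      (isOpen_Ioo.preimage (f := fun x : (ℝ × ℝ) × ℝ => x.1.2) (by fun_prop)).mem_nhds ⟨hr, hr'⟩
    filter_upwards [this] with z hz
    exact B.tor_polarPt hz.1 hz.2 _ (polarPt_not_mem hz.1 (by linarith [hz.2]))
  have e1 := tv_comp (v := ((a, b), c)) (Filter.EventuallyEq.refl (𝓝 x₀) (B.tor ∘ Γ))
    (B.isParam_tor.mdifferentiableAt hpun) dΓ2
  have e2 := tv_comp (v := ((a, b), c)) hev (B.isParam_nbhd.mdifferentiableAt hdom) dΓ'
  rw [e1] at e2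
  have e3 : ((-(r / 4 * sin u) * a + cos u / 4 * b, -(r / 4 * cos u) * a - sin u / 4 * b), c) =
        ((((r * 4⁻¹) • -sin u • π1 + cos u • (4⁻¹ : ℝ) • π2).prod
          (-((r * 4⁻¹) • cos u • π1 + sin u • (4⁻¹ : ℝ) • π2))).prod π3) ((a, b), c) := by
    simp only [π1, π2, π3]
    ext <;> simp <;> ring
  rw [e3]
  refine Eq.trans ?_ (e2.trans ?_)
  · rfl
  · congr 1
    simp only [π1, π2, π3]
    ext <;> simp [x₀] <;> ring

end OpenBook

/-! ### The differential of an adapted contact form near the binding -/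

lemma norm_mul_exp {r : ℝ} (hr : 0 ≤ r) (t : ℝ) :
    ‖(r * exp (τ * t * I) : ℂ)‖ = r := by
  have := norm_exp_ofReal_mul_I (τ * t)
  push_cast at this
  rw [norm_mul, this, mul_one, norm_real, Real.norm_of_nonneg hr]

lemma exists_eq_mul_exp (z : ℂ) :
    ∃ t : ℝ, z = ‖z‖ * exp (τ * t * I) := by
  refine ⟨z.arg / τ, ?_⟩
  conv_lhs => rw [← Complex.norm_mul_exp_arg_mul_I z]
  congr 2
  have : (π : ℂ) ≠ 0 := by exact_mod_cast Real.pi_ne_zero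
  push_cast
  field_simp

namespace OpenBook

lemma pullExtd_tor_pos (B : OpenBook h o) (hs : B.Supports lam) {x : (ℝ × ℝ) × ℝ}
    (hx : x ∈ punct) : 0 < pullExtd lam B.tor x ((1, 0), 0) ((0, 1), 0) := hs.2 x hx

lemma pullExtd_tor (B : OpenBook h o) {x : (ℝ × ℝ) × ℝ} (v w : ℝ × ℝ) :
    pullExtd lam B.tor x (v, 0) (w, 0) =
      (v.1 * w.2 - v.2 * w.1) * pullExtd lam B.tor x ((1, 0), 0) ((0, 1), 0) := by
  have e : ∀ v : ℝ × ℝ, ((v, 0) : (ℝ × ℝ) × ℝ) = v.1 • ((1, 0), 0) + v.2 • ((0, 1), 0) := by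
    intro v; ext <;> simp
  rw [e v, e w]
  simp only [pullExtd_add_left, pullExtd_add_right, pullExtd_smul_left, pullExtd_smul_right,
    pullExtd_self]
  rw [pullExtd_swap (ξ := ((0, 1), 0))]
  ring

lemma pullExtd_nbhd (B : OpenBook h o) {x : ℝ × ℂ} (v w : ℂ) :
    pullExtd lam B.nbhd x (0, v) (0, w) =
      (v.re * w.im - v.im * w.re) * pullExtd lam B.nbhd x (0, 1) (0, I) := by
  have e : ∀ v : ℂ, ((0, v) : ℝ × ℂ) = v.re • ((0, 1) : ℝ × ℂ) + v.im • ((0, I) : ℝ × ℂ) := by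
    intro v
    ext
    · simp
    · simp
  rw [e v, e w]
  simp only [pullExtd_add_left, pullExtd_add_right, pullExtd_smul_left, pullExtd_smul_right,
    pullExtd_self]
  rw [pullExtd_swap (ξ := (0, I))]
  ring

lemma pullExtd_radial_pos (B : OpenBook h o) (hs : B.Supports lam) {u r : ℝ} (hr : 0 < r)
    (hr' : r < 1) (t : ℝ) :
    0 < pullExtd lam B.nbhd (u, r * exp (τ * t * I)) (1, 0)
      (0, exp (τ * t * I)) := by
  have e1 := B.tor_eq_nbhd (u := u) hr hr' (t := t) 1 0 0
  have e2 := B.tor_eq_nbhd (u := u) hr hr' (t := t) 0 1 0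
  have e3 := extd_congr lam e1 e2
  have hpun : ((polarPt u r, t) : (ℝ × ℝ) × ℝ) ∈ punct := polarPt_not_mem hr (by linarith)
  have e4 : 0 < pullExtd lam B.tor (polarPt u r, t)
      ((-(r / 4 * sin u) * 1 + cos u / 4 * 0, -(r / 4 * cos u) * 1 - sin u / 4 * 0), 0)
      ((-(r / 4 * sin u) * 0 + cos u / 4 * 1, -(r / 4 * cos u) * 0 - sin u / 4 * 1), 0) := by
    rw [pullExtd_tor]
    refine mul_pos ?_ (B.pullExtd_tor_pos hs hpun)
    have := sin_sq_add_cos_sq u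
    nlinarith
  rw [pullExtd, e3] at e4
  rw [pullExtd]
  simpa using e4

lemma pullExtd_binding (B : OpenBook h o) (hc : IsContactForm o lam) (hs : B.Supports lam)
    (u : ℝ) (ζ : ℂ) : pullExtd lam B.nbhd (u, 0) (1, 0) (0, ζ) = 0 := by
  have hz : ∀ t : ℝ, 0 ≤ pullExtd lam B.nbhd (u, 0) (1, 0)
      (0, exp (τ * t * I)) := by
    intro t
    let g : ℝ → ℝ × ℂ := fun r => (u, r * exp (τ * t * I))
    have hg : Continuous g := by simp only [g]; fun_prop
    have h0 : g 0 = (u, 0) := by simp [g]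
    have hd : g 0 ∈ nbhdDom := by rw [h0]; simp [nbhdDom]
    have hc1 := continuousAt_pullExtd (lam := lam) (x₀ := (0 : ℝ)) hc.1
      (B.isParam_nbhd.contMDiffAt hd) hg.continuousAt (continuousAt_const (y := ((1, 0) : ℝ × ℂ)))
      (continuousAt_const (y := ((0, exp (τ * t * I)) : ℝ × ℂ)))
    have hc2 := hc1.tendsto.mono_left (nhdsWithin_le_nhds (s := Set.Ioi 0))
    rw [h0] at hc2
    refine ge_of_tendsto hc2 ?_
    filter_upwards [Ioo_mem_nhdsGT (show (0 : ℝ) < 1 by norm_num)] with r hr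
    exact (B.pullExtd_radial_pos hs hr.1 hr.2 t).le
  have key : ∀ t : ℝ, pullExtd lam B.nbhd (u, 0) (1, 0)
      (0, exp (τ * t * I)) = 0 := by
    intro t
    refine le_antisymm ?_ (hz t)
    have h1 := hz (t + 1 / 2)
    have h2 : exp (τ * ((t + 1 / 2 : ℝ) : ℂ) * I) = -exp (τ * t * I) := by
      rw [← Complex.exp_add_pi_mul_I]
      congr 1
      push_cast
      ring
    rw [h2] at h1
    have h3 : ((0, -exp (τ * t * I)) : ℝ × ℂ) =
        (-1 : ℝ) • (0, exp (τ * t * I)) := by simp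
    rw [h3, pullExtd_smul_right] at h1
    linarith
  obtain ⟨t, ht⟩ := exists_eq_mul_exp ζ
  have h3 : ((0, ζ) : ℝ × ℂ) = ‖ζ‖ • (0, exp (τ * t * I)) := by
    rw [Prod.smul_mk, smul_zero, Complex.real_smul, ← ht]
  rw [h3, pullExtd_smul_right, key, mul_zero]

lemma pullExtd_binding_pos (B : OpenBook h o) (hc : IsContactForm o lam) (hs : B.Supports lam)
    (u : ℝ) : 0 < pullExtd lam B.nbhd (u, 0) (0, 1) (0, I) := by
  have hd : ((u, 0) : ℝ × ℂ) ∈ nbhdDom := by simp [nbhdDom]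
  have h1 := hc.2 _ _ (B.isParam_nbhd.pos _ hd)
  have h2 := B.pullExtd_binding hc hs u 1
  have h3 := B.pullExtd_binding hc hs u I
  have h4 := hs.1 u
  rw [pullExtd_swap] at h3
  simp only [pullExtd] at h2 h3 ⊢
  simp only [nbhdVec, Matrix.cons_val_zero, Matrix.cons_val_one, Matrix.cons_val] at h1
  rw [h2, neg_eq_zero.1 h3] at h1
  simp only [mul_zero, add_zero] at h1
  exact pos_of_mul_pos_right h1 h4.le

lemma exists_binding_nbhd (B : OpenBook h o) (hc : IsContactForm o lam) (hs : B.Supports lam) :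
    ∃ ε : ℝ, 0 < ε ∧ ε < 1 ∧ ∀ (u : ℝ) (z : ℂ), ‖z‖ < ε →
      0 < pullExtd lam B.nbhd (u, z) (0, 1) (0, I) := by
  let O : Set (ℝ × ℂ) := {x | x ∈ nbhdDom ∧ 0 < pullExtd lam B.nbhd x (0, 1) (0, I)}
  have hO : IsOpen O := by
    rw [isOpen_iff_mem_nhds]
    rintro x ⟨hx, hx'⟩
    have hc1 := continuousAt_pullExtd (lam := lam) (x₀ := x) (g := id) hc.1
      (B.isParam_nbhd.contMDiffAt hx) continuousAt_id (continuousAt_const (y := ((0, 1) : ℝ × ℂ)))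
      (continuousAt_const (y := ((0, I) : ℝ × ℂ)))
    exact Filter.inter_mem (isOpen_nbhdDom.mem_nhds hx) (hc1 (lt_mem_nhds hx'))
  have hK : IsCompact (Icc 0 τ ×ˢ ({0} : Set ℂ)) := isCompact_Icc.prod isCompact_singleton
  have hKO : Icc 0 τ ×ˢ ({0} : Set ℂ) ⊆ O := by
    rintro ⟨u, z⟩ ⟨-, hz⟩
    obtain rfl : z = 0 := hz
    exact ⟨by simp [nbhdDom], B.pullExtd_binding_pos hc hs u⟩
  obtain ⟨δ, hδ, hδ'⟩ := hK.exists_thickening_subset_open hO hKO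
  refine ⟨min δ (1 / 2), by positivity, lt_of_le_of_lt (min_le_right _ _) (by norm_num), ?_⟩
  intro u z hz
  have hp := two_pi_pos
  set m := ⌊u / τ⌋ with hm
  have h1 : (m : ℝ) * τ ≤ u := (le_div_iff₀ hp).1 (Int.floor_le _)
  have h2 : u < (m + 1) * τ := (div_lt_iff₀ hp).1 (Int.lt_floor_add_one _)
  have h3 : ((u - τ * m, z) : ℝ × ℂ) ∈ O := by
    refine hδ' (Metric.mem_thickening_iff.2 ⟨(u - τ * m, 0), ⟨⟨by linarith, by linarith⟩, rfl⟩, ?_⟩)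
    rw [Prod.dist_eq]
    simp only [dist_self, dist_zero_right]
    exact max_lt hδ (lt_of_lt_of_le hz (min_le_left _ _))
  have h4 := fun v => B.nbhd_translate h3.1 m v
  simp only [sub_add_cancel] at h4
  have h5 := h3.2
  rw [pullExtd, extd_congr lam (h4 _) (h4 _)] at h5
  exact h5

lemma exists_pullExtd_ne_zero (B : OpenBook h o) (hs : B.Supports lam) {ε : ℝ}
    (hε : ∀ (u : ℝ) (z : ℂ), ‖z‖ < ε → 0 < pullExtd lam B.nbhd (u, z) (0, 1) (0, I))
    {u r t : ℝ} (hr : 0 < r) (hr' : r < 1) {a c : ℝ} (ha : 0 ≤ a) (hc : 0 ≤ c) (hac : 0 < a + c)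
    (hcε : c = 0 ∨ r < ε) :
    ∃ η, pullExtd lam B.nbhd (u, r * exp (τ * t * I))
      (-(4 / r * sin (u - τ * t)) * a, (4 * cos (u - τ * t) * a : ℝ) * exp (τ * t * I) +
          c * exp (u * I)) η ≠ 0 := by
  set x : ℝ × ℂ := (u, r * exp (τ * t * I)) with hx
  set e := exp (τ * t * I) with he
  set θ := u - τ * t with hθ
  have hpos := B.pullExtd_radial_pos (u := u) hs hr hr' t
  rw [← he, ← hx] at hpos
  set q := pullExtd lam B.nbhd x (1, 0) (0, e) with hq
  set d := pullExtd lam B.nbhd x (0, e) (0, e * I) with hd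
  have hdc : 0 ≤ c * d ∧ (c = 0 ∨ 0 < d) := by
    rcases hcε with rfl | hcε
    · simp
    · have h1 := hε u (r * e) (by rw [he, norm_mul_exp hr.le]; exact hcε)
      have h2 : d = (e.re * (e * I).im - e.im * (e * I).re) *
        pullExtd lam B.nbhd x (0, 1) (0, I) := B.pullExtd_nbhd _ _
      have h3 : e.re * (e * I).im - e.im * (e * I).re = 1 := by
        have h4 : Complex.normSq e = 1 := by
          rw [Complex.normSq_eq_norm_sq]
          have := norm_mul_exp (zero_le_one) t
          rw [Complex.ofReal_one, one_mul] at this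
          rw [he, this]; norm_num
        rw [Complex.normSq_apply] at h4
        simp
        linarith
      rw [h3, one_mul] at h2
      have h5 : 0 < d := by rw [h2]; exact h1
      exact ⟨mul_nonneg hc h5.le, Or.inr h5⟩
  have hexp : exp (u * I) = (cos θ : ℂ) * e + (sin θ : ℂ) * (e * I) := by
    have h1 : (u : ℂ) * I = (θ : ℂ) * I + τ * t * I := by
      rw [hθ]; push_cast; ring
    rw [h1, Complex.exp_add, Complex.exp_mul_I, ← Complex.ofReal_cos, ← Complex.ofReal_sin, ← he]
    ring
  have hξ : ((-(4 / r * sin θ) * a, (4 * cos θ * a : ℝ) * e + c * exp (u * I)) : ℝ × ℂ) =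
      (-(4 / r * sin θ) * a) • ((1, 0) : ℝ × ℂ) + ((4 * a + c) * cos θ) • ((0, e) : ℝ × ℂ) +
        (c * sin θ) • ((0, e * I) : ℝ × ℂ) := by
    rw [hexp]
    refine Prod.ext ?_ ?_
    · simp
    · simp only [Prod.snd_add, Prod.smul_snd, smul_zero, zero_add, Complex.real_smul]
      push_cast
      ring
  rw [hξ]
  by_cases hsin : sin θ = 0
  · refine ⟨(1, 0), ?_⟩
    simp only [pullExtd_add_left, pullExtd_smul_left, pullExtd_self, hsin]
    rw [pullExtd_swap (ξ := (0, e)), ← hq]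
    have hcos : cos θ ≠ 0 := by
      intro h0
      have := sin_sq_add_cos_sq θ
      rw [h0, hsin] at this
      norm_num at this
    have h4 : 4 * a + c ≠ 0 := by intro h0; linarith
    simp [hcos, h4, hpos.ne']
  · refine ⟨(0, e), ?_⟩
    simp only [pullExtd_add_left, pullExtd_smul_left, pullExtd_self]
    rw [pullExtd_swap (ξ := (0, e * I)), ← hq, ← hd]
    have h5 : 0 < 4 / r * a * q + c * d := by
      rcases hdc.2 with h0 | h0
      · have : 0 < a := by linarith
        have : 0 < 4 / r * a * q := by positivity
        linarith [hdc.1]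
      · rcases ha.eq_or_lt with h6 | h6
        · have : 0 < c := by linarith
          have := mul_pos this h0
          rw [← h6]
          simpa using this
        · have : 0 < 4 / r * a * q := by positivity
          linarith [hdc.1]
    intro h6
    have h7 : sin θ * (4 / r * a * q + c * d) = 0 := by linear_combination -h6
    rcases mul_eq_zero.1 h7 with h8 | h8
    · exact hsin h8
    · exact h5.ne' h8

end OpenBook

/-! ### A vector field transverse to the Reeb field on an open book -/

lemma continuous_mapP {A : X → M2 ℝ} {v : X → ℝ × ℝ}
    (hA : Continuous A) (hv : Continuous v) : Continuous fun x => mapP (A x) (v x) := by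
  have h1 : ∀ i j, Continuous fun x => A x i j := fun i j => hA.matrix_elem i j
  exact (((h1 0 0).mul (continuous_fst.comp hv)).add ((h1 0 1).mul (continuous_snd.comp hv))).prodMk
    (((h1 1 0).mul (continuous_fst.comp hv)).add ((h1 1 1).mul (continuous_snd.comp hv)))

lemma continuous_inv_matrix {A : X → M2 ℝ}
    (hA : Continuous A) (h : ∀ x, 0 < (A x).det) : Continuous fun x => (A x)⁻¹ := by
  simp only [Matrix.inv_def, Ring.inverse_eq_inv']
  exact (hA.matrix_det.inv₀ fun x => (h x).ne').smul hA.matrix_adjugate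

namespace OpenBook

/-- A vector field on an open book that is constant in the page coordinates of the page over `0`
away from the binding, and nowhere parallel to the Reeb field. -/
lemma exists_vectorField [T2Space Y] (B : OpenBook h o) {A : M2 ℤ} (T : IsTwist h A)
    (hc : IsContactForm o lam) (hs : B.Supports lam) :
    ∃ w : ∀ y : Y, 𝕋 y, Continuous (fun y => (⟨y, w y⟩ : TangentBundle (𝓡 3) Y)) ∧
      (∀ y, ∃ u, extd lam y (w y) u ≠ 0) ∧
      ∀ p ∉ range latticePt, ∀ s : ℝ, 0 ≤ s → ∃ u, extd lam (B.tor (p, 0))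
        (w (B.tor (p, 0)) + s • mfderiv 𝓘(ℝ, (ℝ × ℝ) × ℝ) (𝓡 3) B.tor (p, 0) ((1, 0), 0)) u ≠ 0 := by
  obtain ⟨ε, hε, hε1, hεp⟩ := B.exists_binding_nbhd hc hs
  obtain ⟨H, H1, H2, H3, H4, H5, H6⟩ := T.isotopy
  let dir : ℝ → ℝ × ℝ := fun t => (cos (τ * t), -sin (τ * t))
  have hdir1 : ∀ t, dir (t + 1) = dir t := fun t => by
    simp only [dir]
    rw [mul_add, mul_one, Real.cos_add_two_pi, Real.sin_add_two_pi]
  let vt : (ℝ × ℝ) × ℝ → ℝ × ℝ := fun x => mapP (H x.2 x.1)⁻¹ (dir x.2)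
  have hHc : Continuous fun x : (ℝ × ℝ) × ℝ => H x.2 x.1 :=
    H1.comp (continuous_snd.prodMk continuous_fst)
  have hvt : Continuous vt := continuous_mapP (continuous_inv_matrix hHc fun x => H4 _ _)
    (by simp only [dir]; fun_prop)
  have hvt1 : ∀ x : (ℝ × ℝ) × ℝ, H x.2 x.1 = 1 → vt x = dir x.2 := fun x hx => by
    simp only [vt, hx]
    rw [inv_one, mapP_one]
  have hvtH : ∀ x, mapP (H x.2 x.1) (vt x) = dir x.2 := fun x => by
    simp only [vt]
    rw [← mapP_mul, mul_nonsing_inv _ (H4 _ _).ne'.isUnit, mapP_one]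
  have hvt0 : ∀ x, vt x ≠ 0 := fun x h0 => by
    have e1 := hvtH x
    rw [h0] at e1
    have e2 := congrArg Prod.fst e1
    have e3 := congrArg Prod.snd e1
    simp only [mapP, Prod.fst_zero, Prod.snd_zero, mul_zero, add_zero, dir] at e2 e3
    have := sin_sq_add_cos_sq (τ * x.2)
    rw [← e2, neg_eq_zero.1 e3.symm] at this
    norm_num at this
  let F1 : (ℝ × ℝ) × ℝ → TangentBundle (𝓡 3) Y := fun x => tv B.tor x (vt x, 0)
  have hF1m : ∀ x ∈ punct, ∀ m, F1 (x.1 + latticePt m, x.2) = F1 x := fun x hx m => by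
    simp only [F1]
    rw [B.tor_translate hx m]
    simp only [vt, H2]
  have hF1h : ∀ p ∉ range latticePt, ∀ t : ℝ, t ∈ Set.Ioo (-(1 / 4) : ℝ) (1 / 4) →
      F1 (p, t + 1) = F1 (h p, t) := fun p hp t ht => by
    simp only [F1]
    rw [B.tor_monodromy T hp, H6 (t + 1) p (by linarith [ht.1]), hvt1 (h p, t) (H5 _ _ ht.2.le)]
    have := hvtH (p, t + 1)
    simp only at this
    rw [this, hdir1]
  let χ : ℂ → ℝ := fun z => max 0 (min 1 (3 - 4 / ε * ‖z‖))
  have hχc : Continuous χ := by simp only [χ]; fun_prop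
  have hχ0 : ∀ z, 0 ≤ χ z := fun z => le_max_left _ _
  have hχ1 : ∀ z, χ z ≤ 1 := fun z => max_le zero_le_one (min_le_left _ _)
  have hχz : ∀ z, 3 * ε / 4 ≤ ‖z‖ → χ z = 0 := fun z hz => by
    refine max_eq_left ((min_le_right _ _).trans ?_)
    have : 4 / ε * (3 * ε / 4) ≤ 4 / ε * ‖z‖ := by gcongr
    have h2 : 4 / ε * (3 * ε / 4) = 3 := by field_simp
    linarith
  have hχo : ∀ z, ‖z‖ ≤ ε / 2 → χ z = 1 := fun z hz => by
    have : 4 / ε * ‖z‖ ≤ 4 / ε * (ε / 2) := by gcongr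
    have h2 : 4 / ε * (ε / 2) = 2 := by field_simp; norm_num
    simp only [χ]
    rw [min_eq_left (by linarith), max_eq_right zero_le_one]
  let a : ℂ → ℝ := fun z => (1 - χ z) / max (‖z‖ ^ 2) (ε ^ 2 / 4)
  have hmax : ∀ z : ℂ, 0 < max (‖z‖ ^ 2) (ε ^ 2 / 4) := fun z =>
    lt_of_lt_of_le (by positivity) (le_max_right _ _)
  have hac : Continuous a := by
    simp only [a]
    exact (continuous_const.sub hχc).div (by fun_prop) fun z => (hmax z).ne'
  have ha0 : ∀ z, 0 ≤ a z := fun z => div_nonneg (by linarith [hχ1 z]) (hmax z).le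
  let ξ : ℝ × ℂ → ℝ × ℂ := fun x =>
    (-4 * (exp (x.1 * I) * (starRingEnd ℂ x.2)).im * a x.2,
      (4 * (exp (x.1 * I) * (starRingEnd ℂ x.2)).re * a x.2 : ℝ) * x.2 + χ x.2 * exp (x.1 * I))
  have hconj : Continuous fun x : ℝ × ℂ => exp (x.1 * I) * (starRingEnd ℂ x.2) :=
    (by fun_prop : Continuous fun x : ℝ × ℂ => exp (x.1 * I)).mul
      (Complex.continuous_conj.comp continuous_snd)
  have hξc : Continuous ξ := by
    have h1 := Complex.continuous_re.comp hconj
    have h2 := Complex.continuous_im.comp hconj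
    have h3 : Continuous fun x : ℝ × ℂ => a x.2 := hac.comp continuous_snd
    have h4 : Continuous fun x : ℝ × ℂ => χ x.2 := hχc.comp continuous_snd
    refine ((continuous_const.mul h2).mul h3).prodMk (((Complex.continuous_ofReal.comp
      ((continuous_const.mul h1).mul h3)).mul continuous_snd).add
      ((Complex.continuous_ofReal.comp h4).mul (by fun_prop)))
  have hξp : ∀ u r t : ℝ, 0 < r → ξ (u, r * exp (τ * t * I)) = (-(4 / r * sin (u - τ * t)) *
          (a (r * exp (τ * t * I)) * r ^ 2),
        (4 * cos (u - τ * t) * (a (r * exp (τ * t * I)) * r ^ 2) : ℝ) * exp (τ * t * I) +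
          χ (r * exp (τ * t * I)) * exp (u * I)) := by
    intro u r t hr
    have e1 : exp (u * I) * (starRingEnd ℂ)
        (r * exp (τ * t * I)) =
        (r * cos (u - τ * t) : ℝ) + (r * sin (u - τ * t) : ℝ) * I := by
      rw [map_mul, Complex.conj_ofReal, ← Complex.exp_conj]
      have : (starRingEnd ℂ) (τ * t * I) = -(τ * t * I) := by
        have e2 : (τ * t * I : ℂ) = ((τ * t : ℝ) : ℂ) * I := by
          push_cast; ring
        rw [e2, map_mul, Complex.conj_ofReal, Complex.conj_I]
        ring
      rw [this]
      have e3 : exp (u * I) * (r * exp (-(τ * t * I))) = r * exp ((u - τ * t : ℝ) * I) := by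
        have : ((u - τ * t : ℝ) : ℂ) * I =
          u * I + -(τ * t * I) := by push_cast; ring
        rw [this, Complex.exp_add]
        ring
      rw [e3, Complex.exp_mul_I, ← Complex.ofReal_cos, ← Complex.ofReal_sin]
      push_cast
      ring
    simp only [ξ, e1, Complex.add_re, Complex.add_im, Complex.ofReal_re, Complex.ofReal_im,
      Complex.re_ofReal_mul, Complex.im_ofReal_mul, Complex.I_re, Complex.I_im]
    refine Prod.ext ?_ ?_
    · simp only
      field_simp
      ring
    · simp only
      push_cast
      ring
  let F2 : ℝ × ℂ → TangentBundle (𝓡 3) Y := fun x => tv B.nbhd x (ξ x)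
  let K : Set Y := B.nbhd '' {x | ‖x.2‖ ≤ 3 * ε / 4}
  have hK' : K = B.nbhd '' (Icc 0 τ ×ˢ Metric.closedBall 0 (3 * ε / 4)) := by
    apply Set.Subset.antisymm
    · rintro _ ⟨⟨u, z⟩, hz, rfl⟩
      have hp := two_pi_pos
      set m := ⌊u / τ⌋ with hm
      have h1 : (m : ℝ) * τ ≤ u := (le_div_iff₀ hp).1 (Int.floor_le _)
      have h2 : u < (m + 1) * τ := (div_lt_iff₀ hp).1 (Int.lt_floor_add_one _)
      have hz1 : ‖z‖ ≤ 3 * ε / 4 := hz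
      have hz2 : ‖z‖ < 1 := by linarith
      refine ⟨(u - τ * m, z), ⟨⟨by simp only; linarith, by simp only; linarith⟩, ?_⟩, ?_⟩
      · simpa using hz1
      · exact (B.nbhd_eq_iff _ _ hz2 hz2).2 ⟨rfl, -m, by push_cast; ring⟩
    · rintro _ ⟨⟨u, z⟩, ⟨-, hz⟩, rfl⟩
      exact ⟨(u, z), by simpa using hz, rfl⟩
  have hKc : IsClosed K := by
    rw [hK']
    refine ((isCompact_Icc.prod (isCompact_closedBall _ _)).image_of_continuousOn
      (B.nbhd_smooth.continuousOn.mono ?_)).isClosed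
    rintro ⟨u, z⟩ ⟨-, hz⟩
    have : ‖z‖ ≤ 3 * ε / 4 := by simpa using hz
    change ‖z‖ < 1
    linarith
  let V1 : Set ((ℝ × ℝ) × ℝ) := (punct ∩ B.tor ⁻¹' Kᶜ) ∩ {x | x.2 ∈ Set.Ioo (-(1 / 4) : ℝ) (5 / 4)}
  have hV1 : IsOpen V1 := (B.tor_smooth.continuousOn.isOpen_inter_preimage isOpen_punct
    hKc.isOpen_compl).inter (isOpen_Ioo.preimage continuous_snd)
  have hV1p : V1 ⊆ punct := fun x hx => hx.1.1
  have h11 : ∀ x ∈ V1, ∀ x' ∈ V1, B.tor x = B.tor x' → F1 x = F1 x' := by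
    have aux : ∀ x ∈ V1, ∀ x' ∈ V1, ∀ (k : ℤ) (m : ℤ × ℤ), 0 ≤ k → x.2 = x'.2 + k →
        x'.1 = (h ^ k) x.1 + latticePt m → F1 x = F1 x' := by
      rintro ⟨p, t⟩ hx ⟨p', t'⟩ hx' k m hk ht hp
      simp only at ht hp
      have hk2 : (k : ℝ) < 2 := by
        have h1 := hx.2.2
        have h2 := hx'.2.1
        simp only at h1 h2
        linarith
      have hk3 : k < 2 := by exact_mod_cast hk2
      obtain rfl | rfl : k = 0 ∨ k = 1 := by omega
      · subst ht hp
        have := hF1m (p, t') (show p ∉ _ from hV1p hx) m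
        simpa using this.symm
      · have hhp : h p ∉ range latticePt := fun hm => hV1p hx ((T.mem_lattice_iff _).1 hm)
        subst ht hp
        have e1 := hF1h p (hV1p hx) t' ⟨hx'.2.1, by
          have h1 := hx.2.2
          simp only at h1
          push_cast at h1
          linarith⟩
        have e2 := hF1m (h p, t') hhp m
        push_cast
        rw [e1, ← e2]
        rfl
    intro x hx x' hx' he
    obtain ⟨k, m, ht, hp⟩ := (B.tor_eq_iff x.1 (hV1p hx) x'.1 (hV1p hx') x.2 x'.2).1 he
    rcases le_total 0 k with hk | hk
    · exact aux x hx x' hx' k m hk ht hp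
    · obtain ⟨k', m', ht', hp'⟩ := (B.tor_eq_iff x'.1 (hV1p hx') x.1 (hV1p hx) x'.2 x.2).1 he.symm
      refine (aux x' hx' x hx k' m' ?_ ht' hp').symm
      have h1 : (k : ℝ) + k' = 0 := by linarith
      have h2 : k + k' = 0 := by exact_mod_cast h1
      omega
  have h22 : ∀ x ∈ nbhdDom, ∀ x' ∈ nbhdDom, B.nbhd x = B.nbhd x' → F2 x = F2 x' := by
    rintro ⟨u, z⟩ hx ⟨u', z'⟩ hx' he
    obtain ⟨h1, m, h2⟩ := (B.nbhd_eq_iff _ _ hx hx').1 he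
    simp only at h1 h2
    subst h1 h2
    simp only [F2]
    rw [B.nbhd_translate hx' m]
    congr 1
    have : exp (((u' + τ * m : ℝ) : ℂ) * I) = exp (u' * I) := by
      refine exp_eq_exp_iff_exists_int.2 ⟨m, ?_⟩
      push_cast
      ring
    simp only [ξ, this]
  have hrad : ∀ u r t : ℝ, 0 < r → r < 1 → tv B.tor (polarPt u r, t) (dir t, 0) =
      tv B.nbhd (u, r * exp (τ * t * I))
        (-(4 / r * sin (u - τ * t)), (4 * cos (u - τ * t) : ℝ) * exp (τ * t * I)) := by
    intro u r t hr hr'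
    have e1 := B.tor_eq_nbhd (u := u) hr hr' (t := t) (-(4 / r * sin (u - τ * t)))
      (4 * cos (u - τ * t)) 0
    have h1 := sin_sq_add_cos_sq u
    have e2 : -(r / 4 * sin u) * -(4 / r * sin (u - τ * t)) +
        cos u / 4 * (4 * cos (u - τ * t)) = cos (τ * t) := by
      rw [Real.sin_sub, Real.cos_sub]
      field_simp
      linear_combination (cos (τ * t)) * h1
    have e3 : -(r / 4 * cos u) * -(4 / r * sin (u - τ * t)) -
        sin u / 4 * (4 * cos (u - τ * t)) = -sin (τ * t) := by
      rw [Real.sin_sub, Real.cos_sub]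
      field_simp
      linear_combination (-sin (τ * t)) * h1
    rw [e2, e3] at e1
    rw [e1]
    simp
  have hnear : ∀ u r : ℝ, 0 < r → r < 1 → ∀ s, H s (polarPt u r) = 1 := fun u r hr hr' s => by
    refine H3 s _ ?_ ?_
    · simp only [polarPt, abs_mul]
      rw [abs_of_pos (by positivity : 0 < r / 4)]
      have := Real.abs_cos_le_one u
      nlinarith
    · simp only [polarPt, abs_neg, abs_mul]
      rw [abs_of_pos (by positivity : 0 < r / 4)]
      have := Real.abs_sin_le_one u
      nlinarith
  have h12 : ∀ x ∈ V1, ∀ x' ∈ nbhdDom, B.tor x = B.nbhd x' → F1 x = F2 x' := by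
    rintro ⟨p, t⟩ hx ⟨u, z⟩ hx' he
    obtain ⟨h1, h2, m, h3⟩ := B.eq_polar_of_tor_eq_nbhd (hV1p hx) hx' he
    have hz : 3 * ε / 4 < ‖z‖ := by
      by_contra hcon
      exact hx.1.2 ⟨(u, z), not_lt.1 hcon, he.symm⟩
    subst h3
    have e1 := hF1m (polarPt u ‖z‖, t) (polarPt_not_mem h1 (by linarith [show ‖z‖ < 1 from hx'])) m
    have e2 := hrad u ‖z‖ t h1 hx'
    have e3 := hξp u ‖z‖ t h1
    have e4 : a z * ‖z‖ ^ 2 = 1 := by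
      have h5 : max (‖z‖ ^ 2) (ε ^ 2 / 4) = ‖z‖ ^ 2 := max_eq_left (by nlinarith)
      simp only [a, hχz z hz.le, h5]
      field_simp
      norm_num
    rw [← h2, e4, hχz z hz.le, mul_one, mul_one, Complex.ofReal_zero, zero_mul, add_zero] at e3
    rw [← h2] at e2
    refine e1.trans ?_
    simp only [F1, F2]
    rw [hvt1 (polarPt u ‖z‖, t) (hnear u _ h1 hx' _), e2, e3]
  have hcov : ∀ y, (∃ x ∈ V1, B.tor x = y) ∨ ∃ x ∈ nbhdDom, B.nbhd x = y := by
    intro y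
    by_cases hy : y ∈ K
    · obtain ⟨x, hx, rfl⟩ := hy
      have hx1 : ‖x.2‖ ≤ 3 * ε / 4 := hx
      exact Or.inr ⟨x, show ‖x.2‖ < 1 by linarith, rfl⟩
    · rcases B.cover y with ⟨⟨p, t⟩, hx, rfl⟩ | h2
      · have hx1 : p ∉ range latticePt := hx
        have e1 := B.tor_zpow T hx1 (Int.fract t) ⌊t⌋
        rw [Int.fract_add_floor] at e1
        rw [e1] at hy ⊢
        refine Or.inl ⟨_, ⟨⟨?_, hy⟩, ?_, ?_⟩, rfl⟩
        · exact fun hm => hx1 ((T.zpow_mem_lattice_iff _ _).1 hm)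
        · simp only
          linarith [Int.fract_nonneg t]
        · simp only
          linarith [Int.fract_lt_one t]
      · exact Or.inr h2
  obtain ⟨f, hf, hf1, hf2⟩ := exists_glue (φ₁ := B.tor) (φ₂ := B.nbhd) (U₁ := V1) (U₂ := nbhdDom)
    (f₁ := F1) (f₂ := F2)
    (fun x hx => B.isParam_tor.map_nhds (hV1p hx)) (fun x hx => B.isParam_nbhd.map_nhds hx)
    hV1 isOpen_nbhdDom
    (fun x hx => (continuousAt_mfderiv_vec (g := id) (v := fun x => (vt x, 0))
      (B.isParam_tor.contMDiffAt (hV1p hx)) continuousAt_id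
      (hvt.prodMk continuous_const).continuousAt).continuousWithinAt)
    (fun x hx => (continuousAt_mfderiv_vec (g := id) (v := ξ) (B.isParam_nbhd.contMDiffAt hx)
      continuousAt_id hξc.continuousAt).continuousWithinAt)
    h11 h22 h12 hcov
  have hproj : ∀ y, (f y).1 = y := by
    intro y
    rcases hcov y with ⟨x, hx, rfl⟩ | ⟨x, hx, rfl⟩
    · rw [hf1 x hx]; rfl
    · rw [hf2 x hx]; rfl
  let w : ∀ y : Y, 𝕋 y := fun y => (show E 3 from (f y).2)
  have hw : ∀ y, (⟨y, w y⟩ : TangentBundle (𝓡 3) Y) = f y := fun y =>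
    totalSpace_ext (hproj y).symm rfl
  have hmain : ∀ u r t s : ℝ, 0 < r → r < 1 → 0 ≤ s →
      ∃ η, pullExtd lam B.nbhd (u, r * exp (τ * t * I))
        (ξ (u, r * exp (τ * t * I)) + s • (-(4 / r * sin (u - τ * t)), (4 * cos (u - τ * t) : ℝ) *
            exp (τ * t * I))) η ≠ 0 := by
    intro u r t s hr hr' hs0
    have hnz := norm_mul_exp hr.le t
    set z := (r * exp (τ * t * I) : ℂ) with hz
    have e1 := hξp u r t hr
    rw [← hz] at e1
    have h3 : 0 ≤ a z * r ^ 2 := mul_nonneg (ha0 z) (sq_nonneg r)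
    obtain ⟨η, hη⟩ := B.exists_pullExtd_ne_zero hs hεp (u := u) (t := t) hr hr'
      (a := a z * r ^ 2 + s) (c := χ z) (by linarith) (hχ0 z) (by
        rcases (hχ0 z).eq_or_lt with h0 | h0
        · have h4 : 0 < a z := by
            simp only [a]
            rw [← h0]
            exact div_pos (by norm_num) (hmax z)
          have : 0 < a z * r ^ 2 := by positivity
          linarith
        · linarith) (by
        by_cases h0 : 3 * ε / 4 ≤ ‖z‖
        · exact Or.inl (hχz z h0)
        · right
          rw [hnz] at h0
          linarith [not_le.1 h0])
    refine ⟨η, ?_⟩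
    convert hη using 2
    rw [e1]
    refine Prod.ext ?_ ?_
    · simp only [Prod.fst_add, Prod.smul_fst, smul_eq_mul]
      ring
    · simp only [Prod.snd_add, Prod.smul_snd, Complex.real_smul]
      push_cast
      ring
  refine ⟨w, by simpa only [hw] using hf, fun y => ?_, fun p hp s hs0 => ?_⟩
  · rcases hcov y with ⟨x, hx, rfl⟩ | ⟨⟨u, z⟩, hx, rfl⟩
    · have e1 := (hw (B.tor x)).trans (hf1 x hx)
      obtain ⟨v, hv⟩ : ∃ v, pullExtd lam B.tor x (vt x, 0) (v, 0) ≠ 0 := by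
        have hp := B.pullExtd_tor_pos hs (hV1p hx)
        by_cases h0 : (vt x).1 = 0
        · refine ⟨(1, 0), ?_⟩
          have h1 : (vt x).2 ≠ 0 := fun h1 => hvt0 x (Prod.ext h0 h1)
          rw [pullExtd_tor]
          simp [h1, hp.ne']
        · refine ⟨(0, 1), ?_⟩
          rw [pullExtd_tor]
          simp [h0, hp.ne']
      refine ⟨mfderiv 𝓘(ℝ, (ℝ × ℝ) × ℝ) (𝓡 3) B.tor x (v, 0), ?_⟩
      rw [extd_congr lam e1 rfl]
      exact hv
    · have e1 := (hw (B.nbhd (u, z))).trans (hf2 _ hx)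
      obtain ⟨η, hη⟩ : ∃ η, pullExtd lam B.nbhd (u, z) (ξ (u, z)) η ≠ 0 := by
        rcases eq_or_ne z 0 with rfl | hz
        · have hξ0 : ξ (u, 0) = (0, exp (u * I)) := by
            have : χ 0 = 1 := hχo 0 (by simp; positivity)
            simp only [ξ, this]
            simp
          refine ⟨(0, exp (u * I) * I), ?_⟩
          rw [hξ0, pullExtd_nbhd]
          have h4 : Complex.normSq (exp (u * I)) = 1 := by
            rw [Complex.normSq_eq_norm_sq, norm_exp_ofReal_mul_I]; norm_num
          rw [Complex.normSq_apply] at h4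
          have h5 := B.pullExtd_binding_pos hc hs u
          refine mul_ne_zero ?_ h5.ne'
          rw [Complex.mul_re, Complex.mul_im, Complex.I_re, Complex.I_im]
          intro h6
          linarith
        · obtain ⟨t, ht⟩ := exists_eq_mul_exp z
          obtain ⟨η, hη⟩ := hmain u ‖z‖ t 0 (norm_pos_iff.2 hz) hx le_rfl
          rw [zero_smul, add_zero, ← ht] at hη
          exact ⟨η, hη⟩
      refine ⟨mfderiv 𝓘(ℝ, ℝ × ℂ) (𝓡 3) B.nbhd (u, z) η, ?_⟩
      rw [extd_congr lam e1 rfl]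
      exact hη
  · have hdir0 : dir 0 = (1, 0) := by simp [dir]
    by_cases hpK : B.tor (p, 0) ∈ K
    · obtain ⟨⟨u, z⟩, hz, he⟩ := hpK
      have hz1 : ‖z‖ < 1 := by
        have : ‖z‖ ≤ 3 * ε / 4 := hz
        linarith
      obtain ⟨h1, h2, m, h3⟩ := B.eq_polar_of_tor_eq_nbhd hp hz1 he.symm
      have hpp : polarPt u ‖z‖ ∉ range latticePt := polarPt_not_mem h1 (by linarith)
      subst h3
      have e1 := (hw (B.nbhd (u, z))).trans (hf2 (u, z) hz1)
      have e2 := (B.tor_translate (x := (polarPt u ‖z‖, 0)) hpp m (dir 0, 0)).symm.trans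
        (hrad u ‖z‖ 0 h1 hz1)
      rw [← h2, hdir0] at e2
      obtain ⟨η, hη⟩ := hmain u ‖z‖ 0 s h1 hz1 hs0
      rw [← h2] at hη
      rw [he] at e1
      refine ⟨(show E 3 from mfderiv 𝓘(ℝ, ℝ × ℂ) (𝓡 3) B.nbhd (u, z) η), ?_⟩
      have e5 : extd lam (B.tor (polarPt u ‖z‖ + latticePt m, 0))
          (w (B.tor (polarPt u ‖z‖ + latticePt m, 0)) + s • mfderiv 𝓘(ℝ, (ℝ × ℝ) × ℝ) (𝓡 3) B.tor
            (polarPt u ‖z‖ + latticePt m, 0) ((1, 0), 0))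
          (show E 3 from mfderiv 𝓘(ℝ, ℝ × ℂ) (𝓡 3) B.nbhd (u, z) η) =
        pullExtd lam B.nbhd (u, z) (ξ (u, z)) η + s * pullExtd lam B.nbhd (u, z)
          (-(4 / ‖z‖ * sin (u - τ * (0 : ℝ))),
          (4 * cos (u - τ * (0 : ℝ)) : ℝ) * exp (τ * (0 : ℝ) * I)) η := by
        refine (extd_add_left _ _ _).trans ?_
        refine (congrArg (_ + ·) (extd_smul_left _ _ _)).trans ?_
        have e6 : (⟨B.tor (polarPt u ‖z‖ + latticePt m, 0),
            (show E 3 from mfderiv 𝓘(ℝ, ℝ × ℂ) (𝓡 3) B.nbhd (u, z) η)⟩ : TangentBundle (𝓡 3) Y) =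
            ⟨B.nbhd (u, z), mfderiv 𝓘(ℝ, ℝ × ℂ) (𝓡 3) B.nbhd (u, z) η⟩ :=
          totalSpace_ext he.symm rfl
        rw [extd_congr lam e1 e6, extd_congr lam e2 e6]
        rfl
      rw [e5, ← pullExtd_smul_left, ← pullExtd_add_left]
      exact hη
    · have hV : ((p, 0) : (ℝ × ℝ) × ℝ) ∈ V1 := ⟨⟨hp, hpK⟩, by norm_num, by norm_num⟩
      have e1 := (hw (B.tor (p, 0))).trans (hf1 _ hV)
      have e2 : vt (p, 0) = (1, 0) := by
        rw [hvt1 (p, 0) (H5 _ _ (by norm_num)), hdir0]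
      refine ⟨mfderiv 𝓘(ℝ, (ℝ × ℝ) × ℝ) (𝓡 3) B.tor (p, 0) ((0, 1), 0), ?_⟩
      rw [extd_add_left, extd_smul_left, extd_congr lam e1 rfl, e2]
      have hpos := hs.2 (p, 0) hp
      have : 0 < (1 + s) * extd lam (B.tor (p, 0))
        (mfderiv 𝓘(ℝ, (ℝ × ℝ) × ℝ) (𝓡 3) B.tor (p, 0) ((1, 0), 0))
        (mfderiv 𝓘(ℝ, (ℝ × ℝ) × ℝ) (𝓡 3) B.tor (p, 0) ((0, 1), 0)) := mul_pos (by linarith) hpos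
      rw [add_mul, one_mul] at this
      exact this.ne'

end OpenBook

lemma ev_eq_of_segment (δ : LoopClass IsGL) {A A' : 𝕀 → M3} (hA : IsLoop IsGL A)
    (hA' : IsLoop IsGL A')
    (h : ∀ t, ∀ s : 𝕀, IsGL ((1 - (s : ℝ)) • A t + (s : ℝ) • A' t)) :
    δ.ev A = δ.ev A' := by
  refine δ.ev_congr (fun s t => (1 - (s : ℝ)) • A t + (s : ℝ) • A' t) ?_ (fun s t => h t s) ?_
    (by simp) (by simp)
  · have h1 := hA.2.1
    have h2 := hA'.2.1
    fun_prop
  · intro s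
    simp only [hA.2.2, hA'.2.2]

lemma kap_eq_zero_of_rows {A : 𝕀 → M3} (hA : IsLoop IsGL A)
    (h : ∀ t, ∀ j, A t 0 j = (1 : M3) 0 j ∧ A t 1 j = (1 : M3) 1 j) : kap.ev A = 0 := by
  rw [ev_eq_of_segment kap hA (A' := fun _ => 1) ⟨fun _ => isGL_one, continuous_const, rfl⟩, kap.ev_const]
  intro t s
  have h0 : 0 < A t 2 2 := by
    have := hA.1 t
    simpa [IsGL, det_fin_three, (h t _).1, (h t _).2] using this
  have h1 : 0 < (1 - (s : ℝ)) * A t 2 2 + s := by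
    rcases eq_or_lt_of_le s.2.1 with hs | hs
    · rw [← hs]; linarith
    · have := mul_nonneg (sub_nonneg.2 s.2.2) h0.le
      linarith
  have e : ((1 - (s : ℝ)) • A t + (s : ℝ) • (1 : M3)).det = (1 - (s : ℝ)) * A t 2 2 + s := by
    simp [det_fin_three, (h t _).1, (h t _).2, Matrix.add_apply, Matrix.smul_apply]
  unfold IsGL
  rw [e]
  exact h1

lemma kap_eq_zero_of_slit {A : 𝕀 → M3} (hA : IsLoop IsGL A)
    (h : ∀ t, A t 2 0 = 0 ∧ A t 2 1 = 0 ∧ A t 2 2 = 1) (h' : ∀ t, ¬ (A t 0 0 ≤ 0 ∧ A t 0 1 = 0)) :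
    kap.ev A = 0 := by
  have hcont := hA.2.1
  have hdet : ∀ t, 0 < A t 0 0 * A t 1 1 - A t 0 1 * A t 1 0 := by
    intro t
    have := hA.1 t
    simp only [IsGL, det_fin_three, (h t).1, (h t).2.1, (h t).2.2] at this
    linarith
  have hsq : ∀ t, 0 < A t 0 0 ^ 2 + A t 0 1 ^ 2 := by
    intro t
    by_contra hc
    have h0 : A t 0 0 = 0 := by nlinarith [sq_nonneg (A t 0 0), sq_nonneg (A t 0 1)]
    have h1 : A t 0 1 = 0 := by nlinarith [sq_nonneg (A t 0 0), sq_nonneg (A t 0 1)]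
    exact h' t ⟨h0.le, h1⟩
  let A' : 𝕀 → M3 := fun t => !![A t 0 0, A t 0 1, 0; -A t 0 1, A t 0 0, 0; 0, 0, 1]
  have hA' : IsLoop IsGL A' := by
    refine ⟨fun t => ?_, ?_, ?_⟩
    · have := hsq t
      simp only [IsGL, det_fin_three, A']
      simp
      nlinarith
    · refine continuous_matrix fun i j => ?_
      fin_cases i <;> fin_cases j <;> simp [A'] <;> fun_prop
    · simp only [A', hA.2.2]
  have e1 : kap.ev A = kap.ev A' := by
    refine ev_eq_of_segment kap hA hA' fun t s => ?_
    have : ((1 - (s : ℝ)) • A t + (s : ℝ) • A' t).det =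
        (1 - (s : ℝ)) * (A t 0 0 * A t 1 1 - A t 0 1 * A t 1 0) +
          s * (A t 0 0 ^ 2 + A t 0 1 ^ 2) := by
      simp [det_fin_three, (h t).1, (h t).2.1, (h t).2.2, A']
      ring
    unfold IsGL
    rw [this]
    rcases eq_or_lt_of_le s.2.1 with hs | hs
    · rw [← hs]; linarith [hdet t]
    · have := mul_nonneg (sub_nonneg.2 s.2.2) (hdet t).le
      have := mul_pos hs (hsq t)
      linarith
  rw [e1, ev_eq_of_segment kap hA' (A' := fun _ => 1) ⟨fun _ => isGL_one, continuous_const, rfl⟩,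
    kap.ev_const]
  intro t s
  have e : ((1 - (s : ℝ)) • A' t + (s : ℝ) • (1 : M3)).det =
      ((1 - (s : ℝ)) * A t 0 0 + s) ^ 2 + ((1 - (s : ℝ)) * A t 0 1) ^ 2 := by
    simp [det_fin_three, A', Matrix.add_apply, Matrix.smul_apply]
    ring
  unfold IsGL
  rw [e]
  by_contra hc
  have h1 : ((1 - (s : ℝ)) * A t 0 0 + s) = 0 := by
    nlinarith [sq_nonneg ((1 - (s : ℝ)) * A t 0 0 + s), sq_nonneg ((1 - (s : ℝ)) * A t 0 1)]
  have h2 : ((1 - (s : ℝ)) * A t 0 1) = 0 := by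
    nlinarith [sq_nonneg ((1 - (s : ℝ)) * A t 0 0 + s), sq_nonneg ((1 - (s : ℝ)) * A t 0 1)]
  have h3 : (1 - (s : ℝ)) ≠ 0 := by
    intro h3
    rw [h3] at h1
    linarith
  have h4 : 0 < 1 - (s : ℝ) := lt_of_le_of_ne (sub_nonneg.2 s.2.2) h3.symm
  refine h' t ⟨?_, (mul_eq_zero.1 h2).resolve_left h3⟩
  by_contra h5
  have := mul_pos h4 (not_le.1 h5)
  linarith [s.2.1]

lemma vec_eq_sum_coeff {y : Y} {v w : Fin 3 → 𝕋 y}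
    (hw : IsUnit (rawMat (⟨y, w⟩ : Tuple 3 Y)).det) (i : Fin 3) :
    v i = ∑ j, coeff (⟨y, v⟩ : Tuple 3 Y) ⟨y, w⟩ i j • w j :=
  congrFun (Tuple.mk.inj
    (act_coeff (f := (⟨y, v⟩ : Tuple 3 Y)) (g := ⟨y, w⟩) rfl hw)).2.symm i

lemma coeff_row {y : Y} {v w : Fin 3 → 𝕋 y}
    (hw : IsUnit (rawMat (⟨y, w⟩ : Tuple 3 Y)).det) {i : Fin 3} (h : v i = w i) (j : Fin 3) :
    coeff (⟨y, v⟩ : Tuple 3 Y) ⟨y, w⟩ i j = (1 : M3) i j := by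
  have h1 : rawMat (⟨y, v⟩ : Tuple 3 Y) i = rawMat (⟨y, w⟩ : Tuple 3 Y) i := by
    funext l
    change (show E 3 from v i) l = (show E 3 from w i) l
    rw [h]
  rw [← mul_nonsing_inv _ hw]
  unfold coeff
  rw [mul_apply, mul_apply, h1]

lemma continuous_coeff {F G : X → Tuple 3 Y}
    (hF : Continuous F) (hG : Continuous G) (h : ∀ x, (F x).base = (G x).base)
    (hg : ∀ x, IsPos o (G x)) : Continuous fun x => coeff (F x) (G x) :=
  continuous_iff_continuousAt.2 fun x => continuousAt_coeff hF.continuousAt hG.continuousAt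
    (.of_forall h) (hg x).isUnit

lemma ev_add_coeff (Θ : SpinStructure o univ) {F G : 𝕀 → Tuple 3 Y}
    (hF : IsLoop (IsPos o) F) (hG : IsLoop (IsPos o) G) (h : ∀ x, (F x).base = (G x).base) :
    IsLoop IsGL (fun t => coeff (F t) (G t)) ∧
    Θ.cls.ev F = Θ.cls.ev G + kap.ev fun t => coeff (F t) (G t) := by
  have h1 : IsLoop IsGL fun t => coeff (F t) (G t) :=
    ⟨fun t => isGL_coeff (hF.1 t) (hG.1 t) (h t), continuous_coeff hF.2.1 hG.2.1 h hG.1, by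
      simp only [hF.2.2, hG.2.2]⟩
  refine ⟨h1, ?_⟩
  rw [← ev_act Θ hG h1]
  congr 1
  funext t
  exact (act_coeff (h t) (hG.1 t).isUnit).symm

lemma pos_reeb (hc : IsContactForm o lam) {y : Y} {d₁ d₂ : 𝕋 y}
    (hd : 0 < extd lam y d₁ d₂) : o.pos y ![d₁, d₂, reeb hc y] := by
  refine (pos_iff_vol hc).2 ?_
  simp only [vol, Matrix.cons_val_zero, Matrix.cons_val_one, Matrix.cons_val_two, Matrix.head_cons,
    Matrix.tail_cons, extd_reeb, extd_reeb_right, lam_reeb]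
  simpa using hd

lemma coeff_rows_of_extd (hc : IsContactForm o lam) {y : Y} {d₁ d₂ e₀ e₁ : 𝕋 y}
    (hu : IsUnit (rawMat (⟨y, ![d₁, d₂, reeb hc y]⟩ : Tuple 3 Y)).det)
    (he : ∀ s : ℝ, 0 ≤ s → ∃ u, extd lam y (e₀ + s • d₁) u ≠ 0) :
    let C := coeff (⟨y, ![e₀, e₁, reeb hc y]⟩ : Tuple 3 Y) ⟨y, ![d₁, d₂, reeb hc y]⟩
    (C 2 0 = 0 ∧ C 2 1 = 0 ∧ C 2 2 = 1) ∧ ¬ (C 0 0 ≤ 0 ∧ C 0 1 = 0) := by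
  intro C
  have h0 := vec_eq_sum_coeff (v := ![e₀, e₁, reeb hc y]) hu 0
  change e₀ = ∑ j, C 0 j • ![d₁, d₂, reeb hc y] j at h0
  have h2 : ∀ j, C 2 j = (1 : M3) 2 j := coeff_row hu rfl
  refine ⟨⟨by simp [h2], by simp [h2], by simp [h2]⟩, ?_⟩
  rintro ⟨h3, h4⟩
  obtain ⟨u, hu⟩ := he (-C 0 0) (by linarith)
  apply hu
  rw [sum_univ_three, h4] at h0
  rw [h0]
  simp only [Matrix.cons_val_zero, Matrix.cons_val_one, Matrix.cons_val_two, Matrix.head_cons,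
    Matrix.tail_cons, zero_smul, extd_add_left, extd_smul_left, extd_reeb]
  simp
  have : extd lam y (0 : 𝕋 y) u = 0 := by
    have := extd_smul_left (lam := lam) (0 : 𝕋 y) u 0
    simpa using this
  rw [this]

lemma OpenBook.ev_page_eq_zero (B : OpenBook h o) (hc : IsContactForm o lam)
    (hs : B.Supports lam) {e : Fin 2 → ∀ y : Y, 𝕋 y} {σ : Framing o}
    (hσ : ∀ y, (σ.sec y).1 = ⟨y, ![e 0 y, e 1 y, reeb hc y]⟩)
    (he : ∀ p ∉ range latticePt, ∀ s : ℝ, 0 ≤ s → ∃ u, extd lam (B.tor (p, 0))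
        (e 0 (B.tor (p, 0)) + s • mfderiv 𝓘(ℝ, (ℝ × ℝ) × ℝ) (𝓡 3) B.tor (p, 0) ((1, 0), 0)) u ≠ 0)
    {γ : 𝕀 → ℝ × ℝ} (hγ : Continuous γ) (hγ' : ∀ t, γ t ∉ range latticePt)
    {m : ℤ × ℤ} (hm : γ 1 = γ 0 + latticePt m) :
    IsLoop (IsPos o) (fun t => pf B.tor torVec (γ t, 0)) ∧
    σ.spin.cls.ev (fun t => pf B.tor torVec (γ t, 0)) = 0 := by
  have hx : ∀ t, ((γ t, 0) : (ℝ × ℝ) × ℝ) ∈ punct := hγ'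
  have hG : IsLoop (IsPos o) fun t => pf B.tor torVec (γ t, 0) := by
    refine ⟨fun t => B.isParam_tor.isPos (hx t),
      B.isParam_tor.continuous_pf (hγ.prodMk continuous_const) hx, ?_⟩
    have h1 : B.tor (γ 0, 0) = B.tor (γ 1, 0) := by
      rw [hm]; exact (B.tor_add_lattice (hx 0) m).symm
    refine tuple_ext h1 ?_
    ext i j
    have := B.tor_translate (hx 0) m (torVec i)
    rw [show (((γ 0, 0) : (ℝ × ℝ) × ℝ).1 + latticePt m, ((γ 0, 0) : (ℝ × ℝ) × ℝ).2) =
      ((γ 1, 0) : (ℝ × ℝ) × ℝ) by rw [hm]] at this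
    have h3 := congrArg (fun p : TangentBundle (𝓡 3) Y => (show E 3 from p.2) j) this
    exact h3
  refine ⟨hG, ?_⟩
  let y : 𝕀 → Y := fun t => B.tor (γ t, 0)
  have hy : Continuous y := continuous_tuple_base.comp hG.2.1
  have hy' : y 0 = y 1 := congrArg Tuple.base hG.2.2
  let S : 𝕀 → Tuple 3 Y := fun t => ⟨y t, ![e 0 (y t), e 1 (y t), reeb hc (y t)]⟩
  have hS : ∀ t, S t = σ.tuple (y t) := fun t => (hσ (y t)).symm
  have hSl : IsLoop (IsPos o) S := by
    rw [show S = fun t => σ.tuple (y t) from funext hS]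
    exact ⟨fun t => σ.isPos _, σ.continuous_tuple.comp hy, by simp only [hy']⟩
  let R : 𝕀 → Tuple 3 Y := fun t => ⟨y t, ![(pf B.tor torVec (γ t, 0)).vec 0,
    (pf B.tor torVec (γ t, 0)).vec 1, reeb hc (y t)]⟩
  have hd : ∀ t, 0 < extd lam (y t) ((pf B.tor torVec (γ t, 0)).vec 0)
    ((pf B.tor torVec (γ t, 0)).vec 1) := fun t => hs.2 _ (hx t)
  have hR : IsLoop (IsPos o) R := by
    refine ⟨fun t => ⟨trivial, pos_reeb hc (hd t)⟩, ?_, ?_⟩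
    · refine continuous_iff_continuousAt.2 fun t => continuousAt_tuple_of_tot fun i => ?_
      fin_cases i
      · exact ContinuousAt.tot (F := fun t => pf B.tor torVec (γ t, 0)) hG.2.1.continuousAt 0
      · exact ContinuousAt.tot (F := fun t => pf B.tor torVec (γ t, 0)) hG.2.1.continuousAt 1
      · exact ((continuous_reeb hc).comp hy).continuousAt
    · have h3 : ∀ (f g : Tuple 3 Y), f = g →
        (⟨f.base, ![f.vec 0, f.vec 1, reeb hc f.base]⟩ : Tuple 3 Y) =
        ⟨g.base, ![g.vec 0, g.vec 1, reeb hc g.base]⟩ := by rintro f _ rfl; rfl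
      exact h3 _ _ hG.2.2
  have h1 : σ.spin.cls.ev S = 0 := by
    rw [show S = fun t => σ.tuple (y t) from funext hS]
    exact (isInducedBy_iff _ _).1 σ.isInducedBy_spin y hy hy'
  obtain ⟨h2, h3⟩ := ev_add_coeff σ.spin hSl hR fun t => rfl
  obtain ⟨h4, h5⟩ := ev_add_coeff σ.spin hR hG fun t => rfl
  have key := fun t => coeff_rows_of_extd hc (e₀ := e 0 (y t)) (e₁ := e 1 (y t))
    (hR.1 t).isUnit (he _ (hγ' t))
  rw [kap_eq_zero_of_slit h2 (fun t => (key t).1) fun t => (key t).2, h1, add_zero] at h3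
  rw [kap_eq_zero_of_rows h4 fun t j => ⟨coeff_row (hG.1 t).isUnit rfl j,
    coeff_row (hG.1 t).isUnit rfl j⟩, add_zero, ← h3] at h5
  exact h5.symm

/-- `Θ` vanishes on the loops of constant frames in the page over `0`. -/
def OpenBook.IsTrivialOnPage (B : OpenBook h o) (Θ : SpinStructure o univ) : Prop :=
  ∀ γ : 𝕀 → ℝ × ℝ, Continuous γ → (∀ t, γ t ∉ range latticePt) →
    ∀ m : ℤ × ℤ, γ 1 = γ 0 + latticePt m → IsLoop (IsPos o) (fun t => pf B.tor torVec (γ t, 0)) ∧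
      Θ.cls.ev (fun t => pf B.tor torVec (γ t, 0)) = 0

lemma OpenBook.exists_spin [T2Space Y] [CompactSpace Y] (B : OpenBook h o) {P : M2 ℤ}
    (T : IsTwist h (-P)) (hP : ∀ i j, 0 ≤ P i j) (hc : IsContactForm o lam)
    (hs : B.Supports lam) :
    (∃ e, IsTrivialization lam e) ∧
    (∀ e e', IsTrivialization lam e → IsTrivialization lam e' → TrivializationsHomotopic lam e e') ∧
    ∃ Θ : SpinStructure o univ, (∀ e, IsTrivialization lam e →
        ∀ Θ' : SpinStructure o univ, IsInducedByTrivialization lam e Θ' ↔ Θ' = Θ) ∧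
      B.IsTrivialOnPage Θ := by
  obtain ⟨w, hw, hw1, hw2⟩ := B.exists_vectorField T hc hs
  obtain ⟨e, he, he0⟩ := exists_trivialization hc w hw (by
    intro y hy
    obtain ⟨u, hu⟩ := hw1 y
    rw [hy, extd_smul_left, extd_reeb, mul_zero] at hu
    exact hu rfl)
  have hhom : ∀ e e', IsTrivialization lam e → IsTrivialization lam e' →
      TrivializationsHomotopic lam e e' := fun e e' h1 h2 =>
    trivializationsHomotopic_of_log hc (B.exists_log T hP) h1 h2
  obtain ⟨σ, hσ⟩ := exists_framing hc he (continuous_reeb hc) fun y => by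
    rw [lam_reeb]; exact one_pos
  refine ⟨⟨e, he⟩, hhom, σ.spin, fun e' he' Θ' =>
    isInducedByTrivialization_iff hc hhom he hσ he' Θ', fun γ hγ hγ' m hm =>
    B.ev_page_eq_zero hc hs hσ ?_ hγ hγ' hm⟩
  intro p hp s hs0
  obtain ⟨u, hu⟩ := hw2 p hp s hs0
  refine ⟨u, fun h0 => hu ?_⟩
  rw [he0] at h0
  refine Eq.trans ?_ h0
  rw [extd_add_left, extd_add_left, extd_add_left, extd_smul_left, extd_smul_left (lam := lam) (reeb hc _), extd_reeb, mul_zero, add_zero]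

abbrev R3 := ℝ × ℝ × ℝ

def std3 : Fin 3 → R3 := ![(1, 0, 0), (0, 1, 0), (0, 0, 1)]

lemma fderiv_std3 {ι : R3 → V} {x : R3}
    {ι' : R3 →L[ℝ] V} (hι : HasFDerivAt ι ι' x) {r : Fin 3 → V}
    (h0 : HasDerivAt (fun a => ι (a, x.2.1, x.2.2)) (r 0) x.1)
    (h1 : HasDerivAt (fun a => ι (x.1, a, x.2.2)) (r 1) x.2.1)
    (h2 : HasDerivAt (fun a => ι (x.1, x.2.1, a)) (r 2) x.2.2) (i : Fin 3) :
    ι' (std3 i) = r i := by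
  have key : ∀ (γ : ℝ → R3) (a : ℝ) (v : R3) (w : V), HasDerivAt γ v a → γ a = x →
      HasDerivAt (fun a => ι (γ a)) w a → ι' v = w := by
    intro γ a v w hγ ha hw
    rw [← ha] at hι
    exact (hι.comp_hasDerivAt a hγ).unique hw
  fin_cases i
  · exact key _ _ _ _ ((hasDerivAt_id x.1).prodMk ((hasDerivAt_const _ _).prodMk
      (hasDerivAt_const _ _))) rfl h0
  · exact key _ _ _ _ ((hasDerivAt_const _ _).prodMk ((hasDerivAt_id x.2.1).prodMk
      (hasDerivAt_const _ _))) rfl h1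
  · exact key _ _ _ _ ((hasDerivAt_const _ _).prodMk ((hasDerivAt_const _ _).prodMk
      (hasDerivAt_id x.2.2))) rfl h2

lemma contDiff_invStereo : ContDiff ℝ ∞ fun x : E 3 => (invStereo x : EuclideanSpace ℝ (Fin (3 + 1))) := by
  have h : ∀ x : E 3, ‖x‖ ^ 2 + 1 ≠ 0 := fun x => by positivity
  rw [contDiff_piLp]
  intro i
  have hn : ContDiff ℝ ∞ fun x : E 3 => ‖x‖ ^ 2 := contDiff_norm_sq ℝ
  have hc : ∀ j : Fin 3, ContDiff ℝ ∞ fun x : E 3 => x j := fun j =>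
    (EuclideanSpace.proj (𝕜 := ℝ) j).contDiff
  fin_cases i
  · exact (contDiff_const.mul (hc 0)).div (hn.add contDiff_const) h
  · exact (contDiff_const.mul (hc 1)).div (hn.add contDiff_const) h
  · exact (contDiff_const.mul (hc 2)).div (hn.add contDiff_const) h
  · exact (hn.sub contDiff_const).div (hn.add contDiff_const) h

lemma contMDiff_invStereo : ContMDiff 𝓘(ℝ, E 3) (𝓡 3) ∞ invStereo :=
  haveI : Fact (Module.finrank ℝ (EuclideanSpace ℝ (Fin (3 + 1))) = 3 + 1) :=
    ⟨finrank_euclideanSpace_fin⟩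
  ContMDiff.codRestrict_sphere contDiff_invStereo.contMDiff _

lemma invStereo_injective : Injective invStereo := by
  intro x y h
  have h0 : ∀ z : E 3, ‖z‖ ^ 2 + 1 ≠ 0 := fun z => by positivity
  have hv := congrArg (Subtype.val) h
  have h3 : (‖x‖ ^ 2 - 1) / (‖x‖ ^ 2 + 1) = (‖y‖ ^ 2 - 1) / (‖y‖ ^ 2 + 1) := by
    simpa [invStereo] using congrArg (fun v : EuclideanSpace ℝ (Fin (3 + 1)) => v 3) hv
  have hn : ‖x‖ ^ 2 = ‖y‖ ^ 2 := by
    rw [div_eq_div_iff (h0 x) (h0 y)] at h3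
    linarith
  ext i
  have hi : 2 * x i / (‖x‖ ^ 2 + 1) = 2 * y i / (‖y‖ ^ 2 + 1) := by
    fin_cases i
    · simpa [invStereo] using congrArg (fun v : EuclideanSpace ℝ (Fin (3 + 1)) => v 0) hv
    · simpa [invStereo] using congrArg (fun v : EuclideanSpace ℝ (Fin (3 + 1)) => v 1) hv
    · simpa [invStereo] using congrArg (fun v : EuclideanSpace ℝ (Fin (3 + 1)) => v 2) hv
  rw [hn, div_left_inj' (h0 y)] at hi
  linarith

def chain (N k : ℕ) (ε : ℝ) (v : R3) : R3 := ((3 + v.1) * cos (τ * k / N + 5 * π / (4 * N) * v.2.1),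
    (3 + v.1) * sin (τ * k / N + 5 * π / (4 * N) * v.2.1),
    v.2.2 + ε * v.1 * (1 + v.2.1))

/-- The linear coordinates on `E 3`. -/
def toE (v : R3) : E 3 := !₂[v.1, v.2.1, v.2.2]

lemma chainMap_eq (N k : ℕ) (ε : ℝ) (v : R3) :
    chainMap N k ε v.1 v.2.1 v.2.2 = toE (chain N k ε v) := rfl

def toEL : R3 →L[ℝ] E 3 := LinearMap.toContinuousLinearMap
    { toFun := toE
      map_add' := fun u v => by ext i; fin_cases i <;> simp [toE]
      map_smul' := fun c v => by ext i; fin_cases i <;> simp [toE] }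

lemma toEL_apply (v : R3) : toEL v = toE v := rfl

lemma toE_injective : Injective toE := by
  intro u v h
  have h0 := congrArg (fun v : E 3 => v 0) h
  have h1 := congrArg (fun v : E 3 => v 1) h
  have h2 := congrArg (fun v : E 3 => v 2) h
  simp [toE] at h0 h1 h2
  exact Prod.ext h0 (Prod.ext h1 h2)

lemma toE_std3 (i : Fin 3) : toE (std3 i) = EuclideanSpace.single i 1 := by
  ext j
  fin_cases i <;> fin_cases j <;> simp [toE, std3]

/-- The Jacobian matrix of `chain`; its rows are the partial derivatives. -/
def chainJac (N k : ℕ) (ε : ℝ) (v : R3) : M3 :=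
  let A := τ * k / N + 5 * π / (4 * N) * v.2.1
  !![cos A, sin A, ε * (1 + v.2.1);
    (3 + v.1) * (-sin A * (5 * π / (4 * N))),
    (3 + v.1) * (cos A * (5 * π / (4 * N))), ε * v.1;
    0, 0, 1]

lemma isGL_chainJac {N : ℕ} (hN : 0 < N) (k : ℕ) (ε : ℝ) {v : R3} (hv : -3 < v.1) :
    IsGL (chainJac N k ε v) := by
  have e : (chainJac N k ε v).det = (3 + v.1) * (5 * π / (4 * N)) := by
    have := sin_sq_add_cos_sq (τ * k / N + 5 * π / (4 * N) * v.2.1)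
    simp [chainJac, det_fin_three]
    linear_combination (3 + v.1) * (5 * π / (4 * N)) * this
  unfold IsGL
  rw [e]
  have h1 : (0 : ℝ) < N := by exact_mod_cast hN
  have := pi_pos
  have h2 : 0 < 3 + v.1 := by linarith
  positivity

lemma contDiff_chain (N k : ℕ) (ε : ℝ) : ContDiff ℝ ∞ (chain N k ε) := by
  unfold chain
  have h1 : ContDiff ℝ ∞ fun v : R3 => v.1 := contDiff_fst
  have h2 : ContDiff ℝ ∞ fun v : R3 => v.2.1 := contDiff_fst.comp contDiff_snd
  have h3 : ContDiff ℝ ∞ fun v : R3 => v.2.2 := contDiff_snd.comp contDiff_snd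
  have h4 : ContDiff ℝ ∞ fun v : R3 => τ * k / N + 5 * π / (4 * N) * v.2.1 :=
    contDiff_const.add (contDiff_const.mul h2)
  exact ((contDiff_const.add h1).mul (Real.contDiff_cos.comp h4)).prodMk
    (((contDiff_const.add h1).mul (Real.contDiff_sin.comp h4)).prodMk
      (h3.add ((contDiff_const.mul h1).mul (contDiff_const.add h2))))

lemma fderiv_chain (N k : ℕ) (ε : ℝ) (v : R3) (i : Fin 3) :
    fderiv ℝ (chain N k ε) v (std3 i) = ∑ j, chainJac N k ε v i j • std3 j := by
  have hd : HasFDerivAt (chain N k ε) (fderiv ℝ (chain N k ε) v) v :=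
    ((contDiff_chain N k ε).differentiable (by norm_cast)).differentiableAt.hasFDerivAt
  refine fderiv_std3 hd (r := fun i => ∑ j, chainJac N k ε v i j • std3 j) ?_ ?_ ?_ i <;>
    simp only [chain]
  · have h1 : HasDerivAt (fun a : ℝ => 3 + a) 1 v.1 := (hasDerivAt_id' v.1).const_add 3
    refine ((h1.mul_const _).prodMk ((h1.mul_const _).prodMk
      ((((hasDerivAt_id' v.1).const_mul ε).mul_const (1 + v.2.1)).const_add v.2.2))).congr_deriv ?_
    simp [sum_univ_three, chainJac, std3]
  · have h1 : HasDerivAt (fun a : ℝ => τ * k / N + 5 * π / (4 * N) * a)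
        (5 * π / (4 * N)) v.2.1 := by
      simpa using ((hasDerivAt_id' v.2.1).const_mul (5 * π / (4 * N))).const_add
        (τ * k / N)
    refine ((h1.cos.const_mul _).prodMk ((h1.sin.const_mul _).prodMk
      ((((hasDerivAt_id' v.2.1).const_add 1).const_mul (ε * v.1)).const_add v.2.2))).congr_deriv ?_
    simp [sum_univ_three, chainJac, std3]
  · refine ((hasDerivAt_const _ _).prodMk ((hasDerivAt_const _ _).prodMk
      ((hasDerivAt_id' v.2.2).add_const (ε * v.1 * (1 + v.2.1))))).congr_deriv ?_
    simp [sum_univ_three, chainJac, std3]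

lemma chain_eq_iff {N : ℕ} (hN : 0 < N) {k l : ℕ} {ε ε' : ℝ} {v w : R3} (hv : -3 < v.1)
    (hw : -3 < w.1) : chain N k ε v = chain N l ε' w ↔ v.1 = w.1 ∧
      (∃ m : ℤ, v.2.1 = w.2.1 + 8 / 5 * (l - k + m * N)) ∧
      v.2.2 + ε * v.1 * (1 + v.2.1) = w.2.2 + ε' * w.1 * (1 + w.2.1) := by
  have hN' : (N : ℝ) ≠ 0 := by positivity
  have hp := Real.pi_ne_zero
  have hang : ∀ m : ℤ, (v.2.1 = w.2.1 + 8 / 5 * (l - k + m * N) ↔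
      τ * k / N + 5 * π / (4 * N) * v.2.1 =
      τ * l / N + 5 * π / (4 * N) * w.2.1 + τ * m) := by
    intro m
    constructor
    · intro h
      rw [h]
      field_simp
      ring
    · intro h
      field_simp at h
      linarith
  unfold chain
  simp only [Prod.mk.injEq]
  constructor
  · rintro ⟨h1, h2, h3⟩
    set A := τ * k / N + 5 * π / (4 * N) * v.2.1
    set B := τ * l / N + 5 * π / (4 * N) * w.2.1
    have hA := sin_sq_add_cos_sq A
    have hB := sin_sq_add_cos_sq B
    have hr : (3 + v.1) ^ 2 = (3 + w.1) ^ 2 := by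
      have e1 := congrArg (· ^ 2) h1
      have e2 := congrArg (· ^ 2) h2
      simp only [mul_pow] at e1 e2
      linear_combination e1 + e2 - (3 + v.1) ^ 2 * hA + (3 + w.1) ^ 2 * hB
    have hr' : 3 + v.1 = 3 + w.1 := by
      rw [sq_eq_sq₀ (by linarith) (by linarith)] at hr
      exact hr
    refine ⟨by linarith, ?_, h3⟩
    rw [hr'] at h1 h2
    have h4 : 3 + w.1 ≠ 0 := by linarith
    have h5 := mul_left_cancel₀ h4 h1
    have h6 := mul_left_cancel₀ h4 h2
    have h7 : (A : Real.Angle) = B := Real.Angle.cos_sin_inj h5 h6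
    rw [Real.Angle.angle_eq_iff_two_pi_dvd_sub] at h7
    obtain ⟨m, hm⟩ := h7
    exact ⟨m, (hang m).2 (by linarith)⟩
  · rintro ⟨h1, ⟨m, h2⟩, h3⟩
    rw [(hang m).1 h2, h1]
    refine ⟨?_, ?_, by rw [← h3, h1]⟩
    · rw [mul_comm τ (m : ℝ), Real.cos_add_int_mul_two_pi]
    · rw [mul_comm τ (m : ℝ), Real.sin_add_int_mul_two_pi]

lemma component_eq (N k : ℕ) (s : ℝ) :
    component N k s = toE (chain N k (claspSign N k) (cos s, sin s, 0)) := rfl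

/-- The complement of the link in the coordinates around its `k`-th component. -/
def linkCompl (c : List ℕ) (k : ℕ) : Set R3 :=
  {v | -3 < v.1 ∧ invStereo (toE (chain c.length k (claspSign c.length k) v)) ∉ link c}

lemma mem_link_iff {c : List ℕ} {x : E 3} :
    invStereo x ∈ link c ↔ ∃ l < c.length, ∃ s : ℝ, x = component c.length l s := by
  constructor
  · rintro ⟨y, hy, h⟩
    rwa [invStereo_injective h] at hy
  · exact fun h => ⟨x, h, rfl⟩

lemma mem_linkCompl {c : List ℕ} {k : ℕ} (hN : 0 < c.length) {v : R3} (hX : -3 < v.1)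
    (hY : |v.2.1| < 11 / 5) (h : ∀ j : ℤ, (j = -1 ∨ j = 0 ∨ j = 1) → ∀ l < c.length,
      (∃ m : ℤ, j = l - k + m * c.length) → v.1 ^ 2 + (v.2.1 - 8 / 5 * j) ^ 2 = 1 →
      v.2.2 ≠ v.1 * (claspSign c.length l * (1 + v.2.1 - 8 / 5 * j) -
        claspSign c.length k * (1 + v.2.1))) : v ∈ linkCompl c k := by
  refine ⟨hX, fun hm => ?_⟩
  obtain ⟨l, hl, s, hs⟩ := mem_link_iff.1 hm
  rw [component_eq] at hs
  have hc := neg_one_le_cos s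
  obtain ⟨h1, ⟨m, h2⟩, h3⟩ := (chain_eq_iff hN hX (by simp; linarith)).1 (toE_injective hs)
  simp only at h1 h2 h3
  have hs1 := neg_one_le_sin s
  have hs2 := sin_le_one s
  have hj : (l : ℤ) - k + m * c.length = -1 ∨ (l : ℤ) - k + m * c.length = 0 ∨
      (l : ℤ) - k + m * c.length = 1 := by
    obtain ⟨h4, h5⟩ := abs_lt.1 hY
    have h6 : (((l : ℤ) - k + m * c.length : ℤ) : ℝ) = (l : ℝ) - k + m * c.length := by push_cast; ring
    have h7 : (((l : ℤ) - k + m * c.length : ℤ) : ℝ) < 2 := by rw [h6]; linarith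
    have h8 : (-2 : ℝ) < (((l : ℤ) - k + m * c.length : ℤ) : ℝ) := by rw [h6]; linarith
    have h9 : (l : ℤ) - k + m * c.length < 2 := by exact_mod_cast h7
    have h10 : -2 < (l : ℤ) - k + m * c.length := by exact_mod_cast h8
    omega
  have h4 : v.2.1 - 8 / 5 * (((l : ℤ) - k + m * c.length : ℤ) : ℝ) = sin s := by
    push_cast; linarith
  refine h _ hj l hl ⟨m, rfl⟩ ?_ ?_
  · rw [h4, h1]; have := sin_sq_add_cos_sq s; linarith
  · have h5 : 1 + v.2.1 - 8 / 5 * (((l : ℤ) - k + m * c.length : ℤ) : ℝ) = 1 + sin s := by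
      linarith
    rw [h5]
    rw [h1] at h3 ⊢
    linarith

lemma isCompact_component (N k : ℕ) : IsCompact (range (component N k)) := by
  have hc : Continuous (component N k) := by
    have : component N k = fun s => toE (chain N k (claspSign N k) (cos s, sin s, 0)) := rfl
    rw [this]
    exact toEL.continuous.comp ((contDiff_chain N k _).continuous.comp (by fun_prop))
  have : range (component N k) = component N k '' Icc 0 (0 + τ) := by
    refine (Function.Periodic.image_Icc (fun s => ?_) (by positivity) 0).symm
    simp [component]
  rw [this]
  exact isCompact_Icc.image hc

lemma isClosed_link (c : List ℕ) : IsClosed (link c) := by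
  have : {x | ∃ k < c.length, ∃ s : ℝ, x = component c.length k s} =
      ⋃ k ∈ Set.Iio c.length, range (component c.length k) := by
    ext x
    simp [eq_comm]
  have hK : IsCompact {x | ∃ k < c.length, ∃ s : ℝ, x = component c.length k s} := by
    rw [this]
    exact (Set.finite_Iio _).isCompact_biUnion fun k _ => isCompact_component _ k
  exact (hK.image contMDiff_invStereo.continuous).isClosed

lemma isOpen_linkCompl (c : List ℕ) (k : ℕ) : IsOpen (linkCompl c k) := by
  refine (isOpen_lt continuous_const continuous_fst).inter ?_
  exact (isClosed_link c).isOpen_compl.preimage (contMDiff_invStereo.continuous.comp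
    (toEL.continuous.comp (contDiff_chain _ _ _).continuous))

namespace SurgeryPresentation

variable (D : SurgeryPresentation c o)

/-- The link complement in the coordinates around the `k`-th component. -/
def comp (k : ℕ) (v : R3) : Y := D.ext (invStereo (toE (chain c.length k (claspSign c.length k) v)))

lemma isParam_ext : IsParam o (fun x => D.ext (invStereo x)) {x | invStereo x ∉ link c}
    fun i => (EuclideanSpace.single i 1 : E 3) where
  isOpen := (isClosed_link c).isOpen_compl.preimage contMDiff_invStereo.continuous
  smooth := D.ext_smooth.comp contMDiff_invStereo.contMDiffOn fun _ hx => hx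
  pos := D.ext_pos

lemma isParam_comp (hN : 0 < c.length) (k : ℕ) : IsParam o (D.comp k) (linkCompl c k) std3 := by
  have h1 : IsParam o ((fun x => D.ext (invStereo x)) ∘ toEL) {v | invStereo (toE v) ∉ link c}
      std3 := by
    refine D.isParam_ext.comp (J := fun _ => 1) ?_ toEL.contDiff.contDiffOn (fun v hv => hv) ?_ ?_
    · exact (isClosed_link c).isOpen_compl.preimage (contMDiff_invStereo.continuous.comp
        toEL.continuous)
    · intro v _ i
      rw [toEL.fderiv, toEL_apply, toE_std3]
      simp [Matrix.one_apply]
    · exact fun _ _ => isGL_one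
  exact h1.comp (isOpen_linkCompl c k) (contDiff_chain _ _ _).contDiffOn (fun v hv => hv.2)
    (fun v _ i => fderiv_chain _ _ _ v i) fun v hv => isGL_chainJac hN _ _ hv.1

end SurgeryPresentation

lemma claspSign_eq (N k : ℕ) : claspSign N k = 1 ∨ claspSign N k = -1 := by
  unfold claspSign; split_ifs <;> simp

lemma claspSign_of_lt {N k : ℕ} (h : k + 1 < N) : claspSign N k = 1 := by
  unfold claspSign; rw [if_neg (by omega)]

/-- The torus of radius `ρ / 10` around a component. -/
def tube (ρ s ψ : ℝ) : R3 := ((1 + ρ / 10 * cos ψ) * cos s, (1 + ρ / 10 * cos ψ) * sin s,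
    ρ / 10 * sin ψ)

@[fun_prop] theorem continuous_tube {ρ s ψ : X → ℝ}
    (h1 : Continuous ρ) (h2 : Continuous s) (h3 : Continuous ψ) :
    Continuous fun x => tube (ρ x) (s x) (ψ x) := by
  unfold tube
  fun_prop

lemma eq_of_offset_zero {N k l : ℕ} (hk : k < N) (hl : l < N) {m : ℤ}
    (h : (0 : ℤ) = l - k + m * N) : l = k := by
  have h1 : m = 0 := by
    by_contra hm
    rcases lt_or_gt_of_ne hm with h2 | h2
    · have : m * N ≤ -1 * N := mul_le_mul_of_nonneg_right (by omega) (by omega)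
      omega
    · have : 1 * (N : ℤ) ≤ m * N := mul_le_mul_of_nonneg_right (by omega) (by omega)
      omega
  subst h1
  omega

lemma eq_of_offset_neg_one {N k l : ℕ} (hk : k < N) (hk1 : 1 ≤ k) (hl : l < N) {m : ℤ}
    (h : (-1 : ℤ) = l - k + m * N) : l + 1 = k := by
  have h1 : m = 0 := by
    by_contra hm
    rcases lt_or_gt_of_ne hm with h2 | h2
    · have : m * N ≤ -1 * N := mul_le_mul_of_nonneg_right (by omega) (by omega)
      omega
    · have : 1 * (N : ℤ) ≤ m * N := mul_le_mul_of_nonneg_right (by omega) (by omega)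
      omega
  subst h1
  omega

lemma tube_mem {c : List ℕ} {k : ℕ} (hk : k < c.length) {ρ : ℝ} (h0 : 0 < ρ) (h1 : ρ ≤ 1)
    (s ψ : ℝ) : tube ρ s ψ ∈ linkCompl c k := by
  have hcψ := neg_one_le_cos ψ
  have hcψ' := cos_le_one ψ
  have hsψ := neg_one_le_sin ψ
  have hsψ' := sin_le_one ψ
  have hs := sin_sq_add_cos_sq s
  have hψ := sin_sq_add_cos_sq ψ
  set r := 1 + ρ / 10 * cos ψ with hr
  have hb : ∀ a : ℝ, -1 ≤ a → a ≤ 1 → -(1 / 10) ≤ ρ / 10 * a ∧ ρ / 10 * a ≤ 1 / 10 :=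
    fun a h2 h3 => ⟨by nlinarith, by nlinarith⟩
  have hr1 : 9 / 10 ≤ r := by linarith [(hb _ hcψ hcψ').1]
  have hr2 : r ≤ 11 / 10 := by linarith [(hb _ hcψ hcψ').2]
  set X := r * cos s with hX
  set Y := r * sin s with hY
  have hXY : X ^ 2 + Y ^ 2 = r ^ 2 := by rw [hX, hY]; linear_combination r ^ 2 * hs
  have hrr1 : 81 / 100 ≤ r ^ 2 := by
    have := pow_le_pow_left₀ (by norm_num) hr1 2
    linarith
  have hrr2 : r ^ 2 ≤ 121 / 100 := by
    have := pow_le_pow_left₀ (by linarith) hr2 2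
    linarith
  have hZ1 : |ρ / 10 * sin ψ| ≤ 1 / 10 := abs_le.2 (hb _ hsψ hsψ')
  have hYb : |Y| < 11 / 5 :=
    abs_lt_of_sq_lt_sq (by linarith [sq_nonneg X]) (by norm_num)
  have hXb : -3 < X :=
    (abs_lt.1 (abs_lt_of_sq_lt_sq (by linarith [sq_nonneg Y]) (by norm_num : (0 : ℝ) ≤ 3))).1
  refine mem_linkCompl (v := (X, Y, ρ / 10 * sin ψ)) (by omega) hXb hYb ?_
  intro j hj l hl hm h2 h3
  simp only at h2 h3
  have hc1 := claspSign_eq c.length l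
  have hc2 := claspSign_eq c.length k
  have big : ∀ a : ℝ, 8 / 5 ≤ |a| → 1 / 5 ≤ X ^ 2 → ρ / 10 * sin ψ = X * a → False := by
    intro a ha hx he
    rw [he, abs_mul] at hZ1
    have h5 : 2 / 5 ≤ |X| := by
      refine le_of_not_gt fun h6 => ?_
      have h7 : |X| ^ 2 < (2 / 5) ^ 2 := pow_lt_pow_left₀ h6 (abs_nonneg X) two_ne_zero
      rw [sq_abs] at h7
      norm_num at h7
      linarith
    have h8 := mul_le_mul h5 ha (by norm_num) (abs_nonneg X)
    norm_num at h8
    linarith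
  rcases hj with rfl | rfl | rfl
  · push_cast at h2 h3
    have hY1 : Y = -((r ^ 2 + 39 / 25) * (5 / 16)) := by linarith
    have hY2 : -(7 / 8) ≤ Y := by linarith
    have hY3 : Y ≤ -(7 / 10) := by linarith
    have hx : 1 / 5 ≤ X ^ 2 := by
      have := mul_nonneg (show (0 : ℝ) ≤ Y + 7 / 8 by linarith) (show (0 : ℝ) ≤ -(7 / 10) - Y by linarith)
      linarith
    refine big _ ?_ hx h3
    rcases hc1 with e1 | e1 <;> rcases hc2 with e2 | e2 <;> rw [e1, e2, le_abs] <;> first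
      | (left; linarith)
      | (right; linarith)
  · obtain ⟨m, hm⟩ := hm
    obtain rfl := eq_of_offset_zero hk hl hm
    push_cast at h2 h3
    have h4 : ρ / 10 * sin ψ = 0 := by rw [h3]; ring
    have h5 : sin ψ = 0 := by
      rcases mul_eq_zero.1 h4 with h | h
      · linarith
      · exact h
    have h6 : r ^ 2 = 1 := by linarith
    have h7 : r = 1 := (pow_eq_one_iff_of_nonneg (by linarith) two_ne_zero).1 h6
    have h8 : cos ψ = 0 := by
      have : ρ / 10 * cos ψ = 0 := by linarith
      rcases mul_eq_zero.1 this with h | h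
      · linarith
      · exact h
    rw [h5, h8] at hψ
    norm_num at hψ
  · push_cast at h2 h3
    have hY1 : Y = (r ^ 2 + 39 / 25) * (5 / 16) := by linarith
    have hY2 : Y ≤ 7 / 8 := by linarith
    have hY3 : 7 / 10 ≤ Y := by linarith
    have hx : 1 / 5 ≤ X ^ 2 := by
      have := mul_nonneg (show (0 : ℝ) ≤ 7 / 8 - Y by linarith) (show (0 : ℝ) ≤ Y - 7 / 10 by linarith)
      linarith
    refine big _ ?_ hx h3
    rcases hc1 with e1 | e1 <;> rcases hc2 with e2 | e2 <;> rw [e1, e2, le_abs] <;> first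
      | (left; linarith)
      | (right; linarith)

lemma disc_mem {c : List ℕ} {k : ℕ} (hN : 0 < c.length) {X Y : ℝ} (h : X ^ 2 + Y ^ 2 < 1)
    (h1 : ¬ (X = 0 ∧ Y = 3 / 5)) (h2 : ¬ (X = 0 ∧ Y = -(3 / 5))) :
    ((X, Y, 0) : R3) ∈ linkCompl c k := by
  have hY : |Y| < 1 := by rw [← sq_lt_one_iff_abs_lt_one]; nlinarith [sq_nonneg X]
  obtain ⟨hY1, hY2⟩ := abs_lt.1 hY
  refine mem_linkCompl hN (by simp only; nlinarith [sq_nonneg Y, sq_nonneg (X + 1)])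
    (by simp only; linarith) ?_
  intro j hj l hl hm h3 h4
  simp only at h3 h4
  have h4' := h4.symm
  rcases hj with rfl | rfl | rfl
  · push_cast at h3 h4'
    rcases mul_eq_zero.1 h4' with h5 | h5
    · refine h2 ⟨h5, ?_⟩
      rw [h5] at h3
      have : (Y + 3 / 5) * (Y + 13 / 5) = 0 := by linarith
      rcases mul_eq_zero.1 this with h6 | h6 <;> linarith
    · rcases claspSign_eq c.length l with e1 | e1 <;> rcases claspSign_eq c.length k with e2 | e2 <;>
        rw [e1, e2] at h5 <;> linarith
  · push_cast at h3
    nlinarith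
  · push_cast at h3 h4'
    rcases mul_eq_zero.1 h4' with h5 | h5
    · refine h1 ⟨h5, ?_⟩
      rw [h5] at h3
      have : (Y - 3 / 5) * (Y - 13 / 5) = 0 := by linarith
      rcases mul_eq_zero.1 this with h6 | h6 <;> linarith
    · have hY3 : 3 / 5 ≤ Y := by nlinarith [sq_nonneg X]
      rcases claspSign_eq c.length l with e1 | e1 <;> rcases claspSign_eq c.length k with e2 | e2 <;>
        rw [e1, e2] at h5 <;> linarith

lemma near_mem {c : List ℕ} {k : ℕ} (hk : k + 1 < c.length) {σ : ℤ} (hσ : σ = 1 ∨ σ = -1 ∧ 1 ≤ k)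
    {X y Z : ℝ} (hX : |X| ≤ 1 / 10) (hy : |y| ≤ 1 / 10) (h : 0 ≤ σ * Z * X)
    (h' : X = 0 → Z = 0 → y ≠ 0) : ((X, σ * (3 / 5 + y), Z) : R3) ∈ linkCompl c k := by
  obtain ⟨hX1, hX2⟩ := abs_le.1 hX
  obtain ⟨hy1, hy2⟩ := abs_le.1 hy
  have e2 := claspSign_of_lt hk
  have hXX : X ^ 2 ≤ 1 / 100 := by nlinarith
  refine mem_linkCompl (by omega) (by simp only; linarith) ?_ ?_
  · rcases hσ with rfl | ⟨rfl, _⟩ <;> push_cast <;> rw [abs_lt] <;> constructor <;> linarith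
  intro j hj l hl hm h3 h4
  simp only at h3 h4
  rw [e2] at h4
  have key : ∀ a : ℝ, 0 < a → Z = -(σ : ℝ) * (X * a) → (σ : ℝ) * σ = 1 → (y - 1) ^ 2 + X ^ 2 = 1 → False := by
    intro a ha hZ hs hq
    have h5 : X ^ 2 * a ≤ 0 := by
      rw [hZ] at h
      have : (σ : ℝ) * (-σ * (X * a)) * X = -(X ^ 2 * a) * (σ * σ) := by ring
      rw [this, hs] at h
      linarith
    have h6 : X = 0 := by
      by_contra h7
      have : 0 < X ^ 2 := by positivity
      nlinarith
    refine h' h6 (by rw [hZ, h6]; ring) ?_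
    rw [h6] at hq
    have : y * (y - 2) = 0 := by linarith
    rcases mul_eq_zero.1 this with h7 | h7 <;> linarith
  rcases hσ with rfl | ⟨rfl, hk1⟩
  · push_cast at h3 h4
    rcases hj with rfl | rfl | rfl
    · push_cast at h3
      nlinarith [sq_nonneg X]
    · push_cast at h3
      nlinarith [sq_nonneg X]
    · push_cast at h3 h4
      rcases claspSign_eq c.length l with e1 | e1 <;> rw [e1] at h4
      · exact key (8 / 5) (by norm_num) (by rw [h4]; push_cast; ring) (by norm_num) (by linarith)
      · exact key (8 / 5 + 2 * y) (by linarith) (by rw [h4]; push_cast; ring) (by norm_num)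
          (by linarith)
  · push_cast at h3 h4
    rcases hj with rfl | rfl | rfl
    · obtain ⟨m, hm⟩ := hm
      have hl' := eq_of_offset_neg_one (by omega) hk1 hl hm
      rw [claspSign_of_lt (by omega)] at h4
      push_cast at h3 h4
      exact key (8 / 5) (by norm_num) (by rw [h4]; push_cast; ring) (by norm_num) (by linarith)
    · push_cast at h3
      nlinarith [sq_nonneg X]
    · push_cast at h3
      nlinarith [sq_nonneg X]

namespace LoopClass

variable {P : X → Prop} (δ : LoopClass P)

lemma val_symm {x : {x // P x}} (p : Path x x) : δ.val x p.symm = δ.val x p := by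
  have h := δ.trans x p p.symm
  rw [δ.homotopic x _ _ ⟨(Path.Homotopy.reflTransSymm p).symm⟩, δ.val_refl] at h
  have h2 : δ.val x p + (δ.val x p + δ.val x p.symm) = δ.val x p + 0 := by rw [← h]
  rw [← add_assoc, CharTwo.add_self_eq_zero, zero_add, add_zero] at h2
  exact h2

lemma val_eq_add_of_chord {x y : {x // P x}} (p : Path x y) (q : Path y x) (r : Path y x) :
    δ.val x (p.trans q) = δ.val x (p.trans r) + δ.val x (q.symm.trans r) := by
  rw [← δ.val_symm (q.symm.trans r), ← δ.trans]
  refine δ.homotopic x _ _ ?_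
  rw [Path.trans_symm, Path.symm_symm]
  have h1 : ((r.trans r.symm).trans q).Homotopic q :=
    (Path.Homotopic.hcomp ⟨(Path.Homotopy.reflTransSymm r).symm⟩ (Path.Homotopic.refl q)).trans
      ⟨Path.Homotopy.reflTrans q⟩
  have h2 : (r.trans (r.symm.trans q)).Homotopic q :=
    Path.Homotopic.trans ⟨(Path.Homotopy.transAssoc r r.symm q).symm⟩ h1
  have h3 : ((p.trans r).trans (r.symm.trans q)).Homotopic (p.trans q) :=
    Path.Homotopic.trans ⟨Path.Homotopy.transAssoc p r _⟩
      (Path.Homotopic.hcomp (Path.Homotopic.refl p) h2)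
  exact h3.symm

lemma ev_natMul {g : ℝ → X} (hg : Continuous g) (hP : ∀ t, P (g t)) (hper : ∀ t, g (t + 1) = g t)
    (n : ℕ) : δ.ev (fun t => g (n * t)) = n * δ.ev (fun t => g t) := by
  have hn : ∀ (n : ℕ) (x : ℝ), g (x + n) = g x := by
    intro n x
    induction n with
    | zero => simp
    | succ n ih => rw [Nat.cast_succ, ← add_assoc, hper, ih]
  induction n with
  | zero => simpa using δ.ev_const (g 0)
  | succ n ih =>
    rw [δ.ev_add_of_torus (fun s t => g (n * s + t)) (by fun_prop) (fun _ _ => hP _)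
      (fun s => by simp [hper]) (fun t => by simp [add_comm (n : ℝ), hn]) (fun t => ?_)
      (g := fun t => g (n * t)) (fun t => by simp) (k := fun t => g t) (fun t => by simp), ih]
    · push_cast; ring
    · push_cast; ring_nf

lemma ev_neg {g : ℝ → X} (hg : Continuous g) (hP : ∀ t, P (g t)) (hper : ∀ t, g (t + 1) = g t) :
    δ.ev (fun t => g (-t)) = δ.ev (fun t => g t) := by
  have h := δ.ev_add_of_torus (fun s t => g (t - s)) (by fun_prop) (fun _ _ => hP _)
      (fun s => by simp [← hper (-s), add_comm, sub_eq_add_neg]) (fun t => by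
        have := hper ((t : ℝ) - 1)
        simpa using this)
      (f := fun _ => g 0) (fun t => by simp)
      (g := fun t => g (-t)) (fun t => by simp) (k := fun t => g t) (fun t => by simp)
  rw [δ.ev_const] at h
  have h2 := congrArg (· + δ.ev (fun t => g t)) h
  beta_reduce at h2
  rw [zero_add, add_assoc, CharTwo.add_self_eq_zero, add_zero] at h2
  exact h2.symm

lemma ev_shift {g : ℝ → X} (hg : Continuous g) (hP : ∀ t, P (g t)) (hper : ∀ t, g (t + 1) = g t)
    (a : ℝ) : δ.ev (fun t => g (t + a)) = δ.ev (fun t => g t) :=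
  δ.ev_congr (fun s t => g (t + a - s * a)) (by unfold uncurry; fun_prop) (fun _ _ => hP _)
    (fun s => by
      have := hper (a - s * a)
      simp only [Icc.coe_zero, zero_add, Icc.coe_one]
      rw [← this]; congr 1; ring)
    (by simp) (by simp)

end LoopClass

variable {k : ℕ}

lemma two_pi_cos_add_one (t : ℝ) : cos (τ * (t + 1)) = cos (τ * t) := by
  rw [mul_add, mul_one, Real.cos_add_two_pi]

lemma two_pi_sin_add_one (t : ℝ) : sin (τ * (t + 1)) = sin (τ * t) := by
  rw [mul_add, mul_one, Real.sin_add_two_pi]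

namespace LoopClass

variable (δ : LoopClass fun v => v ∈ linkCompl c k)

def mer : ZMod 2 := δ.ev fun t => tube (1 / 2) 0 (τ * t)

lemma ev_tube (hk : k < c.length) (s : ℝ) :
    δ.ev (fun t => tube (1 / 2) s (τ * t)) = δ.mer := by
  refine δ.ev_congr (fun u t => tube (1 / 2) ((1 - u) * s) (τ * t)) ?_
    (fun u t => tube_mem hk (by norm_num) (by norm_num) _ _) (fun u => by simp [tube]) (by simp)
    (by simp)
  unfold uncurry
  fun_prop

lemma tube_add_one (s t : ℝ) : tube (1 / 2) s (τ * (t + 1)) = tube (1 / 2) s (τ * t) := by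
  simp only [tube, two_pi_cos_add_one, two_pi_sin_add_one]

lemma ev_tube_shift (hk : k < c.length) (s a : ℝ) :
    δ.ev (fun t => tube (1 / 2) s (τ * (t + a))) = δ.mer := by
  rw [δ.ev_shift (g := fun t => tube (1 / 2) s (τ * t)) (by fun_prop)
    (fun _ => tube_mem hk (by norm_num) (by norm_num) _ _) (tube_add_one s) a, δ.ev_tube hk]

lemma ev_tube_neg (hk : k < c.length) (s a : ℝ) :
    δ.ev (fun t => tube (1 / 2) s (τ * (-t + a))) = δ.mer := by
  rw [δ.ev_neg (g := fun t => tube (1 / 2) s (τ * (t + a))) (by fun_prop)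
    (fun _ => tube_mem hk (by norm_num) (by norm_num) _ _) (fun t => by
      rw [add_right_comm]; exact tube_add_one s _), δ.ev_tube_shift hk]

lemma ev_tube_mul (hk : k < c.length) (s : ℝ) (n : ℕ) :
    δ.ev (fun t => tube (1 / 2) s (-(n * (τ * t)))) = n * δ.mer := by
  rw [← δ.ev_tube_neg hk s 0, ← δ.ev_natMul (g := fun t => tube (1 / 2) s (τ * (-t + 0)))
    (by fun_prop) (fun _ => tube_mem hk (by norm_num) (by norm_num) _ _) (fun t => by
      rw [← tube_add_one]; congr 2; ring)]
  congr 1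
  funext t
  congr 1
  ring

lemma ev_parallel (hk : k < c.length) (n : ℕ) :
    δ.ev (fun t => tube (1 / 2) (τ * t) (-(n * (τ * t)))) =
      n * δ.mer + δ.ev fun t => tube (1 / 2) (τ * t) π := by
  have h := δ.ev_add_of_torus (fun u v => tube (1 / 2) (τ * u) (-(n * (τ * v))))
    (by unfold uncurry; fun_prop)
    (fun _ _ => tube_mem hk (by norm_num) (by norm_num) _ _)
    (fun u => by
      have := Real.cos_nat_mul_two_pi n
      have h2 : sin (n * τ) = 0 := by
        have := Real.sin_nat_mul_pi (n * 2)
        rw [← this]; congr 1; push_cast; ring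
      simp [tube, this, h2]) (fun v => by simp [tube])
    (fun t => rfl) (g := fun t => tube (1 / 2) (τ * t) 0) (fun t => by simp)
    (k := fun t => tube (1 / 2) (τ * (0 : 𝕀)) (-(n * (τ * t))))
    (fun t => rfl)
  rw [h, δ.ev_tube_mul hk, add_comm]
  congr 1
  refine δ.ev_congr (fun u t => tube (1 / 2) (τ * t) (u * π)) ?_
    (fun u t => tube_mem hk (by norm_num) (by norm_num) _ _) (fun u => by simp [tube]) (by simp)
    (by simp)
  unfold uncurry
  fun_prop

/-- The boundary of the upper or lower half of a disc. -/
def half (σ : ℝ) (t : ℝ) : R3 :=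
  if t ≤ 1 / 2 then (19 / 20 * cos (τ * t), σ * (19 / 20 * sin (τ * t)), 0)
  else (19 / 20 * (4 * t - 3), 0, 0)

lemma ev_circle (hN : 0 < c.length) :
    δ.ev (fun t => tube (1 / 2) (τ * t) π) =
      δ.ev (fun t => half 1 t) + δ.ev (fun t => half (-1) t) := by
  have hc : ∀ s : ℝ, ((19 / 20 * cos s, 19 / 20 * sin s, 0) : R3) ∈ linkCompl c k := by
    intro s
    have hs := sin_sq_add_cos_sq s
    refine disc_mem hN (by linarith) ?_ ?_ <;> rintro ⟨h1, h2⟩ <;> nlinarith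
  have hd : ∀ s ∈ Icc (-1 : ℝ) 1, ((19 / 20 * s, 0, 0) : R3) ∈ linkCompl c k := by
    rintro s ⟨h1, h2⟩
    refine disc_mem hN (by nlinarith) ?_ ?_ <;> rintro ⟨h1, h2⟩ <;> linarith
  have ht0 : ∀ t : 𝕀, (0 : ℝ) ≤ t := fun t => t.2.1
  have ht1 : ∀ t : 𝕀, (t : ℝ) ≤ 1 := fun t => t.2.2
  let x : {v // v ∈ linkCompl c k} := ⟨(19 / 20, 0, 0), by simpa using hc 0⟩
  let y : {v // v ∈ linkCompl c k} := ⟨(-(19 / 20), 0, 0), by simpa using hc π⟩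
  let p : Path x y :=
    { toFun := fun t => ⟨(19 / 20 * cos (π * t), 19 / 20 * sin (π * t), 0), hc _⟩
      continuous_toFun := by fun_prop
      source' := by simp [x]
      target' := by simp [y] }
  let q : Path y x :=
    { toFun := fun t => ⟨(19 / 20 * cos (π * (t + 1)),
        19 / 20 * sin (π * (t + 1)), 0), hc _⟩
      continuous_toFun := by fun_prop
      source' := by simp [y]
      target' := by
        have : π * (1 + 1) = τ := by ring
        simp [x, this] }
  let r : Path y x :=
    { toFun := fun t => ⟨(19 / 20 * (2 * t - 1), 0, 0), hd _ ⟨by linarith [ht0 t], by linarith [ht1 t]⟩⟩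
      continuous_toFun := by fun_prop
      source' := by simp [y]
      target' := by norm_num [x] }
  have h := δ.val_eq_add_of_chord p q r
  rw [← δ.ev_coe, ← δ.ev_coe, ← δ.ev_coe] at h
  have e1 : (fun t => ((p.trans q t : {v // v ∈ linkCompl c k}) : R3)) =
      fun t : 𝕀 => tube (1 / 2) (τ * t) π := by
    funext t
    rw [Path.trans_apply]
    split_ifs
    · simp only [p, tube]
      change (_, _, _) = (_, _, _)
      simp only [Real.cos_pi, Real.sin_pi]
      norm_num
      constructor <;> (congr 1; ring)
    · simp only [q, tube]
      change (_, _, _) = (_, _, _)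
      simp only [Real.cos_pi, Real.sin_pi]
      norm_num
      constructor <;> (congr 1; ring)
  have e2 : (fun t => ((p.trans r t : {v // v ∈ linkCompl c k}) : R3)) = fun t : 𝕀 => half 1 t := by
    funext t
    rw [Path.trans_apply, half]
    split_ifs
    · simp only [p]
      change (_, _, _) = (_, _, _)
      norm_num
      constructor <;> (congr 1; ring)
    · simp only [r]
      change (_, _, _) = (_, _, _)
      norm_num
      ring
  have e3 : (fun t => ((q.symm.trans r t : {v // v ∈ linkCompl c k}) : R3)) =
      fun t : 𝕀 => half (-1) t := by
    funext t
    rw [Path.trans_apply, half]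
    split_ifs
    · rw [Path.symm_apply]
      simp only [q]
      change (_, _, _) = (_, _, _)
      have : ∀ t : ℝ, π * ((1 - 2 * t) + 1) = τ - τ * t := fun t => by ring
      simp only [unitInterval.coe_symm_eq, this, Real.cos_two_pi_sub, Real.sin_two_pi_sub]
      norm_num
    · simp only [r]
      change (_, _, _) = (_, _, _)
      norm_num
      ring
  rw [e1, e2, e3] at h
  exact h

lemma continuous_half (σ : ℝ) : Continuous (half σ) := by
  unfold half
  refine Continuous.if_le (by fun_prop) (by fun_prop) continuous_id continuous_const ?_
  intro t ht
  rw [ht]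
  have : τ * (1 / 2) = π := by ring
  rw [this]
  simp
  norm_num

lemma ne_of_inner_pos {x y x' y' a b s : ℝ} (hs : s ∈ Icc (0 : ℝ) 1)
    (h : 0 < x * a + y * b) (h' : 0 < x' * a + y' * b) :
    ¬ ((1 - s) * x + s * x' = 0 ∧ (1 - s) * y + s * y' = 0) := by
  rintro ⟨h1, h2⟩
  have h3 : (1 - s) * (x * a + y * b) + s * (x' * a + y' * b) = 0 := by
    linear_combination a * h1 + b * h2
  rcases eq_or_lt_of_le hs.1 with h4 | h4
  · rw [← h4] at h3; linarith
  · have h5 := mul_pos h4 h'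
    have h6 := mul_nonneg (sub_nonneg.2 hs.2) h.le
    linarith

lemma ev_around (hN : 0 < c.length) {σ : ℝ} (hσ : σ = 1 ∨ σ = -1) {x y : ℝ → ℝ} (hx : Continuous x)
    (hy : Continuous y) (hx1 : x 0 = x 1) (hy1 : y 0 = y 1)
    (h1 : ∀ t ∈ Icc (0 : ℝ) 1, x t ^ 2 + y t ^ 2 < 1) (h2 : ∀ t ∈ Icc (0 : ℝ) 1, 0 ≤ y t)
    (h3 : ∀ t ∈ Icc (0 : ℝ) 1, 0 < x t * cos (τ * t) + (y t - 3 / 5) * sin (τ * t)) :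
    δ.ev (fun t => (x t, σ * y t, 0)) = δ.ev (fun t => (1 / 20 * cos (τ * t),
      σ * (3 / 5 + 1 / 20 * sin (τ * t)), 0)) := by
  refine δ.ev_congr (fun s t => ((1 - s) * x t + s * (1 / 20 * cos (τ * t)),
      σ * ((1 - s) * y t + s * (3 / 5 + 1 / 20 * sin (τ * t))), 0)) ?_ ?_ ?_
      (by simp) (by simp)
  · unfold uncurry
    fun_prop
  · intro s t
    have hs0 := s.2.1
    have hs1 := s.2.2
    have hsc := sin_sq_add_cos_sq (τ * t)
    set C := cos (τ * t)
    set S := sin (τ * t)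
    have hS := neg_one_le_sin (τ * t)
    have hS' := sin_le_one (τ * t)
    have hσ2 : σ ^ 2 = 1 := by rcases hσ with rfl | rfl <;> norm_num
    have hyy : 0 ≤ (1 - (s : ℝ)) * y t + s * (3 / 5 + 1 / 20 * S) :=
      add_nonneg (mul_nonneg (by linarith) (h2 t t.2)) (mul_nonneg hs0 (by linarith))
    have hne := ne_of_inner_pos s.2 (h3 t t.2) (x' := 1 / 20 * C) (y' := 1 / 20 * S) (by
      have : 1 / 20 * C * C + 1 / 20 * S * S = 1 / 20 := by linear_combination 1 / 20 * hsc
      rw [this]; norm_num)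
    have hnn : ¬ ((1 - (s : ℝ)) * x t + s * (1 / 20 * C) = 0 ∧
        (1 - (s : ℝ)) * y t + s * (3 / 5 + 1 / 20 * S) = 3 / 5) := by
      rintro ⟨h4, h5⟩
      exact hne ⟨h4, by linarith⟩
    have hb : (1 / 20 * C) ^ 2 + (3 / 5 + 1 / 20 * S) ^ 2 < 1 := by nlinarith
    have hdisc : ((1 - (s : ℝ)) * x t + s * (1 / 20 * C)) ^ 2 +
        (σ * ((1 - (s : ℝ)) * y t + s * (3 / 5 + 1 / 20 * S))) ^ 2 < 1 := by
      rw [mul_pow, hσ2, one_mul]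
      have h6 := h1 t t.2
      set x₁ := x t
      set y₁ := y t
      set x₂ := 1 / 20 * C
      set y₂ := 3 / 5 + 1 / 20 * S
      have e : ((1 - (s : ℝ)) * x₁ + s * x₂) ^ 2 + ((1 - (s : ℝ)) * y₁ + s * y₂) ^ 2 =
        (1 - (s : ℝ)) * (x₁ ^ 2 + y₁ ^ 2) + s * (x₂ ^ 2 + y₂ ^ 2) -
        s * (1 - s) * ((x₁ - x₂) ^ 2 + (y₁ - y₂) ^ 2) := by ring
      rw [e]
      have h7 : 0 ≤ (s : ℝ) * (1 - s) * ((x₁ - x₂) ^ 2 + (y₁ - y₂) ^ 2) :=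
        mul_nonneg (mul_nonneg hs0 (by linarith)) (by positivity)
      rcases eq_or_lt_of_le hs0 with h8 | h8
      · rw [← h8] at h7 ⊢; linarith
      · have h9 := mul_lt_mul_of_pos_left hb h8
        have h10 := mul_le_mul_of_nonneg_left h6.le (sub_nonneg.2 hs1)
        linarith
    refine disc_mem hN hdisc ?_ ?_ <;> rintro ⟨h4, h5⟩ <;> rcases hσ with rfl | rfl
    · exact hnn ⟨h4, by linarith⟩
    · linarith
    · linarith
    · exact hnn ⟨h4, by linarith⟩
  · intro s
    simp [hx1, hy1]

lemma ev_half (hN : 0 < c.length) {σ : ℝ} (hσ : σ = 1 ∨ σ = -1) :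
    δ.ev (fun t => half σ t) = δ.ev (fun t => (1 / 20 * cos (τ * t),
      σ * (3 / 5 + 1 / 20 * sin (τ * t)), 0)) := by
  have hc := continuous_half 1
  rw [← δ.ev_around hN hσ (x := fun t => (half 1 t).1) (y := fun t => (half 1 t).2.1)
    (by fun_prop) (by fun_prop) (by norm_num [half]) (by norm_num [half])]
  · congr 1
    funext t
    unfold half
    split_ifs <;> simp
  · rintro t ⟨h0, h1⟩
    unfold half
    split_ifs with h
    · have := sin_sq_add_cos_sq (τ * t)
      simp only
      nlinarith
    · simp only
      nlinarith
  · rintro t ⟨h0, h1⟩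
    unfold half
    split_ifs with h
    · have := Real.sin_nonneg_of_nonneg_of_le_pi (x := τ * t) (by positivity)
        (by nlinarith [pi_pos])
      simp only
      linarith
    · simp
  · rintro t ⟨h0, h1⟩
    have hsc := sin_sq_add_cos_sq (τ * t)
    unfold half
    split_ifs with h
    · have := sin_le_one (τ * t)
      simp only
      nlinarith
    · have hs : sin (τ * t) ≤ 0 := by
        have := Real.sin_nonpos_of_nonpos_of_neg_pi_le (x := τ * t - τ)
          (by nlinarith [pi_pos]) (by nlinarith [pi_pos])
        rwa [Real.sin_sub_two_pi] at this
      have hp := pi_pos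
      have hcos : 0 ≤ (4 * t - 3) * cos (τ * t) := by
        rcases le_total t (3 / 4) with h2 | h2
        · refine mul_nonneg_of_nonpos_of_nonpos (by linarith) ?_
          exact Real.cos_nonpos_of_pi_div_two_le_of_le (by nlinarith) (by nlinarith)
        · have h3 := Real.cos_nonneg_of_neg_pi_div_two_le_of_le (x := τ * t - τ)
            (by nlinarith) (by nlinarith)
          rw [Real.cos_sub_two_pi] at h3
          exact mul_nonneg (by linarith) h3
      simp only
      refine lt_of_le_of_ne (by nlinarith) fun h0 => ?_
      have h5 : sin (τ * t) = 0 := by nlinarith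
      have h6 : (4 * t - 3) * cos (τ * t) = 0 := by nlinarith
      rw [h5] at hsc
      rcases mul_eq_zero.1 h6 with h7 | h7
      · have h8 : τ * t = π + π / 2 := by
          rw [show t = 3 / 4 by linarith]; ring
        rw [h8, Real.sin_add] at h5
        norm_num at h5
      · rw [h7] at hsc
        norm_num at hsc

lemma ev_rotate (hk : k + 1 < c.length) {σ : ℤ} (hσ : σ = 1 ∨ σ = -1 ∧ 1 ≤ k) :
    δ.ev (fun t => (1 / 20 * cos (τ * t), σ * (3 / 5 + 1 / 20 * sin (τ * t)), 0)) =
    δ.ev (fun t => (0, σ * (3 / 5 + 1 / 20 * sin (τ * t)), σ * (1 / 20 * cos (τ * t)))) := by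
  refine δ.ev_congr (fun s t => (1 / 20 * cos (τ * t) * cos (π / 2 * s),
      σ * (3 / 5 + 1 / 20 * sin (τ * t)),
      σ * (1 / 20 * cos (τ * t) * sin (π / 2 * s)))) ?_ ?_ ?_
      (by simp) (by simp)
  · unfold uncurry
    fun_prop
  · intro s t
    have hs0 := s.2.1
    have hs1 := s.2.2
    have hp := pi_pos
    have hcβ : 0 ≤ cos (π / 2 * s) :=
      Real.cos_nonneg_of_neg_pi_div_two_le_of_le (by nlinarith) (by nlinarith)
    have hsβ : 0 ≤ sin (π / 2 * s) :=
      Real.sin_nonneg_of_nonneg_of_le_pi (by positivity) (by nlinarith)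
    have hsc := sin_sq_add_cos_sq (τ * t)
    have hscβ := sin_sq_add_cos_sq (π / 2 * s)
    have hC1 := neg_one_le_cos (τ * t)
    have hC2 := cos_le_one (τ * t)
    have hS1 := neg_one_le_sin (τ * t)
    have hS2 := sin_le_one (τ * t)
    have hB2 := cos_le_one (π / 2 * s)
    have hσ2 : (σ : ℝ) * σ = 1 := by rcases hσ with rfl | ⟨rfl, _⟩ <;> norm_num
    set C := cos (τ * t)
    set S := sin (τ * t)
    set cβ := cos (π / 2 * s)
    set sβ := sin (π / 2 * s)
    refine near_mem hk hσ ?_ ?_ ?_ ?_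
    · rw [abs_le]; constructor <;> nlinarith
    · rw [abs_le]; constructor <;> linarith
    · have : (σ : ℝ) * (σ * (1 / 20 * C * sβ)) * (1 / 20 * C * cβ) =
        σ * σ * ((1 / 20 * C) ^ 2 * (sβ * cβ)) := by ring
      rw [this, hσ2]
      positivity
    · intro h1 h2 h3
      have hs : S = 0 := by linarith
      have hσ0 : (σ : ℝ) ≠ 0 := by intro h; rw [h] at hσ2; norm_num at hσ2
      have h4 := (mul_eq_zero.1 h2).resolve_left hσ0
      have h5 : C ^ 2 * (sβ ^ 2 + cβ ^ 2) = 0 := by linear_combination 20 * C * cβ * h1 + 20 * C * sβ * h4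
      rw [hscβ] at h5
      nlinarith
  · intro s
    simp

end LoopClass

/-! ### Values of `kap` on some loops of matrices -/

lemma kap_eq_zero_of_upper {A : 𝕀 → M3} (hA : IsLoop IsGL A)
    (h : ∀ t, A t 1 0 = 0 ∧ A t 2 0 = 0 ∧ A t 2 1 = 0)
    (hp : ∀ t, 0 < A t 0 0 ∧ 0 < A t 1 1 ∧ 0 < A t 2 2) : kap.ev A = 0 := by
  rw [ev_eq_of_segment kap hA (A' := fun _ => 1) ⟨fun _ => isGL_one, continuous_const, rfl⟩,
    kap.ev_const]
  intro t s
  have e : ((1 - (s : ℝ)) • A t + (s : ℝ) • (1 : M3)).det =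
      ((1 - (s : ℝ)) * A t 0 0 + s) * ((1 - (s : ℝ)) * A t 1 1 + s) *
        ((1 - (s : ℝ)) * A t 2 2 + s) := by
    simp [det_fin_three, (h t).1, (h t).2.1, (h t).2.2, Matrix.add_apply, Matrix.smul_apply]
  have key : ∀ a : ℝ, 0 < a → 0 < (1 - (s : ℝ)) * a + s := by
    intro a ha
    rcases eq_or_lt_of_le s.2.1 with hs | hs
    · rw [← hs]; linarith
    · have := mul_nonneg (sub_nonneg.2 s.2.2) ha.le
      linarith
  unfold IsGL
  rw [e]
  exact mul_pos (mul_pos (key _ (hp t).1) (key _ (hp t).2.1)) (key _ (hp t).2.2)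

lemma isGL_of_upper {A : M3} (h : A 1 0 = 0 ∧ A 2 0 = 0 ∧ A 2 1 = 0)
    (hp : 0 < A 0 0 ∧ 0 < A 1 1 ∧ 0 < A 2 2) : IsGL A := by
  have e : A.det = A 0 0 * A 1 1 * A 2 2 := by
    simp [det_fin_three, h.1, h.2.1, h.2.2]
  unfold IsGL
  rw [e]
  exact mul_pos (mul_pos hp.1 hp.2.1) hp.2.2

def rotY (ψ : ℝ) : M3 := !![cos ψ, 0, sin ψ; 0, 1, 0; -sin ψ, 0, cos ψ]

lemma rotY_eq (ψ : ℝ) :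
    rotY ψ = !![1, 0, 0; 0, 0, -1; 0, 1, 0] * rotZ ψ * !![1, 0, 0; 0, 0, 1; 0, -1, 0] := by
  ext i j
  fin_cases i <;> fin_cases j <;> simp [rotY, rotZ, mul_apply, sum_univ_three]

lemma isGL_rotY (ψ : ℝ) : IsGL (rotY ψ) := by
  have := sin_sq_add_cos_sq ψ
  have e : (rotY ψ).det = 1 := by
    simp [rotY, det_fin_three]
    linear_combination this
  unfold IsGL
  rw [e]
  exact one_pos

@[fun_prop] theorem continuous_rotY : Continuous rotY := by
  unfold rotY
  refine continuous_matrix fun i j => ?_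
  fin_cases i <;> fin_cases j <;> simp <;> fun_prop

lemma kap_rotY : kap.ev (fun t => rotY (τ * t)) = 1 := by
  have h1 : IsGL (!![1, 0, 0; 0, 0, -1; 0, 1, 0] : M3) := by
    simp [IsGL, det_fin_three]
  have h2 : IsGL (!![1, 0, 0; 0, 0, 1; 0, -1, 0] : M3) := by
    simp [IsGL, det_fin_three]
  have h3 : IsLoop IsGL fun t => !![1, 0, 0; 0, 0, -1; 0, 1, 0] * fullRot t :=
    IsLoop.mul ⟨fun _ => h1, continuous_const, rfl⟩ isLoop_fullRot
  have e : (fun t : 𝕀 => rotY (τ * t)) = fun t =>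
      !![1, 0, 0; 0, 0, -1; 0, 1, 0] * fullRot t * !![1, 0, 0; 0, 0, 1; 0, -1, 0] :=
    funext fun t => rotY_eq _
  rw [e, ev_mul_const kap h3 h2, ev_const_mul kap isLoop_fullRot h1, kap_fullRot]

lemma rotY_add_one (t : ℝ) : rotY (τ * (t + 1)) = rotY (τ * t) := by
  simp only [rotY, two_pi_cos_add_one, two_pi_sin_add_one]

lemma kap_rotY_mul (n : ℕ) : kap.ev (fun t => rotY (-(n * (τ * t)))) = n := by
  have h1 : kap.ev (fun t => rotY (τ * (-(t : ℝ)))) = 1 := by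
    rw [kap.ev_neg (g := fun t => rotY (τ * t)) (by fun_prop) (fun _ => isGL_rotY _)
      rotY_add_one, kap_rotY]
  have h2 := kap.ev_natMul (g := fun t => rotY (τ * (-t))) (by fun_prop)
    (fun _ => isGL_rotY _) (fun t => by rw [← rotY_add_one]; congr 1; ring) n
  rw [h1, mul_one] at h2
  rw [← h2]
  congr 1
  funext t
  congr 1
  ring

lemma isLoop_rotY_mul (n : ℕ) : IsLoop IsGL fun t => rotY (-(n * (τ * t))) := by
  refine ⟨fun _ => isGL_rotY _, by fun_prop, ?_⟩
  have h1 := Real.cos_nat_mul_two_pi n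
  have h2 : sin (n * τ) = 0 := by
    have := Real.sin_nat_mul_pi (n * 2)
    rw [← this]; congr 1; push_cast; ring
  simp [rotY, h1, h2]

/-! ### The handle -/

def IsPos4 (f : Tuple 4 (E 4)) : Prop := f.base ∈ handle ∧ stdOrientation.pos f.base f.vec

/-- A spin structure on the handle as a class on loops of frames. -/
def handleCls (Θ' : SpinStructure stdOrientation handle) : LoopClass IsPos4 where
  val := Θ'.val
  homotopic := Θ'.homotopic
  trans := Θ'.trans
  conj := Θ'.conj

lemma continuous_tuple4 {b : X → E 4} {v : X → Fin 4 → E 4}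
    (hb : Continuous b) (hv : ∀ i, Continuous fun x => v x i) :
    Continuous fun x => (⟨b x, v x⟩ : Tuple 4 (E 4)) := by
  refine continuous_induced_rng.2 (hb.prodMk (continuous_pi fun i => ?_))
  have h2 : Continuous fun x : ModelProd (E 4) (E 4) =>
      (tangentBundleModelSpaceHomeomorph (𝓡 4)).symm x :=
    (tangentBundleModelSpaceHomeomorph (𝓡 4)).symm.continuous
  rw [tangentBundleModelSpaceHomeomorph_coe_symm] at h2
  exact h2.comp (hb.prodMk (hv i))

/-- The frame of the handle over `(0, s e^{iφ})` that starts with the radial vector. -/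
def radialFrame (s : ℝ) (φ : ℝ) : Tuple 4 (E 4) := ⟨pt4 0 (s * exp (φ * I)),
    ![pt4 0 (exp (φ * I)), pt4 0 (I * exp (φ * I)), pt4 1 0, pt4 I 0]⟩

lemma continuous_pt4 {w u : X → ℂ} (hw : Continuous w)
    (hu : Continuous u) : Continuous fun x => pt4 (w x) (u x) := by
  unfold pt4
  refine (PiLp.continuous_toLp 2 _).comp (continuous_pi fun i => ?_)
  fin_cases i
  · exact Complex.continuous_re.comp hw
  · exact Complex.continuous_im.comp hw
  · exact Complex.continuous_re.comp hu
  · exact Complex.continuous_im.comp hu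

lemma exp_mul_I_eq (φ : ℝ) :
    exp (φ * I) = ⟨cos φ, sin φ⟩ := by
  apply Complex.ext
  · exact Complex.exp_ofReal_mul_I_re φ
  · exact Complex.exp_ofReal_mul_I_im φ

lemma isPos4_radialFrame {s : ℝ} (hs : s ∈ Icc (0 : ℝ) 1) (φ : ℝ) :
    IsPos4 (radialFrame s φ) := by
  refine ⟨⟨0, s * exp (φ * I), by simp, ?_, rfl⟩, ?_⟩
  · rw [norm_mul, norm_exp_ofReal_mul_I, mul_one, norm_real, norm_eq_abs, abs_of_nonneg hs.1]
    exact hs.2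
  · change 0 < det _
    have e : (Matrix.of fun i j => (![pt4 0 (exp (φ * I)),
        pt4 0 (I * exp (φ * I)), pt4 1 0, pt4 I 0] i) j) =
        !![0, 0, cos φ, sin φ; 0, 0, -sin φ, cos φ; 1, 0, 0, 0; 0, 1, 0, 0] := by
      rw [exp_mul_I_eq]
      ext i j
      fin_cases i <;> fin_cases j <;> simp [pt4]
    have h1 : (!![0, 0, cos φ, sin φ; 0, 0, -sin φ, cos φ; 1, 0, 0, 0;
        0, 1, 0, 0] : Matrix (Fin 4) (Fin 4) ℝ).det = 1 := by
      have := sin_sq_add_cos_sq φ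
      rw [Matrix.det_succ_row_zero]
      simp [Fin.sum_univ_four, det_fin_three, Fin.succAbove, Matrix.submatrix]
      linear_combination this
    refine lt_of_lt_of_eq one_pos ?_
    rw [← h1, ← e]
    rfl

lemma continuous_radialFrame {s φ : X → ℝ} (hs : Continuous s)
    (hφ : Continuous φ) : Continuous fun x => radialFrame (s x) (φ x) := by
  have he : Continuous fun x => exp (φ x * I) := by fun_prop
  refine continuous_tuple4 (continuous_pt4 continuous_const (by fun_prop)) fun i => ?_
  fin_cases i
  · exact continuous_pt4 continuous_const he
  · exact continuous_pt4 continuous_const (by fun_prop)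
  · exact continuous_const
  · exact continuous_const

lemma handleCls_radialFrame (Θ' : SpinStructure stdOrientation handle) :
    (handleCls Θ').ev (fun t => radialFrame 1 (τ * t)) = 1 := by
  have hper : ∀ s : ℝ, radialFrame s (τ * (0 : 𝕀)) = radialFrame s (τ * (1 : 𝕀)) := by
    intro s
    simp [radialFrame]
    rfl
  have h0 : IsLoop IsPos4 fun t => radialFrame 0 (τ * t) :=
    ⟨fun t => isPos4_radialFrame (by simp) _, continuous_radialFrame continuous_const (by fun_prop),
      hper 0⟩
  rw [← (handleCls Θ').ev_congr (fun s t => radialFrame s (τ * t))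
    (f := fun t => radialFrame 0 (τ * t))
    (continuous_radialFrame (by fun_prop) (by fun_prop)) (fun s t => isPos4_radialFrame s.2 _)
    (fun s => hper s) (fun t => by simp) (fun t => by simp), LoopClass.ev_eq _ h0]
  refine Θ'.fibre _ h0.path fun t => ?_
  have hv : ∀ (b b' : E 4) (v w : Fin 4 → E 4), b = b' → v = w →
      (⟨b, v⟩ : Tuple 4 (E 4)) = ⟨b', w⟩ := by rintro b _ v _ rfl rfl; rfl
  have h1 := exp_mul_I_eq (τ * t)
  push_cast at h1
  let f : Fin 4 → E 4 := ![pt4 0 1, pt4 0 I, pt4 1 0, pt4 I 0]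
  have hf : radialFrame 0 (τ * (0 : 𝕀)) = ⟨pt4 0 0, f⟩ :=
    hv _ _ _ _ (by simp) (by simp [f]; rfl)
  have key : ∀ i : Fin 4, (![pt4 0 (exp ((τ * t : ℝ) * I)), pt4 0 (I * exp ((τ * t : ℝ) * I)),
      pt4 1 0, pt4 I 0] : Fin 4 → E 4) i =
      if i = 0 then cos (τ * t) • f 0 + sin (τ * t) • f 1
      else if i = 1 then
        -(sin (τ * t)) • f 0 + cos (τ * t) • f 1
      else f i := by
    intro i
    ext j
    fin_cases i <;> fin_cases j <;> simp [pt4, h1, f]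
  have hrot : ∀ g : Tuple 4 (E 4), g = ⟨pt4 0 0, f⟩ → radialFrame 0 (τ * t) = ⟨g.base, fun i =>
        if i = 0 then cos (τ * t) • g.vec 0 + sin (τ * t) • g.vec 1
        else if i = 1 then
          -(sin (τ * t)) • g.vec 0 + cos (τ * t) • g.vec 1
        else g.vec i⟩ := by
    rintro _ rfl
    exact hv _ _ _ _ (by simp) (funext key)
  exact hrot _ hf

lemma IsParam.pf_translate {φ : V → Y}
    {U : Set V} {b : Fin 3 → V} (h : IsParam o φ U b) {x a : V} (hx : x + a ∈ U)
    (he : φ =ᶠ[𝓝 x] fun z => φ (z + a)) : pf φ b x = pf φ b (x + a) := by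
  rw [pf_congr he b]
  have := h.pf_comp (ι := fun z => z + a) (x := x) (b' := b) (J := 1) hx
    ((hasFDerivAt_id x).add_const a) (fun i => by simp [Matrix.one_apply])
  rw [act_one] at this
  exact this

def polar (v : R3) : ℂ × ℝ := (v.1 * exp (v.2.1 * I), v.2.2)

/-- The standard frame of the domain of `SurgeryPresentation.belt`. -/
def beltVec : Fin 3 → ℂ × ℝ := ![(1, 0), (I, 0), (0, 1)]

def polarScale (ρ : ℝ) : M3 := !![1, 0, 0; 0, ρ, 0; 0, 0, 1]

lemma contDiff_polar : ContDiff ℝ ∞ polar := by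
  have h1 : ContDiff ℝ ∞ fun v : R3 => (v.1 : ℂ) := Complex.ofRealCLM.contDiff.comp contDiff_fst
  have h2 : ContDiff ℝ ∞ fun v : R3 => (v.2.1 : ℂ) :=
    Complex.ofRealCLM.contDiff.comp (contDiff_fst.comp contDiff_snd)
  exact (h1.mul (h2.mul contDiff_const).cexp).prodMk (contDiff_snd.comp contDiff_snd)

lemma fderiv_polar (v : R3) (i : Fin 3) :
    fderiv ℝ polar v (std3 i) = ∑ j, (polarScale v.1 * rotZ v.2.1) i j • beltVec j := by
  have hd : HasFDerivAt polar (fderiv ℝ polar v) v :=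
    (contDiff_polar.differentiable (by norm_cast)).differentiableAt.hasFDerivAt
  have hid : ∀ x : ℝ, HasDerivAt (fun a : ℝ => (a : ℂ)) 1 x := fun x =>
    Complex.ofRealCLM.hasDerivAt
  refine fderiv_std3 hd (r := fun i => ∑ j, (polarScale v.1 * rotZ v.2.1) i j • beltVec j)
    ?_ ?_ ?_ i <;> simp only [polar]
  · refine (((hid v.1).mul_const _).prodMk (hasDerivAt_const _ _)).congr_deriv ?_
    rw [exp_mul_I_eq]
    refine Prod.ext (Complex.ext ?_ ?_) ?_ <;>
      simp [sum_univ_three, polarScale, rotZ, beltVec, mul_apply]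
    · exact (Complex.cos_ofReal_re _).symm
    · exact (Complex.sin_ofReal_re _).symm
  · refine (((((hid v.2.1).mul_const I).cexp).const_mul (v.1 : ℂ)).prodMk
      (hasDerivAt_const _ _)).congr_deriv ?_
    rw [exp_mul_I_eq]
    refine Prod.ext (Complex.ext ?_ ?_) ?_ <;>
      simp [sum_univ_three, polarScale, rotZ, beltVec, mul_apply]
    · exact Or.inl (Complex.sin_ofReal_re _).symm
    · exact Or.inl (Complex.cos_ofReal_re _).symm
  · refine ((hasDerivAt_const _ _).prodMk (hasDerivAt_id' v.2.2)).congr_deriv ?_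
    refine Prod.ext (Complex.ext ?_ ?_) ?_ <;>
      simp [sum_univ_three, polarScale, rotZ, beltVec, mul_apply]

/-- The attaching map in the coordinates around the component. -/
def twistTube (n : ℕ) (v : R3) : R3 := tube v.1 v.2.1 (v.2.2 - n * v.2.1)

def twistScale (n : ℕ) (ρ ψ : ℝ) : M3 :=
  !![1 / 10, 0, 0; 0, 1 + ρ / 10 * cos ψ, -(n * (ρ / 10)); 0, 0, ρ / 10]

def twistJac (n : ℕ) (v : R3) : M3 :=
  twistScale n v.1 (v.2.2 - n * v.2.1) * (rotY (v.2.2 - n * v.2.1) * rotZ v.2.1)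

lemma contDiff_twistTube (n : ℕ) : ContDiff ℝ ∞ (twistTube n) := by
  unfold twistTube tube
  have h1 : ContDiff ℝ ∞ fun v : R3 => v.1 := contDiff_fst
  have h2 : ContDiff ℝ ∞ fun v : R3 => v.2.1 := contDiff_fst.comp contDiff_snd
  have h3 : ContDiff ℝ ∞ fun v : R3 => v.2.2 := contDiff_snd.comp contDiff_snd
  have h4 : ContDiff ℝ ∞ fun v : R3 => v.2.2 - n * v.2.1 := h3.sub (contDiff_const.mul h2)
  have h5 : ContDiff ℝ ∞ fun v : R3 => 1 + v.1 / 10 * cos (v.2.2 - n * v.2.1) :=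
    contDiff_const.add ((h1.div_const 10).mul (Real.contDiff_cos.comp h4))
  exact (h5.mul (Real.contDiff_cos.comp h2)).prodMk ((h5.mul (Real.contDiff_sin.comp h2)).prodMk
    ((h1.div_const 10).mul (Real.contDiff_sin.comp h4)))

lemma fderiv_twistTube (n : ℕ) (v : R3) (i : Fin 3) :
    fderiv ℝ (twistTube n) v (std3 i) = ∑ j, twistJac n v i j • std3 j := by
  have hd : HasFDerivAt (twistTube n) (fderiv ℝ (twistTube n) v) v :=
    ((contDiff_twistTube n).differentiable (by norm_cast)).differentiableAt.hasFDerivAt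
  obtain ⟨ρ, s, φ⟩ := v
  have hρ : HasDerivAt (fun a : ℝ => a / 10) (1 / 10) ρ := (hasDerivAt_id' ρ).div_const 10
  have hs : HasDerivAt (fun a : ℝ => φ - n * a) (-n) s := by
    simpa using ((hasDerivAt_id' s).const_mul (n : ℝ)).const_sub φ
  have hφ : HasDerivAt (fun a : ℝ => a - n * s) 1 φ := (hasDerivAt_id' φ).sub_const _
  refine fderiv_std3 hd (r := fun i => ∑ j, twistJac n (ρ, s, φ) i j • std3 j) ?_ ?_ ?_ i <;>
    simp only [twistTube, tube]
  · have h1 := (hρ.mul_const (cos (φ - n * s))).const_add 1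
    refine ((h1.mul_const (cos s)).prodMk ((h1.mul_const (sin s)).prodMk
      (hρ.mul_const (sin (φ - n * s))))).congr_deriv ?_
    refine Prod.ext ?_ (Prod.ext ?_ ?_) <;>
      simp [sum_univ_three, twistJac, twistScale, rotZ, rotY, std3, mul_apply] <;> ring
  · have h1 := (hs.cos.const_mul (ρ / 10)).const_add 1
    refine ((h1.mul (Real.hasDerivAt_cos s)).prodMk ((h1.mul (Real.hasDerivAt_sin s)).prodMk
      (hs.sin.const_mul (ρ / 10)))).congr_deriv ?_
    refine Prod.ext ?_ (Prod.ext ?_ ?_) <;>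
      simp [sum_univ_three, twistJac, twistScale, rotZ, rotY, std3, mul_apply] <;> ring
  · have h1 := (hφ.cos.const_mul (ρ / 10)).const_add 1
    refine ((h1.mul_const (cos s)).prodMk ((h1.mul_const (sin s)).prodMk
      (hφ.sin.const_mul (ρ / 10)))).congr_deriv ?_
    refine Prod.ext ?_ (Prod.ext ?_ ?_) <;>
      simp [sum_univ_three, twistJac, twistScale, rotZ, rotY, std3, mul_apply] <;> ring

lemma attach_eq (N k n : ℕ) (ρ s φ : ℝ) :
    attach N k n (exp (s * I)) (ρ * exp (φ * I)) =
      toE (chain N k (claspSign N k) (twistTube n (ρ, s, φ))) := by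
  have h1 : (starRingEnd ℂ (exp (s * I))) ^ n * (ρ * exp (φ * I)) =
      ρ * exp ((φ - n * s : ℝ) * I) := by
    rw [← Complex.exp_conj, ← Complex.exp_nat_mul, mul_left_comm, ← Complex.exp_add]
    congr 2
    simp
    ring
  unfold attach
  rw [h1, exp_mul_I_eq, exp_mul_I_eq]
  rw [← chainMap_eq]
  simp only [twistTube, tube, Complex.re_ofReal_mul, Complex.im_ofReal_mul]
  congr 1 <;> ring

lemma kap_rotZ : kap.ev (fun t => rotZ (τ * t)) = 1 := kap_fullRot

namespace SurgeryPresentation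

variable (D : SurgeryPresentation c o)

lemma isParam_belt (k : Fin c.length) : IsParam o (D.belt k) {x | ‖x.1‖ < 1} beltVec where
  isOpen := isOpen_lt (by fun_prop) continuous_const
  smooth := D.belt_smooth k
  pos x hx := D.belt_pos k x hx

/-- The class of a spin structure in the coordinates around the `k`-th component. -/
def cls (hN : 0 < c.length) (Θ : SpinStructure o univ) (k : ℕ) :
    LoopClass fun v => v ∈ linkCompl c k :=
  Θ.cls.comap (pf (D.comp k) std3)
    ((D.isParam_comp hN k).continuous_pf continuous_subtype_val fun x => x.2)
    fun _ hx => (D.isParam_comp hN k).isPos hx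

lemma belt_polar (k : Fin c.length) {v : R3} (h0 : 0 < v.1) (h1 : v.1 < 1) :
    D.belt k (polar v) = D.comp k (twistTube (c.get k) v) := by
  obtain ⟨ρ, s, φ⟩ := v
  have hm := (tube_mem k.2 h0 h1.le s (φ - (c.get k) * s)).2
  have hw : ‖(ρ : ℂ) * exp (s * I)‖ = ρ := by
    rw [norm_mul, norm_exp_ofReal_mul_I, mul_one, norm_real, norm_eq_abs, abs_of_pos h0]
  have hρ : (ρ : ℂ) ≠ 0 := by exact_mod_cast (ne_of_gt h0)
  refine ((D.glue _ hm k _ φ (by rw [hw]; exact h1)).2 ⟨?_, ?_⟩).symm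
  · exact mul_ne_zero hρ (Complex.exp_ne_zero _)
  · rw [hw, mul_div_cancel_left₀ _ hρ, attach_eq]
    rfl

lemma act_belt (hN : 0 < c.length) (k : Fin c.length) {v : R3} (h0 : 0 < v.1) (h1 : v.1 < 1) :
    act (polarScale v.1 * rotZ v.2.1) (pf (D.belt k) beltVec (polar v)) =
      act (twistJac (c.get k) v) (pf (D.comp k) std3 (twistTube (c.get k) v)) := by
  have e1 := (D.isParam_belt k).pf_comp (ι := polar) (x := v) (b' := std3)
    (by
      change ‖(v.1 : ℂ) * exp (v.2.1 * I)‖ < 1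
      rw [norm_mul, norm_exp_ofReal_mul_I, mul_one, norm_real, norm_eq_abs, abs_of_pos h0]
      exact h1)
    (contDiff_polar.differentiable (by norm_cast)).differentiableAt.hasFDerivAt (fderiv_polar v)
  have e2 := (D.isParam_comp hN k).pf_comp (ι := twistTube (c.get k)) (x := v) (b' := std3)
    (tube_mem k.2 h0 h1.le _ _)
    ((contDiff_twistTube _).differentiable (by norm_cast)).differentiableAt.hasFDerivAt
    (fderiv_twistTube _ v)
  rw [← e1, ← e2]
  refine pf_congr ?_ _
  have h3 : ∀ᶠ x in 𝓝 v, 0 < x.1 ∧ x.1 < 1 := ((isOpen_lt continuous_const continuous_fst).inter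
      (isOpen_lt continuous_fst continuous_const)).mem_nhds ⟨h0, h1⟩
  filter_upwards [h3] with x hx
  exact D.belt_polar k hx.1 hx.2

lemma pf_belt_add (k : Fin c.length) {w : ℂ} (hw : ‖w‖ < 1) (φ : ℝ) :
    pf (D.belt k) beltVec (w, φ) = pf (D.belt k) beltVec (w, φ + τ) := by
  have := (D.isParam_belt k).pf_translate (x := (w, φ)) (a := (0, τ))
    (by simpa using hw) ?_
  · rw [this]; simp
  · have h3 : ∀ᶠ x : ℂ × ℝ in 𝓝 (w, φ), ‖x.1‖ < 1 := (D.isParam_belt k).isOpen.mem_nhds hw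
    filter_upwards [h3] with x hx
    refine (D.belt_eq_iff k k _ _ hx (by simpa using hx)).2 ⟨rfl, by simp, -1, ?_⟩
    simp

lemma isLoop_belt (k : Fin c.length) {w : ℂ} (hw : ‖w‖ < 1) :
    IsLoop (IsPos o) fun t => pf (D.belt k) beltVec (w, τ * t) := by
  refine ⟨fun t => (D.isParam_belt k).isPos hw,
    (D.isParam_belt k).continuous_pf (by fun_prop) fun _ => hw, ?_⟩
  have := D.pf_belt_add k hw 0
  simpa using this

lemma isLoop_comp (hN : 0 < c.length) (k : ℕ) {ℓ : 𝕀 → R3}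
    (h : IsLoop (fun v => v ∈ linkCompl c k) ℓ) :
    IsLoop (IsPos o) fun t => pf (D.comp k) std3 (ℓ t) :=
  ⟨fun t => (D.isParam_comp hN k).isPos (h.1 t), (D.isParam_comp hN k).continuous_pf h.2.1 h.1,
    congrArg (pf (D.comp k) std3) h.2.2⟩

lemma isLoop_tube {k : ℕ} (hk : k < c.length) {s ψ : 𝕀 → ℝ} (hs : Continuous s)
    (hψ : Continuous ψ) (h : tube (1 / 2) (s 0) (ψ 0) = tube (1 / 2) (s 1) (ψ 1)) :
    IsLoop (fun v => v ∈ linkCompl c k) fun t => tube (1 / 2) (s t) (ψ t) :=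
  ⟨fun t => tube_mem hk (by norm_num) (by norm_num) _ _, by fun_prop, h⟩

lemma isGL_polarScale {ρ : ℝ} (h : 0 < ρ) : IsGL (polarScale ρ) :=
  isGL_of_upper (by simp [polarScale]) (by simpa [polarScale] using h)

lemma twistScale_props (n : ℕ) {ρ : ℝ} (h : 0 < ρ) (h' : ρ ≤ 1) (ψ : ℝ) :
    (twistScale n ρ ψ 1 0 = 0 ∧ twistScale n ρ ψ 2 0 = 0 ∧ twistScale n ρ ψ 2 1 = 0) ∧
    0 < twistScale n ρ ψ 0 0 ∧ 0 < twistScale n ρ ψ 1 1 ∧ 0 < twistScale n ρ ψ 2 2 := by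
  have h1 := neg_one_le_cos ψ
  refine ⟨by simp [twistScale], ?_⟩
  simp [twistScale]
  constructor <;> nlinarith

lemma isLoop_twistScale (n : ℕ) {ρ : ℝ} (h : 0 < ρ) (h' : ρ ≤ 1) {ψ : 𝕀 → ℝ}
    (hψ : Continuous ψ) (h2 : cos (ψ 0) = cos (ψ 1)) :
    IsLoop IsGL (fun t => twistScale n ρ (ψ t)) ∧ kap.ev (fun t => twistScale n ρ (ψ t)) = 0 := by
  have h3 : IsLoop IsGL (fun t => twistScale n ρ (ψ t)) := by
    refine ⟨fun t => isGL_of_upper (twistScale_props n h h' _).1 (twistScale_props n h h' _).2,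
      ?_, by simp only [twistScale, h2]⟩
    unfold twistScale
    refine continuous_matrix fun i j => ?_
    fin_cases i <;> fin_cases j <;> simp <;> fun_prop
  exact ⟨h3, kap_eq_zero_of_upper h3 (fun t => (twistScale_props n h h' _).1)
    fun t => (twistScale_props n h h' _).2⟩

variable (hN : 0 < c.length) (Θ : SpinStructure o univ)

lemma ev_belt (k : Fin c.length) :
    Θ.cls.ev (fun t => pf (D.belt k) beltVec (0, τ * t)) = (D.cls hN Θ k).mer + 1 := by
  have e0 : Θ.cls.ev (fun t => pf (D.belt k) beltVec (0, τ * t)) =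
      Θ.cls.ev (fun t => pf (D.belt k) beltVec (1 / 2, τ * t)) := by
    have hw : ∀ s : 𝕀, ‖(s : ℂ) * (1 / 2)‖ < 1 := by
      intro s
      have h1 := s.2.1
      have h2 := s.2.2
      rw [norm_mul, norm_real, norm_eq_abs, abs_of_nonneg h1]
      norm_num
      linarith
    refine Θ.cls.ev_congr (fun s t => pf (D.belt k) beltVec ((s : ℂ) * (1 / 2), τ * t))
      ?_ (fun s t => (D.isParam_belt k).isPos (hw s)) (fun s => (D.isLoop_belt k (hw s)).2.2)
      (by simp) (by simp)
    refine (D.isParam_belt k).continuous_pf (g := fun p : 𝕀 × 𝕀 =>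
      ((p.1 : ℂ) * (1 / 2), τ * (p.2 : ℝ))) (by fun_prop) fun p => hw p.1
  have hw2 : ‖(1 / 2 : ℂ)‖ < 1 := by norm_num
  have hl := D.isLoop_belt k hw2
  have hm := isLoop_tube k.2 (s := fun _ => 0) (ψ := fun t => τ * t) continuous_const
    (by fun_prop) (by simp [tube])
  obtain ⟨hA, hA'⟩ := isLoop_twistScale (c.get k) (ρ := 1 / 2) (ψ := fun t => τ * t)
    (by norm_num) (by norm_num) (by fun_prop) (by simp)
  have hR : IsLoop IsGL fun t : 𝕀 => rotY (τ * t) :=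
    ⟨fun _ => isGL_rotY _, by fun_prop, by simp [rotY]⟩
  have hC : IsLoop IsGL fun _ : 𝕀 => polarScale (1 / 2) * rotZ 0 :=
    ⟨fun _ => (isGL_polarScale (by norm_num)).mul (isGL_rotZ _), continuous_const, rfl⟩
  have h1 := ev_act Θ hl hC
  have h2 := ev_act Θ (D.isLoop_comp hN k hm) (hA.mul hR)
  rw [ev_mul kap hA hR, hA', kap_rotY, zero_add] at h2
  rw [kap.ev_const, add_zero] at h1
  have h3 : Θ.cls.ev (fun t => pf (D.comp k) std3 (tube (1 / 2) 0 (τ * t))) =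
      (D.cls hN Θ k).mer := (Θ.cls.ev_comap _ _ _ hm).symm
  rw [e0, ← h1, ← h3, ← h2]
  congr 1
  funext t
  have h4 := D.act_belt hN k (v := (1 / 2, 0, τ * t)) (by norm_num) (by norm_num)
  have hz : rotZ 0 = 1 := by
    ext i j; fin_cases i <;> fin_cases j <;> simp [rotZ]
  simp only [polar, twistJac, twistTube, mul_zero, sub_zero, hz, mul_one] at h4
  rw [hz, mul_one]
  simpa using h4

lemma ev_longitude (k : Fin c.length) :
    (D.cls hN Θ k).ev (fun t => tube (1 / 2) (τ * t) (-((c.get k) * (τ * t)))) =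
      c.get k := by
  set n := c.get k
  have hw : ∀ s t : 𝕀, ‖(s : ℂ) * ((1 / 2 : ℝ) * exp ((τ * t : ℝ) * I))‖ < 1 := by
    intro s t
    have h1 := s.2.1
    have h2 := s.2.2
    rw [norm_mul, norm_mul, norm_exp_ofReal_mul_I, norm_real, norm_real,
      norm_eq_abs, abs_of_nonneg h1]
    norm_num
    linarith
  have hper : ∀ s : 𝕀, ((s : ℂ) * ((1 / 2 : ℝ) * exp ((τ * (0 : 𝕀) : ℝ) * I))) =
      ((s : ℂ) * ((1 / 2 : ℝ) * exp ((τ * (1 : 𝕀) : ℝ) * I))) := by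
    intro s
    simp
  have e0 : Θ.cls.ev (fun t => pf (D.belt k) beltVec (polar (1 / 2, τ * t, 0))) = 0 := by
    rw [← Θ.cls.ev_const (pf (D.belt k) beltVec (0, 0))]
    symm
    refine Θ.cls.ev_congr (fun s t => pf (D.belt k) beltVec
      ((s : ℂ) * ((1 / 2 : ℝ) * exp ((τ * t : ℝ) * I)), 0))
      ?_ (fun s t => (D.isParam_belt k).isPos (hw s t)) (fun s => by rw [hper s])
      (fun t => by simp) (fun t => by simp [polar])
    refine (D.isParam_belt k).continuous_pf (g := fun p : 𝕀 × 𝕀 =>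
      ((p.1 : ℂ) * ((1 / 2 : ℝ) * exp ((τ * p.2 : ℝ) * I)), 0))
      (by fun_prop) fun p => hw p.1 p.2
  have hl : IsLoop (IsPos o) fun t => pf (D.belt k) beltVec (polar (1 / 2, τ * t, 0)) := by
    have h1 : ∀ t : 𝕀, ‖(polar (1 / 2, τ * t, 0)).1‖ < 1 := fun t => by
      have := hw 1 t
      simpa [polar] using this
    refine ⟨fun t => (D.isParam_belt k).isPos (h1 t), (D.isParam_belt k).continuous_pf
      (contDiff_polar.continuous.comp (by fun_prop)) h1, ?_⟩
    exact congrArg (pf (D.belt k) beltVec) (by simp [polar])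
  have hcn := Real.cos_nat_mul_two_pi n
  have hsn : sin (n * τ) = 0 := by
    have := Real.sin_nat_mul_pi (n * 2)
    rw [← this]; congr 1; push_cast; ring
  have hm := isLoop_tube k.2 (s := fun t => τ * t) (ψ := fun t => -(n * (τ * t)))
    (by fun_prop) (by fun_prop) (by simp [tube, hcn, hsn])
  obtain ⟨hA, hA'⟩ := isLoop_twistScale n (ρ := 1 / 2) (ψ := fun t => -(n * (τ * t)))
    (by norm_num) (by norm_num) (by fun_prop) (by simp [hcn])
  have hR := isLoop_rotY_mul n
  have hC : IsLoop IsGL fun _ : 𝕀 => polarScale (1 / 2) :=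
    ⟨fun _ => isGL_polarScale (by norm_num), continuous_const, rfl⟩
  have hZ : IsLoop IsGL fun t : 𝕀 => rotZ (τ * t) := isLoop_fullRot
  have h1 := ev_act Θ hl (hC.mul hZ)
  have h2 := ev_act Θ (D.isLoop_comp hN k hm) (hA.mul (hR.mul hZ))
  rw [ev_mul kap hA (hR.mul hZ), ev_mul kap hR hZ, hA', kap_rotY_mul, zero_add, kap_rotZ] at h2
  rw [ev_mul kap hC hZ, kap.ev_const, kap_rotZ, e0] at h1
  have h3 : Θ.cls.ev (fun t => pf (D.comp k) std3 (tube (1 / 2) (τ * t) (-(n * (τ * t))))) =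
      (D.cls hN Θ k).ev (fun t => tube (1 / 2) (τ * t) (-(n * (τ * t)))) :=
    (Θ.cls.ev_comap _ _ _ hm).symm
  rw [h3] at h2
  have h5 : (fun t : 𝕀 => act (polarScale (1 / 2) * rotZ (τ * t))
      (pf (D.belt k) beltVec (polar (1 / 2, τ * t, 0)))) = fun t : 𝕀 =>
      act (twistScale n (1 / 2) (-(n * (τ * t))) * (rotY (-(n * (τ * t))) * rotZ (τ * t)))
      (pf (D.comp k) std3 (tube (1 / 2) (τ * t) (-(n * (τ * t))))) := by
    funext t
    have h4 := D.act_belt hN k (v := (1 / 2, τ * t, 0)) (by norm_num) (by norm_num)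
    simp only [twistJac, twistTube, zero_sub] at h4
    exact h4
  rw [h5, h2] at h1
  have h6 : ∀ a b : ZMod 2, a + (b + 1) = 0 + (0 + 1) → a = b := by decide
  exact h6 _ _ h1

lemma not_extendsAcross (k : Fin c.length) (h : (D.cls hN Θ k).mer = 1) :
    ¬ ExtendsAcross (D.belt k) Θ := by
  rintro ⟨Θ', hΘ⟩
  let b : Fin 3 → ℂ × ℝ := ![(0, 1), (1, 0), (I, 0)]
  have hQ : IsGL (!![0, 0, 1; 1, 0, 0; 0, 1, 0] : M3) := by
    simp [IsGL, det_fin_three]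
  have hw : ‖(0 : ℂ)‖ < 1 := by simp
  have hl := D.isLoop_belt k hw
  have hQl : IsLoop IsGL fun _ : 𝕀 => (!![0, 0, 1; 1, 0, 0; 0, 1, 0] : M3) :=
    ⟨fun _ => hQ, continuous_const, rfl⟩
  have h1 := ev_act Θ hl hQl
  have hl' := isLoop_act hl hQl
  have h2 : ∀ t : 𝕀, act (!![0, 0, 1; 1, 0, 0; 0, 1, 0] : M3)
      (pf (D.belt k) beltVec (0, τ * t)) = pf (D.belt k) b (0, τ * t) := by
    intro t
    rw [act_pf]
    congr 1
    funext i
    fin_cases i <;> simp [sum_univ_three, beltVec, b]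
  simp only [h2] at h1 hl'
  rw [kap.ev_const, D.ev_belt hN Θ k, h] at h1
  have hr : IsLoop IsPos4 fun t => radialFrame 1 (τ * t) :=
    ⟨fun t => isPos4_radialFrame (by simp) _, continuous_radialFrame continuous_const (by fun_prop),
      by simp [radialFrame]; rfl⟩
  have h3 := handleCls_radialFrame Θ'
  rw [LoopClass.ev_eq _ hr] at h3
  rw [LoopClass.ev_eq _ hl'] at h1
  have h4 := hΘ _ _ hl'.path hr.path fun t => ⟨0, τ * t, b, hw, rfl, ?_⟩
  · have h5 : (1 : ZMod 2) + 1 + 0 = 1 := h1.symm.trans (h4.trans h3)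
    revert h5
    decide
  · have hv : ∀ (b b' : E 4) (v w : Fin 4 → E 4), b = b' → v = w →
      (⟨b, v⟩ : Tuple 4 (E 4)) = ⟨b', w⟩ := by rintro b _ v _ rfl rfl; rfl
    have key : ∀ i : Fin 4, (![pt4 0 (exp ((τ * t : ℝ) * I)), pt4 0 (I * exp ((τ * t : ℝ) * I)),
        pt4 1 0, pt4 I 0] : Fin 4 → E 4) i =
        (Fin.cons (pt4 0 (exp ((τ * t : ℝ) * I))) (fun i => pt4 (b i).1
          ((b i).2 * I * exp ((τ * t : ℝ) * I))) : Fin 4 → E 4) i := by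
      refine Fin.cases rfl fun i => ?_
      rw [Fin.cons_succ]
      fin_cases i <;> simp [b]
    exact hv _ _ _ _ (by simp) (funext key)

end SurgeryPresentation

/-- The change between the coordinates around consecutive components. -/
def nextCoord (ε ε' : ℝ) (v : R3) : R3 :=
  (v.1, v.2.1 - 8 / 5, v.2.2 + ε * v.1 * (1 + v.2.1) - ε' * v.1 * (1 + (v.2.1 - 8 / 5)))

lemma chain_nextCoord {N : ℕ} (hN : 0 < N) (k : ℕ) (ε ε' : ℝ) (v : R3) :
    chain N (k + 1) ε' (nextCoord ε ε' v) = chain N k ε v := by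
  have hN' : (N : ℝ) ≠ 0 := by positivity
  have h : τ * ((k + 1 : ℕ) : ℝ) / N + 5 * π / (4 * N) * (v.2.1 - 8 / 5) =
      τ * k / N + 5 * π / (4 * N) * v.2.1 := by
    push_cast
    field_simp
    ring
  simp only [chain, nextCoord, h]
  refine Prod.ext rfl (Prod.ext rfl ?_)
  simp only
  ring

def nextJac (ε ε' : ℝ) (v : R3) : M3 :=
  !![1, 0, ε * (1 + v.2.1) - ε' * (1 + (v.2.1 - 8 / 5)); 0, 1, ε * v.1 - ε' * v.1; 0, 0, 1]

lemma differentiable_nextCoord (ε ε' : ℝ) : Differentiable ℝ (nextCoord ε ε') := by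
  unfold nextCoord
  fun_prop

lemma fderiv_nextCoord (ε ε' : ℝ) (v : R3) (i : Fin 3) :
    fderiv ℝ (nextCoord ε ε') v (std3 i) = ∑ j, nextJac ε ε' v i j • std3 j := by
  have hd := ((differentiable_nextCoord ε ε') v).hasFDerivAt
  obtain ⟨X, Y, Z⟩ := v
  refine fderiv_std3 hd (r := fun i => ∑ j, nextJac ε ε' (X, Y, Z) i j • std3 j) ?_ ?_ ?_ i <;>
    simp only [nextCoord]
  · refine ((hasDerivAt_id' X).prodMk ((hasDerivAt_const _ _).prodMk
      (((((hasDerivAt_id' X).const_mul ε).mul_const (1 + Y)).const_add Z).sub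
        (((hasDerivAt_id' X).const_mul ε').mul_const (1 + (Y - 8 / 5)))))).congr_deriv ?_
    refine Prod.ext ?_ (Prod.ext ?_ ?_) <;> simp [sum_univ_three, nextJac, std3]
  · refine ((hasDerivAt_const _ _).prodMk (((hasDerivAt_id' Y).sub_const (8 / 5)).prodMk
      (((((hasDerivAt_id' Y).const_add 1).const_mul (ε * X)).const_add Z).sub
        ((((hasDerivAt_id' Y).sub_const (8 / 5)).const_add 1).const_mul (ε' * X))))).congr_deriv ?_
    refine Prod.ext ?_ (Prod.ext ?_ ?_) <;> simp [sum_univ_three, nextJac, std3]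
  · refine ((hasDerivAt_const _ _).prodMk ((hasDerivAt_const _ _).prodMk
      (((hasDerivAt_id' Z).add_const (ε * X * (1 + Y))).sub_const
        (ε' * X * (1 + (Y - 8 / 5)))))).congr_deriv ?_
    refine Prod.ext ?_ (Prod.ext ?_ ?_) <;> simp [sum_univ_three, nextJac, std3]

namespace SurgeryPresentation

variable (D : SurgeryPresentation c o) (hN : 0 < c.length) (Θ : SpinStructure o univ)

lemma nextCoord_mem {k : ℕ} {v : R3} (hN : 0 < c.length) (hv : v ∈ linkCompl c k) :
    nextCoord (claspSign c.length k) (claspSign c.length (k + 1)) v ∈ linkCompl c (k + 1) := by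
  refine ⟨hv.1, ?_⟩
  rw [chain_nextCoord hN]
  exact hv.2

lemma ev_next {k : ℕ} {ℓ : 𝕀 → R3} (hℓ : IsLoop (fun v => v ∈ linkCompl c k) ℓ)
    (h0 : ∀ t, (ℓ t).1 = 0) : (D.cls hN Θ k).ev ℓ =
      (D.cls hN Θ (k + 1)).ev fun t => (0, (ℓ t).2.1 - 8 / 5, (ℓ t).2.2) := by
  set ι := nextCoord (claspSign c.length k) (claspSign c.length (k + 1)) with hι
  have e0 : ∀ t, ι (ℓ t) = (0, (ℓ t).2.1 - 8 / 5, (ℓ t).2.2) := by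
    intro t
    simp [hι, nextCoord, h0]
  have hcomp : D.comp k = D.comp (k + 1) ∘ ι := by
    funext v
    simp only [comp, Function.comp, hι, chain_nextCoord hN]
  have hιc : Continuous ι := (differentiable_nextCoord _ _).continuous
  have hιℓ : IsLoop (fun v => v ∈ linkCompl c (k + 1)) fun t => ι (ℓ t) :=
    ⟨fun t => nextCoord_mem hN (hℓ.1 t), hιc.comp hℓ.2.1, by simp only [hℓ.2.2]⟩
  have hJ : IsLoop IsGL fun t => nextJac (claspSign c.length k) (claspSign c.length (k + 1)) (ℓ t) := by
    refine ⟨fun t => isGL_of_upper (by simp [nextJac]) (by simp [nextJac]), ?_, by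
      simp only [hℓ.2.2]⟩
    have := hℓ.2.1
    unfold nextJac
    refine continuous_matrix fun i j => ?_
    fin_cases i <;> fin_cases j <;> simp <;> fun_prop
  have h1 : (D.cls hN Θ k).ev ℓ = Θ.cls.ev fun t => pf (D.comp k) std3 (ℓ t) :=
    Θ.cls.ev_comap _ _ _ hℓ
  have h2 : (D.cls hN Θ (k + 1)).ev (fun t => ι (ℓ t)) =
      Θ.cls.ev fun t => pf (D.comp (k + 1)) std3 (ι (ℓ t)) := Θ.cls.ev_comap _ _ _ hιℓ
  have h3 := ev_act Θ (D.isLoop_comp hN (k + 1) hιℓ) hJ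
  rw [kap_eq_zero_of_upper hJ (by simp [nextJac]) (by simp [nextJac]), add_zero, ← h2] at h3
  simp only [e0] at h3
  rw [← h3, h1]
  congr 1
  funext t
  rw [hcomp, ← e0]
  exact (D.isParam_comp hN (k + 1)).pf_comp (nextCoord_mem hN (hℓ.1 t))
    ((differentiable_nextCoord _ _) (ℓ t)).hasFDerivAt (fderiv_nextCoord _ _ _)

lemma isLoop_rotate {k : ℕ} (hk : k + 1 < c.length) {σ : ℤ} (hσ : σ = 1 ∨ σ = -1 ∧ 1 ≤ k) :
    IsLoop (fun v => v ∈ linkCompl c k)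
      fun t => (0, σ * (3 / 5 + 1 / 20 * sin (τ * t)),
      σ * (1 / 20 * cos (τ * t))) := by
  refine ⟨fun t => ?_, by fun_prop, by simp⟩
  have hS1 := neg_one_le_sin (τ * t)
  have hS2 := sin_le_one (τ * t)
  refine near_mem hk hσ (by simp) (by rw [abs_le]; constructor <;> linarith) (by simp) ?_
  intro _ h1 h2
  have hσ0 : (σ : ℝ) ≠ 0 := by rcases hσ with rfl | ⟨rfl, _⟩ <;> norm_num
  have h3 := (mul_eq_zero.1 h1).resolve_left hσ0
  have := sin_sq_add_cos_sq (τ * t)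
  nlinarith

lemma ev_upper {k : ℕ} (hk : k + 1 < c.length) :
    (D.cls hN Θ k).ev (fun t => (1 / 20 * cos (τ * t),
      (1 : ℝ) * (3 / 5 + 1 / 20 * sin (τ * t)), 0)) = (D.cls hN Θ (k + 1)).mer := by
  have h1 := (D.cls hN Θ k).ev_rotate hk (σ := 1) (Or.inl rfl)
  rw [D.ev_next hN Θ (isLoop_rotate hk (Or.inl rfl)) (fun _ => rfl),
    ← (D.cls hN Θ (k + 1)).ev_tube_shift hk (3 * π / 2) (1 / 4)] at *
  rw [Int.cast_one] at h1
  rw [h1]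
  congr 1
  funext t
  have e1 : τ * ((t : ℝ) + 1 / 4) = τ * t + π / 2 := by ring
  have e2 : 3 * π / 2 = π / 2 + π := by ring
  rw [e1, e2]
  simp only [tube, Real.cos_add_pi_div_two, Real.sin_add_pi_div_two, Real.cos_add_pi, Real.sin_add_pi,
    Real.cos_pi_div_two, Real.sin_pi_div_two]
  refine Prod.ext ?_ (Prod.ext ?_ ?_) <;> simp only <;> ring

lemma ev_lower {k : ℕ} (hk : k + 2 < c.length) :
    (D.cls hN Θ (k + 1)).ev (fun t => (1 / 20 * cos (τ * t),
      (-1 : ℝ) * (3 / 5 + 1 / 20 * sin (τ * t)), 0)) = (D.cls hN Θ k).mer := by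
  have h1 := (D.cls hN Θ (k + 1)).ev_rotate hk (σ := -1) (Or.inr ⟨rfl, by omega⟩)
  have hk' : k < c.length := by omega
  rw [Int.cast_neg, Int.cast_one] at h1
  rw [h1, ← (D.cls hN Θ k).ev_tube_neg hk' (π / 2) (-(1 / 4))]
  have e : ∀ t : 𝕀, tube (1 / 2) (π / 2) (τ * (-(t : ℝ) + -(1 / 4))) =
      (0, 1 - 1 / 20 * sin (τ * t), -(1 / 20 * cos (τ * t))) := by
    intro t
    have e1 : τ * (-(t : ℝ) + -(1 / 4)) = -(τ * t + π / 2) := by ring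
    rw [e1]
    simp only [tube, Real.cos_neg, Real.sin_neg, Real.cos_add_pi_div_two, Real.sin_add_pi_div_two,
      Real.cos_pi_div_two, Real.sin_pi_div_two]
    refine Prod.ext ?_ (Prod.ext ?_ ?_) <;> simp only <;> ring
  have hl := isLoop_tube hk' (s := fun _ => π / 2)
    (ψ := fun t => τ * (-(t : ℝ) + -(1 / 4))) continuous_const (by fun_prop) (by
      simp only [e]; simp)
  rw [D.ev_next hN Θ hl (fun t => by rw [e])]
  congr 1
  funext t
  rw [e]
  refine Prod.ext ?_ (Prod.ext ?_ ?_) <;> simp only <;> ring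

lemma mer_relation {k : ℕ} (hk : k + 2 < c.length) :
    (c.get ⟨k + 1, by omega⟩ : ZMod 2) = c.get ⟨k + 1, by omega⟩ * (D.cls hN Θ (k + 1)).mer +
      ((D.cls hN Θ (k + 2)).mer + (D.cls hN Θ k).mer) := by
  have h1 := D.ev_longitude hN Θ ⟨k + 1, by omega⟩
  have h2 := (D.cls hN Θ (k + 1)).ev_parallel (by omega) (c.get ⟨k + 1, by omega⟩)
  rw [(D.cls hN Θ (k + 1)).ev_circle hN, (D.cls hN Θ (k + 1)).ev_half hN (Or.inl rfl),
    (D.cls hN Θ (k + 1)).ev_half hN (Or.inr rfl), D.ev_upper hN Θ hk, D.ev_lower hN Θ hk] at h2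
  exact h1.symm.trans h2

lemma mer_eq_one {k : ℕ} (hk : k + 1 < c.length) (h0 : (D.cls hN Θ k).mer = 1)
    (h1 : (D.cls hN Θ (k + 1)).mer = 1) : ∀ l < c.length, (D.cls hN Θ l).mer = 1 := by
  have hz : ∀ a x : ZMod 2, a = a * 1 + (x + 1) → x = 1 := by decide
  have hz' : ∀ a x : ZMod 2, a = a * 1 + (1 + x) → x = 1 := by decide
  have up : ∀ m, k + m + 1 < c.length →
      (D.cls hN Θ (k + m)).mer = 1 ∧ (D.cls hN Θ (k + m + 1)).mer = 1 := by
    intro m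
    induction m with
    | zero => exact fun _ => ⟨h0, h1⟩
    | succ m ih =>
      intro hm
      obtain ⟨h2, h3⟩ := ih (by omega)
      have h4 := D.mer_relation hN Θ (k := k + m) hm
      rw [h2, h3] at h4
      exact ⟨h3, hz _ _ h4⟩
  have down : ∀ m ≤ k, (D.cls hN Θ (k - m)).mer = 1 ∧ (D.cls hN Θ (k - m + 1)).mer = 1 := by
    intro m
    induction m with
    | zero => exact fun _ => ⟨h0, h1⟩
    | succ m ih =>
      intro hm
      obtain ⟨h2, h3⟩ := ih (by omega)
      obtain ⟨d, hd⟩ : ∃ d, k - m = d + 1 := ⟨k - (m + 1), by omega⟩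
      have hd' : k - (m + 1) = d := by omega
      rw [hd] at h2 h3
      rw [hd']
      have h4 := D.mer_relation hN Θ (k := d) (by omega)
      rw [h2, h3] at h4
      exact ⟨hz' _ _ h4, h2⟩
  intro l hl
  rcases le_total l k with h | h
  · have := (down (k - l) (by omega)).1
    rwa [show k - (k - l) = l by omega] at this
  · rcases eq_or_lt_of_le h with rfl | h
    · exact h0
    · have := (up (l - k - 1) (by omega)).2
      rwa [show k + (l - k - 1) + 1 = l by omega] at this

lemma sublink_eq_univ {k : ℕ} (hk : k + 1 < c.length) (h0 : (D.cls hN Θ k).mer = 1)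
    (h1 : (D.cls hN Θ (k + 1)).mer = 1) : D.sublink Θ = Finset.univ := by
  ext l
  simp [sublink, D.not_extendsAcross hN Θ l (D.mer_eq_one hN Θ hk h0 h1 l l.2)]

end SurgeryPresentation

/-! ### Rotation numbers of simple curves on the torus -/

/-- The tangent direction of a regular curve in the plane which is periodic up to a nonzero
translation, and which is embedded modulo the period, has rotation number zero. -/
lemma exists_periodic_log_deriv {z z' : ℝ → ℂ} {T : ℝ} (hT : 0 < T) {m : ℂ} (hm : m ≠ 0)
    (hz : ∀ s, HasDerivAt z (z' s) s) (hz' : Continuous z') (h0 : ∀ s, z' s ≠ 0)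
    (hper : ∀ s, z (s + T) = z s + m) (hinj : ∀ s u, 0 < u → u < T → z (s + u) ≠ z s) :
    ∃ l : ℝ → ℂ, Continuous l ∧ (∀ s, exp (l s) = z' s) ∧ ∀ s, l (s + T) = l s := by
  have hper' : ∀ s, z' (s + T) = z' s := fun s => by
    have h1 : HasDerivAt (fun x => z (x + T)) (z' (s + T)) s := by
      simpa using (hz (s + T)).comp_add_const s T
    have h2 : HasDerivAt (fun x => z x + m) (z' s) s := (hz s).add_const m
    rw [funext hper] at h1
    exact h1.unique h2
  let q : ℝ → ℝ := fun u => max 0 (min u T)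
  have hq0 : ∀ u, 0 ≤ q u := fun u => le_max_left _ _
  have hqT : ∀ u, q u ≤ T := fun u => max_le hT.le (min_le_right _ _)
  let H : ℝ × ℝ → ℂ := fun x => ∫ y in (0 : ℝ)..1, z' (x.1 + q x.2 * y)
  have hH : Continuous H := by
    apply intervalIntegral.continuous_parametric_intervalIntegral_of_continuous'
    unfold uncurry
    fun_prop
  have hsec : ∀ s u, (q u : ℂ) * H (s, u) = z (s + q u) - z s := fun s u => by
    have h1 : ∀ y ∈ Set.uIcc (0 : ℝ) 1, HasDerivAt (fun y : ℝ => z (s + q u * y))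
        (q u * z' (s + q u * y)) y := fun y _ => by
      have h2 : HasDerivAt (fun y : ℝ => s + q u * y) (q u) y := by
        simpa using ((hasDerivAt_id y).const_mul (q u)).const_add s
      simpa [Function.comp_def] using (hz (s + q u * y)).scomp y h2
    have h3 := intervalIntegral.integral_eq_sub_of_hasDerivAt h1
      ((by fun_prop : Continuous fun y : ℝ => (q u : ℂ) * z' (s + q u * y)).intervalIntegrable _ _)
    rw [intervalIntegral.integral_const_mul] at h3
    simpa using h3
  have hH0 : ∀ x ∈ (univ : Set (ℝ × ℝ)), H x ≠ 0 := by
    rintro ⟨s, u⟩ - h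
    have h1 := hsec s u
    rw [h, mul_zero] at h1
    rcases (hq0 u).eq_or_lt with h2 | h2
    · have : H (s, u) = z' s := by simp [H, ← h2]
      exact h0 s (this ▸ h)
    · rcases (hqT u).eq_or_lt with h3 | h3
      · rw [h3, hper] at h1
        exact hm (by simpa using h1.symm)
      · exact hinj s _ h2 h3 (sub_eq_zero.1 h1.symm)
  obtain ⟨l, hl, hlH⟩ := exists_log_of_convex convex_univ isOpen_univ Set.univ_nonempty
    hH.continuousOn hH0
  rw [continuousOn_univ] at hl
  have hHT : ∀ s u, H (s + T, u) = H (s, u) := fun s u => by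
    refine intervalIntegral.integral_congr fun y _ => ?_
    change z' (s + T + q u * y) = z' (s + q u * y)
    rw [← hper' (s + q u * y)]
    ring_nf
  obtain ⟨n, hn⟩ := exists_int_of_exp_eq (isPreconnected_univ (α := ℝ × ℝ))
    (l := fun x => l (x.1 + T, x.2)) (l' := l) (by fun_prop) hl.continuousOn fun x hx => by
      rw [hlH x hx, hlH _ trivial, hHT]
  obtain ⟨n', hn'⟩ := exists_int_of_exp_eq (isPreconnected_univ (α := ℝ))
    (l := fun s => l (s, T)) (l' := fun _ => l (0, T)) (by fun_prop) (by fun_prop) fun s _ => by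
      rw [hlH _ trivial, hlH _ trivial]
      have hqe : q T = T := by simp [q, hT.le]
      have hT' : (T : ℂ) ≠ 0 := by exact_mod_cast hT.ne'
      have h1 := hsec s T
      have h2 := hsec 0 T
      rw [hqe, hper] at h1 h2
      exact mul_left_cancel₀ hT' (by rw [h1, h2]; ring)
  have hn0 : (n : ℂ) * tpi = 0 := by
    have h1 := hn (0, T) trivial
    have h2 := hn' (0 + T) trivial
    have h3 := hn' 0 trivial
    linear_combination h2 - h1 - h3
  refine ⟨fun s => l (s, 0), by fun_prop, fun s => ?_, fun s => ?_⟩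
  · rw [hlH _ trivial]
    have hqe : q 0 = 0 := by simp [q, hT.le]
    simp [H, hqe]
  · have := hn (s, 0) trivial
    rwa [hn0, add_zero] at this

lemma kap_eq_zero_of_planar {A : 𝕀 → M3} (hA : IsLoop IsGL A) (h0 : ∀ t, A t 0 2 = 0)
    (h1 : ∀ t, A t 1 2 = 0) {l : 𝕀 → ℂ} (hl : Continuous l) (hl' : l 0 = l 1)
    (h : ∀ t, exp (l t) = ⟨A t 0 0, A t 0 1⟩) : kap.ev A = 0 := by
  have hAc := hA.2.1
  have hre : ∀ t, A t 0 0 = Real.exp (l t).re * cos (l t).im := fun t => by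
    have := congrArg Complex.re (h t); rw [Complex.exp_re] at this; exact this.symm
  have him : ∀ t, A t 0 1 = Real.exp (l t).re * sin (l t).im := fun t => by
    have := congrArg Complex.im (h t); rw [Complex.exp_im] at this; exact this.symm
  let R : 𝕀 → M3 := fun t => A t * rotZ (-(l t).im)
  have hRL : IsLoop IsGL R := ⟨fun t => (hA.1 t).mul (isGL_rotZ _),
    hAc.mul (continuous_rotZ.comp (by fun_prop)), by simp only [R]; rw [hA.2.2, hl']⟩
  have e1 : kap.ev A = kap.ev R := by
    refine kap.ev_congr (fun s t => A t * rotZ (-(s * (l t).im))) ?_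
      (fun s t => (hA.1 t).mul (isGL_rotZ _)) (fun s => by rw [hA.2.2, hl']) (fun t => ?_)
      (fun t => by simp [R])
    · exact (hAc.comp continuous_snd).mul (continuous_rotZ.comp (by fun_prop))
    · have : rotZ 0 = 1 := by simp [rotZ, Matrix.one_fin_three]
      simp [this]
  have r00 : ∀ t, 0 < R t 0 0 := fun t => by
    have : R t 0 0 = Real.exp (l t).re := by
      simp [R, rotZ, mul_apply, sum_univ_three, hre, him]
      linear_combination Real.exp (l t).re * sin_sq_add_cos_sq (l t).im
    rw [this]; exact Real.exp_pos _
  have r01 : ∀ t, R t 0 1 = 0 := fun t => by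
    simp [R, rotZ, mul_apply, sum_univ_three, hre, him]; ring
  have r02 : ∀ t, R t 0 2 = 0 := fun t => by
    simp [R, rotZ, mul_apply, sum_univ_three, h0]
  have r12 : ∀ t, R t 1 2 = 0 := fun t => by
    simp [R, rotZ, mul_apply, sum_univ_three, h1]
  have hdet : ∀ t, 0 < R t 1 1 * R t 2 2 := fun t => by
    have h2 : 0 < (R t).det := hRL.1 t
    rw [det_fin_three, r01, r02, r12] at h2
    have h3 : 0 < R t 0 0 * (R t 1 1 * R t 2 2) := by linarith
    exact (mul_pos_iff_of_pos_left (r00 t)).1 h3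
  have hRc := hRL.2.1
  have c11 : Continuous fun t => R t 1 1 := hRc.matrix_elem 1 1
  obtain ⟨σ, hσ, hs⟩ : ∃ σ : ℝ, σ ^ 2 = 1 ∧ ∀ t, 0 < σ * R t 1 1 := by
    by_cases hp : ∃ t, 0 < R t 1 1
    · obtain ⟨t₀, ht₀⟩ := hp
      refine ⟨1, by norm_num, fun t => ?_⟩
      by_contra hn
      obtain ⟨t', ht'⟩ := mem_range_of_exists_le_of_exists_ge c11 ⟨t, by linarith⟩ ⟨t₀, ht₀.le⟩
      have := hdet t'
      rw [show R t' 1 1 = 0 from ht', zero_mul] at this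
      exact this.false
    · push Not at hp
      refine ⟨-1, by norm_num, fun t => ?_⟩
      rcases (hp t).eq_or_lt with h2 | h2
      · have := hdet t
        rw [h2, zero_mul] at this
        exact absurd this (lt_irrefl _)
      · linarith
  have hs2 : ∀ t, 0 < σ * R t 2 2 := fun t => by
    have h3 : 0 < (σ * R t 1 1) * (σ * R t 2 2) := by
      have : (σ * R t 1 1) * (σ * R t 2 2) = R t 1 1 * R t 2 2 := by
        linear_combination R t 1 1 * R t 2 2 * hσ
      rw [this]; exact hdet t
    exact (mul_pos_iff_of_pos_left (hs t)).1 h3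
  have hd : IsGL (!![1, 0, 0; 0, σ, 0; 0, 0, σ] : M3) := by
    change 0 < det _
    rw [det_fin_three]
    simp
    nlinarith
  rw [e1, ev_eq_of_segment kap hRL ⟨fun _ => hd, continuous_const, rfl⟩ (fun t s => ?_)]
  · exact kap.ev_const _
  · change 0 < det _
    have hs0 := s.2.1
    have hs1 := s.2.2
    have p : ∀ a b : ℝ, 0 < a → 0 < b → 0 < (1 - (s : ℝ)) * a + s * b := fun a b ha hb => by
      rcases hs0.eq_or_lt with h2 | h2
      · rw [← h2]; simpa using ha
      · exact add_pos_of_nonneg_of_pos (mul_nonneg (by linarith) ha.le) (mul_pos h2 hb)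
    have q0 := p _ 1 (r00 t) one_pos
    have q1 := p _ (σ * σ) (hs t) (by nlinarith)
    have q2 := p _ (σ * σ) (hs2 t) (by nlinarith)
    have : det ((1 - (s : ℝ)) • R t + (s : ℝ) • (!![1, 0, 0; 0, σ, 0; 0, 0, σ] : M3)) =
        ((1 - (s : ℝ)) * R t 0 0 + s * 1) * (((1 - (s : ℝ)) * (σ * R t 1 1) + s * (σ * σ)) *
          ((1 - (s : ℝ)) * (σ * R t 2 2) + s * (σ * σ))) := by
      rw [det_fin_three]
      simp [r01, r02, r12]
      linear_combination (-(((1 - (s : ℝ)) * R t 0 0 + s) * (((1 - (s : ℝ)) * (R t 1 1) + s * (σ)) *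
          ((1 - (s : ℝ)) * (R t 2 2) + s * (σ))))) * hσ
    rw [this]
    exact mul_pos q0 (mul_pos q1 q2)

/-! ### Lifting maps through a parametrization -/

section Lift

variable [FiniteDimensional ℝ V]
  {W : Type*} [NormedAddCommGroup W] [NormedSpace ℝ W]
   {φ : V → Y} {U : Set V} {b : Fin 3 → V}

lemma IsParam.exists_lift (h : IsParam o φ U b) (hd : Module.finrank ℝ V = 3) {x : V}
    (hx : x ∈ U) {ψ : W → Y} {w₀ : W} (hψ : ContMDiffAt 𝓘(ℝ, W) (𝓡 3) ∞ ψ w₀) (he : φ x = ψ w₀) :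
    ∃ R : W → V, ContDiffAt ℝ ∞ R w₀ ∧ R w₀ = x ∧ ∀ᶠ w in 𝓝 w₀, φ (R w) = ψ w := by
  have : CompleteSpace V := FiniteDimensional.complete ℝ V
  set f := extChartAt (𝓡 3) (φ x) ∘ φ with hf
  have hc : ContDiffAt ℝ ∞ f x := contDiffAt_chart (h.contMDiffAt hx)
  have hli : LinearIndependent ℝ fun i => fderiv ℝ f x (b i) := by
    have h2 := (o.indep _ _ (h.pos x hx)).map' (chartVec (φ x) (φ x)).toLinearMap
      (LinearMap.ker_eq_bot.2 (chartVec_injective (mem_chart_source _ _)))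
    convert h2 using 2 with i
    · exact (chartVec_mfderiv (h.mdifferentiableAt hx) (mem_chart_source _ _) (b i)).symm
    · rfl
  have hsurj : Function.Surjective (fderiv ℝ f x).toLinearMap := by
    have h3 : Submodule.span ℝ (range fun i => fderiv ℝ f x (b i)) = ⊤ :=
      hli.span_eq_top_of_card_eq_finrank' (by simp)
    rw [← LinearMap.range_eq_top, eq_top_iff, ← h3, Submodule.span_le]
    rintro _ ⟨i, rfl⟩
    exact ⟨b i, rfl⟩
  have hinj := (LinearMap.injective_iff_surjective_of_finrank_eq_finrank (f := (fderiv ℝ f x).toLinearMap)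
    (by rw [hd]; simp)).2 hsurj
  let e : V ≃L[ℝ] E 3 :=
    (LinearEquiv.ofBijective (fderiv ℝ f x).toLinearMap ⟨hinj, hsurj⟩).toContinuousLinearEquiv
  have he' : HasFDerivAt f (e : V →L[ℝ] E 3) x := (hc.differentiableAt (by simp)).hasFDerivAt
  have h1 : (∞ : WithTop ℕ∞) ≠ 0 := by simp
  have hψ' : ContDiffAt ℝ ∞ (extChartAt (𝓡 3) (φ x) ∘ ψ) w₀ := by
    rw [he]; exact contDiffAt_chart hψ
  have hfx : f x = (extChartAt (𝓡 3) (φ x) ∘ ψ) w₀ := by simp [hf, he]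
  have hR := hc.to_localInverse he' h1
  have hR0 := hc.localInverse_apply_image he' h1
  have hcomp : ContDiffAt ℝ ∞ (hc.localInverse he' h1 ∘ (extChartAt (𝓡 3) (φ x) ∘ ψ)) w₀ :=
    ContDiffAt.comp w₀ (hfx ▸ hR) hψ'
  have hRw : (hc.localInverse he' h1 ∘ (extChartAt (𝓡 3) (φ x) ∘ ψ)) w₀ = x := by
    change hc.localInverse he' h1 ((extChartAt (𝓡 3) (φ x) ∘ ψ) w₀) = x
    rw [← hfx]; exact hR0
  refine ⟨_, hcomp, hRw, ?_⟩
  have hr : ∀ᶠ y in 𝓝 (f x), f (hc.localInverse he' h1 y) = y :=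
    (hc.hasStrictFDerivAt' he' h1).eventually_right_inverse
  have hsrc : ∀ᶠ v in 𝓝 x, φ v ∈ (extChartAt (𝓡 3) (φ x)).source :=
    (h.contMDiffAt hx).continuousAt (extChartAt_source_mem_nhds (I := 𝓡 3) (φ x))
  have hsrc' : ∀ᶠ w in 𝓝 w₀, ψ w ∈ (extChartAt (𝓡 3) (φ x)).source :=
    hψ.continuousAt (by rw [he]; exact extChartAt_source_mem_nhds (I := 𝓡 3) (ψ w₀))
  rw [hfx] at hr
  have hcc := hcomp.continuousAt
  unfold ContinuousAt at hcc
  rw [hRw] at hcc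
  filter_upwards [hψ'.continuousAt.eventually hr, hcc.eventually hsrc, hsrc'] with w h2 h3 h4
  exact (extChartAt (𝓡 3) (φ x)).injOn h3 h4 h2

lemma continuousAt_of_param {X α : Type*} [TopologicalSpace X] [TopologicalSpace α]
    {F : X → Y} {x₀ : X} (hF : ContinuousAt F x₀) (h : IsParam o φ U b) {v₀ : V} (hv : v₀ ∈ U)
    (he : F x₀ = φ v₀) {f : V → α} (hf : ContinuousAt f v₀) {G : X → α}
    (hG : ∀ᶠ v in 𝓝 v₀, ∀ x, F x = φ v → G x = f v) : ContinuousAt G x₀ := by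
  have h0 : G x₀ = f v₀ := hG.self_of_nhds x₀ he
  unfold ContinuousAt
  rw [h0]
  intro N hN
  have h1 : φ '' {v | (∀ x, F x = φ v → G x = f v) ∧ f v ∈ N} ∈ 𝓝 (F x₀) := by
    rw [he, ← h.map_nhds hv]
    exact Filter.image_mem_map (hG.and (hf hN))
  change ∀ᶠ x in 𝓝 x₀, G x ∈ N
  filter_upwards [show ∀ᶠ x in 𝓝 x₀, F x ∈ φ '' _ from hF h1] with x hx
  obtain ⟨v, ⟨h2, h3⟩, h4⟩ := hx
  rw [h2 x h4.symm]
  exact h3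

end Lift

lemma IsParam.exists_lift_coeff
    [FiniteDimensional ℝ V] {φ : V → Y} {U : Set V} {b : Fin 3 → V} (hφ : IsParam o φ U b)
    (hd : Module.finrank ℝ V = 3) {x : V} (hx : x ∈ U) {ψ : R3 → Y} {U' : Set R3}
    (hψ : IsParam o ψ U' std3) {w₀ : R3} (hw : w₀ ∈ U') (he : φ x = ψ w₀) {κ : V → Fin 3 → ℝ}
    (hκ : ∀ v, v = ∑ j, κ v j • b j) :
    ∃ (R : R3 → V) (L : R3 →L[ℝ] V), HasFDerivAt R L w₀ ∧ R w₀ = x ∧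
      (∀ᶠ w in 𝓝 w₀, φ (R w) = ψ w) ∧ IsGL (Matrix.of fun i => κ (L (std3 i))) ∧
      pf ψ std3 w₀ = act (Matrix.of fun i => κ (L (std3 i))) (pf φ b x) := by
  obtain ⟨R, hR, hR0, hRe⟩ := hφ.exists_lift hd hx (hψ.contMDiffAt hw) he
  have hL := (hR.differentiableAt (by simp)).hasFDerivAt
  have e : pf ψ std3 w₀ = act (Matrix.of fun i => κ (fderiv ℝ R w₀ (std3 i))) (pf φ b x) := by
    have h1 : ψ =ᶠ[𝓝 w₀] φ ∘ R := by filter_upwards [hRe] with w h2 using h2.symm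
    rw [pf_congr h1, ← hR0]
    exact hφ.pf_comp (hR0 ▸ hx) hL fun i => hκ _
  refine ⟨R, _, hL, hR0, hRe, ?_, e⟩
  rw [← (hφ.isPos hx).act_iff, ← e]
  exact hψ.isPos hw

namespace OpenBook

lemma real_of_nbhd_mem_page (B : OpenBook h o) {x : ℝ × ℂ} (hx : ‖x.2‖ < 1)
    (hp : B.nbhd x ∈ B.page) : x.2.im = 0 ∧ 0 ≤ x.2.re := by
  rcases hp with ⟨p, hp, e⟩ | ⟨u, e⟩
  · obtain ⟨-, h1, -⟩ := (B.glue p hp 0 x.1 x.2 hx).1 e.symm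
    have h2 : x.2 = (‖x.2‖ : ℂ) := by simpa using h1
    rw [h2]
    simp
  · have := ((B.nbhd_eq_iff x (u, 0) hx (by simp)).1 e).1
    simp [this]

lemma ne_binding (B : OpenBook h o) {ψ : R3 → Y} {U : Set R3} (hψ : IsParam o ψ U std3) {w₀ : R3}
    (hw : w₀ ∈ U) (hp : ∀ᶠ w in 𝓝 w₀, w.2.2 = w₀.2.2 → ψ w ∈ B.page) (u : ℝ) :
    B.nbhd (u, 0) ≠ ψ w₀ := by
  intro he
  obtain ⟨R, L, hL, hR0, hRe, hGL, -⟩ := B.isParam_nbhd.exists_lift_coeff (by simp)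
    (x := (u, 0)) (by simp [nbhdDom]) hψ hw he (κ := fun v => ![v.1, v.2.re, v.2.im]) (fun v => by
      refine Prod.ext ?_ (Complex.ext ?_ ?_) <;> simp [sum_univ_three, nbhdVec])
  have hRc := hL.continuousAt
  have hsm : ∀ᶠ w in 𝓝 w₀, ‖(R w).2‖ < 1 := by
    have : ContinuousAt (fun w => ‖(R w).2‖) w₀ := by fun_prop
    exact this.eventually_lt_const (by simp [hR0])
  have key : ∀ i : Fin 3, i ≠ 2 → (L (std3 i)).2.re = 0 ∧ (L (std3 i)).2.im = 0 := by
    intro i hi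
    have hline : HasDerivAt (fun a : ℝ => w₀ + a • std3 i) (std3 i) 0 := by
      simpa using ((hasDerivAt_id (0 : ℝ)).smul_const (std3 i)).const_add w₀
    have hz0 : w₀ + (0 : ℝ) • std3 i = w₀ := by simp
    have hRl : HasDerivAt (fun a : ℝ => R (w₀ + a • std3 i)) (L (std3 i)) 0 :=
      HasFDerivAt.comp_hasDerivAt (0 : ℝ) (by rw [hz0]; exact hL) hline
    have hev : ∀ᶠ a : ℝ in 𝓝 0, (R (w₀ + a • std3 i)).2.im = 0 ∧
        0 ≤ (R (w₀ + a • std3 i)).2.re := by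
      have hc : Tendsto (fun a : ℝ => w₀ + a • std3 i) (𝓝 0) (𝓝 w₀) := by
        simpa using hline.continuousAt.tendsto
      filter_upwards [hc.eventually hp, hc.eventually hRe, hc.eventually hsm] with a h1 h2 h3
      refine B.real_of_nbhd_mem_page h3 ?_
      rw [h2]
      apply h1
      fin_cases i <;> simp [std3] at hi ⊢
    have hR2 := hRl.snd
    have hre : HasDerivAt (fun a : ℝ => (R (w₀ + a • std3 i)).2.re) (L (std3 i)).2.re 0 :=
      Complex.reCLM.hasFDerivAt.comp_hasDerivAt (0 : ℝ) hR2
    have him : HasDerivAt (fun a : ℝ => (R (w₀ + a • std3 i)).2.im) (L (std3 i)).2.im 0 :=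
      Complex.imCLM.hasFDerivAt.comp_hasDerivAt (0 : ℝ) hR2
    constructor
    · refine IsLocalMin.hasDerivAt_eq_zero ?_ hre
      filter_upwards [hev] with a ha
      simpa [hR0] using ha.2
    · refine IsLocalMin.hasDerivAt_eq_zero ?_ him
      filter_upwards [hev] with a ha
      simp [hR0, ha.1]
  have h0 := key 0 (by decide)
  have h1 := key 1 (by decide)
  have : 0 < det (Matrix.of fun i => ![(L (std3 i)).1, (L (std3 i)).2.re, (L (std3 i)).2.im]) := hGL
  rw [det_fin_three] at this
  simp [h0, h1] at this

lemma exists_eq_tor (B : OpenBook h o) {ψ : R3 → Y} {U : Set R3} (hψ : IsParam o ψ U std3)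
    {w₀ : R3} (hw : w₀ ∈ U) (hp : ∀ᶠ w in 𝓝 w₀, w.2.2 = w₀.2.2 → ψ w ∈ B.page) :
    ∃ p ∉ range latticePt, ψ w₀ = B.tor (p, 0) := by
  rcases hp.self_of_nhds rfl with h1 | ⟨u, h1⟩
  · exact h1
  · exact absurd h1.symm (B.ne_binding hψ hw hp u)

lemma eq_zero_of_tor_mem_page (B : OpenBook h o) {x : (ℝ × ℝ) × ℝ} (hx : x ∈ punct)
    (hx' : |x.2| < 1) (hp : B.tor x ∈ B.page) : x.2 = 0 := by
  rcases hp with ⟨p, hp, e⟩ | ⟨u, e⟩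
  · obtain ⟨j, -, h1, -⟩ := (B.tor_eq_iff x.1 hx p hp x.2 0).1 e
    rw [zero_add] at h1
    rw [h1] at hx' ⊢
    have : |j| < 1 := by exact_mod_cast hx'
    rw [Int.abs_lt_one_iff.1 this]
    simp
  · exact absurd rfl ((B.glue x.1 hx x.2 u 0 (by simp)).1 e).1

lemma exists_lattice_of_tor_eq (B : OpenBook h o) {p p' : ℝ × ℝ}
    (hp : p ∉ range latticePt) (hp' : p' ∉ range latticePt) (e : B.tor (p, 0) = B.tor (p', 0)) :
    ∃ m, p' = p + latticePt m := by
  obtain ⟨j, m, h1, h2⟩ := (B.tor_eq_iff p hp p' hp' 0 0).1 e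
  have : j = 0 := by
    have : (j : ℝ) = 0 := by linarith
    exact_mod_cast this
  subst this
  exact ⟨m, by simpa using h2⟩

lemma exists_page_coeff (B : OpenBook h o) {ψ : R3 → Y} {U : Set R3} (hψ : IsParam o ψ U std3)
    {w₀ : R3} (hw : w₀ ∈ U) (hp : ∀ᶠ w in 𝓝 w₀, w.2.2 = w₀.2.2 → ψ w ∈ B.page)
    {γ : ℝ → ℝ × ℝ} (hγ : Continuous γ) (hγ' : ∀ s, γ s ∉ range latticePt) {s₀ : ℝ}
    (hw₀ : w₀.1 = s₀) (he : ∀ s, B.tor (γ s, 0) = ψ (s, w₀.2)) :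
    ∃ A : M3, IsGL A ∧ pf ψ std3 w₀ = act A (pf B.tor torVec (γ s₀, 0)) ∧ A 0 2 = 0 ∧ A 1 2 = 0 ∧
      HasDerivAt γ (A 0 0, A 0 1) s₀ := by
  have hx : (γ s₀, (0 : ℝ)) ∈ punct := hγ' s₀
  obtain ⟨R, L, hL, hR0, hRe, hGL, hpf⟩ := B.isParam_tor.exists_lift_coeff (by simp) hx hψ hw
    ((he s₀).trans (by rw [← hw₀])) (κ := fun v => ![v.1.1, v.1.2, v.2]) (fun v => by
      refine Prod.ext (Prod.ext ?_ ?_) ?_ <;> simp [sum_univ_three, torVec])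
  have hRc := hL.continuousAt
  have hsm : ∀ᶠ w in 𝓝 w₀, R w ∈ punct ∧ |(R w).2| < 1 := by
    have h1 : ContinuousAt (fun w => |(R w).2|) w₀ := by fun_prop
    have h2 : ∀ᶠ w in 𝓝 w₀, R w ∈ punct :=
      hRc (isOpen_punct.mem_nhds (by rw [hR0]; exact hx))
    have h3 : ∀ᶠ w in 𝓝 w₀, |(R w).2| < 1 := h1.eventually_lt_const (by simp [hR0])
    exact h2.and h3
  have hzero : ∀ᶠ w in 𝓝 w₀, w.2.2 = w₀.2.2 → (R w).2 = 0 := by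
    filter_upwards [hp, hRe, hsm] with w h1 h2 h3 h4
    refine B.eq_zero_of_tor_mem_page h3.1 h3.2 ?_
    rw [h2]; exact h1 h4
  have key : ∀ i : Fin 3, i ≠ 2 → (L (std3 i)).2 = 0 := by
    intro i hi
    have hline : HasDerivAt (fun a : ℝ => w₀ + a • std3 i) (std3 i) 0 := by
      simpa using ((hasDerivAt_id (0 : ℝ)).smul_const (std3 i)).const_add w₀
    have hz0 : w₀ + (0 : ℝ) • std3 i = w₀ := by simp
    have hRl : HasDerivAt (fun a : ℝ => R (w₀ + a • std3 i)) (L (std3 i)) 0 :=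
      HasFDerivAt.comp_hasDerivAt (0 : ℝ) (by rw [hz0]; exact hL) hline
    have hc : Tendsto (fun a : ℝ => w₀ + a • std3 i) (𝓝 0) (𝓝 w₀) := by
      simpa using hline.continuousAt.tendsto
    have hRl2 : HasDerivAt (fun a : ℝ => (R (w₀ + a • std3 i)).2) (L (std3 i)).2 0 := hRl.snd
    refine hRl2.unique ((hasDerivAt_const (0 : ℝ) (0 : ℝ)).congr_of_eventuallyEq ?_)
    filter_upwards [hc.eventually hzero] with a h1
    apply h1
    fin_cases i <;> simp [std3] at hi ⊢
  have hcurve : HasDerivAt (fun s : ℝ => ((s, w₀.2) : R3)) (std3 0) s₀ :=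
    (hasDerivAt_id s₀).prodMk (hasDerivAt_const s₀ w₀.2)
  have hw₁ : ((s₀, w₀.2) : R3) = w₀ := by rw [← hw₀]
  have hRs : HasDerivAt (fun s : ℝ => R (s, w₀.2)) (L (std3 0)) s₀ :=
    HasFDerivAt.comp_hasDerivAt s₀ (by rw [hw₁]; exact hL) hcurve
  refine ⟨_, hGL, hpf, key 0 (by decide), key 1 (by decide), ?_⟩
  refine HasDerivAt.congr_of_eventuallyEq (f := fun s => (R (s, w₀.2)).1) hRs.fst ?_
  have hc : Tendsto (fun s : ℝ => ((s, w₀.2) : R3)) (𝓝 s₀) (𝓝 w₀) := by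
    have := hcurve.continuousAt.tendsto
    rwa [hw₁] at this
  have hclose : ∀ᶠ s in 𝓝 s₀, ‖γ s - (R (s, w₀.2)).1‖ < 1 := by
    have h1 : ContinuousAt (fun s => ‖γ s - (R (s, w₀.2)).1‖) s₀ := by
      exact (hγ.continuousAt.sub (continuous_fst.continuousAt.comp hRs.continuousAt)).norm
    exact h1.eventually_lt_const (by simp [hw₁, hR0])
  filter_upwards [hc.eventually hzero, hc.eventually hRe, hc.eventually hsm, hclose]
    with s h1 h2 h3 h4
  have h5 : R (s, w₀.2) = ((R (s, w₀.2)).1, 0) := Prod.ext rfl (h1 rfl)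
  rw [h5] at h2
  obtain ⟨m, hm⟩ := B.exists_lattice_of_tor_eq h3.1 (hγ' s) (h2.trans (he s).symm)
  rw [hm, add_sub_cancel_left] at h4
  have hm1 : |m.1| < 1 := by
    have : |(m.1 : ℝ)| < 1 := (norm_fst_le (latticePt m)).trans_lt h4
    exact_mod_cast this
  have hm2 : |m.2| < 1 := by
    have : |(m.2 : ℝ)| < 1 := (norm_snd_le (latticePt m)).trans_lt h4
    exact_mod_cast this
  have hm0 : m = 0 := Prod.ext (Int.abs_lt_one_iff.1 hm1) (Int.abs_lt_one_iff.1 hm2)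
  rw [hm, hm0, latticePt_zero, add_zero]

end OpenBook

lemma exp_tpi_add_int (x : ℂ) (n : ℤ) : exp (tpi * (x + n)) = exp (tpi * x) :=
  exp_eq_exp_iff_exists_int.2 ⟨n, by unfold tpi; ring⟩

namespace OpenBook

lemma exists_lift_curve (B : OpenBook h o) {f : ℝ → Y} (hf : Continuous f)
    (hp : ∀ s, ∃ p ∉ range latticePt, f s = B.tor (p, 0)) :
    ∃ γ : ℝ → ℝ × ℝ, Continuous γ ∧ (∀ s, γ s ∉ range latticePt) ∧ ∀ s, B.tor (γ s, 0) = f s := by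
  choose p hp hfp using hp
  have key : ∀ c : ℝ × ℝ →L[ℝ] ℝ, (∀ m, ∃ n : ℤ, c (latticePt m) = n) →
      ∃ a : ℝ → ℝ, Continuous a ∧ ∀ s, ∃ n : ℤ, a s = c (p s) + n := by
    intro c hc
    have hcont : Continuous fun s => exp (tpi * (c (p s) : ℂ)) := by
      rw [continuous_iff_continuousAt]
      intro s₀
      refine continuousAt_of_param (f := fun v => exp (tpi * (c v.1 : ℂ)))
        hf.continuousAt B.isParam_tor (v₀ := (p s₀, 0)) (hp s₀) (hfp s₀) (by fun_prop) ?_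
      have h1 : ∀ᶠ v : (ℝ × ℝ) × ℝ in 𝓝 (p s₀, 0), v ∈ punct := isOpen_punct.mem_nhds (hp s₀)
      have h2 : ∀ᶠ v : (ℝ × ℝ) × ℝ in 𝓝 (p s₀, 0), |v.2| < 1 := by
        have : ContinuousAt (fun v : (ℝ × ℝ) × ℝ => |v.2|) (p s₀, 0) := by fun_prop
        exact this.eventually_lt_const (by simp)
      filter_upwards [h1, h2] with v h3 h4 s hs
      have h5 := B.eq_zero_of_tor_mem_page h3 h4 (Or.inl ⟨p s, hp s, hs.symm.trans (hfp s)⟩)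
      have h6 : v = (v.1, 0) := Prod.ext rfl h5
      rw [h6] at hs
      obtain ⟨m, hm⟩ := B.exists_lattice_of_tor_eq (hp s) h3 ((hfp s).symm.trans hs)
      obtain ⟨n, hn⟩ := hc m
      rw [hm, map_add, hn]
      push_cast
      exact (exp_tpi_add_int _ n).symm
    obtain ⟨l, hl, hle⟩ := exists_log_of_convex convex_univ isOpen_univ Set.univ_nonempty
      hcont.continuousOn fun _ _ => Complex.exp_ne_zero _
    rw [continuousOn_univ] at hl
    refine ⟨fun s => (l s / tpi).re, by fun_prop, fun s => ?_⟩
    obtain ⟨n, hn⟩ := exp_eq_exp_iff_exists_int.1 (hle s trivial)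
    refine ⟨n, ?_⟩
    have h1 : l s / tpi = ((c (p s) + n : ℝ) : ℂ) := by
      rw [div_eq_iff tpi_ne_zero, hn]
      push_cast
      unfold tpi
      ring
    change (l s / tpi).re = _
    rw [h1, Complex.ofReal_re]
  obtain ⟨a, ha, ha'⟩ := key (ContinuousLinearMap.fst ℝ ℝ ℝ) fun m => ⟨m.1, rfl⟩
  obtain ⟨b, hb, hb'⟩ := key (ContinuousLinearMap.snd ℝ ℝ ℝ) fun m => ⟨m.2, rfl⟩
  have hab : ∀ s, ∃ m, (a s, b s) = p s + latticePt m := fun s => by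
    obtain ⟨n, hn⟩ := ha' s
    obtain ⟨n', hn'⟩ := hb' s
    exact ⟨(n, n'), Prod.ext hn hn'⟩
  refine ⟨fun s => (a s, b s), ha.prodMk hb, fun s => ?_, fun s => ?_⟩ <;>
    obtain ⟨m, hm⟩ := hab s <;> beta_reduce <;> rw [hm]
  · exact fun h1 => hp s (add_latticePt_mem.1 h1)
  · exact (B.tor_add_lattice (x := (p s, 0)) (hp s) m).trans (hfp s).symm

lemma exists_period (B : OpenBook h o) {γ : ℝ → ℝ × ℝ} (hγ : Continuous γ)
    (hγ' : ∀ s, γ s ∉ range latticePt) {T : ℝ} (hT : ∀ s, B.tor (γ (s + T), 0) = B.tor (γ s, 0)) :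
    ∃ m, ∀ s, γ (s + T) = γ s + latticePt m := by
  have hm := fun s => B.exists_lattice_of_tor_eq (hγ' s) (hγ' (s + T)) (hT s).symm
  choose m hm using hm
  have key : ∀ c : ℝ × ℝ →L[ℝ] ℝ, (∀ m, ∃ n : ℤ, c (latticePt m) = n) →
      ∃ n : ℤ, ∀ s, c (γ (s + T)) = c (γ s) + n := by
    intro c hc
    obtain ⟨n, hn⟩ := exists_int_of_exp_eq (isPreconnected_univ (α := ℝ))
      (l := fun s => tpi * (c (γ (s + T)) : ℂ)) (l' := fun s => tpi * (c (γ s) : ℂ))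
      (by fun_prop) (by fun_prop) fun s _ => by
        obtain ⟨n, hn⟩ := hc (m s)
        rw [hm, map_add, hn]
        push_cast
        exact exp_tpi_add_int _ n
    refine ⟨n, fun s => ?_⟩
    have h1 := hn s trivial
    have h2 : (c (γ (s + T)) : ℂ) = ((c (γ s) + n : ℝ) : ℂ) := by
      apply mul_left_cancel₀ tpi_ne_zero
      rw [h1]; push_cast; ring
    exact_mod_cast h2
  obtain ⟨a, ha⟩ := key (ContinuousLinearMap.fst ℝ ℝ ℝ) fun m => ⟨m.1, rfl⟩
  obtain ⟨b, hb⟩ := key (ContinuousLinearMap.snd ℝ ℝ ℝ) fun m => ⟨m.2, rfl⟩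
  exact ⟨(a, b), fun s => Prod.ext (ha s) (hb s)⟩

lemma period_ne_zero (B : OpenBook h o) {γ : ℝ → ℝ × ℝ} (hγ : Continuous γ)
    (hγ' : ∀ s, γ s ∉ range latticePt) {m : ℤ × ℤ}
    (hm : ∀ s, γ (s + τ) = γ s + latticePt m) {g : Y → ℂ}
    (hg : ContinuousOn (fun x : (ℝ × ℝ) × ℝ => g (B.tor (x.1, 0))) punct)
    (hg0 : ∀ p ∉ range latticePt, g (B.tor (p, 0)) ≠ 0)
    (hgγ : ∀ s : ℝ, g (B.tor (γ s, 0)) = exp (s * I)) : m ≠ 0 := by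
  rintro rfl
  obtain ⟨L, hL, hLe, r, -⟩ := exists_log_periodic hg (fun x hx => hg0 _ hx) fun x hx m => by
    exact congrArg g (B.tor_add_lattice (x := (x.1, 0)) hx m)
  have hγ2 : Continuous fun s => (γ s, (0 : ℝ)) := by fun_prop
  obtain ⟨n, hn⟩ := exists_int_of_exp_eq (isPreconnected_univ (α := ℝ))
    (l := fun s => L (γ s, 0)) (l' := fun s => s * I)
    (hL.comp hγ2.continuousOn fun s _ => hγ' s) (by fun_prop) fun s _ => by
      rw [hLe _ (hγ' s), hgγ]
  have h1 := hn 0 trivial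
  have h2 := hn (0 + τ) trivial
  rw [hm, latticePt_zero, add_zero] at h2
  have h3 : ((τ : ℝ) : ℂ) * I = 0 := by
    push_cast at h1 h2 ⊢
    linear_combination h1 - h2
  have := pi_pos
  simp at h3

/-- The framing of a surface in a page along an embedded curve of degree one. -/
lemma ev_curve_eq_zero (B : OpenBook h o) {Θ : SpinStructure o univ}
    (hΘ : B.IsTrivialOnPage Θ)
    {ψ : R3 → Y} {U : Set R3} (hψ : IsParam o ψ U std3) {r : ℝ × ℝ} (hU : ∀ s, (s, r) ∈ U)
    (hp : ∀ s, ∀ᶠ w in 𝓝 ((s, r) : R3), w.2.2 = r.2 → ψ w ∈ B.page)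
    (hper : ∀ w, ψ w = ψ (w + (τ, 0, 0)))
    {g : Y → ℂ}
    (hg : ContinuousOn (fun x : (ℝ × ℝ) × ℝ => g (B.tor (x.1, 0))) punct)
    (hg0 : ∀ p ∉ range latticePt, g (B.tor (p, 0)) ≠ 0)
    (hgψ : ∀ s : ℝ, g (ψ (s, r)) = exp (s * I)) :
    IsLoop (IsPos o) (fun t => pf ψ std3 (τ * t, r)) ∧
    Θ.cls.ev (fun t => pf ψ std3 (τ * t, r)) = 0 := by
  have hline : Continuous fun s : ℝ => ((s, r) : R3) := by fun_prop
  have hfc : Continuous fun s : ℝ => ψ (s, r) := by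
    rw [continuous_iff_continuousAt]
    exact fun s => ContinuousAt.comp (g := ψ) (f := fun s : ℝ => ((s, r) : R3))
      (hψ.contMDiffAt (hU s)).continuousAt hline.continuousAt
  obtain ⟨γ, hγ, hγ', hγψ⟩ := B.exists_lift_curve hfc fun s => B.exists_eq_tor hψ (hU s) (hp s)
  have hper1 : ∀ s, ψ (s + τ, r) = ψ (s, r) := fun s => by
    refine ((hper (s, r)).trans (congrArg ψ ?_)).symm
    simp
  obtain ⟨m, hm⟩ := B.exists_period hγ hγ' (T := τ) fun s => by
    rw [hγψ, hγψ, hper1]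
  have hm0 := B.period_ne_zero hγ hγ' hm hg hg0 fun s => by rw [hγψ, hgψ]
  have hA := fun s => B.exists_page_coeff hψ (hU s) (hp s) hγ hγ' rfl hγψ
  choose A hAGL hApf hA0 hA1 hAd using hA
  have hFc : Continuous fun s : ℝ => pf ψ std3 (s, r) := hψ.continuous_pf hline hU
  have hGc : Continuous fun s : ℝ => pf B.tor torVec (γ s, 0) :=
    B.isParam_tor.continuous_pf (by fun_prop) hγ'
  have hGp : ∀ s, IsPos o (pf B.tor torVec (γ s, 0)) := fun s => B.isParam_tor.isPos (hγ' s)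
  have hbase : ∀ s, (pf ψ std3 (s, r)).base = (pf B.tor torVec (γ s, 0)).base :=
    fun s => (hγψ s).symm
  have hAe : ∀ s, coeff (pf ψ std3 (s, r)) (pf B.tor torVec (γ s, 0)) = A s := fun s => by
    rw [hApf s]
    exact coeff_act (hGp s).isUnit
  have hAc : Continuous A := by
    have := continuous_coeff hFc hGc hbase hGp
    simpa only [hAe] using this
  have hloop : IsLoop (IsPos o) (fun t => pf ψ std3 (τ * t, r)) := by
    refine ⟨fun t => hψ.isPos (hU _), hFc.comp (by fun_prop), ?_⟩
    have h1 : ((0, r) : R3) + (τ, 0, 0) = (τ, r) := by simp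
    have h2 := hψ.pf_translate (x := (0, r)) (a := (τ, 0, 0)) (by rw [h1]; exact hU _)
      (.of_forall hper)
    rw [h1] at h2
    simpa using h2
  obtain ⟨hGl, hG0⟩ := hΘ (fun t => γ (τ * t)) (by fun_prop) (fun t => hγ' _) m (by
    have := hm 0
    simpa using this)
  obtain ⟨hCl, hC⟩ := ev_add_coeff Θ hloop hGl fun t => hbase _
  refine ⟨hloop, ?_⟩
  simp only [hAe] at hCl hC
  rw [hC, hG0, zero_add]
  have hmz : (⟨m.1, m.2⟩ : ℂ) ≠ 0 := fun h1 => by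
    have h2 := congrArg Complex.re h1
    have h3 := congrArg Complex.im h1
    simp only [Complex.zero_re, Complex.zero_im] at h2 h3
    exact hm0 (Prod.ext (by exact_mod_cast h2) (by exact_mod_cast h3))
  have hd : ∀ s, HasDerivAt (fun s => (⟨(γ s).1, (γ s).2⟩ : ℂ)) ⟨A s 0 0, A s 0 1⟩ s := fun s => by
    exact (Complex.equivRealProdCLM.symm : ℝ × ℝ →L[ℝ] ℂ).hasFDerivAt.comp_hasDerivAt s (hAd s)
  obtain ⟨l, hl, hle, hlp⟩ := exists_periodic_log_deriv two_pi_pos hmz hd (by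
      have h1 : Continuous fun s => (A s 0 0, A s 0 1) :=
        (hAc.matrix_elem 0 0).prodMk (hAc.matrix_elem 0 1)
      exact Complex.equivRealProdCLM.symm.continuous.comp h1)
    (fun s h1 => by
      have h2 := congrArg Complex.re h1
      have h3 := congrArg Complex.im h1
      simp only [Complex.zero_re, Complex.zero_im] at h2 h3
      have h4 : 0 < (A s).det := hAGL s
      rw [det_fin_three, h2, h3, hA0] at h4
      simp at h4)
    (fun s => by
      rw [hm]
      exact Complex.ext rfl rfl)
    (fun s u h1 h2 h3 => by
      have h4 := congrArg Complex.re h3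
      have h5 := congrArg Complex.im h3
      have h6 : exp ((s + u : ℝ) * I) = exp (s * I) := by
        rw [← hgψ, ← hgψ, ← hγψ, ← hγψ, show γ (s + u) = γ s from Prod.ext h4 h5]
      obtain ⟨n, hn⟩ := exp_eq_exp_iff_exists_int.1 h6
      have h7 : u = n * τ := by
        have := congrArg Complex.im hn
        simp at this
        linarith
      rw [h7] at h1 h2
      have h8 : (0 : ℝ) < n := (mul_pos_iff_of_pos_right two_pi_pos).1 h1
      have h9 : (n : ℝ) < 1 := by
        refine lt_of_mul_lt_mul_right ?_ two_pi_pos.le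
        rwa [one_mul]
      have h8' : 0 < n := by exact_mod_cast h8
      have h9' : n < 1 := by exact_mod_cast h9
      omega)
  exact kap_eq_zero_of_planar hCl (fun t => hA0 _) (fun t => hA1 _)
    (l := fun t => l (τ * t)) (by fun_prop) (by
      have := hlp 0
      simpa using this.symm) fun t => hle _

end OpenBook

/-! ### The page at a clasp -/

/-- The tori around the core of the solid torus bounded by the page, in the coordinates of
`chain`. -/
def torusPt (r θ φ : ℝ) : R3 := ((3 / 5 + r * cos φ) * cos θ, 2 / 5 + (3 / 5 + r * cos φ) * sin θ,
    r * sin φ)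

def torusJac (r θ φ : ℝ) : M3 := !![-((3 / 5 + r * cos φ) * sin θ), (3 / 5 + r * cos φ) * cos θ, 0;
    -(r * sin φ * cos θ), -(r * sin φ * sin θ), r * cos φ;
    cos φ * cos θ, cos φ * sin θ, sin φ]

lemma det_torusJac (r θ φ : ℝ) : (torusJac r θ φ).det = r * (3 / 5 + r * cos φ) := by
  have h1 := sin_sq_add_cos_sq θ
  have h2 := sin_sq_add_cos_sq φ
  simp [torusJac, det_fin_three]
  linear_combination r * (3 / 5 + r * cos φ) * h2 +
    r * (3 / 5 + r * cos φ) * (sin φ ^ 2 + cos φ ^ 2) * h1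

/-- The coordinates `(θ, φ)` of the tori, rotated by a right angle in case `i = 0`, `j = 1`. -/
def torusMap (i j θ₀ φ₀ : ℝ) (v : R3) : R3 :=
  torusPt v.2.2 (θ₀ + i * v.1 - j * v.2.1) (φ₀ + j * v.1 + i * v.2.1)

def torusMapJac (i j θ₀ φ₀ : ℝ) (v : R3) : M3 := !![i, j, 0; -j, i, 0; 0, 0, 1] *
    torusJac v.2.2 (θ₀ + i * v.1 - j * v.2.1) (φ₀ + j * v.1 + i * v.2.1)

lemma contDiff_torusMap (i j θ₀ φ₀ : ℝ) : ContDiff ℝ ∞ (torusMap i j θ₀ φ₀) := by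
  unfold torusMap torusPt
  fun_prop

lemma hasDerivAt_torusPt {θ φ : ℝ → ℝ} {θ' φ' r x : ℝ} (hθ : HasDerivAt θ θ' x)
    (hφ : HasDerivAt φ φ' x) : HasDerivAt (fun a => torusPt r (θ a) (φ a))
      (∑ l, (θ' * torusJac r (θ x) (φ x) 0 l + φ' * torusJac r (θ x) (φ x) 1 l) • std3 l) x := by
  have h1 := (hφ.cos.const_mul r).const_add (3 / 5)
  refine ((h1.mul hθ.cos).prodMk (((h1.mul hθ.sin).const_add (2 / 5)).prodMk
    (hφ.sin.const_mul r))).congr_deriv ?_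
  refine Prod.ext ?_ (Prod.ext ?_ ?_) <;> simp [sum_univ_three, torusJac, std3] <;> ring

lemma fderiv_torusMap (i j θ₀ φ₀ : ℝ) (v : R3) (l : Fin 3) :
    fderiv ℝ (torusMap i j θ₀ φ₀) v (std3 l) = ∑ q, torusMapJac i j θ₀ φ₀ v l q • std3 q := by
  have hd : HasFDerivAt (torusMap i j θ₀ φ₀) (fderiv ℝ (torusMap i j θ₀ φ₀) v) v :=
    ((contDiff_torusMap i j θ₀ φ₀).differentiable (by norm_cast)).differentiableAt.hasFDerivAt
  obtain ⟨a, b, r⟩ := v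
  refine fderiv_std3 hd (r := fun l => ∑ q, torusMapJac i j θ₀ φ₀ (a, b, r) l q • std3 q) ?_ ?_ ?_ l
    <;> simp only [torusMap]
  · refine (hasDerivAt_torusPt (θ' := i) (φ' := j) ?_ ?_).congr_deriv ?_
    · simpa using (((hasDerivAt_id a).const_mul i).const_add θ₀).sub_const (j * b)
    · simpa using (((hasDerivAt_id a).const_mul j).const_add φ₀).add_const (i * b)
    · simp [sum_univ_three, torusMapJac, mul_apply]
  · refine (hasDerivAt_torusPt (θ' := -j) (φ' := i) ?_ ?_).congr_deriv ?_
    · simpa using ((hasDerivAt_id b).const_mul j).const_sub (θ₀ + i * a)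
    · simpa using ((hasDerivAt_id b).const_mul i).const_add (φ₀ + j * a)
    · simp [sum_univ_three, torusMapJac, mul_apply]
  · have h1 : ∀ y : ℝ, HasDerivAt (fun r : ℝ => r * y) y r := fun y => by
      simpa using (hasDerivAt_id r).mul_const y
    have h2 := (h1 (cos (φ₀ + j * a + i * b))).const_add (3 / 5)
    refine ((h2.mul_const _).prodMk (((h2.mul_const _).const_add (2 / 5)).prodMk
      (h1 _))).congr_deriv ?_
    refine Prod.ext ?_ (Prod.ext ?_ ?_) <;>
      simp [sum_univ_three, torusMapJac, torusJac, std3, mul_apply]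

def torusSet : Set R3 :=
  {v | ∃ θ φ : ℝ, 1 ≤ 3 / 5 * (1 + sin θ) + (1 - cos φ) ∧ v = torusPt (3 / 20) θ φ}

lemma abs_lt_of_mem_torusSet {v : R3} (hv : v ∈ torusSet) : |v.2.1| < 8 / 5 := by
  obtain ⟨θ, φ, -, rfl⟩ := hv
  have h1 := neg_one_le_sin θ
  have h2 := sin_le_one θ
  have h3 := neg_one_le_cos φ
  have h4 := cos_le_one φ
  rw [abs_lt]
  constructor <;> simp only [torusPt] <;> nlinarith

lemma torusSet_subset {c : List ℕ} {k : ℕ} (hk : k + 1 < c.length) :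
    torusSet ⊆ linkCompl c k := by
  intro v hv
  have hY := abs_lt_of_mem_torusSet hv
  obtain ⟨θ, φ, hc, hv⟩ := hv
  have hS := sin_sq_add_cos_sq θ
  have hP := sin_sq_add_cos_sq φ
  have h1 := neg_one_le_cos φ
  have h2 := cos_le_one φ
  obtain ⟨X, y, Z⟩ := v
  simp only [torusPt, Prod.mk.injEq] at hv
  obtain ⟨hX, hy, hZ⟩ := hv
  set ρ := 3 / 5 + 3 / 20 * cos φ with hρ
  have hρ1 : 9 / 20 ≤ ρ := by linarith
  have hρ2 : ρ ≤ 3 / 4 := by linarith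
  have hr : X ^ 2 + (y - 2 / 5) ^ 2 = ρ ^ 2 := by
    rw [hX, hy]; linear_combination ρ ^ 2 * hS
  have hz : Z ^ 2 = 9 / 400 - (ρ - 3 / 5) ^ 2 := by
    rw [hZ, hρ]; linear_combination 9 / 400 * hP
  obtain ⟨hyl, hyu⟩ := abs_le_of_sq_le_sq' (a := y - 2 / 5) (b := 3 / 4)
    (by have := sq_nonneg X; have := pow_le_pow_left₀ (by linarith) hρ2 2; linarith) (by norm_num)
  obtain ⟨hXl, -⟩ := abs_le_of_sq_le_sq' (a := X) (b := 3 / 4)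
    (by have := sq_nonneg (y - 2 / 5); have := pow_le_pow_left₀ (by linarith) hρ2 2; linarith)
    (by norm_num)
  have hρ3 := pow_le_pow_left₀ (by norm_num) hρ1 2
  have hX0 := sq_nonneg X
  refine mem_linkCompl (by omega) (by simp only; linarith) (by simp only at hY ⊢; linarith) ?_
  rintro j (rfl | rfl | rfl) l hl ⟨m, hm⟩ h3 h4 <;> push_cast at h3 h4
  · have := pow_le_pow_left₀ (by norm_num) (by linarith : 5 / 4 ≤ y - 8 / 5 * -1) 2
    linarith
  · obtain rfl := eq_of_offset_zero (by omega) hl hm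
    have hZ0 : Z = 0 := by rw [h4]; ring
    have h5 : (ρ - 9 / 20) * (ρ - 3 / 4) = 0 := by
      rw [hZ0] at hz
      linear_combination hz
    rcases mul_eq_zero.1 h5 with h6 | h6
    · rw [show ρ = 9 / 20 by linarith] at hr
      have : y = 383 / 320 := by linear_combination 5 / 4 * h3 - 5 / 4 * hr
      linarith
    · have h7 : ρ = 3 / 4 := by linarith
      rw [h7] at hr hy
      have : y = 239 / 320 := by linear_combination 5 / 4 * h3 - 5 / 4 * hr
      linarith
  · obtain ⟨hy1, -⟩ := abs_le_of_sq_le_sq' (a := y - 8 / 5 * 1) (b := 1) (by linarith) (by norm_num)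
    rw [claspSign_of_lt hk] at h4
    have h5 : 64 / 25 * X ^ 2 ≤ Z ^ 2 := by
      rcases claspSign_eq c.length l with h6 | h6 <;> rw [h6] at h4
      · have : Z = X * -(8 / 5) := by rw [h4]; ring
        rw [this]; linarith
      · have : Z = X * -(2 * y + 2 / 5) := by rw [h4]; ring
        rw [this, mul_pow, mul_comm, neg_sq]
        have := pow_le_pow_left₀ (by norm_num) (by linarith : 8 / 5 ≤ 2 * y + 2 / 5) 2
        exact mul_le_mul_of_nonneg_left (by linarith) hX0
    have h6 : X ^ 2 ≤ 9 / 1000 := by have := sq_nonneg (ρ - 3 / 5); linarith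
    have h7 : y ≤ 61 / 100 := by
      by_contra h8
      push Not at h8
      have := pow_le_pow_left₀ (by linarith) (by linarith : 8 / 5 * 1 - y ≤ 99 / 100) 2
      linarith
    have := pow_le_pow_left₀ (by linarith) (by linarith : y - 2 / 5 ≤ 21 / 100) 2
    linarith

namespace SurgeryPresentation

variable (D : SurgeryPresentation c o)

lemma comp_inj (hN : 2 ≤ c.length) {k : ℕ} {v w : R3} (hv : v ∈ linkCompl c k)
    (hw : w ∈ linkCompl c k) (hv' : |v.2.1| < 8 / 5) (hw' : |w.2.1| < 8 / 5)
    (e : D.comp k v = D.comp k w) : v = w := by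
  obtain ⟨h1, ⟨m, h2⟩, h3⟩ := (chain_eq_iff (by omega) hv.1 hw.1).1
    (toE_injective (invStereo_injective (D.ext_injOn hv.2 hw.2 e)))
  obtain ⟨h4, h5⟩ := abs_lt.1 hv'
  obtain ⟨h6, h7⟩ := abs_lt.1 hw'
  have hN' : (2 : ℝ) ≤ c.length := by exact_mod_cast hN
  have hm : m = 0 := by
    by_contra hm
    have h8 : (1 : ℝ) ≤ |(m : ℝ)| := by exact_mod_cast Int.one_le_abs hm
    have h9 : |(m : ℝ) * c.length| < 2 := by
      rw [abs_lt]; constructor <;> linarith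
    rw [abs_mul, abs_of_nonneg (by linarith : (0 : ℝ) ≤ c.length)] at h9
    nlinarith
  subst hm
  have h8 : v.2.1 = w.2.1 := by rw [h2]; simp
  refine Prod.ext h1 (Prod.ext h8 ?_)
  rw [h1, h8] at h3
  linarith

lemma mem_page_iff {B : OpenBook h o} {k : ℕ} (hk : k + 1 < c.length)
    (hpage : B.page = D.ext '' (invStereo '' pageTorus c.length k)) {y : Y} :
    y ∈ B.page ↔ ∃ v ∈ torusSet, D.comp k v = y := by
  rw [hpage]
  constructor
  · rintro ⟨_, ⟨_, ⟨θ, φ, h1, rfl⟩, rfl⟩, rfl⟩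
    refine ⟨_, ⟨θ, φ, h1, rfl⟩, ?_⟩
    rw [comp, claspSign_of_lt hk, ← chainMap_eq]
    rfl
  · rintro ⟨_, ⟨θ, φ, h1, rfl⟩, rfl⟩
    refine ⟨_, ⟨_, ⟨θ, φ, h1, rfl⟩, rfl⟩, ?_⟩
    rw [comp, claspSign_of_lt hk, ← chainMap_eq]
    rfl

lemma exists_page_function {B : OpenBook h o} {k : ℕ} (hk : k + 1 < c.length)
    (hpage : B.page = D.ext '' (invStereo '' pageTorus c.length k)) {f : R3 → ℂ} (hf : Continuous f)
    (hf0 : ∀ v ∈ torusSet, f v ≠ 0) :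
    ∃ g : Y → ℂ, ContinuousOn (fun x : (ℝ × ℝ) × ℝ => g (B.tor (x.1, 0))) punct ∧
      (∀ p ∉ range latticePt, g (B.tor (p, 0)) ≠ 0) ∧
      ∀ v ∈ torusSet, g (D.comp k v) = f v := by
  have hsub := torusSet_subset hk
  have hy : ∀ p ∉ range latticePt, ∃ v ∈ torusSet, D.comp k v = B.tor (p, 0) := fun p hp =>
    (D.mem_page_iff hk hpage).1 (Or.inl ⟨p, hp, rfl⟩)
  refine ⟨fun y => f (invFunOn (D.comp k) torusSet y), ?_,
    fun p hp => hf0 _ (Function.invFunOn_mem (hy p hp)), fun v hv => ?_⟩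
  · rw [continuousOn_iff_continuous_domRestrict, continuous_iff_continuousAt]
    intro x₀
    have hx₀ := hy x₀.1.1 x₀.2
    have hm := Function.invFunOn_mem hx₀
    refine continuousAt_of_param (F := fun x : punct => B.tor (x.1.1, 0)) (f := f) ?_
      (D.isParam_comp (by omega) k) (hsub hm) (Function.invFunOn_eq hx₀).symm hf.continuousAt ?_
    · exact ContinuousAt.comp (g := B.tor) (f := fun x : punct => (x.1.1, (0 : ℝ)))
        (B.isParam_tor.contMDiffAt (x := (x₀.1.1, 0)) x₀.2).continuousAt (by fun_prop)
    · have h1 : ∀ᶠ v : R3 in 𝓝 (invFunOn (D.comp k) torusSet (B.tor (x₀.1.1, 0))),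
          |v.2.1| < 8 / 5 := by
        have : Continuous fun v : R3 => |v.2.1| := by fun_prop
        exact this.continuousAt.eventually_lt_const (abs_lt_of_mem_torusSet hm)
      filter_upwards [h1, (isOpen_linkCompl c k).mem_nhds (hsub hm)] with v h2 h3 x h4
      have hx := hy x.1.1 x.2
      have hm' := Function.invFunOn_mem hx
      exact congrArg f (D.comp_inj (by omega) (hsub hm') h3 (abs_lt_of_mem_torusSet hm') h2
        ((Function.invFunOn_eq hx).trans h4))
  · have hv' : ∃ w ∈ torusSet, D.comp k w = D.comp k v := ⟨v, hv, rfl⟩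
    have hm := Function.invFunOn_mem hv'
    exact congrArg f (D.comp_inj (by omega) (hsub hm) (hsub hv) (abs_lt_of_mem_torusSet hm)
      (abs_lt_of_mem_torusSet hv) (Function.invFunOn_eq hv'))

lemma ev_page_curve (hN : 0 < c.length) {B : OpenBook h o} {k : ℕ} (hk : k + 1 < c.length)
    (hpage : B.page = D.ext '' (invStereo '' pageTorus c.length k)) {Θ : SpinStructure o univ}
    (hΘ : B.IsTrivialOnPage Θ)
    {i j θ₀ φ₀ : ℝ} (hij : i = 1 ∧ j = 0 ∨ i = 0 ∧ j = 1)
    (hcurve : ∀ s, 1 < 3 / 5 * (1 + sin (θ₀ + i * s)) + (1 - cos (φ₀ + j * s)))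
    {f : R3 → ℂ} (hf : Continuous f) (hf0 : ∀ v ∈ torusSet, f v ≠ 0)
    (hfc : ∀ s : ℝ, f (torusMap i j θ₀ φ₀ (s, 0, 3 / 20)) = exp (s * I))
    (hJ : IsLoop IsGL (fun t => torusMapJac i j θ₀ φ₀ (τ * t, 0, 3 / 20)))
    (hJ1 : kap.ev (fun t => torusMapJac i j θ₀ φ₀ (τ * t, 0, 3 / 20)) = 1) :
    (D.cls hN Θ k).ev (fun t => torusMap i j θ₀ φ₀ (τ * t, 0, 3 / 20)) = 1 := by
  obtain ⟨g, hg, hg0, hgf⟩ := D.exists_page_function hk hpage hf hf0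
  have hmem : ∀ s, torusMap i j θ₀ φ₀ (s, 0, 3 / 20) ∈ torusSet := fun s =>
    ⟨θ₀ + i * s, φ₀ + j * s, (hcurve s).le, by simp [torusMap]⟩
  have hsub := torusSet_subset hk
  have hcont := (contDiff_torusMap i j θ₀ φ₀).continuous
  have hper : ∀ w : R3, torusMap i j θ₀ φ₀ (w + (τ, 0, 0)) = torusMap i j θ₀ φ₀ w := by
    intro w
    rcases hij with ⟨rfl, rfl⟩ | ⟨rfl, rfl⟩
    · have : θ₀ + 1 * (w.1 + τ) = θ₀ + 1 * w.1 + τ := by ring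
      simp [torusMap, torusPt, ← add_assoc]
    · simp [torusMap, torusPt, ← add_assoc]
  let U : Set R3 := torusMap i j θ₀ φ₀ ⁻¹' linkCompl c k ∩ {v | 0 < v.2.2 ∧ v.2.2 < 3 / 5}
  have hUo : IsOpen U := ((isOpen_linkCompl c k).preimage hcont).inter
    ((isOpen_Ioo (a := (0 : ℝ)) (b := 3 / 5)).preimage (continuous_snd.comp continuous_snd))
  have hψ : IsParam o (D.comp k ∘ torusMap i j θ₀ φ₀) U std3 := by
    refine (D.isParam_comp hN k).comp hUo (contDiff_torusMap i j θ₀ φ₀).contDiffOn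
      (fun v hv => hv.1) (fun v _ l => fderiv_torusMap i j θ₀ φ₀ v l) fun v hv => ?_
    change 0 < det _
    rw [torusMapJac, det_mul, det_torusJac]
    have h1 : det (!![i, j, 0; -j, i, 0; 0, 0, 1] : M3) = 1 := by
      rcases hij with ⟨rfl, rfl⟩ | ⟨rfl, rfl⟩ <;> simp [det_fin_three]
    rw [h1, one_mul]
    have h2 := neg_one_le_cos (φ₀ + j * v.1 + i * v.2.1)
    obtain ⟨h3, h4⟩ := hv.2
    exact mul_pos h3 (by nlinarith)
  have hU : ∀ s : ℝ, (s, (0, 3 / 20)) ∈ U := fun s => ⟨hsub (hmem s), by norm_num, by norm_num⟩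
  have hp : ∀ s : ℝ, ∀ᶠ w in 𝓝 ((s, 0, 3 / 20) : R3), w.2.2 = 3 / 20 →
      (D.comp k ∘ torusMap i j θ₀ φ₀) w ∈ B.page := fun s => by
    have hc : Continuous fun w : R3 => 3 / 5 * (1 + sin (θ₀ + i * w.1 - j * w.2.1)) +
      (1 - cos (φ₀ + j * w.1 + i * w.2.1)) := by fun_prop
    have h1 : ∀ᶠ w in 𝓝 ((s, 0, 3 / 20) : R3), 1 < 3 / 5 * (1 + sin (θ₀ + i * w.1 - j * w.2.1)) +
          (1 - cos (φ₀ + j * w.1 + i * w.2.1)) :=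
      hc.continuousAt.eventually_const_lt (by simpa using hcurve s)
    filter_upwards [h1] with w h2 h3
    exact (D.mem_page_iff hk hpage).2 ⟨_, ⟨_, _, h2.le, by rw [torusMap, h3]⟩, rfl⟩
  obtain ⟨-, hev⟩ := B.ev_curve_eq_zero hΘ hψ (r := (0, 3 / 20)) hU hp
    (fun w => congrArg (D.comp k) (hper w).symm) hg hg0
    (fun s => (hgf _ (hmem s)).trans (hfc s))
  have hℓ : IsLoop (fun v => v ∈ linkCompl c k)
      fun t => torusMap i j θ₀ φ₀ (τ * t, 0, 3 / 20) :=
    ⟨fun t => hsub (hmem _), hcont.comp (by fun_prop), by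
      have := hper (0, 0, 3 / 20)
      simpa using this.symm⟩
  have e : ∀ t : 𝕀, pf (D.comp k ∘ torusMap i j θ₀ φ₀) std3 (τ * t, 0, 3 / 20) =
      act (torusMapJac i j θ₀ φ₀ (τ * t, 0, 3 / 20))
        (pf (D.comp k) std3 (torusMap i j θ₀ φ₀ (τ * t, 0, 3 / 20))) := fun t =>
    (D.isParam_comp hN k).pf_comp (hsub (hmem _))
      (((contDiff_torusMap i j θ₀ φ₀).differentiable (by norm_cast)).differentiableAt.hasFDerivAt)
      fun l => fderiv_torusMap i j θ₀ φ₀ _ l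
  simp only [e] at hev
  rw [ev_act Θ (D.isLoop_comp hN k hℓ) hJ, hJ1] at hev
  refine (Θ.cls.ev_comap _ _ _ hℓ).trans ?_
  generalize Θ.cls.ev _ = x at hev ⊢
  revert x
  decide

end SurgeryPresentation

lemma kap_torusMapJac_one :
    IsLoop IsGL (fun t => torusMapJac 1 0 0 π (τ * t, 0, 3 / 20)) ∧
    kap.ev (fun t => torusMapJac 1 0 0 π (τ * t, 0, 3 / 20)) = 1 := by
  have hB : IsGL (!![0, 9 / 20, 0; 0, 0, -(3 / 20); -1, 0, 0] : M3) := by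
    change 0 < det _
    simp [det_fin_three]
  have e : ∀ t : 𝕀, torusMapJac 1 0 0 π (τ * t, 0, 3 / 20) =
      !![0, 9 / 20, 0; 0, 0, -(3 / 20); -1, 0, 0] * fullRot t := by
    intro t
    ext i j
    fin_cases i <;> fin_cases j <;>
      simp [torusMapJac, torusJac, fullRot, rotZ, mul_apply, sum_univ_three] <;> norm_num
  simp only [e]
  have hc : IsLoop IsGL fun _ => (!![0, 9 / 20, 0; 0, 0, -(3 / 20); -1, 0, 0] : M3) :=
    ⟨fun _ => hB, continuous_const, rfl⟩
  exact ⟨hc.mul isLoop_fullRot, (ev_const_mul kap isLoop_fullRot hB).trans kap_fullRot⟩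

lemma kap_torusMapJac_zero :
    IsLoop IsGL (fun t => torusMapJac 0 1 (π / 2) 0 (τ * t, 0, 3 / 20)) ∧
    kap.ev (fun t => torusMapJac 0 1 (π / 2) 0 (τ * t, 0, 3 / 20)) = 1 := by
  let S : ℝ → M3 := fun a => !![0, 3 / 20, 0; 0, 0, a; 1, 0, 0]
  let Q : M3 := !![0, 1, 0; 0, 0, 1; 1, 0, 0]
  have hQ : IsGL Q := by
    change 0 < det _
    simp [Q, det_fin_three]
  have hS : ∀ a, 0 < a → IsGL (S a) := fun a ha => by
    change 0 < det _
    simp [S, det_fin_three]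
    linarith
  have e : ∀ t : 𝕀, torusMapJac 0 1 (π / 2) 0 (τ * t, 0, 3 / 20) =
      S (3 / 5 + 3 / 20 * cos (τ * t)) * (fullRot t * Q) := by
    intro t
    ext i j
    fin_cases i <;> fin_cases j <;>
      simp [S, Q, torusMapJac, torusJac, fullRot, rotZ, mul_apply, sum_univ_three]
  simp only [e]
  have hρ : ∀ t : ℝ, 0 < 3 / 5 + 3 / 20 * cos (τ * t) := fun t => by
    have := neg_one_le_cos (τ * t)
    linarith
  have hSc : Continuous S := by
    refine continuous_matrix fun i j => ?_
    fin_cases i <;> fin_cases j <;> simp [S] <;> fun_prop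
  have hR : IsLoop IsGL fun t => fullRot t * Q :=
    isLoop_fullRot.mul ⟨fun _ => hQ, continuous_const, rfl⟩
  refine ⟨IsLoop.mul ⟨fun t => hS _ (hρ t), hSc.comp (by fun_prop), by simp⟩ hR, ?_⟩
  have h1 := kap.ev_congr (fun s t => S (3 / 5 + 3 / 20 * ((1 - s) * cos (τ * t))) *
      (fullRot t * Q)) ?_ (fun s t => (hS _ ?_).mul (hR.1 t)) (fun s => by
        have := hR.2.2
        beta_reduce at this
        rw [this]; simp)
    (f := fun t => S (3 / 5 + 3 / 20 * cos (τ * t)) * (fullRot t * Q))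
    (g := fun t => S (3 / 5) * (fullRot t * Q)) (by simp) (by simp)
  · rw [h1, ev_const_mul kap hR (hS _ (by norm_num)), ev_mul_const kap isLoop_fullRot hQ, kap_fullRot]
  · exact (hSc.comp (by fun_prop)).mul (hR.2.1.comp continuous_snd)
  · have h2 := neg_one_le_cos (τ * t)
    have h3 := s.2.1
    have h4 := s.2.2
    nlinarith

lemma norm_ofReal_add_mul_I_ne {a b r : ℝ} (hr : 0 < r) (hab : a ^ 2 + b ^ 2 ≠ 0) :
    ((a / r : ℝ) + (b / r : ℝ) * I : ℂ) ≠ 0 := fun h0 => by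
  have h1 := congrArg Complex.re h0
  have h2 := congrArg Complex.im h0
  simp [hr.ne'] at h1 h2
  simp [h1, h2] at hab

lemma exp_mul_I_eq_add (s : ℝ) :
    exp (s * I) = (cos s : ℝ) + (sin s : ℝ) * I := by
  rw [Complex.exp_mul_I, Complex.ofReal_cos, Complex.ofReal_sin]

namespace LoopClass

variable {k : ℕ} (δ : LoopClass fun v => v ∈ linkCompl c k)

lemma ev_latitude (hN : 0 < c.length) :
    δ.ev (fun t => torusMap 1 0 0 π (τ * t, 0, 3 / 20)) = δ.ev (fun t => (1 / 20 * cos (τ * t),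
        (1 : ℝ) * (3 / 5 + 1 / 20 * sin (τ * t)), 0)) := by
  refine δ.ev_congr (fun s t => ((9 / 20 - 2 / 5 * s) * cos (τ * t),
      2 / 5 + 1 / 5 * s + (9 / 20 - 2 / 5 * s) * sin (τ * t), 0)) ?_ ?_ ?_ ?_ ?_
  · unfold uncurry
    fun_prop
  · intro s t
    have hs0 := s.2.1
    have hs1 := s.2.2
    have hsc := sin_sq_add_cos_sq (τ * t)
    have hS := sin_le_one (τ * t)
    have hne : ∀ y : ℝ, ¬ ((9 / 20 - 2 / 5 * (s : ℝ)) * cos (τ * t) = 0 ∧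
        2 / 5 + 1 / 5 * (s : ℝ) + (9 / 20 - 2 / 5 * s) * sin (τ * t) = y) ∨
        y = 17 / 20 - 1 / 5 * s ∨ y = -(1 / 20) + 3 / 5 * s := by
      intro y
      by_cases hc : cos (τ * t) = 0
      · rw [hc] at hsc
        have h1 : (sin (τ * t) - 1) * (sin (τ * t) + 1) = 0 := by
          linear_combination hsc
        by_cases hy : 2 / 5 + 1 / 5 * (s : ℝ) + (9 / 20 - 2 / 5 * s) * sin (τ * t) = y
        · right
          rcases mul_eq_zero.1 h1 with h2 | h2
          · left
            rw [← hy]; linear_combination (9 / 20 - 2 / 5 * (s : ℝ)) * h2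
          · right
            rw [← hy]; linear_combination (9 / 20 - 2 / 5 * (s : ℝ)) * h2
        · exact Or.inl fun h2 => hy h2.2
      · refine Or.inl fun h2 => hc ?_
        exact (mul_eq_zero.1 h2.1).resolve_left (by linarith)
    refine disc_mem hN ?_ ?_ ?_
    · have h1 : (2 / 5 + 1 / 5 * (s : ℝ)) * (9 / 20 - 2 / 5 * s) * sin (τ * t) ≤
          (2 / 5 + 1 / 5 * (s : ℝ)) * (9 / 20 - 2 / 5 * s) * 1 :=
        mul_le_mul_of_nonneg_left hS (mul_nonneg (by linarith) (by linarith))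
      have h2 : (17 / 20 - 1 / 5 * (s : ℝ)) ^ 2 ≤ (17 / 20) ^ 2 :=
        pow_le_pow_left₀ (by linarith) (by linarith) 2
      have h3 : ((9 / 20 - 2 / 5 * (s : ℝ)) * cos (τ * t)) ^ 2 +
          (2 / 5 + 1 / 5 * (s : ℝ) + (9 / 20 - 2 / 5 * s) * sin (τ * t)) ^ 2 =
          (9 / 20 - 2 / 5 * (s : ℝ)) ^ 2 + (2 / 5 + 1 / 5 * (s : ℝ)) ^ 2 +
          2 * ((2 / 5 + 1 / 5 * (s : ℝ)) * (9 / 20 - 2 / 5 * s) * sin (τ * t)) := by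
        linear_combination (9 / 20 - 2 / 5 * (s : ℝ)) ^ 2 * hsc
      rw [h3]
      linarith
    · rcases hne (3 / 5) with h1 | h1 | h1
      · exact h1
      · linarith
      · linarith
    · rcases hne (-(3 / 5)) with h1 | h1 | h1
      · exact h1
      · linarith
      · linarith
  · simp
  · intro t
    refine Prod.ext ?_ (Prod.ext ?_ ?_) <;> simp [torusMap, torusPt] <;> norm_num
  · intro t
    refine Prod.ext ?_ (Prod.ext ?_ ?_) <;> simp <;> ring_nf <;> simp

lemma ev_longitude_curve (hk : k < c.length) :
    δ.ev (fun t => torusMap 0 1 (π / 2) 0 (τ * t, 0, 3 / 20)) = δ.mer := by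
  rw [← δ.ev_tube hk (π / 2)]
  refine δ.ev_congr (fun s t => (0, 1 + (3 / 20 - 1 / 10 * s) * cos (τ * t),
    (3 / 20 - 1 / 10 * s) * sin (τ * t))) ?_ ?_ ?_ ?_ ?_
  · unfold uncurry
    fun_prop
  · intro s t
    have hs0 := s.2.1
    have hs1 := s.2.2
    have hsc := sin_sq_add_cos_sq (τ * t)
    have h1 := neg_one_le_cos (τ * t)
    have h2 := cos_le_one (τ * t)
    have hR : 0 < 3 / 20 - 1 / 10 * (s : ℝ) := by linarith
    have hRc : -(3 / 20) ≤ (3 / 20 - 1 / 10 * (s : ℝ)) * cos (τ * t) ∧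
        (3 / 20 - 1 / 10 * (s : ℝ)) * cos (τ * t) ≤ 3 / 20 := by
      constructor <;> nlinarith
    refine mem_linkCompl (by omega) (by norm_num) ?_ ?_
    · rw [abs_lt]; constructor <;> simp only <;> linarith [hRc.1, hRc.2]
    rintro j hj l hl ⟨m, hm⟩ h3 h4
    simp only [zero_mul] at h3 h4
    have h5 : sin (τ * t) = 0 := (mul_eq_zero.1 h4).resolve_left hR.ne'
    have h6 : (cos (τ * t) - 1) * (cos (τ * t) + 1) = 0 := by
      rw [h5] at hsc; linear_combination hsc
    have h7 : ∃ r : ℝ, (r = 3 / 20 - 1 / 10 * s ∨ r = -(3 / 20 - 1 / 10 * s)) ∧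
        (3 / 20 - 1 / 10 * (s : ℝ)) * cos (τ * t) = r := by
      rcases mul_eq_zero.1 h6 with h7 | h7
      · exact ⟨_, Or.inl rfl, by linear_combination (3 / 20 - 1 / 10 * (s : ℝ)) * h7⟩
      · exact ⟨_, Or.inr rfl, by linear_combination (3 / 20 - 1 / 10 * (s : ℝ)) * h7⟩
    obtain ⟨r, hr, h8⟩ := h7
    rw [h8] at h3 hRc
    rcases hj with rfl | rfl | rfl <;> push_cast at h3
    · nlinarith [hRc.1]
    · have h9 : r * (r + 2) = 0 := by linear_combination h3
      rcases mul_eq_zero.1 h9 with h9 | h9 <;> rcases hr with hr | hr <;> linarith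
    · nlinarith [hRc.1, hRc.2]
  · simp
  · intro t
    refine Prod.ext ?_ (Prod.ext ?_ ?_) <;> simp [torusMap, torusPt]
    ring
  · intro t
    refine Prod.ext ?_ (Prod.ext ?_ ?_) <;> simp [tube] <;> ring_nf <;> simp

end LoopClass

/-- The values of the spin structure on the meridians at the clasp of the page. -/
lemma SurgeryPresentation.mer_clasp (D : SurgeryPresentation c o) (hN : 0 < c.length)
    {B : OpenBook h o} {k : ℕ} (hk : k + 1 < c.length)
    (hpage : B.page = D.ext '' (invStereo '' pageTorus c.length k)) {Θ : SpinStructure o univ}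
    (hΘ : B.IsTrivialOnPage Θ) :
    (D.cls hN Θ k).mer = 1 ∧ (D.cls hN Θ (k + 1)).mer = 1 := by
  have hpos : ∀ θ φ : ℝ, (torusPt (3 / 20) θ φ).1 ^ 2 + ((torusPt (3 / 20) θ φ).2.1 - 2 / 5) ^ 2 =
      (3 / 5 + 3 / 20 * cos φ) ^ 2 ∧ 0 < 3 / 5 + 3 / 20 * cos φ := fun θ φ => by
    have h1 := sin_sq_add_cos_sq θ
    have h2 := neg_one_le_cos φ
    simp only [torusPt]
    exact ⟨by linear_combination (3 / 5 + 3 / 20 * cos φ) ^ 2 * h1, by linarith⟩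
  constructor
  · rw [← LoopClass.ev_longitude_curve _ (by omega : k < c.length)]
    refine D.ev_page_curve hN hk hpage hΘ (Or.inr ⟨rfl, rfl⟩) (fun s => ?_)
      (f := fun v => (((√(v.1 ^ 2 + (v.2.1 - 2 / 5) ^ 2) - 3 / 5) / (3 / 20) : ℝ) : ℂ) +
        ((v.2.2 / (3 / 20) : ℝ) : ℂ) * I) (by fun_prop) ?_ (fun s => ?_)
      kap_torusMapJac_zero.1 kap_torusMapJac_zero.2
    · have := cos_le_one (0 + 1 * s)
      simp only [zero_mul, add_zero, Real.sin_pi_div_two]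
      linarith
    · rintro _ ⟨θ, φ, -, rfl⟩
      refine norm_ofReal_add_mul_I_ne (by norm_num) ?_
      rw [(hpos θ φ).1, Real.sqrt_sq (hpos θ φ).2.le]
      have h1 := sin_sq_add_cos_sq φ
      simp only [torusPt]
      have : (3 / 5 + 3 / 20 * cos φ - 3 / 5) ^ 2 + (3 / 20 * sin φ) ^ 2 = 9 / 400 := by
        linear_combination 9 / 400 * h1
      rw [this]; norm_num
    · rw [exp_mul_I_eq_add, torusMap, (hpos _ _).1, Real.sqrt_sq (hpos 0 _).2.le]
      simp [torusPt]
  · rw [← D.ev_upper hN Θ hk, ← LoopClass.ev_latitude _ hN]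
    refine D.ev_page_curve hN hk hpage hΘ (Or.inl ⟨rfl, rfl⟩) (fun s => ?_)
      (f := fun v => ((v.1 / (9 / 20) : ℝ) : ℂ) + (((v.2.1 - 2 / 5) / (9 / 20) : ℝ) : ℂ) * I)
      (by fun_prop) ?_ (fun s => ?_) kap_torusMapJac_one.1 kap_torusMapJac_one.2
    · have := neg_one_le_sin (0 + 1 * s)
      simp only [zero_mul, add_zero, Real.cos_pi]
      linarith
    · rintro _ ⟨θ, φ, -, rfl⟩
      refine norm_ofReal_add_mul_I_ne (by norm_num) ?_
      rw [(hpos θ φ).1]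
      exact (pow_pos (hpos θ φ).2 2).ne'
    · rw [exp_mul_I_eq_add]
      have h1 : (3 / 5 + 3 / 20 * -1 : ℝ) = 9 / 20 := by norm_num
      simp [torusMap, torusPt, ← sub_eq_add_neg]
      norm_num

/-! ### Linking numbers modulo 2 -/

lemma exists_angle {x y : ℝ} (h : x ^ 2 + y ^ 2 = 1) :
    ∃ s ∈ Set.Ico 0 τ, cos s = x ∧ sin s = y := by
  have hn : ‖(⟨x, y⟩ : ℂ)‖ = 1 := by
    rw [Complex.norm_def, Complex.normSq_mk, Real.sqrt_eq_one]; linarith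
  have h0 : (⟨x, y⟩ : ℂ) ≠ 0 := by intro h0; rw [h0] at hn; simp at hn
  have hc := Complex.cos_arg h0
  have hs := Complex.sin_arg (⟨x, y⟩ : ℂ)
  rw [hn, div_one] at hc hs
  refine ⟨toIcoMod two_pi_pos 0 (Complex.arg ⟨x, y⟩), ?_, ?_, ?_⟩
  · simpa using toIcoMod_mem_Ico two_pi_pos 0 (Complex.arg ⟨x, y⟩)
  · rw [toIcoMod, zsmul_eq_mul, Real.cos_sub_int_mul_two_pi, hc]
  · rw [toIcoMod, zsmul_eq_mul, Real.sin_sub_int_mul_two_pi, hs]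

lemma angle_unique {s s' : ℝ} (hs : s ∈ Set.Ico 0 τ)
    (hs' : s' ∈ Set.Ico 0 τ) (hc : cos s = cos s')
    (h : sin s = sin s') : s = s' := by
  have h1 : (s : Real.Angle) = s' := Real.Angle.cos_sin_inj hc h
  rw [Real.Angle.angle_eq_iff_two_pi_dvd_sub] at h1
  obtain ⟨m, hm⟩ := h1
  have hp := two_pi_pos
  have h2 : m = 0 := by
    have h3 : (m : ℝ) < 1 := by
      refine lt_of_mul_lt_mul_left (a := τ) ?_ hp.le
      linarith [hs.2, hs'.1]
    have h4 : (-1 : ℝ) < m := by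
      refine lt_of_mul_lt_mul_left (a := τ) ?_ hp.le
      linarith [hs.1, hs'.2]
    have h5 : m < 1 := by exact_mod_cast h3
    have h6 : -1 < m := by exact_mod_cast h4
    omega
  rw [h2] at hm
  simp at hm
  linarith

def IsNext (N k l : ℕ) : Prop := l = k + 1 ∨ k + 1 = N ∧ l = 0

def clasp (j : ℤ) : Set (ℝ × ℝ) := {p | p.1 ∈ Set.Ico 0 τ ∧ p.2 ∈ Set.Ico 0 τ ∧ cos p.1 = cos p.2 ∧
    sin p.1 = 4 / 5 * j ∧ sin p.2 = -(4 / 5 * j)}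

lemma clasp_eq_pair {j : ℤ} (hj : (j : ℝ) ^ 2 = 1) : ∃ a b, a ≠ b ∧ clasp j = {a, b} := by
  obtain ⟨s, h1, h2, h3⟩ := exists_angle (x := 3 / 5) (y := 4 / 5 * j) (by linear_combination 16 / 25 * hj)
  obtain ⟨s', h1', h2', h3'⟩ := exists_angle (x := 3 / 5) (y := -(4 / 5 * j))
    (by linear_combination 16 / 25 * hj)
  obtain ⟨r, h4, h5, h6⟩ := exists_angle (x := -(3 / 5)) (y := 4 / 5 * j)
    (by linear_combination 16 / 25 * hj)
  obtain ⟨r', h4', h5', h6'⟩ := exists_angle (x := -(3 / 5)) (y := -(4 / 5 * j))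
    (by linear_combination 16 / 25 * hj)
  refine ⟨(s, s'), (r, r'), ?_, ?_⟩
  · intro h
    rw [(Prod.mk.inj h).1, h5] at h2
    norm_num at h2
  · ext ⟨t, t'⟩
    constructor
    · rintro ⟨g1, g2, g3, g4, g5⟩
      simp only at g1 g2 g3 g4 g5
      have hsc := sin_sq_add_cos_sq t
      have h7 : (cos t - 3 / 5) * (cos t + 3 / 5) = 0 := by
        rw [g4] at hsc
        linear_combination hsc - 16 / 25 * hj
      rcases mul_eq_zero.1 h7 with h8 | h8
      · left
        exact Prod.ext (angle_unique g1 h1 (by linarith) (by rw [g4, h3]))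
          (angle_unique g2 h1' (by linarith) (by rw [g5, h3']))
      · right
        exact Prod.ext (angle_unique g1 h4 (by linarith) (by rw [g4, h6]))
          (angle_unique g2 h4' (by linarith) (by rw [g5, h6']))
    · rintro (h | h) <;> obtain ⟨rfl, rfl⟩ := Prod.mk.inj h
      · exact ⟨h1, h1', by rw [h2, h2'], h3, h3'⟩
      · exact ⟨h4, h4', by rw [h5, h5'], h6, h6'⟩

lemma component_planar_iff {N : ℕ} (hN : 0 < N) (k l : ℕ) (s s' : ℝ) :
    (component N k s 0 = component N l s' 0 ∧ component N k s 1 = component N l s' 1) ↔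
    cos s = cos s' ∧ ∃ m : ℤ, sin s = sin s' + 8 / 5 * (l - k + m * N) := by
  have h := chain_eq_iff hN (k := k) (l := l) (ε := 0) (ε' := 0) (v := (cos s, sin s, 0))
    (w := (cos s', sin s', 0)) (by simp only; linarith [neg_one_le_cos s])
    (by simp only; linarith [neg_one_le_cos s'])
  simp only [chain, zero_mul, add_zero, and_true, Prod.mk.injEq] at h
  exact h

lemma crossings_eq {N k l : ℕ} (hk : k < N) (hl : l < N) (hkl : k ≠ l) :
    crossings N k l = {p | p ∈ clasp 1 ∧ IsNext N k l} ∪ {p | p ∈ clasp (-1) ∧ IsNext N l k} := by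
  have hN : 0 < N := by omega
  ext ⟨s, s'⟩
  simp only [crossings, component_planar_iff hN, clasp, Set.mem_setOf_eq, Set.mem_union]
  have hs := sin_sq_add_cos_sq s
  have hs' := sin_sq_add_cos_sq s'
  have b1 := neg_one_le_sin s
  have b2 := sin_le_one s
  constructor
  · rintro ⟨h1, h2, h3, m, h4⟩
    set j : ℤ := l - k + m * N with hj
    have hjr : (l : ℝ) - k + m * N = j := by rw [hj]; push_cast; ring
    have hj0 : j ≠ 0 := by
      intro h0
      rw [hj] at h0
      rcases lt_trichotomy m 0 with hm | hm | hm
      · have : m * N ≤ -1 * N := mul_le_mul_of_nonneg_right (by omega) (by omega)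
        omega
      · rw [hm] at h0; omega
      · have : 1 * (N : ℤ) ≤ m * N := mul_le_mul_of_nonneg_right (by omega) (by omega)
        omega
    rw [hjr] at h4
    have h5 : (sin s - sin s') * (sin s + sin s') = 0 := by
      rw [h3] at hs; linarith
    have h6 : sin s + sin s' = 0 := by
      refine (mul_eq_zero.1 h5).resolve_left fun h => hj0 ?_
      have : (j : ℝ) = 0 := by linarith
      exact_mod_cast this
    have h7 : sin s = 4 / 5 * j := by linarith
    have h8 : (j : ℝ) < 2 := by linarith
    have h9 : (-2 : ℝ) < j := by linarith
    have h10 : j < 2 := by exact_mod_cast h8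
    have h11 : -2 < j := by exact_mod_cast h9
    have hm : m = 0 ∨ m = 1 ∨ m = -1 := by
      by_contra hc
      rcases lt_trichotomy m 0 with hm | hm | hm
      · have : m * N ≤ -2 * N := mul_le_mul_of_nonneg_right (by omega) (by omega)
        omega
      · omega
      · have : 2 * (N : ℤ) ≤ m * N := mul_le_mul_of_nonneg_right (by omega) (by omega)
        omega
    have hj1 : j = 1 ∨ j = -1 := by omega
    rcases hj1 with h | h
    · left
      rw [h] at h7
      refine ⟨⟨h1, h2, h3, h7, by rw [← h7]; linarith⟩, ?_⟩
      unfold IsNext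
      rcases hm with rfl | rfl | rfl <;> omega
    · right
      rw [h] at h7
      refine ⟨⟨h1, h2, h3, h7, by rw [← h7]; linarith⟩, ?_⟩
      unfold IsNext
      rcases hm with rfl | rfl | rfl <;> omega
  · rintro (⟨⟨h1, h2, h3, h4, h5⟩, h⟩ | ⟨⟨h1, h2, h3, h4, h5⟩, h⟩)
    · refine ⟨h1, h2, h3, ?_⟩
      rcases h with rfl | ⟨rfl, rfl⟩
      · exact ⟨0, by rw [h4, h5]; push_cast; ring⟩
      · exact ⟨1, by rw [h4, h5]; push_cast; ring⟩
    · refine ⟨h1, h2, h3, ?_⟩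
      rcases h with rfl | ⟨rfl, rfl⟩
      · exact ⟨0, by rw [h4, h5]; push_cast; ring⟩
      · exact ⟨-1, by rw [h4, h5]; push_cast; ring⟩

lemma hasDerivAt_component (N k : ℕ) (s : ℝ) :
    HasDerivAt (fun s => component N k s 0)
      (-sin s * cos (τ * k / N + 5 * π / (4 * N) * sin s) +
        (3 + cos s) * (-sin (τ * k / N + 5 * π / (4 * N) * sin s) * (5 * π / (4 * N) * cos s))) s ∧
    HasDerivAt (fun s => component N k s 1)
      (-sin s * sin (τ * k / N + 5 * π / (4 * N) * sin s) +
        (3 + cos s) * (cos (τ * k / N + 5 * π / (4 * N) * sin s) *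
          (5 * π / (4 * N) * cos s))) s := by
  have h1 : HasDerivAt (fun s => 3 + cos s) (-sin s) s := (Real.hasDerivAt_cos s).const_add 3
  have h2 : HasDerivAt (fun s => τ * k / N + 5 * π / (4 * N) * sin s)
      (5 * π / (4 * N) * cos s) s :=
    ((Real.hasDerivAt_sin s).const_mul _).const_add _
  exact ⟨h1.mul h2.cos, h1.mul h2.sin⟩

lemma crossingSign_clasp {N k l : ℕ} (hN : 0 < N) {j : ℤ} (hj : (j : ℝ) ^ 2 = 1) {p : ℝ × ℝ}
    (hp : p ∈ clasp j) (hc : p ∈ crossings N k l) : crossingSign N k l p =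
      SignType.sign (-j * (claspSign N k * (5 + 4 * j) - claspSign N l * (5 - 4 * j)) : ℝ) := by
  obtain ⟨s, s'⟩ := p
  obtain ⟨_, _, h3, h4, h5⟩ := hp
  obtain ⟨_, _, h6, h7⟩ := hc
  simp only at h3 h4 h5 h6 h7
  have hpos : 0 < 3 + cos s := by linarith [neg_one_le_cos s]
  have hκ : 0 < 5 * π / (4 * N : ℝ) := by have := pi_pos; positivity
  have hX : 0 < cos s ^ 2 := by
    have := sin_sq_add_cos_sq s
    rw [h4] at this
    have : cos s ^ 2 = 9 / 25 := by linear_combination this - 16 / 25 * hj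
    rw [this]; norm_num
  unfold crossingSign
  rw [(hasDerivAt_component N k s).1.deriv, (hasDerivAt_component N k s).2.deriv,
    (hasDerivAt_component N l s').1.deriv, (hasDerivAt_component N l s').2.deriv]
  change (3 + cos s) * cos (τ * k / N + 5 * π / (4 * N) * sin s) =
    (3 + cos s') * cos (τ * l / N + 5 * π / (4 * N) * sin s') at h6
  change (3 + cos s) * sin (τ * k / N + 5 * π / (4 * N) * sin s) =
    (3 + cos s') * sin (τ * l / N + 5 * π / (4 * N) * sin s') at h7
  have hz : component N k s 2 = 0 + claspSign N k * cos s * (1 + sin s) := rfl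
  have hz' : component N l s' 2 = 0 + claspSign N l * cos s' * (1 + sin s') := rfl
  rw [hz, hz', ← h3, h4, h5]
  rw [← h3, h4, h5] at h6 h7
  rw [← mul_left_cancel₀ hpos.ne' h6, ← mul_left_cancel₀ hpos.ne' h7]
  set A := τ * k / N + 5 * π / (4 * N) * (4 / 5 * (j : ℝ))
  have hA := sin_sq_add_cos_sq A
  set κ := 5 * π / (4 * N : ℝ)
  set X := cos s
  congr 1
  have e : ∀ a b : ℝ, a = (8 / 25 * (X ^ 2 * (3 + X) * κ)) * b → SignType.sign a = SignType.sign b := by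
    rintro a b rfl
    rw [sign_mul, sign_pos (by positivity), one_mul]
  apply e
  linear_combination (8 / 25 * X ^ 2 * (3 + X) * κ) * (-j * (claspSign N k * (5 + 4 * j) -
    claspSign N l * (5 - 4 * j))) * hA

lemma finsum_clasp {N k l : ℕ} (hN : 0 < N) {j : ℤ} (hj : j = 1 ∨ j = -1) {Q : Prop}
    (h : Q → clasp j ⊆ crossings N k l) [Decidable Q] :
    ∃ e : ℤ, (e : ZMod 2) = 1 ∧
      ∑ᶠ p ∈ {p | p ∈ clasp j ∧ Q}, crossingSign N k l p = 2 * (if Q then e else 0) := by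
  have hj2 : (j : ℝ) ^ 2 = 1 := by rcases hj with rfl | rfl <;> norm_num
  refine ⟨SignType.sign (-j * (claspSign N k * (5 + 4 * j) - claspSign N l * (5 - 4 * j)) : ℝ), ?_, ?_⟩
  · have h0 : (-j * (claspSign N k * (5 + 4 * j) - claspSign N l * (5 - 4 * j)) : ℝ) ≠ 0 := by
      unfold claspSign
      rcases hj with rfl | rfl <;> split_ifs <;> norm_num
    rcases lt_or_gt_of_ne h0 with h1 | h1
    · rw [sign_neg h1]; decide
    · rw [sign_pos h1]; decide
  · by_cases hQ : Q
    · obtain ⟨a, b, hab, he⟩ := clasp_eq_pair hj2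
      simp only [hQ, and_true, if_true, Set.ofPred_mem_eq]
      have ha : a ∈ clasp j := by rw [he]; simp
      have hb : b ∈ clasp j := by rw [he]; simp
      rw [he, finsum_mem_pair hab, crossingSign_clasp hN hj2 ha (h hQ ha),
        crossingSign_clasp hN hj2 hb (h hQ hb), two_mul]
    · simp [hQ]

open Classical in
lemma linkingNumber_mod_two {N k l : ℕ} (hk : k < N) (hl : l < N) (hkl : k ≠ l) :
    (linkingNumber N k l : ZMod 2) =
      (if IsNext N k l then 1 else 0) + (if IsNext N l k then 1 else 0) := by
  have hc := crossings_eq hk hl hkl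
  have hN : 0 < N := by omega
  obtain ⟨e, he, h1⟩ := finsum_clasp (k := k) (l := l) hN (j := 1) (Or.inl rfl) (Q := IsNext N k l)
    fun hQ p hp => by rw [hc]; exact Or.inl ⟨hp, hQ⟩
  obtain ⟨e', he', h2⟩ := finsum_clasp (k := k) (l := l) hN (j := -1) (Or.inr rfl) (Q := IsNext N l k)
    fun hQ p hp => by rw [hc]; exact Or.inr ⟨hp, hQ⟩
  have hfin : ∀ (j : ℤ) (Q : Prop), (j : ℝ) ^ 2 = 1 → {p | p ∈ clasp j ∧ Q}.Finite := by
    intro j Q hj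
    obtain ⟨a, b, _, he⟩ := clasp_eq_pair hj
    exact (Set.Finite.subset (Set.toFinite {a, b}) he.le).subset fun p hp => hp.1
  have hd : Disjoint {p | p ∈ clasp 1 ∧ IsNext N k l} {p | p ∈ clasp (-1) ∧ IsNext N l k} := by
    rw [Set.disjoint_left]
    rintro p ⟨⟨_, _, _, h3, _⟩, _⟩ ⟨⟨_, _, _, h4, _⟩, _⟩
    rw [h3] at h4
    norm_num at h4
  unfold linkingNumber
  rw [hc, finsum_mem_union hd (hfin _ _ (by norm_num)) (hfin _ _ (by norm_num)), h1, h2, ← mul_add,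
    Int.mul_ediv_cancel_left _ two_ne_zero]
  push_cast
  split_ifs <;> simp [he, he']

lemma isCharacteristic_univ {c : List ℕ} (hN : 2 ≤ c.length) : IsCharacteristic c Finset.univ := by
  classical
  intro i
  refine (ZMod.intCast_eq_intCast_iff _ _ 2).1 ?_
  have h1 : ∀ j : Fin c.length,
      (((if j = i then (c.get i : ℤ) else linkingNumber c.length j i) : ℤ) : ZMod 2) =
      (if j = i then (c.get i : ZMod 2) else 0) + ((if IsNext c.length j i then 1 else 0) +
        if IsNext c.length i j then 1 else 0) := by
    intro j
    by_cases h : j = i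
    · have h2 : ¬ IsNext c.length i i := by unfold IsNext; omega
      subst h
      simp [h2]
    · rw [if_neg h, if_neg h, zero_add, linkingNumber_mod_two j.2 i.2 fun h' => h (Fin.ext h')]
  have hi := i.2
  obtain ⟨p, hp⟩ : ∃ p : Fin c.length, ∀ j : Fin c.length, IsNext c.length j i ↔ j = p := by
    by_cases h : (i : ℕ) = 0
    · refine ⟨⟨c.length - 1, by omega⟩, fun j => ?_⟩
      rw [Fin.ext_iff]; unfold IsNext; simp only; omega
    · refine ⟨⟨i - 1, by omega⟩, fun j => ?_⟩
      rw [Fin.ext_iff]; unfold IsNext; simp only; omega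
  obtain ⟨q, hq⟩ : ∃ q : Fin c.length, ∀ j : Fin c.length, IsNext c.length i j ↔ j = q := by
    by_cases h : (i : ℕ) + 1 = c.length
    · refine ⟨⟨0, by omega⟩, fun j => ?_⟩
      rw [Fin.ext_iff]; unfold IsNext; simp only; omega
    · refine ⟨⟨i + 1, by omega⟩, fun j => ?_⟩
      rw [Fin.ext_iff]; unfold IsNext; simp only; omega
  rw [Int.cast_sum]
  simp only [h1, hp, hq, Finset.sum_add_distrib, Finset.sum_ite_eq', Finset.mem_univ, if_true]
  rw [CharTwo.add_self_eq_zero, add_zero]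
  simp

end SpinSurgery
end

open SpinSurgery in
theorem lemma4p2 {Y : Type*} [TopologicalSpace Y] [T2Space Y] [CompactSpace Y]
    [ChartedSpace (E 3) Y] [IsManifold (𝓡 3) ∞ Y] (o : MfdOrientation 3 Y)
    {n : ℕ} (a b : Fin n → ℕ) (ha : ∀ i, 1 ≤ a i) (hb : ∀ i, 1 ≤ b i) (hN : 2 ≤ ∑ i, b i)
    (D : SurgeryPresentation (cString a b) o) (B : OpenBook (monodromy a b) o)
    (k : ℕ) (hk : k + 1 < (cString a b).length)
    (hpage : B.page = D.ext '' (invStereo '' pageTorus (cString a b).length k))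
    (lam : ∀ y : Y, TangentSpace (𝓡 3) y →L[ℝ] ℝ)
    (hcontact : IsContactForm o lam) (hsupp : B.Supports lam) :
    (∃ e, IsTrivialization lam e) ∧
    (∀ e e', IsTrivialization lam e → IsTrivialization lam e' →
      TrivializationsHomotopic lam e e') ∧
    ∃ Θ : SpinStructure o Set.univ,
      (∀ e, IsTrivialization lam e →
        ∀ Θ' : SpinStructure o Set.univ, IsInducedByTrivialization lam e Θ' ↔ Θ' = Θ) ∧
      D.sublink Θ = Finset.univ ∧
      IsCharacteristic (cString a b) Finset.univ := by
  obtain ⟨P, T, hP⟩ := isTwist_monodromy a b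
  obtain ⟨h1, h2, Θ, h3, h4⟩ := B.exists_spin T hP hcontact hsupp
  have hN' : 0 < (cString a b).length := by omega
  have h5 : (D.cls hN' Θ k).mer = 1 ∧ (D.cls hN' Θ (k + 1)).mer = 1 :=
    D.mer_clasp hN' hk hpage h4
  have h6 : IsCharacteristic (cString a b) Finset.univ :=
    isCharacteristic_univ (by omega)
  exact ⟨h1, h2, Θ, h3, D.sublink_eq_univ hN' Θ hk h5.1 h5.2, h6⟩
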